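/- Let $\mathbb T=\mathbb R/2\pi\mathbb Z$ and $\omega(p)=|\sin(p/2)|$. Fix $\beta,\gamma>0$ and let $\mathfrak f(p)=\frac{1}{\beta\omega(p)+\gamma}$ be the associated (non-singular) Rayleigh–Jeans equilibrium. For $x,z\in[0,2\pi]$ put $$h(x,z)=\frac{z-x}{2}+2\arcsin\Big(\tan\frac{|z-x|}{4}\,\cos\frac{z+x}{4}\Big),\qquad F_+(x,z)=\Big[\cos\frac x2+\cos\frac z2\Big]^2+4\sin\frac x2\,\sin\frac z2 .$$ The collision operator of the $\beta$-FPUT kinetic wave equation, linearized around $\mathfrak f$, is $$[Lg](p_0)=\frac1{\mathfrak f(p_0)}\int_0^{2\pi}\frac{\prod_{\ell=0}^3\omega(p_\ell)\,\mathfrak f(p_\ell)}{\sqrt{F_+(p_0,p_2)}}\left[-\frac{g(p_0)}{\mathfrak f(p_0)}-\frac{g(p_1)}{\mathfrak f(p_1)}+\frac{g(p_2)}{\mathfrak f(p_2)}+\frac{g(p_3)}{\mathfrak f(p_3)}\right]dp_2,$$ where $p_0,p_2\in[0,2\pi]$, and $p_1=h(p_0,p_2)$ and $p_3=p_0+p_1-p_2$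 are taken modulo $2\pi$. Write $\langle t\rangle=10+|t|$. All functions are real-valued. **Theorem.** For every $g_0\in L^2(\mathbb T)$ the Cauchy problem $\partial_t g=Lg$, $g(0)=g_0$, has a unique solution in $\mathcal C([0,\infty),L^2(\mathbb T))$, denoted $e^{tL}g_0$. Moreover, for every $\delta>0$ there is a constant $C>0$, depending only on $\delta$ (and on the fixed parameters $\beta,\gamma$), such that for all $\mu,\nu\in(\frac16,\frac12)$, all $g_0\in L^\infty(\mathbb T)$ whose $L^2$-orthogonal projection onto $\operatorname{Ker}L$ is zero, and all $t\ge 0$, $$\big\|\omega^\mu e^{tL}g_0\big\|_{L^\infty}\le C\,\langle t\rangle^{-\frac35(\mu+\nu)+\delta}\,\big\|\omega^{-\nu}g_0\big\|_{L^\infty},$$ the right-hand side being $+\infty$ if $\omega^{-\nu}g_0\notin L^\infty$. -/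

import Mathlib

open MeasureTheory Set

noncomputable section

namespace FPUT

/-- The periodized torus `ℝ / 2πℤ`, with its Lebesgue measure of total mass `2π`. -/
abbrev Torus : Type := AddCircle (2 * Real.pi)

instance fact_two_pi_pos : Fact (0 < 2 * Real.pi) := ⟨Real.two_pi_pos⟩

/-- The real Hilbert space `L²(ℝ / 2πℤ)`. -/
abbrev L2 : Type := Lp ℝ 2 (volume : Measure Torus)

theorem periodic_abs_sin_half :
    Function.Periodic (fun x : ℝ => |Real.sin (x / 2)|) (2 * Real.pi) := by
  intro x
  have h : (x + 2 * Real.pi) / 2 = x / 2 + Real.pi := by ring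
  simp only [h, Real.sin_add_pi, abs_neg]

/-- The dispersion relation `ω(p) = |sin (p / 2)|`. -/
def omega : Torus → ℝ := periodic_abs_sin_half.lift

/-- The Rayleigh-Jeans equilibrium `1 / (β ω(p) + γ)`. -/
def rayleighJeans (β γ : ℝ) (p : Torus) : ℝ := 1 / (β * omega p + γ)

/-- The parametrization of the nontrivial resonances: for `x, z ∈ [0, 2π]`, the momenta
`p₀ = x`, `p₁ = h(x, z)`, `p₂ = z`, `p₃ = p₀ + p₁ - p₂` (modulo `2π`) satisfy
`ω(p₀) + ω(p₁) = ω(p₂) + ω(p₃)`. -/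
def resonance (x z : ℝ) : ℝ :=
  (z - x) / 2 + 2 * Real.arcsin (Real.tan (|z - x| / 4) * Real.cos ((z + x) / 4))

/-- The function `F₊`, whose inverse square root is the density of the resonant manifold. -/
def Fplus (x z : ℝ) : ℝ :=
  (Real.cos (x / 2) + Real.cos (z / 2)) ^ 2 + 4 * Real.sin (x / 2) * Real.sin (z / 2)

/-- The integrand (in `z = p₂`) of the linearized collision operator at `p₀ = x`. -/
def linIntegrand (β γ : ℝ) (g : Torus → ℝ) (x z : ℝ) : ℝ :=
  let p₀ : Torus := (x : Torus)
  let p₁ : Torus := ((resonance x z : ℝ) : Torus)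
  let p₂ : Torus := (z : Torus)
  let p₃ : Torus := ((x + resonance x z - z : ℝ) : Torus)
  let f : Torus → ℝ := rayleighJeans β γ
  1 / f p₀ *
    ((omega p₀ * omega p₁ * omega p₂ * omega p₃) * (f p₀ * f p₁ * f p₂ * f p₃) /
      Real.sqrt (Fplus x z)) *
    (-(g p₀ / f p₀) - g p₁ / f p₁ + g p₂ / f p₂ + g p₃ / f p₃)

/-- The relation `L g = v` on (representatives of) functions on the torus, where `L` is the
collision operator linearized around the Rayleigh-Jeans equilibrium: for almost every
`p₀ = x ∈ (0, 2π]` the integral defining `(L g)(x)` converges absolutely and equals `v(x)`. -/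
def LinearizedEq (β γ : ℝ) (g v : Torus → ℝ) : Prop :=
  ∀ᵐ x ∂(volume.restrict (Ioc (0 : ℝ) (2 * Real.pi))),
    IntervalIntegrable (linIntegrand β γ g x) volume 0 (2 * Real.pi) ∧
      v (x : Torus) = ∫ z in (0 : ℝ)..(2 * Real.pi), linIntegrand β γ g x z

/-- `u ∈ C([0, ∞), L²)` solves `∂ₜ u = L u`, `u(0) = g₀`. The values of `u` at negative times
are irrelevant. -/
structure IsSolution (β γ : ℝ) (g₀ : L2) (u : ℝ → L2) : Prop where
  continuousOn : ContinuousOn u (Ici 0)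
  initial : u 0 = g₀
  equation : ∀ t : ℝ, 0 ≤ t →
    ∃ v : L2, LinearizedEq β γ (u t) v ∧ HasDerivWithinAt u v (Ici 0) t

/-- The kernel of `L` in `L²`. -/
def linearizedKer (β γ : ℝ) : Set L2 := {k | LinearizedEq β γ k 0}

/-- The bracket `⟨t⟩ = 10 + |t|`. -/
def bracket (t : ℝ) : ℝ := 10 + |t|

end FPUT

end

/-! Put φ = g/f and let Dφ = φ(p₀) + φ(p₁) − φ(p₂) − φ(p₃) on the resonant manifold, with the
measure of density `kern` = ∏ωf/√F₊ in (p₀, p₂). This measure is invariant under (p₀,p₁) ↔ (p₂,p₃)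
and under p₂ ↔ p₃. Hence −L = ¼T*T with Tg = D(g/f): a bounded, symmetric, nonnegative operator on
L² (`dissip`). Existence and uniqueness are those of a linear ODE with bounded generator; the decay
is slow because the dissipation degenerates at p = 0.

Geometry. In half-angles, √F₊ = cos θ₁ − cos θ₃, which is also the denominator of the derivatives of
θ₁ and θ₃. The map p₂ ↦ p₃ is therefore an involution preserving the measure, and p₂ ↦ p₁ is at most
two-to-one on each side of p₀, with a Jacobian that vanishes only at p₂ = p₃. Near that set the
difference cos θ₃ − cos θ₂ is itself a good integration variable.

Collision rate. For p₀ near 0 there is a window of p₂ of length about ω₀^{1/3} on which ω₁, ω₂, ω₃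
are all comparable to ω₀^{1/3} and √F₊ ≲ ω₀^{2/3}. There the kernel is at least cω₀^{4/3}, so the
rate is at least cω₀^{5/3}. The factor 3/5 in the theorem is the inverse of this exponent.

Coercivity. In L² with the rate as weight, ‖Dφ‖² = 4(‖φ‖² + ⟨φ₁,φ₀⟩ − 2⟨φ₂,φ₀⟩), and the cross terms
vanish along weakly null sequences. Compactness gives a gap above Ker D (`exists_le_norm_collDiff`).
Averaging Dψ = 0 over the window shows |ψ| ≲ ω^{-1/6} on the kernel
(`exists_le_of_collDiff_eq_zero`), so the projection can be taken back to L²: every g is n + r with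
n ∈ Ker L and ∫ω^{5/3}r² ≲ ⟨−Lg, g⟩ (`exists_decomposition`).

Decay in L². The dissipation at time t is O(1/t), so weighted norms of r decay. If g is orthogonal
to Ker L and |g| ≤ Nω^ν, then ‖e^{tL}g‖² = ⟨g, e^{2tL}g⟩ = ⟨g, r⟩, and interpolation gives decay of
the full norm (`exists_norm_evol_le`). The semigroup property then upgrades the weighted decay of r
and the decay of n (`exists_decomposition_decay`).

Pointwise decay. Write L = −α + gain with α ≳ ω^{5/3} a multiplier. Since L annihilates n, the
Duhamel source is αn plus the gain of r. The gain is bounded by the weighted L² norm of r and,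
through a Hölder inequality for the p₁ term, by the 1/5 power of a weighted sup norm of r
(`exists_gain_le`). This sublinear dependence closes a bootstrap: a bound with constant Y improves
to C(1 + (Y + C)^{1/5}), and iteration from a crude exponential bound leads to a universal constant
(`exists_pointwise_decay`). -/

noncomputable section

namespace FPUT

/-! ### Geometry of the resonant manifold, in half-angles `0 < a < b < π` -/

/-- The angle `α` with `sin α = tan ((b - a) / 2) cos ((a + b) / 2)`. -/
def resAngle (a b : ℝ) : ℝ := Real.arcsin (Real.tan ((b - a) / 2) * Real.cos ((a + b) / 2))

/-- Half of the momentum `p₁`. -/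
def theta1 (a b : ℝ) : ℝ := (b - a) / 2 + resAngle a b

/-- Half of the momentum `p₃`, shifted into `(0, π)`. -/
def theta3 (a b : ℝ) : ℝ := Real.pi - (b - a) / 2 + resAngle a b

section Angles

variable {a b : ℝ}

/-- Since a and b lie in (0, π), |cos((a+b)/2)| < cos((b−a)/2). The strict inequality keeps the
arcsine away from its endpoints, so `resAngle` is smooth and smaller than (b−a)/2 in modulus. -/
theorem abs_tan_mul_cos_lt (ha : 0 < a) (hab : a < b) (hb : b < Real.pi) :
    |Real.tan ((b - a) / 2) * Real.cos ((a + b) / 2)| < Real.sin ((b - a) / 2) := by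
  have hd0 : 0 < (b - a) / 2 := by linarith
  have hd1 : (b - a) / 2 < Real.pi / 2 := by linarith
  have hc : 0 < Real.cos ((b - a) / 2) := Real.cos_pos_of_mem_Ioo ⟨by linarith, hd1⟩
  have hs : 0 < Real.sin ((b - a) / 2) := Real.sin_pos_of_pos_of_lt_pi hd0 (by linarith)
  have h1 : Real.cos ((a + b) / 2) < Real.cos ((b - a) / 2) :=
    Real.cos_lt_cos_of_nonneg_of_le_pi hd0.le (by linarith) (by linarith)
  have h2 : -Real.cos ((b - a) / 2) < Real.cos ((a + b) / 2) := by
    rw [← Real.cos_pi_sub]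
    exact Real.cos_lt_cos_of_nonneg_of_le_pi (by linarith) (by linarith) (by linarith)
  rw [Real.tan_eq_sin_div_cos, abs_mul, abs_of_pos (div_pos hs hc), div_mul_eq_mul_div,
    div_lt_iff₀ hc]
  exact mul_lt_mul_of_pos_left (abs_lt.2 ⟨h2, h1⟩) hs

theorem sin_resAngle (ha : 0 < a) (hab : a < b) (hb : b < Real.pi) :
    Real.sin (resAngle a b) = Real.tan ((b - a) / 2) * Real.cos ((a + b) / 2) := by
  have h := abs_lt.1 ((abs_tan_mul_cos_lt ha hab hb).trans_le (Real.sin_le_one _))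
  exact Real.sin_arcsin h.1.le h.2.le

theorem abs_resAngle_lt (ha : 0 < a) (hab : a < b) (hb : b < Real.pi) :
    |resAngle a b| < (b - a) / 2 := by
  have h := abs_lt.1 (abs_tan_mul_cos_lt ha hab hb)
  have hd : (b - a) / 2 ∈ Icc (-(Real.pi / 2)) (Real.pi / 2) := ⟨by linarith, by linarith⟩
  have e := Real.arcsin_sin hd.1 hd.2
  have b1 := Real.sin_le_one ((b - a) / 2)
  have b2 := Real.neg_one_le_sin ((b - a) / 2)
  rw [abs_lt, resAngle]
  constructor
  · have := Real.strictMonoOn_arcsin (a := -Real.sin ((b - a) / 2)) ⟨by linarith, by linarith⟩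
      ⟨by linarith [h.1], by linarith [h.2]⟩ h.1
    rwa [Real.arcsin_neg, e] at this
  · have := Real.strictMonoOn_arcsin ⟨by linarith [h.1], by linarith [h.2]⟩
      (b := Real.sin ((b - a) / 2)) ⟨by linarith, by linarith⟩ h.2
    rwa [e] at this

theorem theta1_mem (ha : 0 < a) (hab : a < b) (hb : b < Real.pi) :
    0 < theta1 a b ∧ theta1 a b < b ∧ theta1 a b < b - a := by
  have h := abs_lt.1 (abs_resAngle_lt ha hab hb)
  unfold theta1
  refine ⟨by linarith, by linarith, by linarith⟩

theorem theta3_mem (ha : 0 < a) (hab : a < b) (hb : b < Real.pi) :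
    a < theta3 a b ∧ theta3 a b < Real.pi := by
  have h := abs_lt.1 (abs_resAngle_lt ha hab hb)
  unfold theta3
  refine ⟨by linarith, by linarith⟩

theorem theta_sum (a b : ℝ) : theta3 a b = Real.pi + theta1 a b - (b - a) := by
  unfold theta1 theta3; ring

/-- By sum-to-product formulas, the relation reduces to sin α cos((b−a)/2) = sin((b−a)/2)
cos((a+b)/2), which is the definition of α = `resAngle a b`. -/
theorem sin_theta_add (ha : 0 < a) (hab : a < b) (hb : b < Real.pi) :
    Real.sin a + Real.sin (theta1 a b) = Real.sin b + Real.sin (theta3 a b) := by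
  have hc : Real.cos ((b - a) / 2) ≠ 0 :=
    (Real.cos_pos_of_mem_Ioo ⟨by linarith, by linarith⟩).ne'
  have h1 := sin_resAngle ha hab hb
  rw [Real.tan_eq_sin_div_cos] at h1
  have e1 : Real.sin (theta3 a b) = Real.sin ((b - a) / 2 - resAngle a b) := by
    rw [theta3, ← Real.sin_pi_sub]; congr 1; ring
  have e2 : Real.sin a = Real.sin ((a + b) / 2 - (b - a) / 2) := by congr 1; ring
  have e3 : Real.sin b = Real.sin ((a + b) / 2 + (b - a) / 2) := by congr 1; ring
  rw [e1, e2, e3, theta1, Real.sin_sub, Real.sin_sub, Real.sin_add, Real.sin_add, h1]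
  field_simp
  ring

/-- The product formula for the frequencies `ω₁ ω₃`. -/
theorem sin_theta_mul (ha : 0 < a) (hab : a < b) (hb : b < Real.pi) :
    Real.sin (theta1 a b) * Real.sin (theta3 a b) =
      Real.tan ((b - a) / 2) ^ 2 * (Real.sin a * Real.sin b) := by
  have hc : Real.cos ((b - a) / 2) ≠ 0 :=
    (Real.cos_pos_of_mem_Ioo ⟨by linarith, by linarith⟩).ne'
  have h1 := sin_resAngle ha hab hb
  rw [Real.tan_eq_sin_div_cos] at h1 ⊢
  have e1 : Real.sin (theta3 a b) = Real.sin ((b - a) / 2 - resAngle a b) := by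
    rw [theta3, ← Real.sin_pi_sub]; congr 1; ring
  have e2 : Real.sin a = Real.sin ((a + b) / 2 - (b - a) / 2) := by congr 1; ring
  have e3 : Real.sin b = Real.sin ((a + b) / 2 + (b - a) / 2) := by congr 1; ring
  rw [e1, e2, e3, theta1, Real.sin_sub, Real.sin_sub, Real.sin_add, Real.sin_add]
  have h2 : Real.sin (resAngle a b) * Real.cos ((b - a) / 2) =
      Real.sin ((b - a) / 2) * Real.cos ((a + b) / 2) := by rw [h1]; field_simp
  have s1 := Real.sin_sq_add_cos_sq ((b - a) / 2)
  have s2 := Real.sin_sq_add_cos_sq ((a + b) / 2)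
  have s3 := Real.sin_sq_add_cos_sq (resAngle a b)
  generalize Real.sin (resAngle a b) = A at *
  generalize Real.cos (resAngle a b) = A' at *
  generalize Real.sin ((b - a) / 2) = d at *
  generalize Real.cos ((b - a) / 2) = d' at *
  generalize Real.sin ((a + b) / 2) = s at *
  generalize Real.cos ((a + b) / 2) = s' at *
  have k1 : A' ^ 2 = 1 - A ^ 2 := by linarith
  have k2 : s ^ 2 = 1 - s' ^ 2 := by linarith
  have k3 : d ^ 2 = 1 - d' ^ 2 := by linarith
  rw [div_pow, div_mul_eq_mul_div, eq_div_iff (pow_ne_zero 2 hc)]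
  have h3 : (A * d') ^ 2 = (d * s') ^ 2 := by rw [h2]
  have l : (d * A' + d' * A) * (d * A' - d' * A) * d' ^ 2 = (d^2 * A'^2 - (A * d')^2) * d'^2 := by
    ring
  have r : d ^ 2 * ((s * d' - s' * d) * (s * d' + s' * d)) =
      d ^ 2 * (s ^ 2 * d' ^ 2 - s' ^ 2 * d ^ 2) := by ring
  rw [l, r, k1, k2]
  linear_combination (-1 : ℝ) * d ^ 2 * h3 - d' ^ 2 * h3

theorem cos_theta_sub (a b : ℝ) :
    Real.cos (theta1 a b) - Real.cos (theta3 a b) =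
      2 * Real.cos ((b - a) / 2) * Real.cos (resAngle a b) := by
  have e1 : Real.cos (theta3 a b) = -Real.cos ((b - a) / 2 - resAngle a b) := by
    rw [theta3, ← Real.cos_pi_sub]; congr 1; ring
  rw [e1, theta1, Real.cos_add, Real.cos_sub]; ring

theorem cos_theta_sub_pos (ha : 0 < a) (hab : a < b) (hb : b < Real.pi) :
    0 < Real.cos (theta1 a b) - Real.cos (theta3 a b) := by
  have h := abs_lt.1 (abs_resAngle_lt ha hab hb)
  rw [cos_theta_sub]
  have h1 : 0 < Real.cos ((b - a) / 2) := Real.cos_pos_of_mem_Ioo ⟨by linarith, by linarith⟩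
  have h2 : 0 < Real.cos (resAngle a b) := Real.cos_pos_of_mem_Ioo ⟨by linarith, by linarith⟩
  positivity

/-- F₊ is a perfect square in terms of the resonant angles. Its root is the denominator of both
derivatives below, which is why every change of variables on the manifold is compatible with the
density. -/
theorem Fplus_eq (ha : 0 < a) (hab : a < b) (hb : b < Real.pi) :
    Fplus (2 * a) (2 * b) = (Real.cos (theta1 a b) - Real.cos (theta3 a b)) ^ 2 := by
  have hc : Real.cos ((b - a) / 2) ≠ 0 :=
    (Real.cos_pos_of_mem_Ioo ⟨by linarith, by linarith⟩).ne'
  have h1 := sin_resAngle ha hab hb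
  rw [Real.tan_eq_sin_div_cos] at h1
  rw [cos_theta_sub, Fplus]
  have e0 : 2 * a / 2 = (a + b) / 2 - (b - a) / 2 := by ring
  have e3 : 2 * b / 2 = (a + b) / 2 + (b - a) / 2 := by ring
  rw [e0, e3, Real.sin_sub, Real.cos_sub, Real.sin_add, Real.cos_add]
  have h2 : Real.sin (resAngle a b) * Real.cos ((b - a) / 2) =
      Real.sin ((b - a) / 2) * Real.cos ((a + b) / 2) := by rw [h1]; field_simp
  have s2 := Real.sin_sq_add_cos_sq ((a + b) / 2)
  have s3 := Real.sin_sq_add_cos_sq (resAngle a b)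
  generalize Real.sin (resAngle a b) = A at *
  generalize Real.cos (resAngle a b) = A' at *
  generalize Real.sin ((b - a) / 2) = d at *
  generalize Real.cos ((b - a) / 2) = d' at *
  generalize Real.sin ((a + b) / 2) = s at *
  generalize Real.cos ((a + b) / 2) = s' at *
  linear_combination 4 * d' ^ 2 * s2 - 4 * d' ^ 2 * s3 + 4 * (A * d' + d * s') * h2

theorem sqrt_Fplus_eq (ha : 0 < a) (hab : a < b) (hb : b < Real.pi) :
    Real.sqrt (Fplus (2 * a) (2 * b)) = Real.cos (theta1 a b) - Real.cos (theta3 a b) := by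
  rw [Fplus_eq ha hab hb, Real.sqrt_sq (cos_theta_sub_pos ha hab hb).le]

theorem resonance_eq (hab : a < b) : resonance (2 * a) (2 * b) = 2 * theta1 a b := by
  unfold resonance theta1 resAngle
  have e1 : |2 * b - 2 * a| / 4 = (b - a) / 2 := by
    rw [abs_of_pos (by linarith)]; ring
  have e2 : (2 * b + 2 * a) / 4 = (a + b) / 2 := by ring
  rw [e1, e2]; ring

theorem resonance_reflect (x z : ℝ) :
    resonance (2 * Real.pi - x) (2 * Real.pi - z) = -resonance x z := by
  unfold resonance
  have e1 : |2 * Real.pi - z - (2 * Real.pi - x)| / 4 = |z - x| / 4 := by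
    rw [show 2 * Real.pi - z - (2 * Real.pi - x) = -(z - x) by ring, abs_neg]
  have e2 : (2 * Real.pi - z + (2 * Real.pi - x)) / 4 = Real.pi - (z + x) / 4 := by ring
  rw [e1, e2, Real.cos_pi_sub, mul_neg, Real.arcsin_neg]; ring

theorem resonance_swap (x z : ℝ) : resonance z x = x + resonance x z - z := by
  unfold resonance
  rw [abs_sub_comm x z, add_comm x z]; ring

theorem Fplus_reflect (x z : ℝ) : Fplus (2 * Real.pi - x) (2 * Real.pi - z) = Fplus x z := by
  unfold Fplus
  have e1 : (2 * Real.pi - x) / 2 = Real.pi - x / 2 := by ring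
  have e2 : (2 * Real.pi - z) / 2 = Real.pi - z / 2 := by ring
  rw [e1, e2, Real.cos_pi_sub, Real.cos_pi_sub, Real.sin_pi_sub, Real.sin_pi_sub]; ring

theorem Fplus_swap (x z : ℝ) : Fplus z x = Fplus x z := by
  unfold Fplus; ring

theorem hasDerivAt_resAngle (ha : 0 < a) (hab : a < b) (hb : b < Real.pi) :
    HasDerivAt (resAngle a) (1 / 2 - (Real.cos (theta1 a b) - Real.cos b) /
      (Real.cos (theta1 a b) - Real.cos (theta3 a b))) b := by
  have hc : 0 < Real.cos ((b - a) / 2) := Real.cos_pos_of_mem_Ioo ⟨by linarith, by linarith⟩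
  have h := abs_lt.1 (abs_resAngle_lt ha hab hb)
  have hA : 0 < Real.cos (resAngle a b) := Real.cos_pos_of_mem_Ioo ⟨by linarith, by linarith⟩
  have h1 := sin_resAngle ha hab hb
  have hlt := abs_lt.1 ((abs_tan_mul_cos_lt ha hab hb).trans_le (Real.sin_le_one _))
  have hd : HasDerivAt (fun b : ℝ => (b - a) / 2) (1 / 2) b :=
    ((hasDerivAt_id b).sub_const a).div_const 2
  have hs : HasDerivAt (fun b : ℝ => (a + b) / 2) (1 / 2) b :=
    ((hasDerivAt_id b).const_add a).div_const 2
  have ht := (Real.hasDerivAt_tan hc.ne').comp b hd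
  have hco := hs.cos
  have hm := ht.mul hco
  have hx := (Real.hasDerivAt_arcsin hlt.1.ne' hlt.2.ne).comp b hm
  refine hx.congr_deriv ?_
  have hcosA : Real.sqrt (1 - (Real.tan ((b - a) / 2) * Real.cos ((a + b) / 2)) ^ 2) =
      Real.cos (resAngle a b) := by
    rw [← h1, ← Real.cos_sq', Real.sqrt_sq hA.le]
  rw [hcosA, cos_theta_sub]
  have e3 : Real.cos b = Real.cos ((a + b) / 2 + (b - a) / 2) := by congr 1; ring
  rw [e3, theta1, Real.cos_add, Real.cos_add]
  simp only [Function.comp]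
  rw [Real.tan_eq_sin_div_cos] at h1 ⊢
  have h2 : Real.sin (resAngle a b) * Real.cos ((b - a) / 2) =
      Real.sin ((b - a) / 2) * Real.cos ((a + b) / 2) := by rw [h1]; field_simp
  have s1 := Real.sin_sq_add_cos_sq ((b - a) / 2)
  generalize Real.sin (resAngle a b) = A at *
  generalize Real.cos (resAngle a b) = A' at *
  generalize Real.sin ((b - a) / 2) = d at *
  generalize Real.cos ((b - a) / 2) = d' at *
  generalize Real.sin ((a + b) / 2) = s at *
  generalize Real.cos ((a + b) / 2) = s' at *
  field_simp
  linear_combination -d * h2 - s' * s1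

/-- The value is that of implicit differentiation in sin a + sin θ₁ = sin b + sin θ₃ with θ₃' = θ₁'
− 1. The critical points of θ₁ are those with cos b = cos θ₃, that is p₂ = p₃. -/
theorem hasDerivAt_theta1 (ha : 0 < a) (hab : a < b) (hb : b < Real.pi) :
    HasDerivAt (theta1 a) ((Real.cos b - Real.cos (theta3 a b)) /
      (Real.cos (theta1 a b) - Real.cos (theta3 a b))) b := by
  have hd : HasDerivAt (fun b : ℝ => (b - a) / 2) (1 / 2) b :=
    ((hasDerivAt_id b).sub_const a).div_const 2
  refine (hd.add (hasDerivAt_resAngle ha hab hb)).congr_deriv ?_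
  have := cos_theta_sub_pos ha hab hb
  field_simp; ring

theorem hasDerivAt_theta3 (ha : 0 < a) (hab : a < b) (hb : b < Real.pi) :
    HasDerivAt (theta3 a) (-((Real.cos (theta1 a b) - Real.cos b) /
      (Real.cos (theta1 a b) - Real.cos (theta3 a b)))) b := by
  have hd : HasDerivAt (fun b : ℝ => Real.pi - (b - a) / 2) (-(1 / 2)) b :=
    (((hasDerivAt_id b).sub_const a).div_const 2).const_sub Real.pi
  refine (hd.add (hasDerivAt_resAngle ha hab hb)).congr_deriv ?_
  ring

theorem cos_lt_cos_theta1 (ha : 0 < a) (hab : a < b) (hb : b < Real.pi) :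
    Real.cos b < Real.cos (theta1 a b) :=
  Real.cos_lt_cos_of_nonneg_of_le_pi (theta1_mem ha hab hb).1.le hb.le (theta1_mem ha hab hb).2.1

/-- The half-angle `θ₁` is unchanged when the roles of `p₂` and `p₃` are exchanged. -/
theorem theta1_theta3 (ha : 0 < a) (hab : a < b) (hb : b < Real.pi) :
    theta1 a (theta3 a b) = theta1 a b := by
  obtain ⟨h1, h2, h2'⟩ := theta1_mem ha hab hb
  obtain ⟨h3, h4⟩ := theta3_mem ha hab hb
  have hsum := theta_sum a b
  have hres := sin_theta_add ha hab hb
  set c := theta3 a b with hcdef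
  have hc : 0 < Real.cos ((c - a) / 2) := Real.cos_pos_of_mem_Ioo ⟨by linarith, by linarith⟩
  -- The angle is identified through its sine, using θ₁ − (c − a) = b − π and the resonance
  -- relation.
  have key : resAngle a c = theta1 a b - (c - a) / 2 := by
    rw [resAngle]
    have : Real.tan ((c - a) / 2) * Real.cos ((a + c) / 2) =
        Real.sin (theta1 a b - (c - a) / 2) := by
      rw [Real.tan_eq_sin_div_cos, div_mul_eq_mul_div, div_eq_iff hc.ne']
      have i1 : Real.sin ((c - a) / 2) * Real.cos ((a + c) / 2) = (Real.sin c - Real.sin a) / 2 := by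
        rw [Real.sin_sub_sin]; rw [add_comm c a]; ring
      have i2 : Real.sin (theta1 a b - (c - a) / 2) * Real.cos ((c - a) / 2) =
          (Real.sin (theta1 a b) + Real.sin (theta1 a b - (c - a))) / 2 := by
        have := Real.sin_sub_sin (theta1 a b) (-(theta1 a b - (c - a)))
        rw [Real.sin_neg] at this
        rw [show (theta1 a b - -(theta1 a b - (c - a))) / 2 = theta1 a b - (c - a) / 2 by ring,
          show (theta1 a b + -(theta1 a b - (c - a))) / 2 = (c - a) / 2 by ring] at this
        linarith
      have i3 : Real.sin (theta1 a b - (c - a)) = - Real.sin b := by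
        rw [show theta1 a b - (c - a) = b - Real.pi by linarith, Real.sin_sub_pi]
      rw [i1, i2, i3]; linarith
    rw [this, Real.arcsin_sin (by linarith) (by linarith)]
  rw [theta1, key]; ring

theorem theta3_theta3 (ha : 0 < a) (hab : a < b) (hb : b < Real.pi) :
    theta3 a (theta3 a b) = b := by
  have h := theta_sum a (theta3 a b)
  rw [theta1_theta3 ha hab hb] at h
  have := theta_sum a b
  linarith

/-- As b increases, θ₃ decreases, so both terms of the derivative are nonnegative and the term from
−cos b alone is sin b. The signed gap between p₃ and p₂ is thus an admissible integration variable,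
with density at most 1/sin b. -/
theorem sin_le_deriv_cos_sub (ha : 0 < a) (hab : a < b) (hb : b < Real.pi) :
    ∃ D' : ℝ, Real.sin b ≤ D' ∧
      HasDerivAt (fun b => Real.cos (theta3 a b) - Real.cos b) D' b := by
  refine ⟨_, ?_, (hasDerivAt_theta3 ha hab hb).cos.sub (Real.hasDerivAt_cos b)⟩
  have h1 := cos_theta_sub_pos ha hab hb
  have h2 := cos_lt_cos_theta1 ha hab hb
  have h3 : 0 < Real.sin (theta3 a b) :=
    Real.sin_pos_of_pos_of_lt_pi (ha.trans (theta3_mem ha hab hb).1) (theta3_mem ha hab hb).2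
  have h4 : 0 ≤ (Real.cos (theta1 a b) - Real.cos b) /
      (Real.cos (theta1 a b) - Real.cos (theta3 a b)) := by
    apply div_nonneg <;> linarith
  nlinarith [mul_nonneg h3.le h4]

/-- A lower bound for the frequency `ω₁`. -/
theorem sin_theta1_ge (ha : 0 < a) (hab : a < b) (hb : b < Real.pi) :
    Real.sin b ^ 2 * Real.sin (theta3 a b) / 4 ≤ Real.sin (theta1 a b) := by
  obtain ⟨h1, h2, h2'⟩ := theta1_mem ha hab hb
  obtain ⟨h3, h4⟩ := theta3_mem ha hab hb
  have hsum := sin_theta_add ha hab hb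
  have hprod := sin_theta_mul ha hab hb
  have pa : 0 < Real.sin a := Real.sin_pos_of_pos_of_lt_pi ha (by linarith)
  have pb : 0 < Real.sin b := Real.sin_pos_of_pos_of_lt_pi (by linarith) hb
  have p1 : 0 < Real.sin (theta1 a b) := Real.sin_pos_of_pos_of_lt_pi h1 (by linarith)
  have p3 : 0 < Real.sin (theta3 a b) := Real.sin_pos_of_pos_of_lt_pi (by linarith) h4
  have b1 : Real.sin b ≤ 1 := Real.sin_le_one b
  -- If ω₃ ≤ ω₁ the bound is immediate. Otherwise the resonance relation forces sin b ≤ sin a, and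
  -- tan((b−a)/2) ≥ sin θ₃/2 in the product formula for ω₁ω₃ gives the claim.
  rcases le_or_gt (Real.sin (theta3 a b)) (Real.sin (theta1 a b)) with h | h
  · have : Real.sin b ^ 2 ≤ 1 := by nlinarith
    nlinarith
  · have hba : Real.sin b ≤ Real.sin a := by linarith
    have hd0 : 0 < (b - a) / 2 := by linarith
    have hc : 0 < Real.cos ((b - a) / 2) := Real.cos_pos_of_mem_Ioo ⟨by linarith, by linarith⟩
    have hs : 0 < Real.sin ((b - a) / 2) := Real.sin_pos_of_pos_of_lt_pi hd0 (by linarith)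
    have e1 : Real.sin (theta3 a b) = Real.sin ((b - a) / 2 - resAngle a b) := by
      rw [theta3, ← Real.sin_pi_sub]; congr 1; ring
    have hsa : |Real.sin (resAngle a b)| ≤ Real.sin ((b - a) / 2) := by
      rw [sin_resAngle ha hab hb]; exact (abs_tan_mul_cos_lt ha hab hb).le
    have h5 : Real.sin (theta3 a b) ≤ 2 * Real.sin ((b - a) / 2) := by
      rw [e1, Real.sin_sub]
      have := Real.cos_le_one (resAngle a b)
      have := Real.cos_le_one ((b - a) / 2)
      have := neg_le_of_abs_le hsa
      nlinarith
    have h6 : Real.sin ((b - a) / 2) ≤ Real.tan ((b - a) / 2) := by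
      rw [Real.tan_eq_sin_div_cos, le_div_iff₀ hc]
      nlinarith [Real.cos_le_one ((b - a) / 2)]
    have h7 : Real.sin (theta3 a b) ^ 2 / 4 ≤ Real.tan ((b - a) / 2) ^ 2 := by
      nlinarith
    have h8 : Real.sin (theta3 a b) ^ 2 / 4 * (Real.sin b * Real.sin b) ≤
        Real.sin (theta1 a b) * Real.sin (theta3 a b) := by
      rw [hprod]
      apply mul_le_mul h7 _ (by positivity) (by positivity)
      exact mul_le_mul_of_nonneg_right hba pb.le
    have h9 : Real.sin (theta3 a b) * (Real.sin b ^ 2 * Real.sin (theta3 a b) / 4) ≤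
        Real.sin (theta3 a b) * Real.sin (theta1 a b) := by nlinarith
    exact le_of_mul_le_mul_left h9 p3

end Angles

/-! ### Changes of variables along the resonant manifold -/

/-- The substitution b ↦ θ₃ is an involution of (a, π) that fixes θ₁. Its Jacobian (cos θ₁ − cos
b)/(cos θ₁ − cos θ₃) turns the substituted weight 1/(cos θ₁ − cos b) back into the original one. -/
theorem lintegral_exchange {a : ℝ} (ha : 0 < a) (G : ℝ → ℝ → ℝ → ENNReal) :
    ∫⁻ b in Ioo a Real.pi, ENNReal.ofReal (1 / (Real.cos (theta1 a b) - Real.cos (theta3 a b))) *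
        G (theta1 a b) b (theta3 a b) =
      ∫⁻ b in Ioo a Real.pi, ENNReal.ofReal (1 / (Real.cos (theta1 a b) - Real.cos (theta3 a b))) *
        G (theta1 a b) (theta3 a b) b := by
  have himg : theta3 a '' Ioo a Real.pi = Ioo a Real.pi := by
    ext c
    constructor
    · rintro ⟨b, hb, rfl⟩
      exact theta3_mem ha hb.1 hb.2
    · intro hc
      exact ⟨theta3 a c, theta3_mem ha hc.1 hc.2, theta3_theta3 ha hc.1 hc.2⟩
  have hinj : InjOn (theta3 a) (Ioo a Real.pi) := by
    intro b hb c hc h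
    rw [← theta3_theta3 ha hb.1 hb.2, h, theta3_theta3 ha hc.1 hc.2]
  have h := lintegral_image_eq_lintegral_abs_deriv_mul (measurableSet_Ioo (a := a) (b := Real.pi))
    (fun b hb => (hasDerivAt_theta3 ha hb.1 hb.2).hasDerivWithinAt) hinj
    (fun b => ENNReal.ofReal (1 / (Real.cos (theta1 a b) - Real.cos (theta3 a b))) *
        G (theta1 a b) b (theta3 a b))
  rw [himg] at h
  rw [h]
  refine setLIntegral_congr_fun measurableSet_Ioo fun b hb => ?_
  have h1 := cos_theta_sub_pos ha hb.1 hb.2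
  have h2 := cos_lt_cos_theta1 ha hb.1 hb.2
  rw [theta1_theta3 ha hb.1 hb.2, theta3_theta3 ha hb.1 hb.2, ← mul_assoc,
    ← ENNReal.ofReal_mul (abs_nonneg _)]
  congr 2
  rw [abs_neg, abs_of_nonneg (div_nonneg (by linarith) h1.le)]
  have h3 : Real.cos (theta1 a b) - Real.cos b ≠ 0 := by linarith
  field_simp

theorem strictMonoOn_cos_sub {a : ℝ} (ha : 0 < a) :
    StrictMonoOn (fun b => Real.cos (theta3 a b) - Real.cos b) (Ioo a Real.pi) := by
  refine strictMonoOn_of_deriv_pos (convex_Ioo _ _) ?_ ?_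
  · intro b hb
    obtain ⟨D', -, h⟩ := sin_le_deriv_cos_sub ha hb.1 hb.2
    exact h.continuousAt.continuousWithinAt
  · intro b hb
    rw [interior_Ioo] at hb
    obtain ⟨D', h1, h⟩ := sin_le_deriv_cos_sub ha hb.1 hb.2
    rw [h.deriv]
    exact (Real.sin_pos_of_pos_of_lt_pi (ha.trans hb.1) hb.2).trans_le h1

theorem lintegral_sin_mul_le {a : ℝ} (ha : 0 < a) (Θ : ℝ → ENNReal) :
    ∫⁻ b in Ioo a Real.pi, ENNReal.ofReal (Real.sin b) *
        Θ (Real.cos (theta3 a b) - Real.cos b) ≤ ∫⁻ y in Icc (-2 : ℝ) 2, Θ y := by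
  choose! D' h1 h2 using fun (b : ℝ) (hb : b ∈ Ioo a Real.pi) => sin_le_deriv_cos_sub ha hb.1 hb.2
  have h := lintegral_image_eq_lintegral_abs_deriv_mul (measurableSet_Ioo (a := a) (b := Real.pi))
    (fun b hb => (h2 b hb).hasDerivWithinAt) (strictMonoOn_cos_sub ha).injOn Θ
  calc _ ≤ ∫⁻ b in Ioo a Real.pi, ENNReal.ofReal |D' b| *
        Θ (Real.cos (theta3 a b) - Real.cos b) := by
        refine setLIntegral_mono' measurableSet_Ioo fun b hb => ?_
        gcongr
        exact (h1 b hb).trans (le_abs_self _)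
    _ = _ := h.symm
    _ ≤ _ := by
        refine lintegral_mono_set ?_
        rintro _ ⟨b, -, rfl⟩
        constructor <;>
        linarith [Real.cos_le_one b, Real.neg_one_le_cos b, Real.cos_le_one (theta3 a b),
          Real.neg_one_le_cos (theta3 a b)]

/-- The weight is |θ₁'(b)|. The sign of θ₁' is opposite to that of cos θ₃ − cos b, which is strictly
increasing in b; hence θ₁ is monotone on two intervals and at most two-to-one off a set where the
weight vanishes. This is the factor 2. -/
theorem lintegral_jacobian_le {a : ℝ} (ha : 0 < a) (H : ℝ → ENNReal) :
    ∫⁻ b in Ioo a Real.pi, ENNReal.ofReal (|Real.cos (theta3 a b) - Real.cos b| /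
        (Real.cos (theta1 a b) - Real.cos (theta3 a b))) * H (theta1 a b) ≤
      2 * ∫⁻ y in Ioo 0 Real.pi, H y := by
  set D : ℝ → ℝ := fun b => Real.cos (theta3 a b) - Real.cos b with hD
  have hmono := strictMonoOn_cos_sub ha
  set s : Set ℝ := {b | b ∈ Ioo a Real.pi ∧ 0 < D b} with hs
  set r : Set ℝ := {b | b ∈ Ioo a Real.pi ∧ D b < 0} with hr
  have cs : s.OrdConnected := by
    refine ⟨fun x hx y hy z hz => ?_⟩
    have hz' : z ∈ Ioo a Real.pi := ⟨hx.1.1.trans_le hz.1, hz.2.trans_lt hy.1.2⟩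
    exact ⟨hz', hx.2.trans_le (hmono.monotoneOn hx.1 hz' hz.1)⟩
  have cr : r.OrdConnected := by
    refine ⟨fun x hx y hy z hz => ?_⟩
    have hz' : z ∈ Ioo a Real.pi := ⟨hx.1.1.trans_le hz.1, hz.2.trans_lt hy.1.2⟩
    exact ⟨hz', (hmono.monotoneOn hz' hy.1 hz.2).trans_lt hy.2⟩
  have piece : ∀ t : Set ℝ, t.OrdConnected → t ⊆ Ioo a Real.pi → InjOn (theta1 a) t →
      ∫⁻ b in t, ENNReal.ofReal (|D b| / (Real.cos (theta1 a b) - Real.cos (theta3 a b))) *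
        H (theta1 a b) ≤ ∫⁻ y in Ioo 0 Real.pi, H y := by
    intro t ht hsub hinj
    have h := lintegral_image_eq_lintegral_abs_deriv_mul ht.measurableSet
      (fun b hb => (hasDerivAt_theta1 ha (hsub hb).1 (hsub hb).2).hasDerivWithinAt) hinj H
    calc _ = ∫⁻ y in theta1 a '' t, H y := by
          rw [h]
          refine setLIntegral_congr_fun ht.measurableSet fun b hb => ?_
          rw [abs_div, abs_of_pos (cos_theta_sub_pos ha (hsub hb).1 (hsub hb).2), hD]
          dsimp only
          rw [abs_sub_comm]
      _ ≤ _ := by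
          refine lintegral_mono_set ?_
          rintro _ ⟨b, hb, rfl⟩
          have := theta1_mem ha (hsub hb).1 (hsub hb).2
          exact ⟨this.1, this.2.1.trans (hsub hb).2⟩
  have contOn : ∀ t ⊆ Ioo a Real.pi, ContinuousOn (theta1 a) t := fun t ht b hb =>
    (hasDerivAt_theta1 ha (ht hb).1 (ht hb).2).continuousAt.continuousWithinAt
  have is : InjOn (theta1 a) s := by
    refine (strictAntiOn_of_deriv_neg cs.convex (contOn s fun b hb => hb.1) ?_).injOn
    intro b hb
    have hb := interior_subset hb
    rw [(hasDerivAt_theta1 ha hb.1.1 hb.1.2).deriv]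
    have := hb.2
    simp only [hD] at this
    exact div_neg_of_neg_of_pos (by linarith) (cos_theta_sub_pos ha hb.1.1 hb.1.2)
  have ir : InjOn (theta1 a) r := by
    refine (strictMonoOn_of_deriv_pos cr.convex (contOn r fun b hb => hb.1) ?_).injOn
    intro b hb
    have hb := interior_subset hb
    rw [(hasDerivAt_theta1 ha hb.1.1 hb.1.2).deriv]
    have := hb.2
    simp only [hD] at this
    exact div_pos (by linarith) (cos_theta_sub_pos ha hb.1.1 hb.1.2)
  have hle : ∀ b ∈ Ioo a Real.pi,
      ENNReal.ofReal (|D b| / (Real.cos (theta1 a b) - Real.cos (theta3 a b))) * H (theta1 a b) ≤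
      (s ∪ r).indicator (fun b => ENNReal.ofReal (|D b| /
        (Real.cos (theta1 a b) - Real.cos (theta3 a b))) * H (theta1 a b)) b := by
    intro b hb
    by_cases hmem : b ∈ s ∪ r
    · rw [indicator_of_mem hmem]
    · have : D b = 0 := by
        rcases lt_trichotomy (D b) 0 with h | h | h
        · exact absurd (Or.inr ⟨hb, h⟩) hmem
        · exact h
        · exact absurd (Or.inl ⟨hb, h⟩) hmem
      simp [this]
  calc _ ≤ ∫⁻ b in Ioo a Real.pi, (s ∪ r).indicator (fun b => ENNReal.ofReal (|D b| /
        (Real.cos (theta1 a b) - Real.cos (theta3 a b))) * H (theta1 a b)) b :=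
        setLIntegral_mono' measurableSet_Ioo hle
    _ ≤ ∫⁻ b, (s ∪ r).indicator (fun b => ENNReal.ofReal (|D b| /
        (Real.cos (theta1 a b) - Real.cos (theta3 a b))) * H (theta1 a b)) b :=
        setLIntegral_le_lintegral _ _
    _ = ∫⁻ b in s ∪ r, ENNReal.ofReal (|D b| /
        (Real.cos (theta1 a b) - Real.cos (theta3 a b))) * H (theta1 a b) :=
        lintegral_indicator (cs.measurableSet.union cr.measurableSet) _
    _ ≤ _ := lintegral_union_le _ _ _
    _ ≤ _ := by
        rw [two_mul]
        exact add_le_add (piece s cs (fun b hb => hb.1) is) (piece r cr (fun b hb => hb.1) ir)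

/-! ### Coordinates on the torus -/

/-- The representative of a point of the torus in `(0, 2π]`. -/
def rep (p : Torus) : ℝ := (AddCircle.equivIoc (2 * Real.pi) 0 p : ℝ)

theorem rep_mem (p : Torus) : rep p ∈ Ioc 0 (2 * Real.pi) := by
  have h : rep p ∈ Ioc 0 (0 + 2 * Real.pi) := (AddCircle.equivIoc (2 * Real.pi) 0 p).2
  rwa [zero_add] at h

theorem coe_rep (p : Torus) : ((rep p : ℝ) : Torus) = p :=
  (AddCircle.equivIoc (2 * Real.pi) 0).symm_apply_apply p

theorem rep_coe {x : ℝ} (hx : x ∈ Ioc 0 (2 * Real.pi)) : rep (x : Torus) = x := by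
  have hx' : x ∈ Ioc 0 (0 + 2 * Real.pi) := by rwa [zero_add]
  have := (AddCircle.equivIoc (2 * Real.pi) 0).apply_symm_apply ⟨x, hx'⟩
  exact congrArg Subtype.val this

theorem measurable_rep : Measurable rep :=
  measurable_subtype_coe.comp (AddCircle.measurableEquivIoc (2 * Real.pi) 0).measurable

theorem rep_neg {p : Torus} (hp : p ≠ 0) : rep (-p) = 2 * Real.pi - rep p := by
  have h := rep_mem p
  have hne : rep p ≠ 2 * Real.pi := by
    intro h'
    apply hp
    rw [← coe_rep p, h', AddCircle.coe_period]
  have : -p = ((2 * Real.pi - rep p : ℝ) : Torus) := by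
    rw [AddCircle.coe_sub, AddCircle.coe_period, coe_rep, zero_sub]
  rw [this, rep_coe]
  exact ⟨by linarith [lt_of_le_of_ne h.2 hne], by linarith [h.1]⟩

theorem neg_coe_two_mul (c : ℝ) :
    -((2 * c : ℝ) : Torus) = ((2 * (Real.pi - c) : ℝ) : Torus) := by
  rw [show 2 * (Real.pi - c) = 2 * Real.pi - 2 * c by ring, AddCircle.coe_sub,
    AddCircle.coe_period, zero_sub]

theorem exists_half_angle {p : Torus} (hp : p ≠ 0) :
    ∃ a : ℝ, 0 < a ∧ a < Real.pi ∧ p = ((2 * a : ℝ) : Torus) := by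
  have h := rep_mem p
  have hne : rep p ≠ 2 * Real.pi := by
    intro h'
    apply hp
    rw [← coe_rep p, h', AddCircle.coe_period]
  refine ⟨rep p / 2, by linarith [h.1], by linarith [lt_of_le_of_ne h.2 hne], ?_⟩
  rw [show 2 * (rep p / 2) = rep p by ring, coe_rep]

theorem rep_two_mul {c : ℝ} (h0 : 0 < c) (h1 : c ≤ Real.pi) :
    rep ((2 * c : ℝ) : Torus) = 2 * c := rep_coe ⟨by linarith, by linarith⟩

/-- The function `cos (p / 2)`, `p ∈ (0, 2π]`, on the torus. -/
def cosHalf (p : Torus) : ℝ := Real.cos (rep p / 2)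

theorem cosHalf_two_mul {c : ℝ} (h0 : 0 < c) (h1 : c < Real.pi) :
    cosHalf ((2 * c : ℝ) : Torus) = Real.cos c := by
  rw [cosHalf, rep_two_mul h0 h1.le]; congr 1; ring

theorem cosHalf_neg_two_mul {c : ℝ} (h0 : 0 < c) (h1 : c < Real.pi) :
    cosHalf (-((2 * c : ℝ) : Torus)) = -Real.cos c := by
  rw [neg_coe_two_mul, cosHalf_two_mul (by linarith) (by linarith), Real.cos_pi_sub]

theorem measurable_cosHalf : Measurable cosHalf := by
  unfold cosHalf; exact Real.measurable_cos.comp (measurable_rep.div_const 2)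

theorem omega_coe (x : ℝ) : omega (x : Torus) = |Real.sin (x / 2)| :=
  periodic_abs_sin_half.lift_coe x

theorem omega_two_mul {c : ℝ} (h0 : 0 ≤ c) (h1 : c ≤ Real.pi) :
    omega ((2 * c : ℝ) : Torus) = Real.sin c := by
  rw [omega_coe, show 2 * c / 2 = c by ring, abs_of_nonneg (Real.sin_nonneg_of_nonneg_of_le_pi h0 h1)]

theorem omega_eq_rep (p : Torus) : omega p = Real.sin (rep p / 2) := by
  have h := rep_mem p
  conv_lhs => rw [← coe_rep p, omega_coe]
  exact abs_of_nonneg (Real.sin_nonneg_of_nonneg_of_le_pi (by linarith [h.1]) (by linarith [h.2]))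

theorem omega_neg (p : Torus) : omega (-p) = omega p := by
  conv_rhs => rw [← coe_rep p]
  conv_lhs => rw [← coe_rep p]
  rw [← AddCircle.coe_neg, omega_coe, omega_coe, neg_div, Real.sin_neg, abs_neg]

theorem omega_nonneg (p : Torus) : 0 ≤ omega p := by
  rw [← coe_rep p, omega_coe]; exact abs_nonneg _

theorem omega_le_one (p : Torus) : omega p ≤ 1 := by
  rw [← coe_rep p, omega_coe]; exact Real.abs_sin_le_one _

theorem measurable_omega : Measurable omega := by
  have : omega = fun p => Real.sin (rep p / 2) := funext omega_eq_rep
  rw [this]; exact Real.measurable_sin.comp (measurable_rep.div_const 2)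

theorem omega_pos {p : Torus} (hp : p ≠ 0) : 0 < omega p := by
  obtain ⟨a, h0, h1, rfl⟩ := exists_half_angle hp
  rw [omega_two_mul h0.le h1.le]; exact Real.sin_pos_of_pos_of_lt_pi h0 h1

theorem lintegral_torus (Φ : Torus → ENNReal) :
    ∫⁻ q, Φ q = 2 * ∫⁻ b in Ioo 0 Real.pi, Φ ((2 * b : ℝ) : Torus) := by
  rw [← AddCircle.lintegral_preimage (2 * Real.pi) 0 Φ, zero_add, ← setLIntegral_congr Ioo_ae_eq_Ioc]
  have himg : (fun b : ℝ => 2 * b) '' Ioo 0 Real.pi = Ioo 0 (2 * Real.pi) := by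
    rw [image_mul_left_Ioo (by norm_num : (0 : ℝ) < 2), mul_zero]
  have h := lintegral_image_eq_lintegral_abs_deriv_mul (measurableSet_Ioo (a := (0 : ℝ)) (b := Real.pi))
    (f := fun b : ℝ => 2 * b) (f' := fun _ => 2)
    (fun b hb => by simpa using ((hasDerivAt_id b).const_mul 2).hasDerivWithinAt)
    (fun x _ y _ h => by simpa using h) (fun x : ℝ => Φ (x : Torus))
  rw [himg] at h
  rw [h, ← lintegral_const_mul' _ _ (by norm_num)]
  simp

/-- The angle formulas are available for 0 < a < b < π. The remaining range b < a is brought to that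
form by the reflection p ↦ −p, which replaces a by π − a. -/
theorem lintegral_torus_split (Φ : Torus → ENNReal) {a : ℝ} (h0 : 0 < a) (h1 : a < Real.pi) :
    ∫⁻ q, Φ q = 2 * ((∫⁻ b in Ioo a Real.pi, Φ ((2 * b : ℝ) : Torus)) +
      ∫⁻ b in Ioo (Real.pi - a) Real.pi, Φ (-((2 * b : ℝ) : Torus))) := by
  rw [lintegral_torus]
  congr 1
  have e : Ioo (0 : ℝ) Real.pi =ᵐ[volume] (Ioo a Real.pi ∪ Ioo 0 a : Set ℝ) := by
    have : Ioo (0 : ℝ) Real.pi = Ico a Real.pi ∪ Ioo 0 a := by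
      rw [union_comm, Ioo_union_Ico_eq_Ioo h0 h1.le]
    rw [this]
    exact (Ioo_ae_eq_Ico.symm).union (ae_eq_refl _)
  rw [setLIntegral_congr e, lintegral_union measurableSet_Ioo]
  · congr 1
    have himg : (fun b : ℝ => Real.pi - b) '' Ioo (Real.pi - a) Real.pi = Ioo 0 a := by
      rw [image_const_sub_Ioo]; simp
    have h := lintegral_image_eq_lintegral_abs_deriv_mul
      (measurableSet_Ioo (a := Real.pi - a) (b := Real.pi))
      (f := fun b : ℝ => Real.pi - b) (f' := fun _ => -1)
      (fun b hb => ((hasDerivAt_id b).const_sub Real.pi).hasDerivWithinAt)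
      (fun x _ y _ h => by simpa using h) (fun x : ℝ => Φ ((2 * x : ℝ) : Torus))
    rw [himg] at h
    rw [h]
    simp [neg_coe_two_mul]
  · rw [Set.disjoint_left]
    intro x hx hx'
    exact absurd hx.1 (not_lt.2 hx'.2.le)

/-! ### The resonant momenta and the density on the torus -/

/-- The momentum `p₁ = h(p₀, p₂)`. -/
def mom1 (p q : Torus) : Torus := ((resonance (rep p) (rep q) : ℝ) : Torus)

/-- The momentum `p₃ = p₀ + p₁ - p₂`. -/
def mom3 (p q : Torus) : Torus := p + mom1 p q - q

/-- The function `√F₊`. -/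
def dens (p q : Torus) : ℝ := Real.sqrt (Fplus (rep p) (rep q))

theorem mom1_two_mul {a b : ℝ} (ha : 0 < a) (hab : a < b) (hb : b < Real.pi) :
    mom1 ((2 * a : ℝ) : Torus) ((2 * b : ℝ) : Torus) = ((2 * theta1 a b : ℝ) : Torus) := by
  rw [mom1, rep_two_mul ha (by linarith), rep_two_mul (by linarith) hb.le, resonance_eq hab]

theorem mom3_two_mul {a b : ℝ} (ha : 0 < a) (hab : a < b) (hb : b < Real.pi) :
    mom3 ((2 * a : ℝ) : Torus) ((2 * b : ℝ) : Torus) = ((2 * theta3 a b : ℝ) : Torus) := by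
  rw [mom3, mom1_two_mul ha hab hb, theta_sum,
    show 2 * (Real.pi + theta1 a b - (b - a)) = 2 * Real.pi + (2 * a + 2 * theta1 a b - 2 * b) by ring,
    AddCircle.coe_add, AddCircle.coe_period, zero_add, AddCircle.coe_sub, AddCircle.coe_add]

theorem dens_two_mul {a b : ℝ} (ha : 0 < a) (hab : a < b) (hb : b < Real.pi) :
    dens ((2 * a : ℝ) : Torus) ((2 * b : ℝ) : Torus) =
      Real.cos (theta1 a b) - Real.cos (theta3 a b) := by
  rw [dens, rep_two_mul ha (by linarith), rep_two_mul (by linarith) hb.le, sqrt_Fplus_eq ha hab hb]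

theorem mom1_neg {p q : Torus} (hp : p ≠ 0) (hq : q ≠ 0) : mom1 (-p) (-q) = -mom1 p q := by
  rw [mom1, mom1, rep_neg hp, rep_neg hq, resonance_reflect, AddCircle.coe_neg]

theorem mom3_neg {p q : Torus} (hp : p ≠ 0) (hq : q ≠ 0) : mom3 (-p) (-q) = -mom3 p q := by
  rw [mom3, mom3, mom1_neg hp hq]; abel

theorem dens_neg {p q : Torus} (hp : p ≠ 0) (hq : q ≠ 0) : dens (-p) (-q) = dens p q := by
  rw [dens, dens, rep_neg hp, rep_neg hq, Fplus_reflect]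

/-- Exchanging p₀ with p₂ exchanges p₁ with p₃; with the symmetry of F₊ this makes the kernel
symmetric. -/
theorem mom1_swap (p q : Torus) : mom1 q p = mom3 p q := by
  rw [mom3, mom1, mom1, resonance_swap, AddCircle.coe_sub, AddCircle.coe_add, coe_rep, coe_rep]

theorem mom3_swap (p q : Torus) : mom3 q p = mom1 p q := by
  rw [mom3, mom1_swap, mom3]; abel

theorem dens_swap (p q : Torus) : dens q p = dens p q := by
  rw [dens, dens, Fplus_swap]

theorem two_mul_ne_zero_torus {c : ℝ} (h0 : 0 < c) (h1 : c < Real.pi) :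
    ((2 * c : ℝ) : Torus) ≠ 0 := by
  intro h
  have h' := omega_two_mul h0.le h1.le
  rw [h, ← AddCircle.coe_zero, omega_coe] at h'
  have := Real.sin_pos_of_pos_of_lt_pi h0 h1
  rw [← h'] at this
  simp at this

/-- Outside of a null set, a pair of momenta is, up to the reflection `p ↦ -p`, given by half-angles
`0 < a < b < π`. -/
theorem exists_half_angles {p q : Torus} (hp : p ≠ 0) (hq : q ≠ 0) (hpq : p ≠ q) :
    ∃ a b : ℝ, 0 < a ∧ a < b ∧ b < Real.pi ∧
      ((p = ((2 * a : ℝ) : Torus) ∧ q = ((2 * b : ℝ) : Torus)) ∨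
        (p = -((2 * a : ℝ) : Torus) ∧ q = -((2 * b : ℝ) : Torus))) := by
  obtain ⟨a, a0, a1, rfl⟩ := exists_half_angle hp
  obtain ⟨b, b0, b1, rfl⟩ := exists_half_angle hq
  rcases lt_trichotomy a b with h | h | h
  · exact ⟨a, b, a0, h, b1, Or.inl ⟨rfl, rfl⟩⟩
  · exact absurd (by rw [h]) hpq
  · refine ⟨Real.pi - a, Real.pi - b, by linarith, by linarith, by linarith, Or.inr ?_⟩
    rw [neg_coe_two_mul, neg_coe_two_mul]; simp

/-- The difference `cos (p₃ / 2) - cos (p₂ / 2)`. -/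
def cosGap (p q : Torus) : ℝ := |cosHalf (mom3 p q) - cosHalf q|

theorem cosGap_two_mul {a b : ℝ} (ha : 0 < a) (hab : a < b) (hb : b < Real.pi) :
    cosGap ((2 * a : ℝ) : Torus) ((2 * b : ℝ) : Torus) =
      |Real.cos (theta3 a b) - Real.cos b| := by
  have h3 := theta3_mem ha hab hb
  rw [cosGap, mom3_two_mul ha hab hb, cosHalf_two_mul (by linarith) h3.2,
    cosHalf_two_mul (by linarith) hb]

theorem cosGap_neg {a b : ℝ} (ha : 0 < a) (hab : a < b) (hb : b < Real.pi) :
    cosGap (-((2 * a : ℝ) : Torus)) (-((2 * b : ℝ) : Torus)) =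
      |Real.cos (theta3 a b) - Real.cos b| := by
  have h3 := theta3_mem ha hab hb
  rw [cosGap, mom3_neg (two_mul_ne_zero_torus ha (by linarith))
    (two_mul_ne_zero_torus (by linarith) hb), mom3_two_mul ha hab hb,
    cosHalf_neg_two_mul (by linarith) h3.2,
    cosHalf_neg_two_mul (by linarith) hb, ← abs_neg]
  congr 1; ring

theorem measurable_mom1 : Measurable fun w : Torus × Torus => mom1 w.1 w.2 := by
  have h1 : Measurable fun w : Torus × Torus => rep w.1 := measurable_rep.comp measurable_fst
  have h2 : Measurable fun w : Torus × Torus => rep w.2 := measurable_rep.comp measurable_snd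
  refine AddCircle.measurable_mk'.comp ?_
  unfold resonance
  simp only [Real.tan_eq_sin_div_cos]
  have h3 : Measurable fun w : Torus × Torus => |rep w.2 - rep w.1| / 4 :=
    ((h2.sub h1).abs).div_const 4
  exact ((h2.sub h1).div_const 2).add (((Real.measurable_arcsin.comp
    ((h3.sin.div h3.cos).mul ((h2.add h1).div_const 4).cos))).const_mul 2)

theorem measurable_mom3 : Measurable fun w : Torus × Torus => mom3 w.1 w.2 :=
  (measurable_fst.add measurable_mom1).sub measurable_snd

theorem measurable_dens : Measurable fun w : Torus × Torus => dens w.1 w.2 := by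
  have h1 : Measurable fun w : Torus × Torus => rep w.1 / 2 :=
    (measurable_rep.comp measurable_fst).div_const 2
  have h2 : Measurable fun w : Torus × Torus => rep w.2 / 2 :=
    (measurable_rep.comp measurable_snd).div_const 2
  unfold dens Fplus
  exact (((h1.cos.add h2.cos).pow_const 2).add ((h1.sin.const_mul 4).mul h2.sin)).sqrt

theorem measurable_cosGap : Measurable fun w : Torus × Torus => cosGap w.1 w.2 :=
  ((measurable_cosHalf.comp measurable_mom3).sub (measurable_cosHalf.comp measurable_snd)).abs

theorem lintegral_torus_exchange {p : Torus} (hp : p ≠ 0) (G : Torus → Torus → Torus → ENNReal) :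
    ∫⁻ q, ENNReal.ofReal (1 / dens p q) * G (mom1 p q) q (mom3 p q) =
      ∫⁻ q, ENNReal.ofReal (1 / dens p q) * G (mom1 p q) (mom3 p q) q := by
  obtain ⟨a, a0, a1, rfl⟩ := exists_half_angle hp
  have a0' : 0 < Real.pi - a := by linarith
  have ea : ((2 * a : ℝ) : Torus) = -((2 * (Real.pi - a) : ℝ) : Torus) := by
    rw [neg_coe_two_mul]; simp
  rw [lintegral_torus_split _ a0 a1, lintegral_torus_split _ a0 a1]
  congr 2
  · have := lintegral_exchange a0 fun x y z =>
      G ((2 * x : ℝ) : Torus) ((2 * y : ℝ) : Torus) ((2 * z : ℝ) : Torus)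
    refine Eq.trans (setLIntegral_congr_fun measurableSet_Ioo fun b hb => ?_)
      (this.trans (setLIntegral_congr_fun measurableSet_Ioo fun b hb => ?_)) <;>
    simp only [mom1_two_mul a0 hb.1 hb.2, mom3_two_mul a0 hb.1 hb.2, dens_two_mul a0 hb.1 hb.2]
  · have := lintegral_exchange a0' fun x y z =>
      G (-((2 * x : ℝ) : Torus)) (-((2 * y : ℝ) : Torus)) (-((2 * z : ℝ) : Torus))
    refine Eq.trans (setLIntegral_congr_fun measurableSet_Ioo fun b hb => ?_)
      (this.trans (setLIntegral_congr_fun measurableSet_Ioo fun b hb => ?_)) <;>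
    · have n1 := two_mul_ne_zero_torus a0' (by linarith)
      have n2 := two_mul_ne_zero_torus (a0'.trans hb.1) hb.2
      rw [ea, mom1_neg n1 n2, mom3_neg n1 n2, dens_neg n1 n2, mom1_two_mul a0' hb.1 hb.2,
        mom3_two_mul a0' hb.1 hb.2, dens_two_mul a0' hb.1 hb.2]

/-- This controls the neighbourhood of p₂ = p₃, where p₂ ↦ p₁ degenerates. The factor 4 is the 2 of
p = 2b times the two pieces on either side of p₀. -/
theorem lintegral_omega_cosGap_le {p : Torus} (hp : p ≠ 0) (Θ : ℝ → ENNReal) :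
    ∫⁻ q, ENNReal.ofReal (omega q) * Θ (cosGap p q) ≤ 4 * ∫⁻ y in Icc (-2 : ℝ) 2, Θ |y| := by
  obtain ⟨a, a0, a1, rfl⟩ := exists_half_angle hp
  have a0' : 0 < Real.pi - a := by linarith
  have ea : ((2 * a : ℝ) : Torus) = -((2 * (Real.pi - a) : ℝ) : Torus) := by
    rw [neg_coe_two_mul]; simp
  rw [lintegral_torus_split _ a0 a1, show (4 : ENNReal) = 2 * 2 by norm_num, mul_assoc, two_mul (∫⁻ _ in _, _)]
  gcongr 2 * (?_ + ?_)
  · refine le_trans (le_of_eq ?_) (lintegral_sin_mul_le a0 fun y => Θ |y|)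
    refine setLIntegral_congr_fun measurableSet_Ioo fun b hb => ?_
    rw [omega_two_mul (a0.trans hb.1).le hb.2.le, cosGap_two_mul a0 hb.1 hb.2]
  · refine le_trans (le_of_eq ?_) (lintegral_sin_mul_le a0' fun y => Θ |y|)
    refine setLIntegral_congr_fun measurableSet_Ioo fun b hb => ?_
    rw [omega_neg, omega_two_mul (a0'.trans hb.1).le hb.2.le, ea, cosGap_neg a0' hb.1 hb.2]

theorem lintegral_mom1_le {p : Torus} (hp : p ≠ 0) (H : Torus → ENNReal) :
    ∫⁻ q, ENNReal.ofReal (cosGap p q / dens p q) * H (mom1 p q) ≤ 4 * ∫⁻ y, H y := by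
  obtain ⟨a, a0, a1, rfl⟩ := exists_half_angle hp
  have a0' : 0 < Real.pi - a := by linarith
  have ea : ((2 * a : ℝ) : Torus) = -((2 * (Real.pi - a) : ℝ) : Torus) := by
    rw [neg_coe_two_mul]; simp
  rw [lintegral_torus_split _ a0 a1, show (4 : ENNReal) = 2 * 2 by norm_num, mul_assoc,
    two_mul (∫⁻ _, _)]
  gcongr 2 * (?_ + ?_)
  · refine le_trans (le_of_eq ?_) ((lintegral_jacobian_le a0 fun y => H ((2 * y : ℝ) : Torus)).trans
      (le_of_eq (lintegral_torus H).symm))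
    refine setLIntegral_congr_fun measurableSet_Ioo fun b hb => ?_
    rw [mom1_two_mul a0 hb.1 hb.2, dens_two_mul a0 hb.1 hb.2, cosGap_two_mul a0 hb.1 hb.2]
  · refine le_trans (le_of_eq ?_) ((lintegral_jacobian_le a0' fun y =>
      H (-((2 * y : ℝ) : Torus))).trans (le_of_eq ((lintegral_torus fun q => H (-q)).symm.trans
        (lintegral_neg_eq_self H))))
    refine setLIntegral_congr_fun measurableSet_Ioo fun b hb => ?_
    have n1 := two_mul_ne_zero_torus a0' (by linarith)
    have n2 := two_mul_ne_zero_torus (a0'.trans hb.1) hb.2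
    rw [ea, mom1_neg n1 n2, dens_neg n1 n2, mom1_two_mul a0' hb.1 hb.2,
      dens_two_mul a0' hb.1 hb.2, cosGap_neg a0' hb.1 hb.2]

/-! ### Pointwise properties of generic resonant quadruples -/

theorem generic_facts {p q : Torus} (hp : p ≠ 0) (hq : q ≠ 0) (hpq : p ≠ q) :
    0 < omega (mom1 p q) ∧ 0 < omega (mom3 p q) ∧ 0 < dens p q ∧
      omega q ^ 2 * omega (mom3 p q) / 4 ≤ omega (mom1 p q) := by
  obtain ⟨a, b, a0, hab, b1, h⟩ := exists_half_angles hp hq hpq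
  obtain ⟨h1, h2, -⟩ := theta1_mem a0 hab b1
  obtain ⟨h3, h4⟩ := theta3_mem a0 hab b1
  have n1 := two_mul_ne_zero_torus a0 (hab.trans b1)
  have n2 := two_mul_ne_zero_torus (a0.trans hab) b1
  have e1 := omega_two_mul h1.le (h2.trans b1).le
  have e3 := omega_two_mul (a0.trans h3).le h4.le
  have e2 := omega_two_mul (a0.trans hab).le b1.le
  have s1 := Real.sin_pos_of_pos_of_lt_pi h1 (h2.trans b1)
  have s3 := Real.sin_pos_of_pos_of_lt_pi (a0.trans h3) h4
  rcases h with ⟨rfl, rfl⟩ | ⟨rfl, rfl⟩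
  · rw [mom1_two_mul a0 hab b1, mom3_two_mul a0 hab b1, dens_two_mul a0 hab b1, e1, e3, e2]
    exact ⟨s1, s3, cos_theta_sub_pos a0 hab b1, sin_theta1_ge a0 hab b1⟩
  · rw [mom1_neg n1 n2, mom3_neg n1 n2, dens_neg n1 n2, omega_neg, omega_neg, omega_neg,
      mom1_two_mul a0 hab b1, mom3_two_mul a0 hab b1, dens_two_mul a0 hab b1, e1, e3, e2]
    exact ⟨s1, s3, cos_theta_sub_pos a0 hab b1, sin_theta1_ge a0 hab b1⟩

theorem dens_ge (p q : Torus) : 2 * Real.sqrt (omega p * omega q) ≤ dens p q := by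
  have h0 : 0 ≤ omega p * omega q := mul_nonneg (omega_nonneg p) (omega_nonneg q)
  rw [dens]
  apply Real.le_sqrt_of_sq_le
  rw [mul_pow, Real.sq_sqrt h0, Fplus, omega_eq_rep, omega_eq_rep]
  nlinarith [sq_nonneg (Real.cos (rep p / 2) + Real.cos (rep q / 2))]

theorem dens_nonneg (p q : Torus) : 0 ≤ dens p q := Real.sqrt_nonneg _

theorem ae_generic (p : Torus) : ∀ᵐ q : Torus, q ≠ 0 ∧ p ≠ q := by
  have h0 (r : Torus) : ∀ᵐ q : Torus, q ≠ r := by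
    have := AddCircle.volume_closedBall (2 * Real.pi) (x := r) 0
    rw [Metric.closedBall_zero, mul_zero, min_eq_right Real.two_pi_pos.le, ENNReal.ofReal_zero] at this
    exact measure_eq_zero_iff_ae_notMem.1 this
  have h1 := h0 0
  have h2 := h0 p
  filter_upwards [h1, h2] with q h1 h2 using ⟨h1, h2.symm⟩

theorem ae_ne_zero : ∀ᵐ q : Torus, q ≠ 0 := (ae_generic 0).mono fun _ h => h.1

/-! ### The window of resonances whose other three frequencies are comparable to ω₀^{1/3} -/

theorem bounds_of_mul_of_sub {ρ x y : ℝ} (hρ : 0 < ρ) (hy : 0 < y)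
    (h1 : 0.024 * ρ ^ 2 ≤ x * y) (h2 : x * y ≤ 84.5 * ρ ^ 2) (h3 : x ≤ y + ρ) (h4 : y ≤ x + ρ) :
    ρ / 500 ≤ x ∧ x ≤ 11 * ρ := by
  have hρ2 : 0 < ρ ^ 2 := by positivity
  -- If u > 11ρ then v > 10ρ and uv > 110ρ², beyond the allowed 84.5ρ². With both factors at most
  -- 11ρ, a factor below ρ/500 would make the product at most 0.022ρ² < 0.024ρ².
  have key : ∀ u v : ℝ, u ≤ v + ρ → u * v ≤ 84.5 * ρ ^ 2 → u ≤ 11 * ρ := by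
    intro u v h h'
    by_contra hu
    push Not at hu
    have : 10 * ρ < v := by linarith
    have : 11 * ρ * (10 * ρ) < u * v := by gcongr
    linarith
  refine ⟨?_, key x y h3 h2⟩
  by_contra hx
  push Not at hx
  have hy' : y ≤ 11 * ρ := key y x h4 (by rwa [mul_comm])
  have : x * y ≤ ρ / 500 * (11 * ρ) := by gcongr
  linarith

/-- With b = π − ζ and ζ of order ρ = (sin a)^{1/3}, the angle (b−a)/2 is within order ρ of π/2, so
its tangent is of order 1/ρ. The product ω₁ω₃ = tan² · sin a · sin b is then of order ρ⁻²·ρ³·ρ = ρ²,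
while |ω₁ − ω₃| ≤ ρ by resonance. Together these force ω₁ and ω₃ to be of order ρ. -/
theorem window_bounds {a ρ ζ : ℝ} (ha : 0 < a) (ha' : a ≤ Real.pi / 2) (hρ : 0 < ρ)
    (hρa : ρ ^ 3 = Real.sin a) (hζ : ρ / 4 < ζ) (hζ' : ζ < ρ / 2) :
    a < Real.pi - ζ ∧ Real.pi - ζ < Real.pi ∧
    (ρ / 500 ≤ Real.sin (Real.pi - ζ) ∧ Real.sin (Real.pi - ζ) ≤ 11 * ρ) ∧
    (ρ / 500 ≤ Real.sin (theta1 a (Real.pi - ζ)) ∧ Real.sin (theta1 a (Real.pi - ζ)) ≤ 11 * ρ) ∧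
    (ρ / 500 ≤ Real.sin (theta3 a (Real.pi - ζ)) ∧ Real.sin (theta3 a (Real.pi - ζ)) ≤ 11 * ρ) ∧
    Real.cos (theta1 a (Real.pi - ζ)) - Real.cos (theta3 a (Real.pi - ζ)) ≤ 2 * ρ ^ 2 := by
  have pi1 := Real.pi_gt_d2
  have pi2 := Real.pi_lt_d2
  have hρ1 : ρ ≤ 1 := by
    have := Real.sin_le_one a
    by_contra h
    push Not at h
    linarith [one_lt_pow₀ h three_ne_zero]
  have ζ0 : 0 < ζ := by linarith
  have hab : a < Real.pi - ζ := by linarith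
  have hb : Real.pi - ζ < Real.pi := by linarith
  have jordan : ∀ x, 0 ≤ x → x ≤ Real.pi / 2 → 0.63 * x ≤ Real.sin x := by
    intro x h0 h1
    refine le_trans ?_ (Real.mul_le_sin h0 h1)
    gcongr
    rw [le_div_iff₀ Real.pi_pos]; linarith
  have hρ3 : ρ ^ 3 ≤ ρ := pow_le_of_le_one hρ.le hρ1 three_ne_zero
  have aρ : a ≤ 1.6 * ρ := by have := jordan a ha.le ha'; linarith
  have aρ3 : a ≤ 1.6 * ρ ^ 3 := by have := jordan a ha.le ha'; linarith
  have sζ1 : 0.15 * ρ ≤ Real.sin ζ := by have := jordan ζ ζ0.le (by linarith); linarith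
  have sζ2 : Real.sin ζ ≤ ρ / 2 := (Real.sin_le ζ0.le).trans hζ'.le
  have hsb : Real.sin (Real.pi - ζ) = Real.sin ζ := Real.sin_pi_sub ζ
  obtain ⟨m1, m2, -⟩ := theta1_mem ha hab hb
  obtain ⟨m3, m4⟩ := theta3_mem ha hab hb
  have s1 := Real.sin_pos_of_pos_of_lt_pi m1 (m2.trans hb)
  have s3 := Real.sin_pos_of_pos_of_lt_pi (ha.trans m3) m4
  have hsum := sin_theta_add ha hab hb
  have hprod := sin_theta_mul ha hab hb
  rw [hsb, ← hρa] at hsum hprod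
  set y := (ζ + a) / 2 with hy
  have hd : (Real.pi - ζ - a) / 2 = Real.pi / 2 - y := by rw [hy]; ring
  have y0 : ρ / 8 ≤ y := by rw [hy]; linarith
  have y1 : y ≤ 1.05 * ρ := by rw [hy]; linarith
  have y2 : y ≤ 1.04 := by rw [hy]; linarith
  have sy1 : Real.sin y ≤ 1.05 * ρ := (Real.sin_le (by linarith)).trans y1
  have sy2 : 0.63 * (ρ / 8) ≤ Real.sin y :=
    le_trans (by linarith) (jordan y (by linarith) (by linarith))
  have sy0 : 0 < Real.sin y := by linarith
  have cy1 : 0.45 ≤ Real.cos y := by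
    have h := Real.one_sub_sq_div_two_le_cos (x := y)
    have : y ^ 2 ≤ 1.04 ^ 2 := by gcongr
    linarith
  have cy2 := Real.cos_le_one y
  have ht : Real.tan (Real.pi / 2 - y) = Real.cos y / Real.sin y := by
    rw [Real.tan_eq_sin_div_cos, Real.sin_pi_div_two_sub, Real.cos_pi_div_two_sub]
  have t1 : 0.4 ≤ Real.tan (Real.pi / 2 - y) * ρ := by
    rw [ht, div_mul_eq_mul_div, le_div_iff₀ sy0]
    have : 0.45 * ρ ≤ Real.cos y * ρ := by gcongr
    linarith
  have t2 : Real.tan (Real.pi / 2 - y) * ρ ≤ 13 := by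
    rw [ht, div_mul_eq_mul_div, div_le_iff₀ sy0]
    have : Real.cos y * ρ ≤ 1 * ρ := by gcongr
    linarith
  rw [hd] at hprod
  set t := Real.tan (Real.pi / 2 - y) with htdef
  set w1 := Real.sin (theta1 a (Real.pi - ζ)) with hw1
  set w3 := Real.sin (theta3 a (Real.pi - ζ)) with hw3
  have hprod' : w1 * w3 = (t * ρ) ^ 2 * (ρ * Real.sin ζ) := by rw [hprod]; ring
  have tt1 : (0.4 : ℝ) ^ 2 ≤ (t * ρ) ^ 2 := by gcongr
  have tt2 : (t * ρ) ^ 2 ≤ 13 ^ 2 := by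
    have : 0 ≤ t * ρ := by linarith
    gcongr
  have P1 : 0.024 * ρ ^ 2 ≤ w1 * w3 := by
    rw [hprod']
    calc 0.024 * ρ ^ 2 = 0.4 ^ 2 * (ρ * (0.15 * ρ)) := by ring
      _ ≤ _ := by gcongr
  have P2 : w1 * w3 ≤ 84.5 * ρ ^ 2 := by
    rw [hprod']
    calc _ ≤ 13 ^ 2 * (ρ * (ρ / 2)) := by
          have : 0 ≤ ρ * Real.sin ζ := mul_nonneg hρ.le (by linarith)
          gcongr
      _ = _ := by ring
  have hρ30 : 0 < ρ ^ 3 := by positivity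
  -- The resonance relation reads w₁ − w₃ = sin ζ − ρ³, with both terms on the right between 0 and
  -- ρ.
  have d1 : w1 ≤ w3 + ρ := by linarith
  have d3 : w3 ≤ w1 + ρ := by linarith
  obtain ⟨L1, U1⟩ := bounds_of_mul_of_sub hρ s3 P1 P2 d1 d3
  obtain ⟨L3, U3⟩ := bounds_of_mul_of_sub hρ s1 (mul_comm w1 w3 ▸ P1) (mul_comm w1 w3 ▸ P2) d3 d1
  refine ⟨hab, hb, ⟨by rw [hsb]; linarith, by rw [hsb]; linarith⟩, ⟨L1, U1⟩, ⟨L3, U3⟩, ?_⟩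
  -- F₊ = (cos a − cos ζ)² + 4 sin a sin ζ. Both terms are of order ρ⁴, with total constant 1.28² +
  -- 2 < 4.
  rw [← sqrt_Fplus_eq ha hab hb]
  apply Real.sqrt_le_iff.2 ⟨by positivity, ?_⟩
  rw [Fplus, mul_div_cancel_left₀ _ two_ne_zero, mul_div_cancel_left₀ _ two_ne_zero, hsb,
    Real.cos_pi_sub, ← hρa]
  have c1 := Real.one_sub_sq_div_two_le_cos (x := a)
  have c2 := Real.one_sub_sq_div_two_le_cos (x := ζ)
  have c3 := Real.cos_le_one a
  have c4 := Real.cos_le_one ζ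
  have a2 : a ^ 2 ≤ (1.6 * ρ) ^ 2 := by gcongr
  have z2 : ζ ^ 2 ≤ (ρ / 2) ^ 2 := by gcongr
  have hρ2 : 0 < ρ ^ 2 := by positivity
  have k1 : Real.cos a + -Real.cos ζ ≤ 1.28 * ρ ^ 2 := by linarith
  have k2 : -(1.28 * ρ ^ 2) ≤ Real.cos a + -Real.cos ζ := by linarith
  have k3 : (Real.cos a + -Real.cos ζ) ^ 2 ≤ (1.28 * ρ ^ 2) ^ 2 := sq_le_sq' k2 k1
  have k4 : 4 * ρ ^ 3 * Real.sin ζ ≤ 4 * ρ ^ 3 * (ρ / 2) := by gcongr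
  have k5 := pow_pos hρ 4
  linarith

/-- The momenta `p₂ = q` for which all frequencies but `ω₀` have size `ω₀^{1/3}`. -/
def window (p : Torus) : Set Torus :=
  {q | (omega p ^ (1 / 3 : ℝ) / 500 ≤ omega q ∧ omega q ≤ 11 * omega p ^ (1 / 3 : ℝ)) ∧
    (omega p ^ (1 / 3 : ℝ) / 500 ≤ omega (mom1 p q) ∧
      omega (mom1 p q) ≤ 11 * omega p ^ (1 / 3 : ℝ)) ∧
    (omega p ^ (1 / 3 : ℝ) / 500 ≤ omega (mom3 p q) ∧
      omega (mom3 p q) ≤ 11 * omega p ^ (1 / 3 : ℝ)) ∧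
    dens p q ≤ 2 * (omega p ^ (1 / 3 : ℝ)) ^ 2}

theorem measurable_mom1_right (p : Torus) : Measurable (mom1 p) :=
  Measurable.of_uncurry_left (f := mom1) measurable_mom1

theorem measurable_mom3_right (p : Torus) : Measurable (mom3 p) :=
  Measurable.of_uncurry_left (f := mom3) measurable_mom3

theorem measurable_dens_right (p : Torus) : Measurable (dens p) :=
  Measurable.of_uncurry_left (f := dens) measurable_dens

theorem measurable_cosGap_right (p : Torus) : Measurable (cosGap p) :=
  Measurable.of_uncurry_left (f := cosGap) measurable_cosGap

theorem measurableSet_window (p : Torus) : MeasurableSet (window p) := by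
  have h0 := measurable_omega
  have h1 := h0.comp (measurable_mom1_right p)
  have h3 := h0.comp (measurable_mom3_right p)
  exact ((measurableSet_le measurable_const h0).inter (measurableSet_le h0 measurable_const)).inter
    (((measurableSet_le measurable_const h1).inter (measurableSet_le h1 measurable_const)).inter
    (((measurableSet_le measurable_const h3).inter (measurableSet_le h3 measurable_const)).inter
    (measurableSet_le (measurable_dens_right p) measurable_const)))

theorem volume_window {p : Torus} (hp : p ≠ 0) :
    ENNReal.ofReal (omega p ^ (1 / 3 : ℝ) / 2) ≤ volume (window p) := by
  have hw := omega_pos hp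
  set ρ := omega p ^ (1 / 3 : ℝ) with hρ
  have ρ0 : 0 < ρ := Real.rpow_pos_of_pos hw _
  have ρ3 : ρ ^ 3 = omega p := by
    rw [hρ, ← Real.rpow_natCast, ← Real.rpow_mul hw.le]; norm_num
  have hvol : ENNReal.ofReal (ρ / 2) =
      2 * ∫⁻ b in Ioo (Real.pi - ρ / 2) (Real.pi - ρ / 4), 1 := by
    rw [setLIntegral_one, Real.volume_Ioo, ← ENNReal.ofReal_ofNat, ← ENNReal.ofReal_mul (by norm_num)]
    congr 1; ring
  rw [← lintegral_indicator_one (measurableSet_window p), hvol]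
  obtain ⟨a, a0, a1, rfl⟩ := exists_half_angle hp
  rw [lintegral_torus_split _ a0 a1]
  gcongr 2 * ?_
  -- The window is found near the far end π of the half-angle interval, in whichever of the two
  -- pieces starts at a half-angle at most π/2.
  rcases le_or_gt a (Real.pi / 2) with ha | ha
  · refine le_trans ?_ le_self_add
    have hρa : ρ ^ 3 = Real.sin a := by rw [ρ3, omega_two_mul a0.le a1.le]
    calc _ ≤ ∫⁻ b in Ioo (Real.pi - ρ / 2) (Real.pi - ρ / 4),
          (window ((2 * a : ℝ) : Torus)).indicator 1 ((2 * b : ℝ) : Torus) := by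
          refine setLIntegral_mono' measurableSet_Ioo fun b hb => ?_
          have W := window_bounds a0 ha ρ0 hρa (ζ := Real.pi - b) (by linarith [hb.2])
            (by linarith [hb.1])
          rw [sub_sub_cancel] at W
          obtain ⟨hab, hb1, W2, W1, W3, WF⟩ := W
          obtain ⟨m1, m2, -⟩ := theta1_mem a0 hab hb1
          obtain ⟨m3, m4⟩ := theta3_mem a0 hab hb1
          rw [indicator_of_mem]
          · rfl
          · refine ⟨?_, ?_, ?_, ?_⟩
            · rwa [omega_two_mul (a0.trans hab).le hb1.le]
            · rwa [mom1_two_mul a0 hab hb1, omega_two_mul m1.le (m2.trans hb1).le]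
            · rwa [mom3_two_mul a0 hab hb1, omega_two_mul (a0.trans m3).le m4.le]
            · rwa [dens_two_mul a0 hab hb1]
      _ ≤ _ := by
          refine lintegral_mono_set fun b hb => ?_
          have W := window_bounds a0 ha ρ0 hρa (ζ := Real.pi - b) (by linarith [hb.2])
            (by linarith [hb.1])
          rw [sub_sub_cancel] at W
          exact ⟨W.1, W.2.1⟩
  · refine le_trans ?_ le_add_self
    have a0' : 0 < Real.pi - a := by linarith
    have ha' : Real.pi - a ≤ Real.pi / 2 := by linarith
    have ea : ((2 * a : ℝ) : Torus) = -((2 * (Real.pi - a) : ℝ) : Torus) := by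
      rw [neg_coe_two_mul]; simp
    have hρa : ρ ^ 3 = Real.sin (Real.pi - a) := by
      rw [ρ3, omega_two_mul a0.le a1.le, Real.sin_pi_sub]
    calc _ ≤ ∫⁻ b in Ioo (Real.pi - ρ / 2) (Real.pi - ρ / 4),
          (window ((2 * a : ℝ) : Torus)).indicator 1 (-((2 * b : ℝ) : Torus)) := by
          refine setLIntegral_mono' measurableSet_Ioo fun b hb => ?_
          have W := window_bounds a0' ha' ρ0 hρa (ζ := Real.pi - b) (by linarith [hb.2])
            (by linarith [hb.1])
          rw [sub_sub_cancel] at W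
          obtain ⟨hab, hb1, W2, W1, W3, WF⟩ := W
          obtain ⟨m1, m2, -⟩ := theta1_mem a0' hab hb1
          obtain ⟨m3, m4⟩ := theta3_mem a0' hab hb1
          have n1 := two_mul_ne_zero_torus a0' (by linarith)
          have n2 := two_mul_ne_zero_torus (a0'.trans hab) hb1
          rw [indicator_of_mem]
          · rfl
          · refine ⟨?_, ?_, ?_, ?_⟩
            · rwa [omega_neg, omega_two_mul (a0'.trans hab).le hb1.le]
            · have e : mom1 ((2 * a : ℝ) : Torus) (-((2 * b : ℝ) : Torus)) =
                  -((2 * theta1 (Real.pi - a) b : ℝ) : Torus) := by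
                rw [ea, mom1_neg n1 n2, mom1_two_mul a0' hab hb1]
              rwa [e, omega_neg, omega_two_mul m1.le (m2.trans hb1).le]
            · have e : mom3 ((2 * a : ℝ) : Torus) (-((2 * b : ℝ) : Torus)) =
                  -((2 * theta3 (Real.pi - a) b : ℝ) : Torus) := by
                rw [ea, mom3_neg n1 n2, mom3_two_mul a0' hab hb1]
              rwa [e, omega_neg, omega_two_mul (a0'.trans m3).le m4.le]
            · have e : dens ((2 * a : ℝ) : Torus) (-((2 * b : ℝ) : Torus)) = _ :=
                (by rw [ea] : _ = dens (-((2 * (Real.pi - a) : ℝ) : Torus)) _).trans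
                  ((dens_neg n1 n2).trans (dens_two_mul a0' hab hb1))
              rwa [e]
      _ ≤ _ := by
          refine lintegral_mono_set fun b hb => ?_
          have W := window_bounds a0' ha' ρ0 hρa (ζ := Real.pi - b) (by linarith [hb.2])
            (by linarith [hb.1])
          rw [sub_sub_cancel] at W
          exact ⟨W.1, W.2.1⟩

/-- The set where the gap between `p₂` and `p₃` is small is small. -/
theorem lintegral_omega_gap_small {p : Torus} (hp : p ≠ 0) (η : ℝ) :
    ∫⁻ q in {q | cosGap p q ≤ η}, ENNReal.ofReal (omega q) ≤ ENNReal.ofReal (8 * η) := by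
  have hm : MeasurableSet {q | cosGap p q ≤ η} :=
    measurableSet_le (measurable_cosGap_right p) measurable_const
  rw [← lintegral_indicator hm]
  have h := lintegral_omega_cosGap_le hp ((Iic η).indicator 1)
  calc _ = ∫⁻ q, ENNReal.ofReal (omega q) * (Iic η).indicator 1 (cosGap p q) := by
        refine lintegral_congr fun q => ?_
        by_cases hq : cosGap p q ≤ η
        · rw [indicator_of_mem (show q ∈ {q | cosGap p q ≤ η} from hq),
            indicator_of_mem (show cosGap p q ∈ Iic η from hq)]; simp
        · rw [indicator_of_notMem (show q ∉ {q | cosGap p q ≤ η} from hq),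
            indicator_of_notMem (show cosGap p q ∉ Iic η from hq)]; simp
    _ ≤ _ := h
    _ ≤ 4 * ∫⁻ y : ℝ, (Icc (-η) η).indicator 1 y := by
        gcongr 4 * ?_
        refine (setLIntegral_le_lintegral _ _).trans (lintegral_mono fun y => ?_)
        by_cases hy : |y| ≤ η
        · rw [indicator_of_mem (show |y| ∈ Iic η from hy), indicator_of_mem (show y ∈ Icc (-η) η from abs_le.1 hy)]; simp
        · rw [indicator_of_notMem (show |y| ∉ Iic η from hy)]; simp
    _ = _ := by
        rw [lintegral_indicator_one measurableSet_Icc, Real.volume_Icc, ← ENNReal.ofReal_ofNat,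
          ← ENNReal.ofReal_mul (by norm_num)]
        congr 1; ring

/-- In the window ω₂ ≥ ρ/500, so the part with gap at most η has measure at most 500·8η/ρ. The
choice η = ρ²/16000 makes this ρ/4, half of the lower bound for the window. -/
theorem volume_window_gap {p : Torus} (hp : p ≠ 0) :
    ENNReal.ofReal (omega p ^ (1 / 3 : ℝ) / 4) ≤
      volume (window p ∩ {q | (omega p ^ (1 / 3 : ℝ)) ^ 2 / 16000 < cosGap p q}) := by
  have hw := omega_pos hp
  have hvol := volume_window hp
  set ρ := omega p ^ (1 / 3 : ℝ) with hρ
  have ρ0 : 0 < ρ := Real.rpow_pos_of_pos hw _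
  set S := {q | cosGap p q ≤ ρ ^ 2 / 16000} with hS
  have hm : MeasurableSet S := measurableSet_le (measurable_cosGap_right p) measurable_const
  have h := lintegral_omega_gap_small hp (ρ ^ 2 / 16000)
  have h1 : ENNReal.ofReal (ρ / 500) * volume (window p ∩ S) ≤ ENNReal.ofReal (8 * (ρ ^ 2 / 16000)) := by
    refine le_trans ?_ h
    rw [← setLIntegral_const]
    refine (setLIntegral_mono' ((measurableSet_window p).inter hm) fun q hq => ?_).trans
      (lintegral_mono_set inter_subset_right)
    exact ENNReal.ofReal_le_ofReal hq.1.1.1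
  have h2 : volume (window p ∩ S) ≤ ENNReal.ofReal (ρ / 4) := by
    have e : ENNReal.ofReal (8 * (ρ ^ 2 / 16000)) = ENNReal.ofReal (ρ / 500) * ENNReal.ofReal (ρ / 4) := by
      rw [← ENNReal.ofReal_mul (by positivity)]; congr 1; ring
    rw [e] at h1
    exact (ENNReal.mul_le_mul_iff_right (ENNReal.ofReal_pos.2 (by positivity)).ne'
      ENNReal.ofReal_ne_top).1 h1
  have h3 : window p ∩ {q | ρ ^ 2 / 16000 < cosGap p q} = window p \ S := by
    ext q; simp [hS]
  rw [h3]
  have h4 := measure_inter_add_sdiff (μ := volume) (window p) hm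
  have h5 : ENNReal.ofReal (ρ / 2) = ENNReal.ofReal (ρ / 4) + ENNReal.ofReal (ρ / 4) := by
    rw [← ENNReal.ofReal_add (by positivity) (by positivity)]; congr 1; ring
  have h6 : ENNReal.ofReal (ρ / 4) + ENNReal.ofReal (ρ / 4) ≤
      ENNReal.ofReal (ρ / 4) + volume (window p \ S) := by
    rw [← h5]
    refine hvol.trans ?_
    rw [← h4]
    gcongr
  exact (ENNReal.add_le_add_iff_left ENNReal.ofReal_ne_top).1 h6

/-! ### Integrals of powers of `ω` -/

theorem min_le_sin {b : ℝ} (h0 : 0 ≤ b) (h1 : b ≤ Real.pi) :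
    min b (Real.pi - b) / 2 ≤ Real.sin b := by
  have key : ∀ x, 0 ≤ x → x ≤ Real.pi / 2 → x / 2 ≤ Real.sin x := by
    intro x hx hx'
    refine le_trans ?_ (Real.mul_le_sin hx hx')
    rw [div_eq_inv_mul]
    gcongr
    rw [← one_div, div_le_div_iff₀ two_pos Real.pi_pos]
    linarith [Real.pi_le_four]
  rcases le_total b (Real.pi / 2) with h | h
  · exact (by gcongr; exact min_le_left _ _ : _ ≤ b / 2).trans (key b h0 h)
  · rw [← Real.sin_pi_sub]
    exact (by gcongr; exact min_le_right _ _ : _ ≤ (Real.pi - b) / 2).trans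
      (key (Real.pi - b) (by linarith) (by linarith))

theorem volume_omega_le {r : ℝ} (hr : 0 ≤ r) :
    volume {q : Torus | omega q ≤ r} ≤ ENNReal.ofReal (8 * r) := by
  have hm : MeasurableSet {q : Torus | omega q ≤ r} :=
    measurableSet_le measurable_omega measurable_const
  rw [← lintegral_indicator_one hm, lintegral_torus]
  have h1 : ∫⁻ b in Ioo 0 Real.pi, ({q : Torus | omega q ≤ r}).indicator 1 ((2 * b : ℝ) : Torus) ≤
      ∫⁻ b, (Icc 0 (2 * r) ∪ Icc (Real.pi - 2 * r) Real.pi : Set ℝ).indicator 1 b := by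
    refine (setLIntegral_mono' measurableSet_Ioo fun b hb => ?_).trans (setLIntegral_le_lintegral (Ioo 0 Real.pi) _)
    by_cases h : omega ((2 * b : ℝ) : Torus) ≤ r
    · have h' := h
      rw [omega_two_mul hb.1.le hb.2.le] at h'
      have := (min_le_sin hb.1.le hb.2.le).trans h'
      rw [indicator_of_mem (show b ∈ (Icc 0 (2 * r) ∪ Icc (Real.pi - 2 * r) Real.pi : Set ℝ) from ?_)]
      · exact indicator_le_self' (fun _ _ => zero_le_one) _
      · rcases min_cases b (Real.pi - b) with ⟨e, _⟩ | ⟨e, _⟩ <;> rw [e] at this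
        · exact Or.inl ⟨hb.1.le, by linarith⟩
        · exact Or.inr ⟨by linarith, hb.2.le⟩
    · rw [indicator_of_notMem (show ((2 * b : ℝ) : Torus) ∉ {q : Torus | omega q ≤ r} from h)]
      exact zero_le
  calc _ ≤ 2 * (ENNReal.ofReal (2 * r) + ENNReal.ofReal (2 * r)) := by
        gcongr 2 * ?_
        refine h1.trans ?_
        rw [lintegral_indicator_one (measurableSet_Icc.union measurableSet_Icc)]
        refine (measure_union_le _ _).trans ?_
        rw [Real.volume_Icc, Real.volume_Icc]
        gcongr <;> linarith
    _ = _ := by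
        rw [← ENNReal.ofReal_add (by linarith) (by linarith), ← ENNReal.ofReal_ofNat,
          ← ENNReal.ofReal_mul (by norm_num)]
        congr 1; ring

theorem lintegral_omega_rpow_lt_top {s : ℝ} (hs : -1 < s) :
    ∫⁻ q, ENNReal.ofReal (omega q ^ s) < ⊤ := by
  rw [lintegral_torus]
  refine ENNReal.mul_lt_top (by norm_num) ?_
  rcases le_or_gt 0 s with h | h
  · calc _ ≤ ∫⁻ b in Ioo 0 Real.pi, 1 := by
          refine lintegral_mono fun b => ?_
          rw [ENNReal.ofReal_le_one]
          exact Real.rpow_le_one (omega_nonneg _) (omega_le_one _) h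
      _ < ⊤ := by simp
  · have hi : IntegrableOn (fun b : ℝ => (b / 2) ^ s + ((Real.pi - b) / 2) ^ s) (Ioo 0 Real.pi) := by
      have i0 : IntervalIntegrable (fun b : ℝ => b ^ s) volume 0 (Real.pi / 2) :=
        intervalIntegral.intervalIntegrable_rpow' hs
      have i1 : IntervalIntegrable (fun b : ℝ => (b / 2) ^ s) volume 0 Real.pi := by
        have := i0.comp_mul_right (c := 1 / 2)
        norm_num at this
        simpa [div_eq_mul_inv] using this
      have i2 := i1.comp_sub_left Real.pi
      rw [sub_zero, sub_self] at i2
      have i3 := i1.add i2.symm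
      exact ((intervalIntegrable_iff_integrableOn_Ioo_of_le Real.pi_pos.le).1 i3)
    refine lt_of_le_of_lt (setLIntegral_mono' measurableSet_Ioo fun b hb => ?_) hi.setLIntegral_lt_top
    rw [omega_two_mul hb.1.le hb.2.le]
    apply ENNReal.ofReal_le_ofReal
    have h1 := min_le_sin hb.1.le hb.2.le
    have p1 : 0 < b / 2 := by linarith [hb.1]
    have p2 : 0 < (Real.pi - b) / 2 := by linarith [hb.2]
    rcases min_cases b (Real.pi - b) with ⟨e, _⟩ | ⟨e, _⟩ <;> rw [e] at h1
    · have := Real.rpow_le_rpow_of_nonpos p1 h1 h.le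
      linarith [Real.rpow_nonneg p2.le s]
    · have := Real.rpow_le_rpow_of_nonpos p2 h1 h.le
      linarith [Real.rpow_nonneg p1.le s]

theorem lintegral_abs_rpow_lt_top : ∫⁻ y in Icc (-2 : ℝ) 2, ENNReal.ofReal (|y| ^ (-(2 / 3) : ℝ)) < ⊤ := by
  have i0 : IntervalIntegrable (fun b : ℝ => b ^ (-(2 / 3) : ℝ)) volume 0 2 :=
    intervalIntegral.intervalIntegrable_rpow' (by norm_num)
  have i1 : IntervalIntegrable (fun b : ℝ => |b| ^ (-(2 / 3) : ℝ)) volume 0 2 := by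
    refine i0.congr fun b hb => ?_
    rw [uIoc_of_le (by norm_num)] at hb
    simp only [abs_of_pos hb.1]
  have i2 : IntervalIntegrable (fun b : ℝ => |b| ^ (-(2 / 3) : ℝ)) volume (-2) 0 := by
    have := (i1.comp_sub_left 0).symm
    simpa using this
  have i3 := (intervalIntegrable_iff_integrableOn_Icc_of_le (by norm_num : (-2 : ℝ) ≤ 2)).1 (i2.trans i1)
  exact i3.setLIntegral_lt_top

/-! ### The collision kernel -/

section Kernel

variable {β γ : ℝ}

theorem rayleighJeans_pos (hβ : 0 < β) (hγ : 0 < γ) (p : Torus) : 0 < rayleighJeans β γ p := by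
  have := omega_nonneg p
  unfold rayleighJeans; positivity

theorem rayleighJeans_le (hβ : 0 < β) (hγ : 0 < γ) (p : Torus) : rayleighJeans β γ p ≤ 1 / γ := by
  have := omega_nonneg p
  unfold rayleighJeans
  apply one_div_le_one_div_of_le hγ; nlinarith

theorem le_rayleighJeans (hβ : 0 < β) (hγ : 0 < γ) (p : Torus) :
    1 / (β + γ) ≤ rayleighJeans β γ p := by
  have := omega_nonneg p
  have := omega_le_one p
  unfold rayleighJeans
  apply one_div_le_one_div_of_le <;> nlinarith

theorem measurable_rayleighJeans (β γ : ℝ) : Measurable (rayleighJeans β γ) :=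
  ((measurable_omega.const_mul β).add_const γ).const_div 1

/-- The numerator of the collision kernel. -/
def kernNum (β γ : ℝ) (p₀ p₁ p₂ p₃ : Torus) : ℝ :=
  (omega p₀ * omega p₁ * omega p₂ * omega p₃) *
    (rayleighJeans β γ p₀ * rayleighJeans β γ p₁ * rayleighJeans β γ p₂ * rayleighJeans β γ p₃)

/-- The collision kernel, as a function of `p₀` and `p₂`. -/
def kern (β γ : ℝ) (p q : Torus) : ℝ := kernNum β γ p (mom1 p q) q (mom3 p q) / dens p q

theorem kernNum_nonneg (hβ : 0 < β) (hγ : 0 < γ) (p₀ p₁ p₂ p₃ : Torus) :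
    0 ≤ kernNum β γ p₀ p₁ p₂ p₃ := by
  have h := omega_nonneg
  have h' := fun p => (rayleighJeans_pos hβ hγ p).le
  unfold kernNum
  exact mul_nonneg (mul_nonneg (mul_nonneg (mul_nonneg (h _) (h _)) (h _)) (h _))
    (mul_nonneg (mul_nonneg (mul_nonneg (h' _) (h' _)) (h' _)) (h' _))

theorem kernNum_le (hβ : 0 < β) (hγ : 0 < γ) (p₀ p₁ p₂ p₃ : Torus) :
    kernNum β γ p₀ p₁ p₂ p₃ ≤ (1 / γ) ^ 4 * (omega p₀ * omega p₁ * omega p₂ * omega p₃) := by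
  have h0 : ∀ p, 0 ≤ rayleighJeans β γ p := fun p => (rayleighJeans_pos hβ hγ p).le
  have h1 := rayleighJeans_le hβ hγ
  have h2 : rayleighJeans β γ p₀ * rayleighJeans β γ p₁ * rayleighJeans β γ p₂ *
      rayleighJeans β γ p₃ ≤ (1 / γ) * (1 / γ) * (1 / γ) * (1 / γ) := by
    have e1 := mul_le_mul (h1 p₀) (h1 p₁) (h0 p₁) (by positivity)
    have e2 := mul_le_mul e1 (h1 p₂) (h0 p₂) (by positivity)
    exact mul_le_mul e2 (h1 p₃) (h0 p₃) (by positivity)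
  have h3 : 0 ≤ omega p₀ * omega p₁ * omega p₂ * omega p₃ := by
    have h := omega_nonneg
    exact mul_nonneg (mul_nonneg (mul_nonneg (h _) (h _)) (h _)) (h _)
  unfold kernNum
  calc _ ≤ _ := mul_le_mul_of_nonneg_left h2 h3
    _ = _ := by ring

theorem le_kernNum (hβ : 0 < β) (hγ : 0 < γ) (p₀ p₁ p₂ p₃ : Torus) :
    (1 / (β + γ)) ^ 4 * (omega p₀ * omega p₁ * omega p₂ * omega p₃) ≤ kernNum β γ p₀ p₁ p₂ p₃ := by
  have h0 : ∀ p, 0 ≤ rayleighJeans β γ p := fun p => (rayleighJeans_pos hβ hγ p).le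
  have h1 := le_rayleighJeans hβ hγ
  have hc : 0 ≤ 1 / (β + γ) := by positivity
  have h2 : (1 / (β + γ)) * (1 / (β + γ)) * (1 / (β + γ)) * (1 / (β + γ)) ≤
      rayleighJeans β γ p₀ * rayleighJeans β γ p₁ * rayleighJeans β γ p₂ *
      rayleighJeans β γ p₃ := by
    have e1 := mul_le_mul (h1 p₀) (h1 p₁) hc (h0 _)
    have e2 := mul_le_mul e1 (h1 p₂) hc (mul_nonneg (h0 _) (h0 _))
    exact mul_le_mul e2 (h1 p₃) hc (mul_nonneg (mul_nonneg (h0 _) (h0 _)) (h0 _))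
  have h3 : 0 ≤ omega p₀ * omega p₁ * omega p₂ * omega p₃ := by
    have h := omega_nonneg
    exact mul_nonneg (mul_nonneg (mul_nonneg (h _) (h _)) (h _)) (h _)
  unfold kernNum
  calc _ = _ := by ring
    _ ≤ _ := mul_le_mul_of_nonneg_left h2 h3

theorem kern_nonneg (hβ : 0 < β) (hγ : 0 < γ) (p q : Torus) : 0 ≤ kern β γ p q :=
  div_nonneg (kernNum_nonneg hβ hγ _ _ _ _) (Real.sqrt_nonneg _)

theorem kern_swap (p q : Torus) : kern β γ q p = kern β γ p q := by
  unfold kern kernNum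
  rw [mom1_swap p q, mom3_swap p q, dens_swap p q]
  congr 1; ring

theorem measurable_kern (β γ : ℝ) : Measurable fun w : Torus × Torus => kern β γ w.1 w.2 := by
  have o := measurable_omega
  have f := measurable_rayleighJeans β γ
  have m1 := measurable_mom1
  have m3 := measurable_mom3
  unfold kern kernNum
  exact ((((((o.comp measurable_fst).mul (o.comp m1)).mul (o.comp measurable_snd)).mul
    (o.comp m3))).mul ((((f.comp measurable_fst).mul (f.comp m1)).mul (f.comp measurable_snd)).mul
    (f.comp m3))).div measurable_dens

theorem measurable_kern_right (β γ : ℝ) (p : Torus) : Measurable (kern β γ p) :=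
  Measurable.of_uncurry_left (f := kern β γ) (measurable_kern β γ)

theorem sqrt_omega_pos {p q : Torus} (hp : p ≠ 0) (hq : q ≠ 0) :
    0 < Real.sqrt (omega p * omega q) :=
  Real.sqrt_pos.2 (mul_pos (omega_pos hp) (omega_pos hq))

/-- Since √F₊ ≥ 2√(ω₀ω₂), dividing by the density costs half a power of ω₀ and of ω₂. -/
theorem kern_le (hβ : 0 < β) (hγ : 0 < γ) {p q : Torus} (hp : p ≠ 0) (hq : q ≠ 0) :
    kern β γ p q ≤ (1 / γ) ^ 4 *
      (omega p ^ (1 / 2 : ℝ) * omega q ^ (1 / 2 : ℝ) * omega (mom1 p q) * omega (mom3 p q)) := by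
  have hs := sqrt_omega_pos hp hq
  have hd := dens_ge p q
  have hd0 : 0 < dens p q := by linarith
  have e : omega p * omega q = Real.sqrt (omega p * omega q) * Real.sqrt (omega p * omega q) :=
    (Real.mul_self_sqrt (mul_nonneg (omega_nonneg p) (omega_nonneg q))).symm
  rw [kern, div_le_iff₀ hd0, ← Real.sqrt_eq_rpow, ← Real.sqrt_eq_rpow, ← Real.sqrt_mul (omega_nonneg p)]
  refine (kernNum_le hβ hγ _ _ _ _).trans ?_
  have h1 := omega_nonneg (mom1 p q)
  have h3 := omega_nonneg (mom3 p q)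
  calc (1 / γ) ^ 4 * (omega p * omega (mom1 p q) * omega q * omega (mom3 p q))
      = (1 / γ) ^ 4 * (Real.sqrt (omega p * omega q) * omega (mom1 p q) * omega (mom3 p q)) *
        Real.sqrt (omega p * omega q) := by
        rw [show omega p * omega (mom1 p q) * omega q * omega (mom3 p q) =
          (omega p * omega q) * omega (mom1 p q) * omega (mom3 p q) by ring]
        nth_rewrite 1 [e]
        ring
    _ ≤ _ := by
        gcongr
        linarith

theorem lintegral_kern_exchange {p : Torus} (hp : p ≠ 0) (G : Torus → Torus → Torus → ENNReal) :
    ∫⁻ q, ENNReal.ofReal (kern β γ p q) * G (mom1 p q) q (mom3 p q) =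
      ∫⁻ q, ENNReal.ofReal (kern β γ p q) * G (mom1 p q) (mom3 p q) q := by
  have h := lintegral_torus_exchange hp fun x y z => ENNReal.ofReal (kernNum β γ p x y z) * G x y z
  have e : ∀ q, ENNReal.ofReal (kern β γ p q) = ENNReal.ofReal (1 / dens p q) *
      ENNReal.ofReal (kernNum β γ p (mom1 p q) q (mom3 p q)) := by
    intro q
    rw [← ENNReal.ofReal_mul (one_div_nonneg.2 (dens_nonneg p q)), kern]
    congr 1; ring
  have e' : ∀ q, kernNum β γ p (mom1 p q) (mom3 p q) q = kernNum β γ p (mom1 p q) q (mom3 p q) := by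
    intro q; unfold kernNum; ring
  simp only [e, mul_assoc]
  rw [h]
  simp only [e']

/-- The collision rate. -/
def rateE (β γ : ℝ) (p : Torus) : ENNReal := ∫⁻ q, ENNReal.ofReal (kern β γ p q)

theorem measurable_rateE (β γ : ℝ) : Measurable (rateE β γ) :=
  (measurable_kern β γ).ennreal_ofReal.lintegral_prod_right'

theorem kern_le_const (hβ : 0 < β) (hγ : 0 < γ) {p q : Torus} (hp : p ≠ 0) (hq : q ≠ 0) :
    kern β γ p q ≤ (1 / γ) ^ 4 := by
  refine (kern_le hβ hγ hp hq).trans ?_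
  have h0 := omega_nonneg
  have h1 := omega_le_one
  have k : ∀ r : Torus, omega r ^ (1 / 2 : ℝ) ≤ 1 := fun r =>
    Real.rpow_le_one (h0 r) (h1 r) (by norm_num)
  have k0 : ∀ r : Torus, 0 ≤ omega r ^ (1 / 2 : ℝ) := fun r => Real.rpow_nonneg (h0 r) _
  have : omega p ^ (1 / 2 : ℝ) * omega q ^ (1 / 2 : ℝ) * omega (mom1 p q) * omega (mom3 p q) ≤ 1 :=
    mul_le_one₀ (mul_le_one₀ (mul_le_one₀ (k p) (k0 q) (k q)) (h0 _) (h1 _)) (h0 _) (h1 _)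
  calc _ ≤ (1 / γ) ^ 4 * 1 := by gcongr
    _ = _ := mul_one _

theorem rateE_le (hβ : 0 < β) (hγ : 0 < γ) {p : Torus} (hp : p ≠ 0) :
    rateE β γ p ≤ ENNReal.ofReal ((1 / γ) ^ 4 * (2 * Real.pi)) := by
  calc rateE β γ p ≤ ∫⁻ _ : Torus, ENNReal.ofReal ((1 / γ) ^ 4) := by
        refine lintegral_mono_ae ?_
        filter_upwards [ae_ne_zero] with q hq
        exact ENNReal.ofReal_le_ofReal (kern_le_const hβ hγ hp hq)
    _ = _ := by
        rw [lintegral_const, AddCircle.measure_univ, ← ENNReal.ofReal_mul (by positivity)]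

/-- The lower bound `kern ≥ c ω₀^{4/3}` in the window. -/
theorem kern_ge_of_mem_window (hβ : 0 < β) (hγ : 0 < γ) {p q : Torus} (hp : p ≠ 0)
    (hq : q ∈ window p) :
    (1 / (β + γ)) ^ 4 * ((omega p ^ (1 / 3 : ℝ)) ^ 4 / (2 * 500 ^ 3)) ≤ kern β γ p q := by
  have hw := omega_pos hp
  obtain ⟨⟨h2, -⟩, ⟨h1, -⟩, ⟨h3, -⟩, hd⟩ := hq
  set ρ := omega p ^ (1 / 3 : ℝ) with hρ
  have ρ0 : 0 < ρ := Real.rpow_pos_of_pos hw _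
  have ρ3 : ρ ^ 3 = omega p := by
    rw [hρ, ← Real.rpow_natCast, ← Real.rpow_mul hw.le]; norm_num
  have hq0 : q ≠ 0 := by
    rintro rfl
    rw [← AddCircle.coe_zero, omega_coe] at h2
    simp at h2
    linarith
  have hd0 : 0 < dens p q := by linarith [dens_ge p q, sqrt_omega_pos hp hq0]
  rw [kern, le_div_iff₀ hd0]
  refine le_trans ?_ (le_kernNum hβ hγ _ _ _ _)
  rw [← ρ3]
  calc _ ≤ (1 / (β + γ)) ^ 4 * (ρ ^ 4 / (2 * 500 ^ 3)) * (2 * ρ ^ 2) := by gcongr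
    _ = (1 / (β + γ)) ^ 4 * (ρ ^ 3 * (ρ / 500) * (ρ / 500) * (ρ / 500)) := by field_simp
    _ ≤ _ := by
        have := omega_nonneg q
        have := omega_nonneg (mom1 p q)
        gcongr

/-- With ρ = ω₀^{1/3}, the kernel is at least of order ρ⁴ on a window of measure at least ρ/2, which
gives ρ⁵ = ω₀^{5/3}. -/
theorem exists_rateE_ge (hβ : 0 < β) (hγ : 0 < γ) : ∃ c : ℝ, 0 < c ∧ ∀ p : Torus, p ≠ 0 →
    ENNReal.ofReal (c * omega p ^ (5 / 3 : ℝ)) ≤ rateE β γ p := by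
  refine ⟨(1 / (β + γ)) ^ 4 / (4 * 500 ^ 3), by positivity, fun p hp => ?_⟩
  have hw := omega_pos hp
  have hvol := volume_window hp
  have hk := fun q => kern_ge_of_mem_window hβ hγ hp (q := q)
  have ρ5 : (omega p ^ (1 / 3 : ℝ)) ^ 5 = omega p ^ (5 / 3 : ℝ) := by
    rw [← Real.rpow_natCast, ← Real.rpow_mul hw.le]; norm_num
  rw [← ρ5]
  set ρ := omega p ^ (1 / 3 : ℝ) with hρ
  have ρ0 : 0 < ρ := Real.rpow_pos_of_pos hw _
  calc _ = ENNReal.ofReal ((1 / (β + γ)) ^ 4 * (ρ ^ 4 / (2 * 500 ^ 3))) * ENNReal.ofReal (ρ / 2) := by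
        rw [← ENNReal.ofReal_mul (by positivity)]; congr 1; ring
    _ ≤ ENNReal.ofReal ((1 / (β + γ)) ^ 4 * (ρ ^ 4 / (2 * 500 ^ 3))) * volume (window p) := by gcongr
    _ = ∫⁻ _ in window p, ENNReal.ofReal ((1 / (β + γ)) ^ 4 * (ρ ^ 4 / (2 * 500 ^ 3))) :=
        (setLIntegral_const _ _).symm
    _ ≤ ∫⁻ q in window p, ENNReal.ofReal (kern β γ p q) :=
        setLIntegral_mono' (measurableSet_window p) fun q hq => ENNReal.ofReal_le_ofReal (hk q hq)
    _ ≤ _ := setLIntegral_le_lintegral _ _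

theorem kern_pos (hβ : 0 < β) (hγ : 0 < γ) {p q : Torus} (hp : p ≠ 0) (hq : q ≠ 0) (hpq : p ≠ q) :
    0 < kern β γ p q := by
  obtain ⟨h1, h3, hd, -⟩ := generic_facts hp hq hpq
  have hf := rayleighJeans_pos hβ hγ
  have h0 := omega_pos hp
  have h2 := omega_pos hq
  unfold kern kernNum
  have := hf p
  have := hf q
  have := hf (mom1 p q)
  have := hf (mom3 p q)
  positivity

end Kernel

/-! ### Estimates for integrals against the collision kernel -/

theorem lintegral_mul_le_sqrt {X : Type*} [MeasurableSpace X] {μ : Measure X} {f g : X → ENNReal}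
    (hf : AEMeasurable f μ) (hg : AEMeasurable g μ) :
    ∫⁻ a, f a * g a ∂μ ≤ (∫⁻ a, f a ^ 2 ∂μ) ^ (1 / 2 : ℝ) * (∫⁻ a, g a ^ 2 ∂μ) ^ (1 / 2 : ℝ) := by
  have := ENNReal.lintegral_mul_le_Lp_mul_Lq μ Real.HolderConjugate.two_two hf hg
  simpa using this

section Kernel

variable {β γ : ℝ}

/-- The operator `φ ↦ ∫ kern φ(p₂) dp₂`. -/
theorem exists_lintegral_kern_le (hβ : 0 < β) (hγ : 0 < γ) : ∃ C : ℝ, 0 < C ∧ ∀ p : Torus, p ≠ 0 →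
    ∀ Φ : Torus → ENNReal, Measurable Φ →
    ∫⁻ q, ENNReal.ofReal (kern β γ p q) * Φ q ≤ ENNReal.ofReal (C * omega p ^ (1 / 2 : ℝ)) *
      (∫⁻ q, ENNReal.ofReal (omega q ^ (5 / 3 : ℝ)) * Φ q ^ 2) ^ (1 / 2 : ℝ) := by
  have hI := lintegral_omega_rpow_lt_top (s := -(2 / 3)) (by norm_num)
  set I := (∫⁻ q, ENNReal.ofReal (omega q ^ (-(2 / 3) : ℝ))) ^ (1 / 2 : ℝ) with hIdef
  have hIt : I ≠ ⊤ := ENNReal.rpow_ne_top_of_nonneg (by norm_num) hI.ne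
  refine ⟨(1 / γ) ^ 4 * (I.toReal + 1), by positivity, fun p hp Φ hΦ => ?_⟩
  have m := measurable_omega
  -- The factor ω₂^{1/2} is split as ω₂^{-1/3}·ω₂^{5/6} for Cauchy–Schwarz: ω^{-2/3} is integrable,
  -- and the other square carries the weight ω^{5/3} of the rate.
  calc ∫⁻ q, ENNReal.ofReal (kern β γ p q) * Φ q
      ≤ ∫⁻ q, ENNReal.ofReal ((1 / γ) ^ 4 * omega p ^ (1 / 2 : ℝ)) *
        (ENNReal.ofReal (omega q ^ (-(1 / 3) : ℝ)) *
          (ENNReal.ofReal (omega q ^ (5 / 6 : ℝ)) * Φ q)) := by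
        refine lintegral_mono_ae ?_
        filter_upwards [ae_ne_zero] with q hq
        have hq0 := omega_pos hq
        rw [← mul_assoc, ← mul_assoc, ← ENNReal.ofReal_mul (by positivity [omega_nonneg p]),
          ← ENNReal.ofReal_mul (by have := omega_nonneg p; positivity)]
        gcongr
        refine (kern_le hβ hγ hp hq).trans ?_
        rw [mul_assoc _ (omega q ^ _) (omega q ^ _), ← Real.rpow_add hq0]
        have h0 := omega_nonneg
        have h1 := omega_le_one
        have h2 : omega (mom1 p q) * omega (mom3 p q) ≤ 1 := mul_le_one₀ (h1 _) (h0 _) (h1 _)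
        have h3 : 0 ≤ omega p ^ (1 / 2 : ℝ) := Real.rpow_nonneg (h0 p) _
        norm_num
        calc _ = (γ ^ 4)⁻¹ * omega p ^ (1 / 2 : ℝ) * omega q ^ (1 / 2 : ℝ) *
              (omega (mom1 p q) * omega (mom3 p q)) := by ring
          _ ≤ (γ ^ 4)⁻¹ * omega p ^ (1 / 2 : ℝ) * omega q ^ (1 / 2 : ℝ) * 1 := by gcongr
          _ = _ := mul_one _
    _ = ENNReal.ofReal ((1 / γ) ^ 4 * omega p ^ (1 / 2 : ℝ)) *
        ∫⁻ q, (ENNReal.ofReal (omega q ^ (-(1 / 3) : ℝ)) *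
          (ENNReal.ofReal (omega q ^ (5 / 6 : ℝ)) * Φ q)) :=
        lintegral_const_mul' _ _ ENNReal.ofReal_ne_top
    _ ≤ ENNReal.ofReal ((1 / γ) ^ 4 * omega p ^ (1 / 2 : ℝ)) * (I *
        (∫⁻ q, ENNReal.ofReal (omega q ^ (5 / 3 : ℝ)) * Φ q ^ 2) ^ (1 / 2 : ℝ)) := by
        gcongr
        refine (lintegral_mul_le_sqrt ((m.pow_const _).ennreal_ofReal.aemeasurable)
          (((m.pow_const _).ennreal_ofReal.mul hΦ).aemeasurable)).trans (le_of_eq ?_)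
        have e : ∀ (s : ℝ) (q : Torus), ENNReal.ofReal (omega q ^ s) ^ 2 =
            ENNReal.ofReal (omega q ^ (2 * s)) := by
          intro s q
          rw [← ENNReal.ofReal_pow (Real.rpow_nonneg (omega_nonneg q) _), ← Real.rpow_natCast,
            ← Real.rpow_mul (omega_nonneg q)]
          congr 2; push_cast; ring
        rw [hIdef]
        congr 2
        · congr 1
          funext q
          rw [e]; norm_num
        · refine lintegral_congr fun q => ?_
          rw [Pi.mul_apply, mul_pow, e]; norm_num
    _ ≤ _ := by
        rw [← mul_assoc]
        gcongr
        have h3 : 0 ≤ omega p ^ (1 / 2 : ℝ) := Real.rpow_nonneg (omega_nonneg p) _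
        have h4 : 0 ≤ I.toReal := ENNReal.toReal_nonneg
        calc _ = ENNReal.ofReal ((1 / γ) ^ 4 * omega p ^ (1 / 2 : ℝ)) * ENNReal.ofReal I.toReal := by
              rw [ENNReal.ofReal_toReal hIt]
          _ = ENNReal.ofReal ((1 / γ) ^ 4 * I.toReal * omega p ^ (1 / 2 : ℝ)) := by
              rw [← ENNReal.ofReal_mul (by positivity)]; congr 1; ring
          _ ≤ _ := by gcongr; linarith

theorem ae_cosGap_pos {p : Torus} (hp : p ≠ 0) : ∀ᵐ q : Torus, 0 < cosGap p q := by
  have h := lintegral_omega_gap_small hp 0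
  have hm : MeasurableSet {q | cosGap p q ≤ 0} :=
    measurableSet_le (measurable_cosGap_right p) measurable_const
  rw [mul_zero, ENNReal.ofReal_zero, nonpos_iff_eq_zero,
    lintegral_eq_zero_iff measurable_omega.ennreal_ofReal, Filter.EventuallyEq,
    ae_restrict_iff' hm] at h
  filter_upwards [h, ae_ne_zero] with q h1 h2
  by_contra h3
  have := h1 (not_lt.1 h3)
  simp only [Pi.zero_apply, ENNReal.ofReal_eq_zero] at this
  linarith [omega_pos h2]

/-- The operator `φ ↦ ∫ kern φ(p₁) dp₂`. -/
theorem exists_lintegral_kern_mom1_le (hβ : 0 < β) (hγ : 0 < γ) : ∃ C : ℝ, 0 < C ∧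
    ∀ p : Torus, p ≠ 0 → ∀ Φ : Torus → ENNReal, Measurable Φ →
    ∫⁻ q, ENNReal.ofReal (kern β γ p q) * Φ (mom1 p q) ≤
      ENNReal.ofReal (C * omega p ^ (7 / 10 : ℝ)) *
      (∫⁻ q, ENNReal.ofReal (omega q ^ (5 / 2 : ℝ)) * Φ q ^ (5 / 2 : ℝ)) ^ (2 / 5 : ℝ) := by
  have hI := lintegral_abs_rpow_lt_top
  set I := ∫⁻ y in Icc (-2 : ℝ) 2, ENNReal.ofReal (|y| ^ (-(2 / 3) : ℝ)) with hIdef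
  set A : ℝ := (1 / γ) ^ 4 with hA
  have hA0 : 0 < A := by positivity
  have hIt : (4 * I) ^ (3 / 5 : ℝ) ≠ ⊤ :=
    ENNReal.rpow_ne_top_of_nonneg (by norm_num) (ENNReal.mul_ne_top (by norm_num) hI.ne)
  have h4t : (4 : ENNReal) ^ (2 / 5 : ℝ) ≠ ⊤ :=
    ENNReal.rpow_ne_top_of_nonneg (by norm_num) (by norm_num)
  refine ⟨A * (((4 * I) ^ (3 / 5 : ℝ)).toReal * ((4 : ENNReal) ^ (2 / 5 : ℝ)).toReal + 1),
    by positivity, fun p hp Φ hΦ => ?_⟩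
  have hp0 := omega_pos hp
  have m := measurable_omega
  have mg := measurable_cosGap_right p
  have md := measurable_dens_right p
  have m1 := measurable_mom1_right p
  have mk := measurable_kern_right β γ p
  -- Hölder with exponents 5/2 and 5/3. The power 2/5 of the Jacobian gap/√F₊ becomes the full
  -- Jacobian of p₂ ↦ p₁ in f^{5/2}. What is left of 1/√F₊ is bounded by (ω₀ω₂)^{-3/10}, and the
  -- compensating gap^{-2/5} becomes gap^{-2/3} in g^{5/3}, integrable in the gap variable against
  -- ω₂.
  set f : Torus → ENNReal := fun q => ENNReal.ofReal ((cosGap p q / dens p q) ^ (2 / 5 : ℝ) *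
    omega (mom1 p q)) * Φ (mom1 p q) with hf
  set g : Torus → ENNReal := fun q => ENNReal.ofReal (A * (omega p * omega q) ^ (7 / 10 : ℝ) *
    cosGap p q ^ (-(2 / 5) : ℝ)) with hg
  have hfm : Measurable f := (((mg.div md).pow_const _).mul (m.comp m1)).ennreal_ofReal.mul (hΦ.comp m1)
  have hgm : Measurable g := ((((m.const_mul _).pow_const _).const_mul _).mul
    (mg.pow_const _)).ennreal_ofReal
  have gap0 : ∀ q, 0 ≤ cosGap p q := fun q => abs_nonneg _
  have hpt : ∀ᵐ q, ENNReal.ofReal (kern β γ p q) * Φ (mom1 p q) ≤ (f * g) q := by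
    filter_upwards [ae_generic p, ae_cosGap_pos hp] with q hq hgq
    obtain ⟨o1, o3, hd, -⟩ := generic_facts hp hq.1 hq.2
    have hq0 := omega_pos hq.1
    have key : kern β γ p q ≤ (cosGap p q / dens p q) ^ (2 / 5 : ℝ) * omega (mom1 p q) *
        (A * (omega p * omega q) ^ (7 / 10 : ℝ) * cosGap p q ^ (-(2 / 5) : ℝ)) := by
      have e1 : (cosGap p q / dens p q) ^ (2 / 5 : ℝ) =
          cosGap p q ^ (2 / 5 : ℝ) * dens p q ^ (-(2 / 5) : ℝ) := by
        rw [Real.div_rpow hgq.le hd.le, Real.rpow_neg hd.le]; rfl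
      have e2 : cosGap p q ^ (2 / 5 : ℝ) * cosGap p q ^ (-(2 / 5) : ℝ) = 1 := by
        rw [← Real.rpow_add hgq]; norm_num
      have hw : 0 < omega p * omega q := mul_pos hp0 hq0
      have e3 : (omega p * omega q) ^ (3 / 10 : ℝ) ≤ dens p q ^ (3 / 5 : ℝ) := by
        calc _ = (Real.sqrt (omega p * omega q)) ^ (3 / 5 : ℝ) := by
              rw [Real.sqrt_eq_rpow, ← Real.rpow_mul hw.le]; norm_num
          _ ≤ _ := by
              apply Real.rpow_le_rpow (Real.sqrt_nonneg _) _ (by norm_num)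
              linarith [dens_ge p q, Real.sqrt_nonneg (omega p * omega q)]
      have e4 : omega p * omega q = (omega p * omega q) ^ (7 / 10 : ℝ) *
          (omega p * omega q) ^ (3 / 10 : ℝ) := by
        rw [← Real.rpow_add hw]; norm_num
      have e5 : dens p q ^ (-(2 / 5) : ℝ) * dens p q = dens p q ^ (3 / 5 : ℝ) := by
        nth_rewrite 2 [← Real.rpow_one (dens p q)]
        rw [← Real.rpow_add hd]; norm_num
      rw [kern, div_le_iff₀ hd]
      refine (kernNum_le hβ hγ _ _ _ _).trans ?_
      have hw7 : 0 ≤ (omega p * omega q) ^ (7 / 10 : ℝ) := Real.rpow_nonneg hw.le _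
      calc A * (omega p * omega (mom1 p q) * omega q * omega (mom3 p q))
          ≤ A * (omega p * omega (mom1 p q) * omega q * 1) := by
            gcongr; exact omega_le_one _
        _ = A * omega (mom1 p q) * (omega p * omega q) := by ring
        _ = A * omega (mom1 p q) * ((omega p * omega q) ^ (7 / 10 : ℝ) *
            (omega p * omega q) ^ (3 / 10 : ℝ)) := by rw [← e4]
        _ ≤ A * omega (mom1 p q) * ((omega p * omega q) ^ (7 / 10 : ℝ) *
            dens p q ^ (3 / 5 : ℝ)) := by gcongr
        _ = A * omega (mom1 p q) * ((omega p * omega q) ^ (7 / 10 : ℝ) *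
            (dens p q ^ (-(2 / 5) : ℝ) * dens p q)) *
            (cosGap p q ^ (2 / 5 : ℝ) * cosGap p q ^ (-(2 / 5) : ℝ)) := by rw [e5, e2, mul_one]
        _ = _ := by rw [e1]; ring
    calc _ ≤ ENNReal.ofReal ((cosGap p q / dens p q) ^ (2 / 5 : ℝ) * omega (mom1 p q) *
        (A * (omega p * omega q) ^ (7 / 10 : ℝ) * cosGap p q ^ (-(2 / 5) : ℝ))) * Φ (mom1 p q) := by
          gcongr
      _ = _ := by
          rw [ENNReal.ofReal_mul (mul_nonneg (Real.rpow_nonneg (div_nonneg hgq.le hd.le) _) o1.le)]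
          simp only [hf, hg, Pi.mul_apply]; ring
  have hHolder : (5 / 2 : ℝ).HolderConjugate (5 / 3 : ℝ) :=
    Real.holderConjugate_iff.2 ⟨by norm_num, by norm_num⟩
  have hF : ∫⁻ q, f q ^ (5 / 2 : ℝ) ≤
      4 * ∫⁻ q, ENNReal.ofReal (omega q ^ (5 / 2 : ℝ)) * Φ q ^ (5 / 2 : ℝ) := by
    refine le_trans (le_of_eq (lintegral_congr fun q => ?_)) (lintegral_mom1_le hp fun r =>
      ENNReal.ofReal (omega r ^ (5 / 2 : ℝ)) * Φ r ^ (5 / 2 : ℝ))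
    have hJ : 0 ≤ cosGap p q / dens p q := div_nonneg (gap0 q) (dens_nonneg p q)
    simp only [hf]
    rw [ENNReal.mul_rpow_of_nonneg _ _ (by norm_num : (0 : ℝ) ≤ 5 / 2),
      ENNReal.ofReal_rpow_of_nonneg (mul_nonneg (Real.rpow_nonneg hJ _) (omega_nonneg _)) (by norm_num),
      Real.mul_rpow (Real.rpow_nonneg hJ _) (omega_nonneg _), ← Real.rpow_mul hJ,
      ENNReal.ofReal_mul (Real.rpow_nonneg hJ _), mul_assoc]
    norm_num
  have hG : ∫⁻ q, g q ^ (5 / 3 : ℝ) ≤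
      ENNReal.ofReal (A ^ (5 / 3 : ℝ) * omega p ^ (7 / 6 : ℝ)) * (4 * I) := by
    calc ∫⁻ q, g q ^ (5 / 3 : ℝ) ≤ ∫⁻ q, ENNReal.ofReal (A ^ (5 / 3 : ℝ) * omega p ^ (7 / 6 : ℝ)) *
          (ENNReal.ofReal (omega q) * ENNReal.ofReal (cosGap p q ^ (-(2 / 3) : ℝ))) := by
          refine lintegral_mono fun q => ?_
          have hg0 := gap0 q
          have hq0 := omega_nonneg q
          have e1 : (A * (omega p * omega q) ^ (7 / 10 : ℝ) * cosGap p q ^ (-(2 / 5) : ℝ)) ^ (5 / 3 : ℝ)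
              = A ^ (5 / 3 : ℝ) * omega p ^ (7 / 6 : ℝ) * (omega q ^ (7 / 6 : ℝ) *
              cosGap p q ^ (-(2 / 3) : ℝ)) := by
            rw [Real.mul_rpow (by positivity) (by positivity), Real.mul_rpow hA0.le (by positivity),
              ← Real.rpow_mul (by positivity), ← Real.rpow_mul hg0, Real.mul_rpow hp0.le hq0]
            norm_num
            ring
          simp only [hg]
          rw [ENNReal.ofReal_rpow_of_nonneg (by positivity) (by norm_num), e1,
            ← ENNReal.ofReal_mul hq0, ← ENNReal.ofReal_mul (by positivity)]
          apply ENNReal.ofReal_le_ofReal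
          gcongr
          calc omega q ^ (7 / 6 : ℝ) ≤ omega q ^ (1 : ℝ) :=
                Real.rpow_le_rpow_of_exponent_ge' hq0 (omega_le_one q) (by norm_num) (by norm_num)
            _ = omega q := Real.rpow_one _
      _ = ENNReal.ofReal (A ^ (5 / 3 : ℝ) * omega p ^ (7 / 6 : ℝ)) *
          ∫⁻ q, (ENNReal.ofReal (omega q) * ENNReal.ofReal (cosGap p q ^ (-(2 / 3) : ℝ))) :=
          lintegral_const_mul' _ _ ENNReal.ofReal_ne_top
      _ ≤ _ := by
          gcongr
          exact lintegral_omega_cosGap_le hp fun y => ENNReal.ofReal (y ^ (-(2 / 3) : ℝ))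
  have hfin := ENNReal.lintegral_mul_le_Lp_mul_Lq volume hHolder hfm.aemeasurable hgm.aemeasurable
  refine (lintegral_mono_ae hpt).trans (hfin.trans ?_)
  set N := ∫⁻ q, ENNReal.ofReal (omega q ^ (5 / 2 : ℝ)) * Φ q ^ (5 / 2 : ℝ) with hN
  calc _ ≤ (4 * N) ^ (1 / (5 / 2) : ℝ) *
        (ENNReal.ofReal (A ^ (5 / 3 : ℝ) * omega p ^ (7 / 6 : ℝ)) * (4 * I)) ^ (1 / (5 / 3) : ℝ) := by
        gcongr
    _ = (4 : ENNReal) ^ (2 / 5 : ℝ) * (4 * I) ^ (3 / 5 : ℝ) *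
        ENNReal.ofReal (A * omega p ^ (7 / 10 : ℝ)) * N ^ (2 / 5 : ℝ) := by
        rw [ENNReal.mul_rpow_of_nonneg _ _ (by norm_num), ENNReal.mul_rpow_of_nonneg _ _ (by norm_num),
          ENNReal.ofReal_rpow_of_nonneg (by positivity) (by norm_num),
          Real.mul_rpow (by positivity) (by positivity), ← Real.rpow_mul hA0.le,
          ← Real.rpow_mul hp0.le]
        norm_num
        ring
    _ ≤ _ := by
        gcongr
        rw [← ENNReal.ofReal_toReal hIt, ← ENNReal.ofReal_toReal h4t,
          ← ENNReal.ofReal_mul (by positivity), ← ENNReal.ofReal_mul (by positivity),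
          ENNReal.toReal_ofReal (by positivity), ENNReal.toReal_ofReal (by positivity)]
        apply ENNReal.ofReal_le_ofReal
        have : 0 ≤ A * omega p ^ (7 / 10 : ℝ) := by positivity
        nlinarith

/-- Smallness of the collision kernel near `p₂ = p₃`. -/
theorem exists_lintegral_kern_gap_le (hβ : 0 < β) (hγ : 0 < γ) {ε : ℝ} (hε : 0 < ε) :
    ∃ η : ℝ, 0 < η ∧ ∀ p : Torus, p ≠ 0 →
      ∫⁻ q in {q | cosGap p q ≤ η}, ENNReal.ofReal (kern β γ p q * omega (mom1 p q) ^ (-(7 / 6) : ℝ)) ≤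
        ENNReal.ofReal (ε * omega p ^ (1 / 2 : ℝ)) := by
  set A : ℝ := (1 / γ) ^ 4 with hA
  have hA0 : 0 < A := by positivity
  -- The final bound is 2Aω₀^{1/2}·l(2π + 8), and l makes this equal to εω₀^{1/2}. The gap threshold
  -- is l⁶ so that l⁻⁵∫ω₂ ≤ 8l on the small-gap set.
  set l : ℝ := ε / (2 * A * (2 * Real.pi + 8)) with hl
  have l0 : 0 < l := by have := Real.pi_pos; positivity
  refine ⟨l ^ 6, by positivity, fun p hp => ?_⟩
  have hp0 := omega_pos hp
  have hm : MeasurableSet {q | cosGap p q ≤ l ^ 6} :=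
    measurableSet_le (measurable_cosGap_right p) measurable_const
  calc _ ≤ ∫⁻ q in {q | cosGap p q ≤ l ^ 6}, ENNReal.ofReal (2 * A * omega p ^ (1 / 2 : ℝ)) *
        (ENNReal.ofReal l + ENNReal.ofReal ((l ^ 5)⁻¹) * ENNReal.ofReal (omega q)) := by
        refine lintegral_mono_ae (ae_restrict_of_ae ?_)
        filter_upwards [ae_generic p] with q hq
        obtain ⟨o1, o3, hd, hlow⟩ := generic_facts hp hq.1 hq.2
        have hq0 := omega_pos hq.1
        rw [← ENNReal.ofReal_mul (by positivity), ← ENNReal.ofReal_add (by positivity) (by positivity),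
          ← ENNReal.ofReal_mul (by positivity)]
        apply ENNReal.ofReal_le_ofReal
        have e1 : omega (mom1 p q) * omega (mom1 p q) ^ (-(7 / 6) : ℝ) =
            omega (mom1 p q) ^ (-(1 / 6) : ℝ) := by
          nth_rewrite 1 [← Real.rpow_one (omega (mom1 p q))]
          rw [← Real.rpow_add o1]; norm_num
        -- The singular power of ω₁ is traded for powers of ω₂ and ω₃ through ω₁ ≥ ω₂²ω₃/4; the
        -- kernel has enough of both to absorb them.
        have e2 : omega (mom1 p q) ^ (-(1 / 6) : ℝ) ≤
            2 * (omega q ^ (-(1 / 3) : ℝ) * omega (mom3 p q) ^ (-(1 / 6) : ℝ)) := by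
          refine (Real.rpow_le_rpow_of_nonpos (by positivity) hlow (by norm_num)).trans ?_
          rw [div_eq_mul_inv, Real.mul_rpow (by positivity) (by positivity),
            Real.mul_rpow (by positivity) (by positivity), ← Real.rpow_natCast, ← Real.rpow_mul hq0.le,
            mul_comm]
          have : (4⁻¹ : ℝ) ^ (-(1 / 6) : ℝ) ≤ 2 := by
            rw [Real.inv_rpow (by norm_num), Real.rpow_neg (by norm_num), inv_inv]
            calc (4 : ℝ) ^ (1 / 6 : ℝ) ≤ 4 ^ (1 / 2 : ℝ) :=
                  Real.rpow_le_rpow_of_exponent_le (by norm_num) (by norm_num)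
              _ = 2 := by
                  rw [← Real.sqrt_eq_rpow, show (4 : ℝ) = 2 ^ 2 by norm_num]
                  exact Real.sqrt_sq (by norm_num)
          norm_num at this ⊢
          gcongr
        have e3 : omega q ^ (1 / 2 : ℝ) * omega q ^ (-(1 / 3) : ℝ) = omega q ^ (1 / 6 : ℝ) := by
          rw [← Real.rpow_add hq0]; norm_num
        have e4 : omega (mom3 p q) * omega (mom3 p q) ^ (-(1 / 6) : ℝ) ≤ 1 := by
          nth_rewrite 1 [← Real.rpow_one (omega (mom3 p q))]
          rw [← Real.rpow_add o3]
          exact Real.rpow_le_one o3.le (omega_le_one _) (by norm_num)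
        -- Either ω₂^{1/6} ≤ l, or ω₂^{1/6} is at most l⁻⁵ times its sixth power. The second term is
        -- the one controlled on the small-gap set.
        have e5 : omega q ^ (1 / 6 : ℝ) ≤ l + (l ^ 5)⁻¹ * omega q := by
          set y := omega q ^ (1 / 6 : ℝ) with hy
          have y0 : 0 < y := Real.rpow_pos_of_pos hq0 _
          have y6 : y ^ 6 = omega q := by
            rw [hy, ← Real.rpow_natCast, ← Real.rpow_mul hq0.le]; norm_num
          rw [← y6]
          rcases le_total y l with h | h
          · have : 0 ≤ (l ^ 5)⁻¹ * y ^ 6 := by positivity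
            linarith
          · have : y ≤ (l ^ 5)⁻¹ * y ^ 6 := by
              rw [inv_mul_eq_div, le_div_iff₀ (by positivity)]
              calc y * l ^ 5 ≤ y * y ^ 5 := by gcongr
                _ = y ^ 6 := by ring
            linarith
        calc kern β γ p q * omega (mom1 p q) ^ (-(7 / 6) : ℝ)
            ≤ A * (omega p ^ (1 / 2 : ℝ) * omega q ^ (1 / 2 : ℝ) * omega (mom1 p q) *
              omega (mom3 p q)) * omega (mom1 p q) ^ (-(7 / 6) : ℝ) := by
              gcongr; exact kern_le hβ hγ hp hq.1
          _ = A * (omega p ^ (1 / 2 : ℝ) * omega q ^ (1 / 2 : ℝ) * omega (mom3 p q)) *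
              (omega (mom1 p q) * omega (mom1 p q) ^ (-(7 / 6) : ℝ)) := by ring
          _ ≤ A * (omega p ^ (1 / 2 : ℝ) * omega q ^ (1 / 2 : ℝ) * omega (mom3 p q)) *
              (2 * (omega q ^ (-(1 / 3) : ℝ) * omega (mom3 p q) ^ (-(1 / 6) : ℝ))) := by
              rw [e1]; gcongr
          _ = 2 * A * omega p ^ (1 / 2 : ℝ) * ((omega q ^ (1 / 2 : ℝ) * omega q ^ (-(1 / 3) : ℝ)) *
              (omega (mom3 p q) * omega (mom3 p q) ^ (-(1 / 6) : ℝ))) := by ring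
          _ ≤ 2 * A * omega p ^ (1 / 2 : ℝ) * (omega q ^ (1 / 6 : ℝ) * 1) := by rw [e3]; gcongr
          _ ≤ _ := by rw [mul_one]; gcongr
    _ = ENNReal.ofReal (2 * A * omega p ^ (1 / 2 : ℝ)) *
        ∫⁻ q in {q | cosGap p q ≤ l ^ 6},
          (ENNReal.ofReal l + ENNReal.ofReal ((l ^ 5)⁻¹) * ENNReal.ofReal (omega q)) :=
        lintegral_const_mul' _ _ ENNReal.ofReal_ne_top
    _ ≤ ENNReal.ofReal (2 * A * omega p ^ (1 / 2 : ℝ)) *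
        (ENNReal.ofReal (l * (2 * Real.pi)) + ENNReal.ofReal ((l ^ 5)⁻¹) * ENNReal.ofReal (8 * l ^ 6)) := by
        gcongr
        rw [lintegral_add_left measurable_const, lintegral_const_mul' _ _ ENNReal.ofReal_ne_top]
        gcongr
        · rw [setLIntegral_const, ENNReal.ofReal_mul l0.le, ← AddCircle.measure_univ (2 * Real.pi)]
          gcongr
          exact subset_univ _
        · exact lintegral_omega_gap_small hp _
    _ = _ := by
        have := Real.pi_pos
        rw [← ENNReal.ofReal_mul (by positivity), ← ENNReal.ofReal_add (by positivity) (by positivity),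
          ← ENNReal.ofReal_mul (by positivity)]
        congr 1
        have : (l ^ 5)⁻¹ * (8 * l ^ 6) = 8 * l := by field_simp
        rw [this]
        have h2 : l * (2 * A * (2 * Real.pi + 8)) = ε := by rw [hl]; field_simp
        rw [← h2]; ring

end Kernel

/-! ### Averaging over the resonant manifold -/

/-- The momenta whose frequency has size `ω₀^{1/3}`. -/
def resBand (p : Torus) : Set Torus :=
  {r | omega p ^ (1 / 3 : ℝ) / 500 ≤ omega r ∧ omega r ≤ 11 * omega p ^ (1 / 3 : ℝ)}

theorem measurableSet_resBand (p : Torus) : MeasurableSet (resBand p) :=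
  (measurableSet_le measurable_const measurable_omega).inter
    (measurableSet_le measurable_omega measurable_const)

/-- A weight localizing `p₁, p₂, p₃` to `resBand p`, and damping the set where `p₂` and `p₃` are
close to each other. -/
def resWeight (p x y z : Torus) : ENNReal :=
  (resBand p).indicator 1 x * (resBand p).indicator 1 y * (resBand p).indicator 1 z *
    ENNReal.ofReal (min |cosHalf z - cosHalf y| ((omega p ^ (1 / 3 : ℝ)) ^ 2))

theorem resWeight_comm (p x y z : Torus) : resWeight p x y z = resWeight p x z y := by
  unfold resWeight
  rw [abs_sub_comm, mul_right_comm ((resBand p).indicator 1 x)]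

theorem resWeight_of_mem {p x y z : Torus} (hx : x ∈ resBand p) (hy : y ∈ resBand p)
    (hz : z ∈ resBand p) : resWeight p x y z =
      ENNReal.ofReal (min |cosHalf z - cosHalf y| ((omega p ^ (1 / 3 : ℝ)) ^ 2)) := by
  simp [resWeight, hx, hy, hz]

theorem resWeight_eq_zero {p x y z : Torus} (h : ¬(x ∈ resBand p ∧ y ∈ resBand p ∧ z ∈ resBand p)) :
    resWeight p x y z = 0 := by
  unfold resWeight
  by_cases hx : x ∈ resBand p <;> by_cases hy : y ∈ resBand p <;> by_cases hz : z ∈ resBand p <;>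
    simp_all

theorem measurable_resWeight (p : Torus) :
    Measurable fun q => resWeight p (mom1 p q) q (mom3 p q) := by
  have hi : Measurable ((resBand p).indicator (1 : Torus → ENNReal)) :=
    measurable_one.indicator (measurableSet_resBand p)
  exact (((hi.comp (measurable_mom1_right p)).mul hi).mul (hi.comp (measurable_mom3_right p))).mul
    ((measurable_cosGap_right p).min measurable_const).ennreal_ofReal

section Average

variable {β γ : ℝ}

/-- When p₁, p₂, p₃ lie in the band, the kernel is at most of order ρ^{3/2}·ρ^{1/2}·ρ·ρ = ρ⁴, and
the cutoff in the weight supplies a further ρ². -/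
theorem lintegral_kern_resWeight_le (hβ : 0 < β) (hγ : 0 < γ) {p : Torus} (hp : p ≠ 0)
    (Φ : Torus → ENNReal) :
    ∫⁻ q, ENNReal.ofReal (kern β γ p q) * (resWeight p (mom1 p q) q (mom3 p q) * Φ q) ≤
      ENNReal.ofReal (1331 * (1 / γ) ^ 4 * (omega p ^ (1 / 3 : ℝ)) ^ 6) *
        ∫⁻ q in resBand p, Φ q := by
  rw [← lintegral_const_mul' _ _ ENNReal.ofReal_ne_top,
    ← lintegral_indicator (measurableSet_resBand p)]
  refine lintegral_mono_ae ?_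
  filter_upwards [ae_ne_zero] with q hq
  by_cases h : mom1 p q ∈ resBand p ∧ q ∈ resBand p ∧ mom3 p q ∈ resBand p
  swap
  · rw [resWeight_eq_zero h]; simp
  obtain ⟨h1, h2, h3⟩ := h
  rw [resWeight_of_mem h1 h2 h3, indicator_of_mem h2, ← mul_assoc,
    ← ENNReal.ofReal_mul (kern_nonneg hβ hγ _ _)]
  refine mul_le_mul' (ENNReal.ofReal_le_ofReal ?_) le_rfl
  have hk := kern_le hβ hγ hp hq
  have hp0 := omega_pos hp
  have hq0 := omega_nonneg q
  have e1 : omega p ^ (1 / 2 : ℝ) = (omega p ^ (1 / 3 : ℝ)) ^ (3 / 2 : ℝ) := by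
    rw [← Real.rpow_mul hp0.le]; norm_num
  set ρ := omega p ^ (1 / 3 : ℝ) with hρ
  have ρ0 : 0 < ρ := Real.rpow_pos_of_pos hp0 _
  have e2 : omega q ^ (1 / 2 : ℝ) ≤ 11 * ρ ^ (1 / 2 : ℝ) := by
    calc omega q ^ (1 / 2 : ℝ) ≤ (11 * ρ) ^ (1 / 2 : ℝ) :=
          Real.rpow_le_rpow hq0 h2.2 (by norm_num)
      _ = (11 : ℝ) ^ (1 / 2 : ℝ) * ρ ^ (1 / 2 : ℝ) := Real.mul_rpow (by norm_num) ρ0.le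
      _ ≤ (11 : ℝ) ^ (1 : ℝ) * ρ ^ (1 / 2 : ℝ) := by
          refine mul_le_mul_of_nonneg_right ?_ (by positivity)
          exact Real.rpow_le_rpow_of_exponent_le (by norm_num) (by norm_num)
      _ = _ := by rw [Real.rpow_one]
  have e3 : ρ ^ (3 / 2 : ℝ) * ρ ^ (1 / 2 : ℝ) = ρ ^ 2 := by
    rw [← Real.rpow_add ρ0, ← Real.rpow_natCast]; norm_num
  have h1' := h1.2
  have h3' := h3.2
  have o1 := omega_nonneg (mom1 p q)
  have o3 := omega_nonneg (mom3 p q)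
  rw [e1] at hk
  calc _ ≤ ((1 / γ) ^ 4 * (ρ ^ (3 / 2 : ℝ) * (11 * ρ ^ (1 / 2 : ℝ)) * (11 * ρ) * (11 * ρ))) * ρ ^ 2 := by
        refine mul_le_mul (hk.trans ?_) (min_le_right _ _)
          (le_min (abs_nonneg _) (by positivity)) (by positivity)
        gcongr
    _ = 1331 * (1 / γ) ^ 4 * ((ρ ^ (3 / 2 : ℝ) * ρ ^ (1 / 2 : ℝ)) * ρ * ρ * ρ ^ 2) := by ring
    _ = _ := by rw [e3]; ring

/-- Here the other entry of the minimum is used: kernel times gap is the numerator, at most of order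
ρ⁶, times the Jacobian of p₂ ↦ p₁. The damping by the gap is exactly what permits this change of
variables. -/
theorem lintegral_kern_resWeight_mom1_le (hβ : 0 < β) (hγ : 0 < γ) {p : Torus} (hp : p ≠ 0)
    (Φ : Torus → ENNReal) :
    ∫⁻ q, ENNReal.ofReal (kern β γ p q) *
        (resWeight p (mom1 p q) q (mom3 p q) * Φ (mom1 p q)) ≤
      ENNReal.ofReal (5324 * (1 / γ) ^ 4 * (omega p ^ (1 / 3 : ℝ)) ^ 6) *
        ∫⁻ q in resBand p, Φ q := by
  have hp0 := omega_pos hp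
  have hρ3 : (omega p ^ (1 / 3 : ℝ)) ^ 3 = omega p := by
    rw [← Real.rpow_natCast, ← Real.rpow_mul hp0.le]; norm_num
  calc _ ≤ ∫⁻ q, ENNReal.ofReal (1331 * (1 / γ) ^ 4 * (omega p ^ (1 / 3 : ℝ)) ^ 6) *
        (ENNReal.ofReal (cosGap p q / dens p q) * (resBand p).indicator Φ (mom1 p q)) := by
        refine lintegral_mono_ae ?_
        filter_upwards [ae_generic p] with q hq
        obtain ⟨-, -, hd, -⟩ := generic_facts hp hq.1 hq.2
        by_cases h : mom1 p q ∈ resBand p ∧ q ∈ resBand p ∧ mom3 p q ∈ resBand p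
        swap
        · rw [resWeight_eq_zero h]; simp
        obtain ⟨h1, h2, h3⟩ := h
        rw [resWeight_of_mem h1 h2 h3, indicator_of_mem h1, ← mul_assoc, ← mul_assoc,
          ← ENNReal.ofReal_mul (kern_nonneg hβ hγ _ _), ← ENNReal.ofReal_mul (by positivity)]
        refine mul_le_mul' (ENNReal.ofReal_le_ofReal ?_) le_rfl
        set ρ := omega p ^ (1 / 3 : ℝ) with hρ
        have ρ0 : 0 < ρ := Real.rpow_pos_of_pos hp0 _
        have h1' := h1.2
        have h2' := h2.2
        have h3' := h3.2
        have o1 := omega_nonneg (mom1 p q)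
        have o2 := omega_nonneg q
        have o3 := omega_nonneg (mom3 p q)
        have hk : kernNum β γ p (mom1 p q) q (mom3 p q) ≤ 1331 * (1 / γ) ^ 4 * ρ ^ 6 := by
          calc _ ≤ (1 / γ) ^ 4 * (omega p * omega (mom1 p q) * omega q * omega (mom3 p q)) :=
                kernNum_le hβ hγ _ _ _ _
            _ ≤ (1 / γ) ^ 4 * (ρ ^ 3 * (11 * ρ) * (11 * ρ) * (11 * ρ)) := by
                rw [← hρ3]; gcongr
            _ = _ := by ring
        calc kern β γ p q * min |cosHalf (mom3 p q) - cosHalf q| (ρ ^ 2)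
            ≤ kern β γ p q * cosGap p q :=
              mul_le_mul_of_nonneg_left (min_le_left _ _) (kern_nonneg hβ hγ _ _)
          _ = kernNum β γ p (mom1 p q) q (mom3 p q) * (cosGap p q / dens p q) := by
              rw [kern]; ring
          _ ≤ _ := mul_le_mul_of_nonneg_right hk (div_nonneg (abs_nonneg _) hd.le)
    _ = ENNReal.ofReal (1331 * (1 / γ) ^ 4 * (omega p ^ (1 / 3 : ℝ)) ^ 6) *
        ∫⁻ q, ENNReal.ofReal (cosGap p q / dens p q) * (resBand p).indicator Φ (mom1 p q) :=
        lintegral_const_mul' _ _ ENNReal.ofReal_ne_top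
    _ ≤ ENNReal.ofReal (1331 * (1 / γ) ^ 4 * (omega p ^ (1 / 3 : ℝ)) ^ 6) *
        (4 * ∫⁻ q in resBand p, Φ q) := by
        gcongr
        rw [← lintegral_indicator (measurableSet_resBand p)]
        exact lintegral_mom1_le hp _
    _ = _ := by
        rw [← mul_assoc]
        congr 1
        rw [show (4 : ENNReal) = ENNReal.ofReal 4 by simp, ← ENNReal.ofReal_mul (by positivity)]
        congr 1; ring

/-- On the part of the window with gap above ρ²/16000, the kernel contributes ρ⁴, the weight ρ² and
the measure ρ. -/
theorem le_lintegral_kern_resWeight (hβ : 0 < β) (hγ : 0 < γ) {p : Torus} (hp : p ≠ 0) :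
    ENNReal.ofReal ((1 / (β + γ)) ^ 4 / (2 * 500 ^ 3 * 64000) * (omega p ^ (1 / 3 : ℝ)) ^ 7) ≤
      ∫⁻ q, ENNReal.ofReal (kern β γ p q) * resWeight p (mom1 p q) q (mom3 p q) := by
  have hp0 := omega_pos hp
  have hv := volume_window_gap hp
  have hk := fun q => kern_ge_of_mem_window hβ hγ hp (q := q)
  have hm : MeasurableSet (window p ∩ {q | (omega p ^ (1 / 3 : ℝ)) ^ 2 / 16000 < cosGap p q}) :=
    (measurableSet_window p).inter (measurableSet_lt measurable_const (measurable_cosGap_right p))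
  have ρ0 : 0 < omega p ^ (1 / 3 : ℝ) := Real.rpow_pos_of_pos hp0 _
  set ρ := omega p ^ (1 / 3 : ℝ) with hρ
  calc _ = ENNReal.ofReal ((1 / (β + γ)) ^ 4 * (ρ ^ 4 / (2 * 500 ^ 3)) * (ρ ^ 2 / 16000)) *
        ENNReal.ofReal (ρ / 4) := by
        rw [← ENNReal.ofReal_mul (by positivity)]; congr 1; ring
    _ ≤ ENNReal.ofReal ((1 / (β + γ)) ^ 4 * (ρ ^ 4 / (2 * 500 ^ 3)) * (ρ ^ 2 / 16000)) *
        volume (window p ∩ {q | ρ ^ 2 / 16000 < cosGap p q}) := by gcongr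
    _ = ∫⁻ _ in window p ∩ {q | ρ ^ 2 / 16000 < cosGap p q},
        ENNReal.ofReal ((1 / (β + γ)) ^ 4 * (ρ ^ 4 / (2 * 500 ^ 3)) * (ρ ^ 2 / 16000)) :=
        (setLIntegral_const _ _).symm
    _ ≤ ∫⁻ q in window p ∩ {q | ρ ^ 2 / 16000 < cosGap p q},
        ENNReal.ofReal (kern β γ p q) * resWeight p (mom1 p q) q (mom3 p q) := by
        refine setLIntegral_mono' hm fun q hq => ?_
        obtain ⟨⟨h2, h1, h3, -⟩, hg⟩ := id hq
        rw [resWeight_of_mem h1 h2 h3, ← ENNReal.ofReal_mul (kern_nonneg hβ hγ _ _)]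
        apply ENNReal.ofReal_le_ofReal
        refine mul_le_mul (hk q hq.1) (le_min (le_of_lt hg) ?_) (by positivity)
          (kern_nonneg hβ hγ _ _)
        have : 0 < ρ ^ 2 := by positivity
        linarith
    _ ≤ _ := setLIntegral_le_lintegral _ _

/-- Cauchy–Schwarz on the band, whose measure is at most 8·11ρ; the constant uses √88 ≤ 10. -/
theorem setLIntegral_resBand_le {p : Torus} {Φ : Torus → ENNReal} (hΦ : Measurable Φ) :
    ∫⁻ q in resBand p, Φ q ≤ ENNReal.ofReal (10 * (omega p ^ (1 / 3 : ℝ)) ^ (1 / 2 : ℝ)) *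
      (∫⁻ q in {q | omega p ^ (1 / 3 : ℝ) / 500 ≤ omega q}, Φ q ^ 2) ^ (1 / 2 : ℝ) := by
  have ρ0 : 0 ≤ omega p ^ (1 / 3 : ℝ) := Real.rpow_nonneg (omega_nonneg p) _
  have h := lintegral_mul_le_sqrt (μ := volume.restrict (resBand p)) (f := fun _ => 1)
    (g := Φ) aemeasurable_const hΦ.aemeasurable
  simp only [one_mul, one_pow, lintegral_const, Measure.restrict_apply_univ] at h
  refine h.trans (mul_le_mul' ?_ ?_)
  · set ρ := omega p ^ (1 / 3 : ℝ)
    calc volume (resBand p) ^ (1 / 2 : ℝ) ≤ ENNReal.ofReal (8 * (11 * ρ)) ^ (1 / 2 : ℝ) := by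
          gcongr
          exact (measure_mono fun q hq => hq.2).trans (volume_omega_le (by positivity))
      _ = ENNReal.ofReal ((88 * ρ) ^ (1 / 2 : ℝ)) := by
          rw [ENNReal.ofReal_rpow_of_nonneg (by positivity) (by norm_num)]
          ring_nf
      _ ≤ _ := by
          apply ENNReal.ofReal_le_ofReal
          rw [Real.mul_rpow (by norm_num) ρ0]
          gcongr
          calc (88 : ℝ) ^ (1 / 2 : ℝ) ≤ ((10 : ℝ) ^ (2 : ℝ)) ^ (1 / 2 : ℝ) :=
                Real.rpow_le_rpow (by norm_num) (by norm_num) (by norm_num)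
            _ = 10 := by rw [← Real.rpow_mul (by norm_num)]; norm_num
  · gcongr
    exact fun q hq => hq.1

/-- A function which at `p` is dominated by its values at the other momenta of almost every
resonance is bounded at `p` by an `L²` norm. -/
theorem exists_le_of_resonant (hβ : 0 < β) (hγ : 0 < γ) : ∃ C : ℝ, 0 < C ∧ ∀ p : Torus, p ≠ 0 →
    ∀ (a : ENNReal) (Φ : Torus → ENNReal), Measurable Φ →
    (∀ᵐ q, a ≤ Φ (mom1 p q) + Φ q + Φ (mom3 p q)) →
    a ≤ ENNReal.ofReal (C * omega p ^ (-(1 / 6) : ℝ)) *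
      (∫⁻ q in {q | omega p ^ (1 / 3 : ℝ) / 500 ≤ omega q}, Φ q ^ 2) ^ (1 / 2 : ℝ) := by
  set c : ℝ := (1 / (β + γ)) ^ 4 / (2 * 500 ^ 3 * 64000) with hc
  have c0 : 0 < c := by positivity
  set K : ℝ := 7986 * (1 / γ) ^ 4 with hK
  have K0 : 0 < K := by positivity
  refine ⟨c⁻¹ * K * 10, by positivity, fun p hp a Φ hΦ ha => ?_⟩
  have hp0 := omega_pos hp
  have hlow := le_lintegral_kern_resWeight hβ hγ hp
  have hband := setLIntegral_resBand_le (p := p) hΦ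
  have h1 := lintegral_kern_resWeight_mom1_le hβ hγ hp Φ
  have h2 := lintegral_kern_resWeight_le hβ hγ hp Φ
  -- The p₃ term equals the p₂ term, because the weight is symmetric in p₂ and p₃.
  have h3 : ∫⁻ q, ENNReal.ofReal (kern β γ p q) *
      (resWeight p (mom1 p q) q (mom3 p q) * Φ (mom3 p q)) =
      ∫⁻ q, ENNReal.ofReal (kern β γ p q) * (resWeight p (mom1 p q) q (mom3 p q) * Φ q) := by
    rw [lintegral_kern_exchange hp fun x y z => resWeight p x y z * Φ z]
    simp only [resWeight_comm p _ (mom3 p _)]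
  rw [← hc] at hlow
  have e6 : omega p ^ (-(1 / 6) : ℝ) = (omega p ^ (1 / 3 : ℝ)) ^ (-(1 / 2) : ℝ) := by
    rw [← Real.rpow_mul hp0.le]; norm_num
  rw [e6]
  set ρ := omega p ^ (1 / 3 : ℝ) with hρ
  have ρ0 : 0 < ρ := Real.rpow_pos_of_pos hp0 _
  set N := (∫⁻ q in {q | ρ / 500 ≤ omega q}, Φ q ^ 2) ^ (1 / 2 : ℝ) with hN
  have mk := (measurable_kern_right β γ p).ennreal_ofReal
  have mw := measurable_resWeight p
  -- The pointwise inequality is averaged against kernel times weight. The total mass is at least of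
  -- order ρ⁷ and each of the three terms is at most of order ρ⁶·ρ^{1/2} times the L² norm; the
  -- quotient is ρ^{-1/2} = ω₀^{-1/6}.
  have key : ENNReal.ofReal (c * ρ ^ 7) * a ≤ ENNReal.ofReal (K * ρ ^ 6) *
      (ENNReal.ofReal (10 * ρ ^ (1 / 2 : ℝ)) * N) := by
    calc ENNReal.ofReal (c * ρ ^ 7) * a
        ≤ (∫⁻ q, ENNReal.ofReal (kern β γ p q) * resWeight p (mom1 p q) q (mom3 p q)) * a := by
          gcongr
      _ = ∫⁻ q, ENNReal.ofReal (kern β γ p q) * resWeight p (mom1 p q) q (mom3 p q) * a :=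
          (lintegral_mul_const _ (mk.mul mw)).symm
      _ ≤ ∫⁻ q, (ENNReal.ofReal (kern β γ p q) *
              (resWeight p (mom1 p q) q (mom3 p q) * Φ (mom1 p q)) +
            ENNReal.ofReal (kern β γ p q) * (resWeight p (mom1 p q) q (mom3 p q) * Φ q)) +
            ENNReal.ofReal (kern β γ p q) *
              (resWeight p (mom1 p q) q (mom3 p q) * Φ (mom3 p q)) := by
          refine lintegral_mono_ae ?_
          filter_upwards [ha] with q hq
          rw [← mul_add, ← mul_add, ← mul_add, ← mul_add, mul_assoc]
          gcongr
      _ ≤ (ENNReal.ofReal (5324 * (1 / γ) ^ 4 * ρ ^ 6) + ENNReal.ofReal (1331 * (1 / γ) ^ 4 * ρ ^ 6) +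
            ENNReal.ofReal (1331 * (1 / γ) ^ 4 * ρ ^ 6)) * ∫⁻ q in resBand p, Φ q := by
          rw [lintegral_add_left, lintegral_add_left, h3, add_mul, add_mul]
          · gcongr
          · exact mk.mul (mw.mul (hΦ.comp (measurable_mom1_right p)))
          · exact (mk.mul (mw.mul (hΦ.comp (measurable_mom1_right p)))).add (mk.mul (mw.mul hΦ))
      _ ≤ _ := by
          rw [← ENNReal.ofReal_add (by positivity) (by positivity),
            ← ENNReal.ofReal_add (by positivity) (by positivity)]
          gcongr
          rw [hK]; apply le_of_eq; ring
  have hne : ENNReal.ofReal (c * ρ ^ 7) ≠ 0 := by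
    rw [Ne, ENNReal.ofReal_eq_zero, not_le]; positivity
  refine (ENNReal.mul_le_mul_iff_right hne ENNReal.ofReal_ne_top).1 (key.trans (le_of_eq ?_))
  rw [← mul_assoc, ← mul_assoc, ← ENNReal.ofReal_mul (by positivity),
    ← ENNReal.ofReal_mul (by positivity)]
  congr 2
  have e : ρ ^ (-(1 / 2) : ℝ) = ρ ^ (1 / 2 : ℝ) / ρ := by
    rw [eq_div_iff ρ0.ne', ← Real.rpow_add_one ρ0.ne']; norm_num
  rw [e]
  field_simp

end Average

/-! ### Lower bounds on the orthogonal complement of a kernel -/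

section Gap

variable {H F : Type*} [NormedAddCommGroup H] [InnerProductSpace ℝ H] [CompleteSpace H]
  [NormedAddCommGroup F] [InnerProductSpace ℝ F]

/-- Bounded sequences of a separable Hilbert space have weakly convergent subsequences. -/
theorem exists_subseq_tendsto_inner [TopologicalSpace.SeparableSpace H] (x : ℕ → H)
    (hx : ∀ n, ‖x n‖ ≤ 1) : ∃ (y : H) (k : ℕ → ℕ), StrictMono k ∧
      ∀ z : H, Filter.Tendsto (fun n => inner ℝ (x (k n)) z) Filter.atTop (nhds (inner ℝ y z)) := by
  have hc := WeakDual.isSeqCompact_closedBall ℝ H (0 : StrongDual ℝ H) 1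
  obtain ⟨a, -, k, hk, hlim⟩ := hc
    (x := fun n => StrongDual.toWeakDual (InnerProductSpace.toDual ℝ H (x n))) (fun n => by
      simpa using hx n)
  refine ⟨(InnerProductSpace.toDual ℝ H).symm (WeakDual.toStrongDual a), k, hk, fun z => ?_⟩
  rw [InnerProductSpace.toDual_symm_apply]
  have := ((WeakDual.eval_continuous (𝕜 := ℝ) z).tendsto a).comp hlim
  simpa [Function.comp_def] using this

/-- A bounded operator which does not shrink any weakly null sequence of unit vectors to zero is
bounded below on the orthogonal complement of its kernel. -/
theorem exists_le_norm_of_mem_ker_orthogonal [TopologicalSpace.SeparableSpace H] (D : H →L[ℝ] F)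
    (hD : ∀ x : ℕ → H, (∀ n, ‖x n‖ = 1) →
      (∀ z, Filter.Tendsto (fun n => inner ℝ (x n) z) Filter.atTop (nhds 0)) →
      ¬Filter.Tendsto (fun n => ‖D (x n)‖) Filter.atTop (nhds 0)) :
    ∃ c : ℝ, 0 < c ∧ ∀ x : H, (∀ z, D z = 0 → inner ℝ x z = 0) → c * ‖x‖ ≤ ‖D x‖ := by
  -- Otherwise there are unit vectors xₙ orthogonal to ker D with Dxₙ → 0. A weak limit lies in ker
  -- D and is orthogonal to it, so it is 0, and the subsequence contradicts the hypothesis on weakly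
  -- null sequences.
  by_contra! h
  choose v hv hlt using fun n : ℕ => h (1 / ((n : ℝ) + 1)) (by positivity)
  have hv0 : ∀ n, v n ≠ 0 := fun n h0 => by
    have := hlt n
    simp [h0] at this
  have hn0 : ∀ n, 0 < ‖v n‖ := fun n => norm_pos_iff.2 (hv0 n)
  set x : ℕ → H := fun n => (‖v n‖)⁻¹ • v n with hxdef
  have hx1 : ∀ n, ‖x n‖ = 1 := fun n => by
    rw [hxdef]; simp [norm_smul, (hn0 n).ne']
  have hxo : ∀ n z, D z = 0 → inner ℝ (x n) z = 0 := fun n z hz => by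
    simp [hxdef, inner_smul_left, hv n z hz]
  have hxD : ∀ n, ‖D (x n)‖ ≤ 1 / ((n : ℝ) + 1) := fun n => by
    have h1 := (hlt n).le
    rw [hxdef]
    simp only [map_smul, norm_smul, norm_inv, norm_norm]
    rw [inv_mul_le_iff₀ (hn0 n), mul_comm]
    exact h1
  have hxt : Filter.Tendsto (fun n => ‖D (x n)‖) Filter.atTop (nhds 0) :=
    squeeze_zero (fun _ => norm_nonneg _) hxD tendsto_one_div_add_atTop_nhds_zero_nat
  obtain ⟨y, k, hk, hlim⟩ := exists_subseq_tendsto_inner x fun n => (hx1 n).le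
  have hyo : ∀ z, D z = 0 → inner ℝ y z = 0 := fun z hz => by
    refine tendsto_nhds_unique (hlim z) ?_
    simp [hxo _ z hz]
  have hDy : D y = 0 := by
    have hb : ∀ w : F, inner ℝ (D y) w = 0 := fun w => by
      set l : StrongDual ℝ H := (innerSL ℝ w).comp D with hl
      have hlim' := hlim ((InnerProductSpace.toDual ℝ H).symm l)
      have e : ∀ u, inner ℝ u ((InnerProductSpace.toDual ℝ H).symm l) = inner ℝ w (D u) := fun u => by
        rw [real_inner_comm, InnerProductSpace.toDual_symm_apply]; rfl
      simp only [e] at hlim'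
      have h0 : Filter.Tendsto (fun n => inner ℝ w (D (x (k n)))) Filter.atTop (nhds 0) := by
        refine squeeze_zero_norm (fun n => norm_inner_le_norm w _) ?_
        simpa using (hxt.comp hk.tendsto_atTop).const_mul ‖w‖
      rw [real_inner_comm]
      exact tendsto_nhds_unique hlim' h0
    exact inner_self_eq_zero.1 (hb (D y))
  have hy : y = 0 := inner_self_eq_zero.1 (hyo y hDy)
  refine hD (x ∘ k) (fun n => hx1 _) (fun z => ?_) (hxt.comp hk.tendsto_atTop)
  simpa [hy] using hlim z

end Gap

/-! ### The collision measure -/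

section Collision

/-- The momenta of a resonance. -/
def momenta (w : Torus × Torus) : Torus × Torus × Torus × Torus :=
  (w.1, mom1 w.1 w.2, w.2, mom3 w.1 w.2)

theorem measurable_momenta : Measurable momenta :=
  measurable_fst.prodMk (measurable_mom1.prodMk (measurable_snd.prodMk measurable_mom3))

/-- The measure with density `rateE`. -/
def rateMeasure (β γ : ℝ) : Measure Torus := volume.withDensity (rateE β γ)

/-- The distribution of the momenta of a resonance. -/
def collMeasure (β γ : ℝ) : Measure (Torus × Torus × Torus × Torus) :=
  (((volume : Measure Torus).prod volume).withDensity
    fun w => ENNReal.ofReal (kern β γ w.1 w.2)).map momenta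

variable (β γ : ℝ)

theorem lintegral_collMeasure {G : Torus × Torus × Torus × Torus → ENNReal} (hG : Measurable G) :
    ∫⁻ r, G r ∂collMeasure β γ =
      ∫⁻ p, ∫⁻ q, ENNReal.ofReal (kern β γ p q) * G (momenta (p, q)) := by
  have mk := (measurable_kern β γ).ennreal_ofReal
  have mG : Measurable fun w => G (momenta w) := hG.comp measurable_momenta
  rw [collMeasure, lintegral_map hG measurable_momenta,
    lintegral_withDensity_eq_lintegral_mul _ mk mG, lintegral_prod _ (mk.mul mG).aemeasurable]
  rfl

/-- The exchange of the incoming and the outgoing pair. -/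
def pairSwap (r : Torus × Torus × Torus × Torus) : Torus × Torus × Torus × Torus :=
  (r.2.2.1, r.2.2.2, r.1, r.2.1)

/-- The exchange of the outgoing particles. -/
def outSwap (r : Torus × Torus × Torus × Torus) : Torus × Torus × Torus × Torus :=
  (r.1, r.2.1, r.2.2.2, r.2.2.1)

theorem measurable_pairSwap : Measurable pairSwap := by unfold pairSwap; fun_prop

theorem measurable_outSwap : Measurable outSwap := by unfold outSwap; fun_prop

/-- Tonelli exchanges p₀ and p₂, and the symmetry of the kernel does the rest. -/
theorem measurePreserving_pairSwap :
    MeasurePreserving pairSwap (collMeasure β γ) (collMeasure β γ) := by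
  refine ⟨measurable_pairSwap, Measure.ext_of_lintegral _ fun G hG => ?_⟩
  rw [lintegral_map hG measurable_pairSwap,
    lintegral_collMeasure β γ (G := fun r => G (pairSwap r)) (hG.comp measurable_pairSwap), lintegral_collMeasure β γ hG]
  have m : Measurable fun w : Torus × Torus => ENNReal.ofReal (kern β γ w.1 w.2) *
      G (pairSwap (momenta w)) :=
    (measurable_kern β γ).ennreal_ofReal.mul (hG.comp (measurable_pairSwap.comp measurable_momenta))
  rw [lintegral_lintegral_swap m.aemeasurable]
  refine lintegral_congr fun p => lintegral_congr fun q => ?_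
  simp only [pairSwap, momenta, kern_swap p q, mom1_swap p q, mom3_swap p q]

theorem measurePreserving_outSwap :
    MeasurePreserving outSwap (collMeasure β γ) (collMeasure β γ) := by
  refine ⟨measurable_outSwap, Measure.ext_of_lintegral _ fun G hG => ?_⟩
  rw [lintegral_map hG measurable_outSwap,
    lintegral_collMeasure β γ (G := fun r => G (outSwap r)) (hG.comp measurable_outSwap), lintegral_collMeasure β γ hG]
  refine lintegral_congr_ae ?_
  filter_upwards [ae_ne_zero] with p hp
  exact (lintegral_kern_exchange hp fun x y z => G (p, x, y, z)).symm

/-- Integrating out p₂ leaves the rate as the law of p₀. The two exchanges carry p₀ to every other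
coordinate, so all four momenta have the same law and all four pullbacks are isometries. -/
theorem measurePreserving_coord₀ :
    MeasurePreserving (fun r : Torus × Torus × Torus × Torus => r.1) (collMeasure β γ)
      (rateMeasure β γ) := by
  refine ⟨measurable_fst, Measure.ext_of_lintegral _ fun G hG => ?_⟩
  rw [lintegral_map hG measurable_fst, lintegral_collMeasure β γ (G := fun r => G r.1) (hG.comp measurable_fst),
    rateMeasure, lintegral_withDensity_eq_lintegral_mul _ (measurable_rateE β γ) hG]
  refine lintegral_congr fun p => ?_
  exact lintegral_mul_const (G p) (measurable_kern_right β γ p).ennreal_ofReal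

theorem measurePreserving_coord₂ :
    MeasurePreserving (fun r : Torus × Torus × Torus × Torus => r.2.2.1) (collMeasure β γ)
      (rateMeasure β γ) :=
  (measurePreserving_coord₀ β γ).comp (measurePreserving_pairSwap β γ)

theorem measurePreserving_coord₃ :
    MeasurePreserving (fun r : Torus × Torus × Torus × Torus => r.2.2.2) (collMeasure β γ)
      (rateMeasure β γ) :=
  (measurePreserving_coord₂ β γ).comp (measurePreserving_outSwap β γ)

theorem measurePreserving_coord₁ :
    MeasurePreserving (fun r : Torus × Torus × Torus × Torus => r.2.1) (collMeasure β γ)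
      (rateMeasure β γ) :=
  (measurePreserving_coord₃ β γ).comp (measurePreserving_pairSwap β γ)

/-- The Hilbert space of functions of one momentum. -/
abbrev RateL2 : Type := Lp ℝ 2 (rateMeasure β γ)

/-- The Hilbert space of functions of a resonance. -/
abbrev CollL2 : Type := Lp ℝ 2 (collMeasure β γ)

/-- The pullback along `p₀`. -/
def pull₀ : RateL2 β γ →ₗᵢ[ℝ] CollL2 β γ :=
  Lp.compMeasurePreservingₗᵢ ℝ _ (measurePreserving_coord₀ β γ)

/-- The pullback along `p₁`. -/
def pull₁ : RateL2 β γ →ₗᵢ[ℝ] CollL2 β γ :=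
  Lp.compMeasurePreservingₗᵢ ℝ _ (measurePreserving_coord₁ β γ)

/-- The pullback along `p₂`. -/
def pull₂ : RateL2 β γ →ₗᵢ[ℝ] CollL2 β γ :=
  Lp.compMeasurePreservingₗᵢ ℝ _ (measurePreserving_coord₂ β γ)

/-- The pullback along `p₃`. -/
def pull₃ : RateL2 β γ →ₗᵢ[ℝ] CollL2 β γ :=
  Lp.compMeasurePreservingₗᵢ ℝ _ (measurePreserving_coord₃ β γ)

/-- The pullback along `pairSwap`. -/
def pullPair : CollL2 β γ →ₗᵢ[ℝ] CollL2 β γ :=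
  Lp.compMeasurePreservingₗᵢ ℝ _ (measurePreserving_pairSwap β γ)

/-- The pullback along `outSwap`. -/
def pullOut : CollL2 β γ →ₗᵢ[ℝ] CollL2 β γ :=
  Lp.compMeasurePreservingₗᵢ ℝ _ (measurePreserving_outSwap β γ)

/-- The collision difference `φ₀ + φ₁ - φ₂ - φ₃`. -/
def collDiff : RateL2 β γ →L[ℝ] CollL2 β γ :=
  (pull₀ β γ).toContinuousLinearMap + (pull₁ β γ).toContinuousLinearMap -
    (pull₂ β γ).toContinuousLinearMap - (pull₃ β γ).toContinuousLinearMap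

variable {β γ}

theorem collDiff_apply (φ : RateL2 β γ) :
    collDiff β γ φ = pull₀ β γ φ + pull₁ β γ φ - pull₂ β γ φ - pull₃ β γ φ := rfl

theorem coeFn_pull₀ (φ : RateL2 β γ) : pull₀ β γ φ =ᵐ[collMeasure β γ] fun r => φ r.1 :=
  Lp.coeFn_compMeasurePreserving _ (measurePreserving_coord₀ β γ)

theorem coeFn_pull₁ (φ : RateL2 β γ) : pull₁ β γ φ =ᵐ[collMeasure β γ] fun r => φ r.2.1 :=
  Lp.coeFn_compMeasurePreserving _ (measurePreserving_coord₁ β γ)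

theorem coeFn_pull₂ (φ : RateL2 β γ) : pull₂ β γ φ =ᵐ[collMeasure β γ] fun r => φ r.2.2.1 :=
  Lp.coeFn_compMeasurePreserving _ (measurePreserving_coord₂ β γ)

theorem coeFn_pull₃ (φ : RateL2 β γ) : pull₃ β γ φ =ᵐ[collMeasure β γ] fun r => φ r.2.2.2 :=
  Lp.coeFn_compMeasurePreserving _ (measurePreserving_coord₃ β γ)

theorem coeFn_collDiff (φ : RateL2 β γ) : collDiff β γ φ =ᵐ[collMeasure β γ]
    fun r => φ r.1 + φ r.2.1 - φ r.2.2.1 - φ r.2.2.2 := by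
  rw [collDiff_apply]
  filter_upwards [coeFn_pull₀ φ, coeFn_pull₁ φ, coeFn_pull₂ φ, coeFn_pull₃ φ,
    Lp.coeFn_sub (pull₀ β γ φ + pull₁ β γ φ - pull₂ β γ φ) (pull₃ β γ φ),
    Lp.coeFn_sub (pull₀ β γ φ + pull₁ β γ φ) (pull₂ β γ φ),
    Lp.coeFn_add (pull₀ β γ φ) (pull₁ β γ φ)] with r h0 h1 h2 h3 e1 e2 e3
  rw [e1, Pi.sub_apply, e2, Pi.sub_apply, e3, Pi.add_apply, h0, h1, h2, h3]

theorem pullPair_pull₀ (φ : RateL2 β γ) : pullPair β γ (pull₀ β γ φ) = pull₂ β γ φ :=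
  (Lp.compMeasurePreserving_comp_apply _ (measurePreserving_coord₀ β γ)
    (measurePreserving_pairSwap β γ)).symm

theorem pullPair_pull₂ (φ : RateL2 β γ) : pullPair β γ (pull₂ β γ φ) = pull₀ β γ φ :=
  (Lp.compMeasurePreserving_comp_apply _ (measurePreserving_coord₂ β γ)
    (measurePreserving_pairSwap β γ)).symm

theorem pullPair_pull₁ (φ : RateL2 β γ) : pullPair β γ (pull₁ β γ φ) = pull₃ β γ φ :=
  (Lp.compMeasurePreserving_comp_apply _ (measurePreserving_coord₁ β γ)
    (measurePreserving_pairSwap β γ)).symm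

theorem pullPair_pull₃ (φ : RateL2 β γ) : pullPair β γ (pull₃ β γ φ) = pull₁ β γ φ :=
  (Lp.compMeasurePreserving_comp_apply _ (measurePreserving_coord₃ β γ)
    (measurePreserving_pairSwap β γ)).symm

theorem pullOut_pull₀ (φ : RateL2 β γ) : pullOut β γ (pull₀ β γ φ) = pull₀ β γ φ :=
  (Lp.compMeasurePreserving_comp_apply _ (measurePreserving_coord₀ β γ)
    (measurePreserving_outSwap β γ)).symm

theorem pullOut_pull₁ (φ : RateL2 β γ) : pullOut β γ (pull₁ β γ φ) = pull₁ β γ φ :=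
  (Lp.compMeasurePreserving_comp_apply _ (measurePreserving_coord₁ β γ)
    (measurePreserving_outSwap β γ)).symm

theorem pullOut_pull₂ (φ : RateL2 β γ) : pullOut β γ (pull₂ β γ φ) = pull₃ β γ φ :=
  (Lp.compMeasurePreserving_comp_apply _ (measurePreserving_coord₂ β γ)
    (measurePreserving_outSwap β γ)).symm

theorem pullOut_pull₃ (φ : RateL2 β γ) : pullOut β γ (pull₃ β γ φ) = pull₂ β γ φ :=
  (Lp.compMeasurePreserving_comp_apply _ (measurePreserving_coord₃ β γ)
    (measurePreserving_outSwap β γ)).symm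

/-- Dφ is odd under the exchange of pairs and even under p₂ ↔ p₃, so its inner products with the
four pullbacks of ψ agree up to the signs that D carries. This is the H-theorem identity −L = ¼T*T
in weak form. -/
theorem inner_collDiff (φ ψ : RateL2 β γ) :
    inner ℝ (collDiff β γ φ) (collDiff β γ ψ) = 4 * inner ℝ (collDiff β γ φ) (pull₀ β γ ψ) := by
  have hs : pullPair β γ (collDiff β γ φ) = -collDiff β γ φ := by
    simp only [collDiff_apply, map_add, map_sub, pullPair_pull₀, pullPair_pull₁, pullPair_pull₂,
      pullPair_pull₃]
    abel
  have ht : pullOut β γ (collDiff β γ φ) = collDiff β γ φ := by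
    simp only [collDiff_apply, map_add, map_sub, pullOut_pull₀, pullOut_pull₁, pullOut_pull₂,
      pullOut_pull₃]
    abel
  have e2 : inner ℝ (collDiff β γ φ) (pull₂ β γ ψ) = -inner ℝ (collDiff β γ φ) (pull₀ β γ ψ) := by
    rw [← (pullPair β γ).inner_map_map, hs, pullPair_pull₂, inner_neg_left]
  have e3 : inner ℝ (collDiff β γ φ) (pull₃ β γ ψ) = inner ℝ (collDiff β γ φ) (pull₂ β γ ψ) := by
    rw [← (pullOut β γ).inner_map_map, ht, pullOut_pull₃]
  have e1 : inner ℝ (collDiff β γ φ) (pull₁ β γ ψ) = -inner ℝ (collDiff β γ φ) (pull₃ β γ ψ) := by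
    rw [← (pullPair β γ).inner_map_map, hs, pullPair_pull₁, inner_neg_left]
  rw [collDiff_apply ψ, inner_sub_right, inner_sub_right, inner_add_right, e1, e3, e2]
  ring

/-- The diagonal term is the loss part; the two kinds of cross terms are the gain part, to be shown
compact. -/
theorem norm_sq_collDiff (φ : RateL2 β γ) :
    ‖collDiff β γ φ‖ ^ 2 = 4 * (‖φ‖ ^ 2 + inner ℝ (pull₁ β γ φ) (pull₀ β γ φ) -
      2 * inner ℝ (pull₂ β γ φ) (pull₀ β γ φ)) := by
  have e3 : inner ℝ (pull₃ β γ φ) (pull₀ β γ φ) = inner ℝ (pull₂ β γ φ) (pull₀ β γ φ) := by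
    rw [← (pullOut β γ).inner_map_map, pullOut_pull₃, pullOut_pull₀]
  rw [← real_inner_self_eq_norm_sq, inner_collDiff, collDiff_apply, inner_sub_left, inner_sub_left,
    inner_add_left, e3, real_inner_self_eq_norm_sq, (pull₀ β γ).norm_map]
  ring

end Collision

/-! ### Integration against the collision measure -/

section Weights

variable {β γ : ℝ}

instance (β γ : ℝ) : SFinite (rateMeasure β γ) := by unfold rateMeasure; infer_instance

instance (β γ : ℝ) : TopologicalSpace.SeparableSpace (RateL2 β γ) := by
  have : Fact ((2 : ENNReal) ≠ ⊤) := ⟨ENNReal.ofNat_ne_top⟩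
  infer_instance

theorem enorm_sq_Lp {X : Type*} [MeasurableSpace X] {μ : Measure X} (φ : Lp ℝ 2 μ) :
    ‖φ‖ₑ ^ 2 = ∫⁻ x, ‖φ x‖ₑ ^ 2 ∂μ := by
  rw [Lp.enorm_def, eLpNorm_eq_lintegral_rpow_enorm_toReal (by norm_num) (by norm_num),
    ← ENNReal.rpow_natCast, ← ENNReal.rpow_mul]
  norm_num

theorem measurable_enorm_Lp {X : Type*} [MeasurableSpace X] {μ : Measure X} (φ : Lp ℝ 2 μ) :
    Measurable fun x => ‖φ x‖ₑ :=
  (Lp.stronglyMeasurable φ).measurable.enorm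

theorem enorm_sq_RateL2 (φ : RateL2 β γ) : ‖φ‖ₑ ^ 2 = ∫⁻ p, rateE β γ p * ‖φ p‖ₑ ^ 2 := by
  exact (enorm_sq_Lp φ).trans (lintegral_withDensity_eq_lintegral_mul volume (measurable_rateE β γ)
    ((measurable_enorm_Lp φ).pow_const 2))

theorem exists_lintegral_omega_sq_le (hβ : 0 < β) (hγ : 0 < γ) : ∃ K : ℝ, 0 < K ∧
    ∀ φ : RateL2 β γ,
      ∫⁻ p, ENNReal.ofReal (omega p ^ (5 / 3 : ℝ)) * ‖φ p‖ₑ ^ 2 ≤ ENNReal.ofReal K * ‖φ‖ₑ ^ 2 := by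
  obtain ⟨c, c0, hc⟩ := exists_rateE_ge hβ hγ
  refine ⟨c⁻¹, by positivity, fun φ => ?_⟩
  rw [enorm_sq_RateL2, ← lintegral_const_mul' _ _ ENNReal.ofReal_ne_top]
  refine lintegral_mono_ae ?_
  filter_upwards [ae_ne_zero] with p hp
  rw [← mul_assoc]
  gcongr
  calc ENNReal.ofReal (omega p ^ (5 / 3 : ℝ)) =
        ENNReal.ofReal c⁻¹ * ENNReal.ofReal (c * omega p ^ (5 / 3 : ℝ)) := by
        rw [← ENNReal.ofReal_mul (by positivity)]; congr 1; field_simp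
    _ ≤ _ := by gcongr; exact hc p hp

theorem exists_lintegral_omega_le (hβ : 0 < β) (hγ : 0 < γ) : ∃ K : ℝ, 0 < K ∧
    ∀ φ : RateL2 β γ,
      ∫⁻ p, ENNReal.ofReal (omega p ^ (1 / 2 : ℝ)) * ‖φ p‖ₑ ≤ ENNReal.ofReal K * ‖φ‖ₑ := by
  obtain ⟨K, K0, hK⟩ := exists_lintegral_omega_sq_le hβ hγ
  have hI := lintegral_omega_rpow_lt_top (s := -(2 / 3)) (by norm_num)
  set I := (∫⁻ q, ENNReal.ofReal (omega q ^ (-(2 / 3) : ℝ))) ^ (1 / 2 : ℝ) with hIdef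
  have hIt : I ≠ ⊤ := ENNReal.rpow_ne_top_of_nonneg (by norm_num) hI.ne
  have m := measurable_omega
  refine ⟨I.toReal * K ^ (1 / 2 : ℝ) + 1, by positivity, fun φ => ?_⟩
  have mφ := measurable_enorm_Lp φ
  have e : ∀ (s : ℝ) (q : Torus), ENNReal.ofReal (omega q ^ s) ^ 2 =
      ENNReal.ofReal (omega q ^ (2 * s)) := by
    intro s q
    rw [← ENNReal.ofReal_pow (Real.rpow_nonneg (omega_nonneg q) _), ← Real.rpow_natCast,
      ← Real.rpow_mul (omega_nonneg q)]
    congr 2; push_cast; ring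
  calc ∫⁻ p, ENNReal.ofReal (omega p ^ (1 / 2 : ℝ)) * ‖φ p‖ₑ
      = ∫⁻ p, ENNReal.ofReal (omega p ^ (-(1 / 3) : ℝ)) *
          (ENNReal.ofReal (omega p ^ (5 / 6 : ℝ)) * ‖φ p‖ₑ) := by
        refine lintegral_congr_ae ?_
        filter_upwards [ae_ne_zero] with p hp
        rw [← mul_assoc, ← ENNReal.ofReal_mul (Real.rpow_nonneg (omega_nonneg p) _),
          ← Real.rpow_add (omega_pos hp)]
        norm_num
    _ ≤ (∫⁻ p, ENNReal.ofReal (omega p ^ (-(1 / 3) : ℝ)) ^ 2) ^ (1 / 2 : ℝ) *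
        (∫⁻ p, (ENNReal.ofReal (omega p ^ (5 / 6 : ℝ)) * ‖φ p‖ₑ) ^ 2) ^ (1 / 2 : ℝ) :=
        lintegral_mul_le_sqrt (m.pow_const _).ennreal_ofReal.aemeasurable
          ((m.pow_const _).ennreal_ofReal.mul mφ).aemeasurable
    _ = I * (∫⁻ p, ENNReal.ofReal (omega p ^ (5 / 3 : ℝ)) * ‖φ p‖ₑ ^ 2) ^ (1 / 2 : ℝ) := by
        simp only [e, mul_pow]
        rw [hIdef]; norm_num
    _ ≤ I * (ENNReal.ofReal K * ‖φ‖ₑ ^ 2) ^ (1 / 2 : ℝ) := by gcongr; exact hK φ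
    _ = ENNReal.ofReal (I.toReal * K ^ (1 / 2 : ℝ)) * ‖φ‖ₑ := by
        rw [ENNReal.mul_rpow_of_nonneg _ _ (by norm_num), ← ENNReal.rpow_natCast,
          ← ENNReal.rpow_mul, ENNReal.ofReal_rpow_of_pos K0, ← mul_assoc,
          ENNReal.ofReal_mul ENNReal.toReal_nonneg, ENNReal.ofReal_toReal hIt]
        norm_num
    _ ≤ _ := by gcongr; linarith

theorem ae_rateE_pos (hβ : 0 < β) (hγ : 0 < γ) : ∀ᵐ p, rateE β γ p ≠ 0 := by
  obtain ⟨c, c0, hc⟩ := exists_rateE_ge hβ hγ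
  filter_upwards [ae_ne_zero] with p hp
  have h := hc p hp
  have : 0 < c * omega p ^ (5 / 3 : ℝ) := mul_pos c0 (Real.rpow_pos_of_pos (omega_pos hp) _)
  exact (lt_of_lt_of_le (ENNReal.ofReal_pos.2 this) h).ne'

theorem volume_absolutelyContinuous_rateMeasure (hβ : 0 < β) (hγ : 0 < γ) :
    (volume : Measure Torus) ≪ rateMeasure β γ :=
  withDensity_absolutelyContinuous' (measurable_rateE β γ).aemeasurable (ae_rateE_pos hβ hγ)

theorem rateMeasure_absolutelyContinuous_volume (β γ : ℝ) :
    rateMeasure β γ ≪ (volume : Measure Torus) :=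
  withDensity_absolutelyContinuous _ _

theorem ae_collMeasure_iff (hβ : 0 < β) (hγ : 0 < γ) {P : Torus × Torus × Torus × Torus → Prop}
    (h : ∀ᵐ r ∂collMeasure β γ, P r) : ∀ᵐ p : Torus, ∀ᵐ q : Torus, P (momenta (p, q)) := by
  have h1 := ae_of_ae_map measurable_momenta.aemeasurable h
  have h2 : ∀ᵐ w ∂((volume : Measure Torus).prod volume), kern β γ w.1 w.2 ≠ 0 → P (momenta w) := by
    rw [ae_withDensity_iff (measurable_kern β γ).ennreal_ofReal] at h1
    filter_upwards [h1] with w hw hk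
    refine hw ?_
    rw [Ne, ENNReal.ofReal_eq_zero, not_le]
    exact lt_of_le_of_ne (kern_nonneg hβ hγ _ _) hk.symm
  filter_upwards [Measure.ae_ae_of_ae_prod h2, ae_ne_zero] with p hp hp0
  filter_upwards [hp, ae_generic p] with q hq hg
  exact hq (kern_pos hβ hγ hp0 hg.1 hg.2).ne'

theorem integrable_kern_mul (hβ : 0 < β) (hγ : 0 < γ) {F : Torus × Torus × Torus × Torus → ℝ}
    (hF : Integrable F (collMeasure β γ)) :
    Integrable (fun w : Torus × Torus => kern β γ w.1 w.2 * F (momenta w))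
      ((volume : Measure Torus).prod volume) := by
  have h1 := (integrable_map_measure hF.aestronglyMeasurable measurable_momenta.aemeasurable).1 hF
  have h2 := (integrable_withDensity_iff_integrable_smul' (measurable_kern β γ).ennreal_ofReal
    (Filter.Eventually.of_forall fun _ => ENNReal.ofReal_lt_top)).1 h1
  refine h2.congr (Filter.Eventually.of_forall fun w => ?_)
  simp [ENNReal.toReal_ofReal (kern_nonneg hβ hγ _ _)]

theorem integral_collMeasure (hβ : 0 < β) (hγ : 0 < γ) {F : Torus × Torus × Torus × Torus → ℝ}
    (hF : Integrable F (collMeasure β γ)) :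
    ∫ r, F r ∂collMeasure β γ = ∫ p, ∫ q, kern β γ p q * F (momenta (p, q)) := by
  rw [← integral_prod _ (integrable_kern_mul hβ hγ hF)]
  unfold collMeasure
  rw [integral_map measurable_momenta.aemeasurable hF.aestronglyMeasurable,
    integral_withDensity_eq_integral_toReal_smul (measurable_kern β γ).ennreal_ofReal
      (Filter.Eventually.of_forall fun _ => ENNReal.ofReal_lt_top)]
  refine integral_congr_ae (Filter.Eventually.of_forall fun w => ?_)
  simp [ENNReal.toReal_ofReal (kern_nonneg hβ hγ _ _)]

end Weights

/-! ### The spectral gap -/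

section SpectralGap

variable {β γ : ℝ}

/-- The integral of `φ` against a kernel, as a functional on `RateL2`. -/
theorem exists_kernel_functional (hβ : 0 < β) (hγ : 0 < γ) {C : ℝ} (hC : 0 ≤ C) :
    ∃ K : ℝ, 0 < K ∧ ∀ (κ : Torus → ℝ) (m : Torus → Torus), Measurable κ → Measurable m →
      (∀ q, 0 ≤ κ q) → ∀ r : ℝ, 0 ≤ r → (∀ H : Torus → ENNReal, Measurable H →
        ∫⁻ q, ENNReal.ofReal (κ q) * H (m q) ≤ ENNReal.ofReal (C * r) *
          ∫⁻ q, ENNReal.ofReal (omega q ^ (1 / 2 : ℝ)) * H q) →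
      ∃ l : StrongDual ℝ (RateL2 β γ), ‖l‖ ≤ K * r ∧ ∀ φ, l φ = ∫ q, κ q * φ (m q) := by
  obtain ⟨K, K0, hK⟩ := exists_lintegral_omega_le hβ hγ
  refine ⟨C * K + 1, by positivity, fun κ m mκ mm κ0 r r0 h => ?_⟩
  have hle : ∀ φ : RateL2 β γ, ∫⁻ q, ‖κ q * φ (m q)‖ₑ ≤ ENNReal.ofReal (C * r * K) * ‖φ‖ₑ := by
    intro φ
    calc ∫⁻ q, ‖κ q * φ (m q)‖ₑ = ∫⁻ q, ENNReal.ofReal (κ q) * ‖φ (m q)‖ₑ := by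
          refine lintegral_congr fun q => ?_
          rw [enorm_mul, Real.enorm_of_nonneg (κ0 q)]
      _ ≤ ENNReal.ofReal (C * r) * (ENNReal.ofReal K * ‖φ‖ₑ) :=
          (h _ (measurable_enorm_Lp φ)).trans (by gcongr; exact hK φ)
      _ = _ := by rw [← mul_assoc, ← ENNReal.ofReal_mul (by positivity)]
  have hint : ∀ φ : RateL2 β γ, Integrable fun q => κ q * φ (m q) := fun φ =>
    ⟨(mκ.mul ((Lp.stronglyMeasurable φ).measurable.comp mm)).aestronglyMeasurable,
      (hle φ).trans_lt (ENNReal.mul_lt_top ENNReal.ofReal_lt_top (by simp))⟩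
  -- An element of `RateL2` is a class of functions. Applying the kernel bound to |f − g| shows that
  -- the composition with m, weighted by κ, does not depend on the representative.
  have hae : ∀ f g : Torus → ℝ, Measurable f → Measurable g → f =ᵐ[rateMeasure β γ] g →
      (fun q => κ q * f (m q)) =ᵐ[volume] fun q => κ q * g (m q) := by
    intro f g mf mg hfg
    have h1 := h (fun q => ‖f q - g q‖ₑ) (mf.sub mg).enorm
    have h2 : ∫⁻ q, ENNReal.ofReal (omega q ^ (1 / 2 : ℝ)) * ‖f q - g q‖ₑ = 0 := by
      rw [← lintegral_zero (μ := (volume : Measure Torus))]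
      refine lintegral_congr_ae ?_
      filter_upwards [(volume_absolutelyContinuous_rateMeasure hβ hγ).ae_eq hfg] with q hq
      simp [hq]
    have h3 : Measurable fun q => ENNReal.ofReal (κ q) * ‖f (m q) - g (m q)‖ₑ :=
      mκ.ennreal_ofReal.mul ((mf.sub mg).enorm.comp mm)
    rw [h2, mul_zero, nonpos_iff_eq_zero, lintegral_eq_zero_iff h3] at h1
    filter_upwards [h1] with q hq
    simp only [Pi.zero_apply, mul_eq_zero, ENNReal.ofReal_eq_zero, enorm_eq_zero] at hq
    rcases hq with hq | hq
    · rw [le_antisymm hq (κ0 q)]; simp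
    · rw [sub_eq_zero.1 hq]
  have mL : ∀ φ : RateL2 β γ, Measurable φ := fun φ => (Lp.stronglyMeasurable φ).measurable
  let l₀ : RateL2 β γ →ₗ[ℝ] ℝ :=
    { toFun := fun φ => ∫ q, κ q * φ (m q)
      map_add' := fun φ ψ => by
        rw [← integral_add (hint φ) (hint ψ)]
        refine integral_congr_ae ((hae _ _ (mL _) ((mL φ).add (mL ψ)) (Lp.coeFn_add φ ψ)).trans ?_)
        exact Filter.Eventually.of_forall fun q => mul_add _ _ _
      map_smul' := fun c φ => by
        rw [RingHom.id_apply, smul_eq_mul, ← integral_const_mul]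
        refine integral_congr_ae ((hae _ _ (mL _) ((mL φ).const_smul c) (Lp.coeFn_smul c φ)).trans ?_)
        exact Filter.Eventually.of_forall fun q => mul_left_comm _ _ _ }
  have hb : ∀ φ, ‖l₀ φ‖ ≤ (C * r * K) * ‖φ‖ := fun φ => by
    have h1 := (enorm_integral_le_lintegral_enorm (fun q => κ q * φ (m q))).trans (hle φ)
    rw [← ofReal_norm, ← ofReal_norm, ← ENNReal.ofReal_mul (by positivity),
      ENNReal.ofReal_le_ofReal_iff (by positivity)] at h1
    exact h1
  refine ⟨l₀.mkContinuous _ hb, (l₀.mkContinuous_norm_le (by positivity) hb).trans ?_, fun φ => rfl⟩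
  nlinarith

/-- Quadratic forms with a kernel dominated by a product are weakly sequentially continuous. -/
theorem tendsto_lintegral_kernel (hβ : 0 < β) (hγ : 0 < γ) {C : ℝ} (hC : 0 ≤ C)
    {κ : Torus × Torus → ℝ} {m : Torus × Torus → Torus} (mκ : Measurable κ) (mm : Measurable m)
    (κ0 : ∀ w, 0 ≤ κ w) (h : ∀ p, p ≠ 0 → ∀ H : Torus → ENNReal, Measurable H →
        ∫⁻ q, ENNReal.ofReal (κ (p, q)) * H (m (p, q)) ≤
          ENNReal.ofReal (C * omega p ^ (1 / 2 : ℝ)) *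
          ∫⁻ q, ENNReal.ofReal (omega q ^ (1 / 2 : ℝ)) * H q)
    {x : ℕ → RateL2 β γ} (hx : ∀ n, ‖x n‖ = 1)
    (hx0 : ∀ z, Filter.Tendsto (fun n => inner ℝ (x n) z) Filter.atTop (nhds 0)) :
    Filter.Tendsto (fun n => ∫⁻ p, ‖x n p‖ₑ * ‖∫ q, κ (p, q) * x n (m (p, q))‖ₑ)
      Filter.atTop (nhds 0) := by
  obtain ⟨K, K0, hK⟩ := exists_lintegral_omega_sq_le hβ hγ
  obtain ⟨K', K'0, hK'⟩ := exists_kernel_functional (β := β) (γ := γ) hβ hγ hC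
  have mo := measurable_omega
  have mL : ∀ n, Measurable (x n) := fun n => (Lp.stronglyMeasurable (x n)).measurable
  have hl : ∀ p, p ≠ 0 → ∃ l : StrongDual ℝ (RateL2 β γ), ‖l‖ ≤ K' * omega p ^ (1 / 2 : ℝ) ∧
      ∀ φ, l φ = ∫ q, κ (p, q) * φ (m (p, q)) := fun p hp =>
    hK' (fun q => κ (p, q)) (fun q => m (p, q)) (mκ.comp measurable_prodMk_left)
      (mm.comp measurable_prodMk_left) (fun q => κ0 _) _ (Real.rpow_nonneg (omega_nonneg p) _) (h p hp)
  set G : ℕ → Torus → ENNReal := fun n p => ‖∫ q, κ (p, q) * x n (m (p, q))‖ₑ with hG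
  have mG : ∀ n, Measurable (G n) := fun n => by
    have : Measurable (Function.uncurry fun p q => κ (p, q) * x n (m (p, q))) :=
      mκ.mul ((mL n).comp mm)
    exact (this.stronglyMeasurable.integral_prod_right (ν := (volume : Measure Torus))).measurable.enorm
  have hGb : ∀ n p, p ≠ 0 → G n p ≤ ENNReal.ofReal (K' * omega p ^ (1 / 2 : ℝ)) := by
    intro n p hp
    obtain ⟨l, hl1, hl2⟩ := hl p hp
    rw [hG]; dsimp only
    rw [← hl2, ← ofReal_norm]
    apply ENNReal.ofReal_le_ofReal
    have := l.le_opNorm (x n)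
    rw [hx, mul_one] at this
    exact this.trans hl1
  have hG0 : ∀ p, p ≠ 0 → Filter.Tendsto (fun n => G n p) Filter.atTop (nhds 0) := by
    intro p hp
    obtain ⟨l, -, hl2⟩ := hl p hp
    have h1 := hx0 ((InnerProductSpace.toDual ℝ _).symm l)
    have e : ∀ n, inner ℝ (x n) ((InnerProductSpace.toDual ℝ _).symm l) = l (x n) := fun n => by
      rw [real_inner_comm, InnerProductSpace.toDual_symm_apply]
    simp only [e, hl2] at h1
    simpa using h1.enorm
  have hI := lintegral_omega_rpow_lt_top (s := -(2 / 3)) (by norm_num)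
  -- For each p the inner integral is a continuous functional of the sequence, so it tends to 0. Its
  -- norm is at most K'ω^{1/2}, so ω^{-5/3}G² is dominated by a multiple of the integrable ω^{-2/3}.
  have hdom : Filter.Tendsto (fun n => ∫⁻ p, ENNReal.ofReal (omega p ^ (-(5 / 3) : ℝ)) * G n p ^ 2)
      Filter.atTop (nhds 0) := by
    rw [← lintegral_zero (μ := (volume : Measure Torus))]
    refine tendsto_lintegral_of_dominated_convergence
      (fun p => ENNReal.ofReal (K' ^ 2) * ENNReal.ofReal (omega p ^ (-(2 / 3) : ℝ)))
      (fun n => (mo.pow_const _).ennreal_ofReal.mul ((mG n).pow_const _)) (fun n => ?_) ?_ ?_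
    · filter_upwards [ae_ne_zero] with p hp
      have hp0 := omega_pos hp
      calc _ ≤ ENNReal.ofReal (omega p ^ (-(5 / 3) : ℝ)) *
            ENNReal.ofReal (K' * omega p ^ (1 / 2 : ℝ)) ^ 2 := by gcongr; exact hGb n p hp
        _ = _ := by
            rw [← ENNReal.ofReal_pow (by positivity), ← ENNReal.ofReal_mul (by positivity),
              ← ENNReal.ofReal_mul (by positivity), mul_pow, ← Real.rpow_natCast (omega p ^ _),
              ← Real.rpow_mul hp0.le, mul_left_comm, ← Real.rpow_add hp0]
            norm_num
    · rw [lintegral_const_mul' _ _ ENNReal.ofReal_ne_top]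
      exact ENNReal.mul_ne_top ENNReal.ofReal_ne_top hI.ne
    · filter_upwards [ae_ne_zero] with p hp
      have h1 := (((ENNReal.continuous_pow 2).tendsto 0).comp (hG0 p hp))
      simp only [ne_eq, OfNat.ofNat_ne_zero, not_false_eq_true, zero_pow] at h1
      simpa using ENNReal.Tendsto.const_mul h1 (Or.inr (ENNReal.ofReal_ne_top
        (r := omega p ^ (-(5 / 3) : ℝ))))
  have hbound : ∀ n, ∫⁻ p, ‖x n p‖ₑ * G n p ≤ (ENNReal.ofReal K) ^ (1 / 2 : ℝ) *
      (∫⁻ p, ENNReal.ofReal (omega p ^ (-(5 / 3) : ℝ)) * G n p ^ 2) ^ (1 / 2 : ℝ) := by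
    intro n
    have mx := measurable_enorm_Lp (x n)
    calc ∫⁻ p, ‖x n p‖ₑ * G n p = ∫⁻ p, (ENNReal.ofReal (omega p ^ (5 / 6 : ℝ)) * ‖x n p‖ₑ) *
          (ENNReal.ofReal (omega p ^ (-(5 / 6) : ℝ)) * G n p) := by
          refine lintegral_congr_ae ?_
          filter_upwards [ae_ne_zero] with p hp
          have hp0 := omega_pos hp
          rw [mul_mul_mul_comm, ← ENNReal.ofReal_mul (by positivity), ← Real.rpow_add hp0]
          norm_num
      _ ≤ (∫⁻ p, (ENNReal.ofReal (omega p ^ (5 / 6 : ℝ)) * ‖x n p‖ₑ) ^ 2) ^ (1 / 2 : ℝ) *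
          (∫⁻ p, (ENNReal.ofReal (omega p ^ (-(5 / 6) : ℝ)) * G n p) ^ 2) ^ (1 / 2 : ℝ) :=
          lintegral_mul_le_sqrt ((mo.pow_const _).ennreal_ofReal.mul mx).aemeasurable
            ((mo.pow_const _).ennreal_ofReal.mul (mG n)).aemeasurable
      _ ≤ _ := by
          have e : ∀ (s : ℝ) (q : Torus), ENNReal.ofReal (omega q ^ s) ^ 2 =
              ENNReal.ofReal (omega q ^ (2 * s)) := by
            intro s q
            rw [← ENNReal.ofReal_pow (Real.rpow_nonneg (omega_nonneg q) _), ← Real.rpow_natCast,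
              ← Real.rpow_mul (omega_nonneg q)]
            congr 2; push_cast; ring
          simp only [e, mul_pow]
          norm_num
          gcongr
          have h1 := hK (x n)
          rwa [← ofReal_norm (x n), hx n, ENNReal.ofReal_one, one_pow, mul_one] at h1
  have hz := (((ENNReal.continuous_rpow_const (y := (1 / 2 : ℝ))).tendsto 0).comp hdom)
  rw [ENNReal.zero_rpow_of_pos (by norm_num)] at hz
  have hz' := ENNReal.Tendsto.const_mul hz (Or.inr (ENNReal.rpow_ne_top_of_nonneg
    (by norm_num : (0 : ℝ) ≤ 1 / 2) (ENNReal.ofReal_ne_top (r := K))))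
  rw [mul_zero] at hz'
  exact tendsto_of_tendsto_of_tendsto_of_le_of_le tendsto_const_nhds hz' (fun _ => zero_le) hbound

end SpectralGap

/-! ### Compactness of the cross terms and coercivity of the collision difference -/

section SpectralGap

variable {β γ : ℝ}

/-- The distance of the outgoing particles. -/
def outGap (r : Torus × Torus × Torus × Torus) : ℝ := |cosHalf r.2.2.2 - cosHalf r.2.2.1|

theorem measurable_outGap : Measurable outGap := by
  have h := measurable_cosHalf
  exact ((h.comp (by fun_prop)).sub (h.comp (by fun_prop))).abs

/-- The exchange of the incoming particles. -/
def inSwap (r : Torus × Torus × Torus × Torus) : Torus × Torus × Torus × Torus :=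
  (r.2.1, r.1, r.2.2.1, r.2.2.2)

theorem measurePreserving_inSwap (β γ : ℝ) :
    MeasurePreserving inSwap (collMeasure β γ) (collMeasure β γ) :=
  (measurePreserving_pairSwap β γ).comp ((measurePreserving_outSwap β γ).comp
    (measurePreserving_pairSwap β γ))

theorem ae_collMeasure_of {P : Torus × Torus × Torus × Torus → Prop}
    (hP : MeasurableSet {r | P r})
    (h : ∀ p q : Torus, p ≠ 0 → q ≠ 0 → p ≠ q → P (momenta (p, q))) :
    ∀ᵐ r ∂collMeasure β γ, P r := by
  unfold collMeasure
  rw [ae_map_iff measurable_momenta.aemeasurable hP,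
    ae_withDensity_iff (measurable_kern β γ).ennreal_ofReal]
  have : ∀ᵐ w ∂((volume : Measure Torus).prod volume), P (momenta w) := by
    rw [Measure.ae_prod_iff_ae_ae (p := fun w => P (momenta w)) (measurable_momenta hP)]
    filter_upwards [ae_ne_zero] with p hp
    filter_upwards [ae_generic p] with q hq
    exact h p q hp hq.1 hq.2
  filter_upwards [this] with w hw _ using hw

theorem ae_omega_pos : ∀ᵐ r ∂collMeasure β γ, 0 < omega r.1 ∧ 0 < omega r.2.1 := by
  have mo := measurable_omega
  refine ae_collMeasure_of ((measurableSet_lt measurable_const (mo.comp measurable_fst)).inter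
    (measurableSet_lt measurable_const (mo.comp (by fun_prop)))) fun p q hp hq hpq => ?_
  exact ⟨omega_pos hp, (generic_facts hp hq hpq).1⟩

/-- The contribution of nearly equal outgoing momenta is small. -/
theorem exists_lintegral_outGap_le (hβ : 0 < β) (hγ : 0 < γ) {ε : ℝ} (hε : 0 < ε) :
    ∃ η : ℝ, 0 < η ∧ ∀ φ : RateL2 β γ,
      ∫⁻ r in {r | outGap r ≤ η}, ‖φ r.2.1‖ₑ * ‖φ r.1‖ₑ ∂collMeasure β γ ≤
        ENNReal.ofReal ε * ‖φ‖ₑ ^ 2 := by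
  obtain ⟨K, K0, hK⟩ := exists_lintegral_omega_sq_le hβ hγ
  obtain ⟨η, η0, hη⟩ := exists_lintegral_kern_gap_le hβ hγ (ε := ε / K) (by positivity)
  refine ⟨η, η0, fun φ => ?_⟩
  set S : Set (Torus × Torus × Torus × Torus) := {r | outGap r ≤ η} with hS
  have mS : MeasurableSet S := measurableSet_le measurable_outGap measurable_const
  have mo := measurable_omega
  have mφ := measurable_enorm_Lp φ
  -- A Schur-test weight (ω₀/ω₁)^{7/12}. Its square supplies ω₀^{7/6}ω₁^{-7/6}: the small-gap
  -- estimate absorbs ω₁^{-7/6} and returns ω₀^{1/2}, which completes ω₀^{5/3}. The factor with p₀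
  -- and p₁ exchanged has the same integral, since the set and the measure are invariant.
  set a : Torus → Torus → ENNReal := fun x y =>
    ENNReal.ofReal (omega x ^ (7 / 12 : ℝ) * omega y ^ (-(7 / 12) : ℝ)) with ha
  have ma : Measurable fun r : Torus × Torus × Torus × Torus => a r.1 r.2.1 :=
    ((mo.comp measurable_fst).pow_const _).mul ((mo.comp (by fun_prop)).pow_const _) |>.ennreal_ofReal
  have m0 : Measurable fun r : Torus × Torus × Torus × Torus => ‖φ r.1‖ₑ := mφ.comp measurable_fst
  set F : Torus × Torus × Torus × Torus → ENNReal :=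
    S.indicator fun r => (a r.1 r.2.1 * ‖φ r.1‖ₑ) ^ 2 with hF
  have mF : Measurable F := ((ma.mul m0).pow_const 2).indicator mS
  have hval : ∫⁻ r, F r ∂collMeasure β γ ≤ ENNReal.ofReal ε * ‖φ‖ₑ ^ 2 := by
    rw [lintegral_collMeasure β γ mF]
    calc _ ≤ ∫⁻ p, ENNReal.ofReal (ε / K) * (ENNReal.ofReal (omega p ^ (5 / 3 : ℝ)) * ‖φ p‖ₑ ^ 2) := by
          refine lintegral_mono_ae ?_
          filter_upwards [ae_ne_zero] with p hp
          have hp0 := omega_pos hp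
          have mgap : MeasurableSet {q | cosGap p q ≤ η} :=
            measurableSet_le (measurable_cosGap_right p) measurable_const
          calc _ = ∫⁻ q in {q | cosGap p q ≤ η},
                (ENNReal.ofReal (omega p ^ (7 / 6 : ℝ)) * ‖φ p‖ₑ ^ 2) *
                ENNReal.ofReal (kern β γ p q * omega (mom1 p q) ^ (-(7 / 6) : ℝ)) := by
                rw [← lintegral_indicator mgap]
                refine lintegral_congr fun q => ?_
                by_cases hq : cosGap p q ≤ η
                · rw [hF, indicator_of_mem (show momenta (p, q) ∈ S from hq), indicator_of_mem
                    (show q ∈ {q | cosGap p q ≤ η} from hq), ha]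
                  have h1 := omega_nonneg (mom1 p q)
                  simp only [momenta]
                  rw [mul_pow, ← ENNReal.ofReal_pow (by positivity), ENNReal.ofReal_mul
                    (kern_nonneg hβ hγ _ _), mul_pow, ← Real.rpow_natCast, ← Real.rpow_natCast,
                    ← Real.rpow_mul hp0.le, ← Real.rpow_mul h1, ENNReal.ofReal_mul (by positivity)]
                  norm_num
                  ring
                · rw [hF, indicator_of_notMem (show momenta (p, q) ∉ S from hq), indicator_of_notMem
                    (show q ∉ {q | cosGap p q ≤ η} from hq), mul_zero]
            _ = (ENNReal.ofReal (omega p ^ (7 / 6 : ℝ)) * ‖φ p‖ₑ ^ 2) *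
                ∫⁻ q in {q | cosGap p q ≤ η},
                ENNReal.ofReal (kern β γ p q * omega (mom1 p q) ^ (-(7 / 6) : ℝ)) :=
                lintegral_const_mul' _ _ (ENNReal.mul_ne_top ENNReal.ofReal_ne_top (by simp))
            _ ≤ (ENNReal.ofReal (omega p ^ (7 / 6 : ℝ)) * ‖φ p‖ₑ ^ 2) *
                ENNReal.ofReal (ε / K * omega p ^ (1 / 2 : ℝ)) := by gcongr; exact hη p hp
            _ = _ := by
                rw [ENNReal.ofReal_mul (by positivity)]
                have : ENNReal.ofReal (omega p ^ (5 / 3 : ℝ)) = ENNReal.ofReal (omega p ^ (7 / 6 : ℝ)) *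
                    ENNReal.ofReal (omega p ^ (1 / 2 : ℝ)) := by
                  rw [← ENNReal.ofReal_mul (by positivity), ← Real.rpow_add hp0]; norm_num
                rw [this]; ring
      _ = ENNReal.ofReal (ε / K) * ∫⁻ p, (ENNReal.ofReal (omega p ^ (5 / 3 : ℝ)) * ‖φ p‖ₑ ^ 2) :=
          lintegral_const_mul' _ _ ENNReal.ofReal_ne_top
      _ ≤ ENNReal.ofReal (ε / K) * (ENNReal.ofReal K * ‖φ‖ₑ ^ 2) := by gcongr; exact hK φ
      _ = _ := by
          rw [← mul_assoc, ← ENNReal.ofReal_mul (by positivity)]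
          congr 2; field_simp
  have hsymm : ∫⁻ r, F (inSwap r) ∂collMeasure β γ = ∫⁻ r, F r ∂collMeasure β γ :=
    (measurePreserving_inSwap β γ).lintegral_comp mF
  have m1 : Measurable fun r : Torus × Torus × Torus × Torus => ‖φ r.2.1‖ₑ := mφ.comp (by fun_prop)
  have ma' : Measurable fun r : Torus × Torus × Torus × Torus => a r.2.1 r.1 :=
    ((mo.comp (by fun_prop)).pow_const _).mul ((mo.comp measurable_fst).pow_const _) |>.ennreal_ofReal
  calc _ = ∫⁻ r in S, (a r.1 r.2.1 * ‖φ r.1‖ₑ) * (a r.2.1 r.1 * ‖φ r.2.1‖ₑ) ∂collMeasure β γ := by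
        refine lintegral_congr_ae (ae_restrict_of_ae ?_)
        filter_upwards [ae_omega_pos] with r hr
        rw [ha, mul_mul_mul_comm, ← ENNReal.ofReal_mul (by have := hr.1; have := hr.2; positivity)]
        have e : ∀ y : ℝ, 0 < y → y ^ (7 / 12 : ℝ) * y ^ (-(7 / 12) : ℝ) = 1 := fun y hy => by
          rw [← Real.rpow_add hy]; norm_num
        rw [show omega r.1 ^ (7 / 12 : ℝ) * omega r.2.1 ^ (-(7 / 12) : ℝ) *
          (omega r.2.1 ^ (7 / 12 : ℝ) * omega r.1 ^ (-(7 / 12) : ℝ)) =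
          (omega r.1 ^ (7 / 12 : ℝ) * omega r.1 ^ (-(7 / 12) : ℝ)) *
          (omega r.2.1 ^ (7 / 12 : ℝ) * omega r.2.1 ^ (-(7 / 12) : ℝ)) by ring, e _ hr.1, e _ hr.2]
        simp [mul_comm]
    _ ≤ (∫⁻ r in S, (a r.1 r.2.1 * ‖φ r.1‖ₑ) ^ 2 ∂collMeasure β γ) ^ (1 / 2 : ℝ) *
        (∫⁻ r in S, (a r.2.1 r.1 * ‖φ r.2.1‖ₑ) ^ 2 ∂collMeasure β γ) ^ (1 / 2 : ℝ) :=
        lintegral_mul_le_sqrt (ma.mul m0).aemeasurable (ma'.mul m1).aemeasurable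
    _ = (∫⁻ r, F r ∂collMeasure β γ) ^ (1 / 2 : ℝ) *
        (∫⁻ r, F (inSwap r) ∂collMeasure β γ) ^ (1 / 2 : ℝ) := by
        rw [← lintegral_indicator mS, ← lintegral_indicator mS]
        rfl
    _ = ∫⁻ r, F r ∂collMeasure β γ := by
        rw [hsymm, ← ENNReal.rpow_add_of_nonneg _ _ (by norm_num) (by norm_num)]
        norm_num
    _ ≤ _ := hval

theorem enorm_setIntegral_collMeasure_le (hβ : 0 < β) (hγ : 0 < γ)
    {S : Set (Torus × Torus × Torus × Torus)} (hS : MeasurableSet S)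
    {c : Torus × Torus × Torus × Torus → Torus} (φ : RateL2 β γ)
    (hi : Integrable (fun r => φ r.1 * φ (c r)) (collMeasure β γ)) :
    ‖∫ r in S, φ r.1 * φ (c r) ∂collMeasure β γ‖ₑ ≤ ∫⁻ p, ‖φ p‖ₑ *
      ‖∫ q, (kern β γ p q * S.indicator 1 (momenta (p, q))) * φ (c (momenta (p, q)))‖ₑ := by
  rw [← integral_indicator hS, integral_collMeasure hβ hγ (hi.indicator hS)]
  refine (enorm_integral_le_lintegral_enorm _).trans (lintegral_mono fun p => ?_)
  rw [← enorm_mul, ← integral_const_mul]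
  refine le_of_eq (congrArg _ (integral_congr_ae (Filter.Eventually.of_forall fun q => ?_)))
  by_cases h : momenta (p, q) ∈ S
  · simp only [indicator_of_mem h, Pi.one_apply]
    simp only [momenta]; ring
  · simp only [indicator_of_notMem h]; ring

/-- The kernel is dominated by a multiple of the product ω₀^{1/2}ω₂^{1/2}, so no localization is
needed for this cross term. -/
theorem tendsto_inner_pull₂ (hβ : 0 < β) (hγ : 0 < γ) {x : ℕ → RateL2 β γ} (hx : ∀ n, ‖x n‖ = 1)
    (hx0 : ∀ z, Filter.Tendsto (fun n => inner ℝ (x n) z) Filter.atTop (nhds 0)) :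
    Filter.Tendsto (fun n => inner ℝ (pull₂ β γ (x n)) (pull₀ β γ (x n))) Filter.atTop (nhds 0) := by
  have key := tendsto_lintegral_kernel (C := (1 / γ) ^ 4) hβ hγ (by positivity)
    (κ := fun w => kern β γ w.1 w.2 * (univ : Set (Torus × Torus × Torus × Torus)).indicator 1
      (momenta w)) (m := fun w => w.2)
    (by simpa using measurable_kern β γ) measurable_snd
    (fun w => by simpa using kern_nonneg hβ hγ _ _) (fun p hp H hH => ?_) hx hx0
  · rw [tendsto_zero_iff_norm_tendsto_zero]
    have : Filter.Tendsto (fun n => ‖inner ℝ (pull₂ β γ (x n)) (pull₀ β γ (x n))‖ₑ)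
        Filter.atTop (nhds 0) := by
      refine tendsto_of_tendsto_of_tendsto_of_le_of_le tendsto_const_nhds key (fun _ => zero_le)
        fun n => ?_
      have hae : (fun r => inner ℝ (pull₂ β γ (x n) r) (pull₀ β γ (x n) r)) =ᵐ[collMeasure β γ]
          fun r => x n r.1 * x n r.2.2.1 := by
        filter_upwards [coeFn_pull₀ (x n), coeFn_pull₂ (x n)] with r h0 h2
        simp [h0, h2]
      rw [L2.inner_def, integral_congr_ae hae, ← setIntegral_univ]
      exact enorm_setIntegral_collMeasure_le hβ hγ MeasurableSet.univ (x n)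
        ((L2.integrable_inner _ _).congr hae)
    have h2 := (ENNReal.tendsto_toReal ENNReal.zero_ne_top).comp this
    simpa [Function.comp_def] using h2
  · rw [← lintegral_const_mul' _ _ ENNReal.ofReal_ne_top]
    refine lintegral_mono_ae ?_
    filter_upwards [ae_ne_zero] with q hq
    rw [← mul_assoc]
    have hp0 := omega_pos hp
    have hq0 := omega_pos hq
    rw [← ENNReal.ofReal_mul (by positivity)]
    refine mul_le_mul' (ENNReal.ofReal_le_ofReal ?_) le_rfl
    simp only [indicator_univ, Pi.one_apply, mul_one]
    refine (kern_le hβ hγ hp hq).trans ?_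
    have h1 := omega_nonneg (mom1 p q)
    have h3 := omega_nonneg (mom3 p q)
    have : omega (mom1 p q) * omega (mom3 p q) ≤ 1 :=
      mul_le_one₀ (omega_le_one _) h3 (omega_le_one _)
    calc _ = (1 / γ) ^ 4 * omega p ^ (1 / 2 : ℝ) * omega q ^ (1 / 2 : ℝ) *
          (omega (mom1 p q) * omega (mom3 p q)) := by ring
      _ ≤ (1 / γ) ^ 4 * omega p ^ (1 / 2 : ℝ) * omega q ^ (1 / 2 : ℝ) * 1 := by gcongr
      _ = _ := mul_one _

/-- Where the outgoing momenta are η-close, the term is at most ε/2 for all unit vectors. Elsewhere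
1 ≤ gap/η inserts the Jacobian of p₂ ↦ p₁, and the form in (p₀, p₁) has a kernel of product type. -/
theorem tendsto_inner_pull₁ (hβ : 0 < β) (hγ : 0 < γ) {x : ℕ → RateL2 β γ} (hx : ∀ n, ‖x n‖ = 1)
    (hx0 : ∀ z, Filter.Tendsto (fun n => inner ℝ (x n) z) Filter.atTop (nhds 0)) :
    Filter.Tendsto (fun n => inner ℝ (pull₁ β γ (x n)) (pull₀ β γ (x n))) Filter.atTop (nhds 0) := by
  have hae : ∀ n, (fun r => inner ℝ (pull₁ β γ (x n) r) (pull₀ β γ (x n) r)) =ᵐ[collMeasure β γ]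
      fun r => x n r.1 * x n r.2.1 := fun n => by
    filter_upwards [coeFn_pull₀ (x n), coeFn_pull₁ (x n)] with r h0 h2
    simp [h0, h2]
  have hi : ∀ n, Integrable (fun r => x n r.1 * x n r.2.1) (collMeasure β γ) := fun n =>
    (L2.integrable_inner _ _).congr (hae n)
  rw [Metric.tendsto_atTop]
  intro ε hε
  obtain ⟨η, η0, hη⟩ := exists_lintegral_outGap_le hβ hγ (ε := ε / 2) (by positivity)
  set S : Set (Torus × Torus × Torus × Torus) := {r | outGap r ≤ η} with hS
  have mS : MeasurableSet S := measurableSet_le measurable_outGap measurable_const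
  have mind : Measurable (Sᶜ.indicator (1 : Torus × Torus × Torus × Torus → ℝ)) :=
    measurable_one.indicator mS.compl
  have key := tendsto_lintegral_kernel (C := 4 * (1 / γ) ^ 4 / η) hβ hγ (by positivity)
    (κ := fun w => kern β γ w.1 w.2 * Sᶜ.indicator 1 (momenta w)) (m := fun w => mom1 w.1 w.2)
    ((measurable_kern β γ).mul (mind.comp measurable_momenta)) measurable_mom1
    (fun w => mul_nonneg (kern_nonneg hβ hγ _ _) (indicator_nonneg (fun _ _ => zero_le_one) _))
    (fun p hp H hH => ?_) hx hx0
  · have h1 : Filter.Tendsto (fun n => ‖∫ r in Sᶜ, x n r.1 * x n r.2.1 ∂collMeasure β γ‖)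
        Filter.atTop (nhds 0) := by
      have : Filter.Tendsto (fun n => ‖∫ r in Sᶜ, x n r.1 * x n r.2.1 ∂collMeasure β γ‖ₑ)
          Filter.atTop (nhds 0) :=
        tendsto_of_tendsto_of_tendsto_of_le_of_le tendsto_const_nhds key (fun _ => zero_le)
          fun n => enorm_setIntegral_collMeasure_le hβ hγ mS.compl (x n) (hi n)
      have h2 := (ENNReal.tendsto_toReal ENNReal.zero_ne_top).comp this
      simpa [Function.comp_def] using h2
    obtain ⟨N, hN⟩ := Metric.tendsto_atTop.1 h1 (ε / 2) (by positivity)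
    refine ⟨N, fun n hn => ?_⟩
    have h3 := hN n hn
    rw [dist_zero_right, norm_norm] at h3
    have h4 : ‖∫ r in S, x n r.1 * x n r.2.1 ∂collMeasure β γ‖ ≤ ε / 2 := by
      have h5 := (enorm_integral_le_lintegral_enorm (μ := (collMeasure β γ).restrict S)
        (fun r => x n r.1 * x n r.2.1)).trans (le_trans (le_of_eq ?_) (hη (x n)))
      · rw [← ofReal_norm, ← ofReal_norm, hx n, ENNReal.ofReal_one, one_pow, mul_one,
          ENNReal.ofReal_le_ofReal_iff (by positivity)] at h5
        exact h5
      · refine lintegral_congr fun r => ?_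
        rw [enorm_mul, mul_comm]
    rw [dist_zero_right, L2.inner_def, integral_congr_ae (hae n), ← integral_add_compl mS (hi n)]
    calc _ ≤ _ := norm_add_le _ _
      _ < ε / 2 + ε / 2 := by linarith
      _ = ε := by ring
  · have hp0 := omega_pos hp
    calc _ ≤ ∫⁻ q, ENNReal.ofReal ((1 / γ) ^ 4 / η * omega p ^ (1 / 2 : ℝ)) *
          (ENNReal.ofReal (cosGap p q / dens p q) *
            (ENNReal.ofReal (omega (mom1 p q) ^ (1 / 2 : ℝ)) * H (mom1 p q))) := by
          refine lintegral_mono_ae ?_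
          filter_upwards [ae_generic p] with q hq
          obtain ⟨o1, o3, hd, -⟩ := generic_facts hp hq.1 hq.2
          by_cases h : cosGap p q ≤ η
          · have : momenta (p, q) ∉ Sᶜ := fun h' => h' h
            simp [indicator_of_notMem this]
          · have h' : momenta (p, q) ∈ Sᶜ := h
            rw [not_le] at h
            rw [indicator_of_mem h', Pi.one_apply, mul_one, ← mul_assoc, ← mul_assoc,
              ← ENNReal.ofReal_mul (by positivity), ← ENNReal.ofReal_mul
                (mul_nonneg (by positivity) (div_nonneg (η0.trans h).le hd.le))]
            refine mul_le_mul' (ENNReal.ofReal_le_ofReal ?_) le_rfl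
            have k2 : ∀ y : ℝ, 0 ≤ y → y ≤ 1 → y ≤ y ^ (1 / 2 : ℝ) := fun y h0 h1 => by
              calc y = y ^ (1 : ℝ) := (Real.rpow_one y).symm
                _ ≤ y ^ (1 / 2 : ℝ) := Real.rpow_le_rpow_of_exponent_ge' h0 h1 (by norm_num) (by norm_num)
            have hq0 := omega_nonneg q
            have hk : kernNum β γ p (mom1 p q) q (mom3 p q) ≤
                (1 / γ) ^ 4 * (omega p ^ (1 / 2 : ℝ) * omega (mom1 p q) ^ (1 / 2 : ℝ)) := by
              refine (kernNum_le hβ hγ _ _ _ _).trans (mul_le_mul_of_nonneg_left ?_ (by positivity))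
              have : omega q * omega (mom3 p q) ≤ 1 :=
                mul_le_one₀ (omega_le_one _) o3.le (omega_le_one _)
              calc _ = omega p * omega (mom1 p q) * (omega q * omega (mom3 p q)) := by ring
                _ ≤ omega p * omega (mom1 p q) * 1 := by gcongr
                _ = omega p * omega (mom1 p q) := mul_one _
                _ ≤ _ := by
                    gcongr
                    · exact k2 _ hp0.le (omega_le_one _)
                    · exact k2 _ o1.le (omega_le_one _)
            calc kern β γ p q ≤ (1 / γ) ^ 4 * (omega p ^ (1 / 2 : ℝ) * omega (mom1 p q) ^ (1 / 2 : ℝ)) /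
                  dens p q * 1 := by rw [kern, mul_one]; gcongr
              _ ≤ (1 / γ) ^ 4 * (omega p ^ (1 / 2 : ℝ) * omega (mom1 p q) ^ (1 / 2 : ℝ)) /
                  dens p q * (cosGap p q / η) := by
                  gcongr; rw [one_le_div η0]; exact h.le
              _ = _ := by ring
      _ = ENNReal.ofReal ((1 / γ) ^ 4 / η * omega p ^ (1 / 2 : ℝ)) *
          ∫⁻ q, (ENNReal.ofReal (cosGap p q / dens p q) *
            (ENNReal.ofReal (omega (mom1 p q) ^ (1 / 2 : ℝ)) * H (mom1 p q))) :=
          lintegral_const_mul' _ _ ENNReal.ofReal_ne_top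
      _ ≤ ENNReal.ofReal ((1 / γ) ^ 4 / η * omega p ^ (1 / 2 : ℝ)) *
          (4 * ∫⁻ q, (ENNReal.ofReal (omega q ^ (1 / 2 : ℝ)) * H q)) := by
          gcongr
          exact lintegral_mom1_le hp fun q => ENNReal.ofReal (omega q ^ (1 / 2 : ℝ)) * H q
      _ = _ := by
          rw [← mul_assoc]
          congr 1
          rw [show (4 : ENNReal) = ENNReal.ofReal 4 by simp, ← ENNReal.ofReal_mul (by positivity)]
          congr 1; ring

/-- The spectral gap of the collision difference. -/
theorem exists_le_norm_collDiff (hβ : 0 < β) (hγ : 0 < γ) : ∃ c : ℝ, 0 < c ∧ ∀ φ : RateL2 β γ,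
    (∀ ψ, collDiff β γ ψ = 0 → inner ℝ φ ψ = 0) → c * ‖φ‖ ≤ ‖collDiff β γ φ‖ := by
  refine exists_le_norm_of_mem_ker_orthogonal _ fun x hx hx0 hlim => ?_
  have h1 := tendsto_inner_pull₁ hβ hγ hx hx0
  have h2 := tendsto_inner_pull₂ hβ hγ hx hx0
  have h3 : Filter.Tendsto (fun n => ‖collDiff β γ (x n)‖ ^ 2) Filter.atTop (nhds 4) := by
    simp only [norm_sq_collDiff, hx]
    have := (((h1.const_add (1 ^ 2)).sub (h2.const_mul 2)).const_mul 4)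
    simpa using this
  have h4 := hlim.pow 2
  have := tendsto_nhds_unique h3 h4
  norm_num at this

end SpectralGap

/-! ### The linearized collision operator -/

section Operator

variable {β γ : ℝ}

/-- The quotient by the equilibrium. -/
def quot (β γ : ℝ) (g : Torus → ℝ) (p : Torus) : ℝ := g p / rayleighJeans β γ p

theorem measurable_quot {g : Torus → ℝ} (hg : Measurable g) : Measurable (quot β γ g) :=
  hg.div (measurable_rayleighJeans β γ)

theorem inv_rayleighJeans_le (hβ : 0 < β) (hγ : 0 < γ) (p : Torus) :
    1 / rayleighJeans β γ p ≤ β + γ := by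
  have h := le_rayleighJeans hβ hγ p
  rw [div_le_iff₀ (by positivity)] at h
  rw [div_le_iff₀ (rayleighJeans_pos hβ hγ p), mul_comm]
  exact h

theorem norm_quot_le (hβ : 0 < β) (hγ : 0 < γ) (g : Torus → ℝ) (p : Torus) :
    ‖quot β γ g p‖ ≤ (β + γ) * ‖g p‖ := by
  have hf := rayleighJeans_pos hβ hγ p
  rw [quot, norm_div, Real.norm_of_nonneg hf.le, div_eq_mul_one_div, mul_comm]
  gcongr
  exact inv_rayleighJeans_le hβ hγ p

theorem rateMeasure_le (hβ : 0 < β) (hγ : 0 < γ) :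
    rateMeasure β γ ≤ ENNReal.ofReal ((1 / γ) ^ 4 * (2 * Real.pi)) • volume := by
  rw [← withDensity_const]
  refine withDensity_mono ?_
  filter_upwards [ae_ne_zero] with p hp
  exact rateE_le hβ hγ hp

theorem memLp_quot (hβ : 0 < β) (hγ : 0 < γ) (g : L2) :
    MemLp (quot β γ g) 2 (rateMeasure β γ) := by
  refine MemLp.of_measure_le_smul ENNReal.ofReal_ne_top (rateMeasure_le hβ hγ) ?_
  exact (Lp.memLp g).of_le_mul
    (measurable_quot (Lp.stronglyMeasurable g).measurable).aestronglyMeasurable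
    (Filter.Eventually.of_forall fun p => norm_quot_le hβ hγ g p)

theorem lintegral_enorm_quot_le (hβ : 0 < β) (hγ : 0 < γ) (g : L2) :
    ∫⁻ p, ‖quot β γ g p‖ₑ ^ 2 ∂rateMeasure β γ ≤
      ENNReal.ofReal ((1 / γ) ^ 4 * (2 * Real.pi) * (β + γ) ^ 2) * ‖g‖ₑ ^ 2 := by
  have hπ := Real.pi_pos
  rw [enorm_sq_Lp]
  calc _ ≤ ∫⁻ p, ‖quot β γ g p‖ₑ ^ 2 ∂(ENNReal.ofReal ((1 / γ) ^ 4 * (2 * Real.pi)) • volume) :=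
        lintegral_mono' (rateMeasure_le hβ hγ) le_rfl
    _ = ENNReal.ofReal ((1 / γ) ^ 4 * (2 * Real.pi)) * ∫⁻ p, ‖quot β γ g p‖ₑ ^ 2 := by
        rw [lintegral_smul_measure, smul_eq_mul]
    _ ≤ ENNReal.ofReal ((1 / γ) ^ 4 * (2 * Real.pi)) *
        ∫⁻ p, ENNReal.ofReal ((β + γ) ^ 2) * ‖g p‖ₑ ^ 2 := by
        gcongr with p
        rw [← ofReal_norm, ← ofReal_norm, ENNReal.ofReal_pow (by positivity), ← mul_pow,
          ← ENNReal.ofReal_mul (by positivity)]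
        gcongr
        exact norm_quot_le hβ hγ g p
    _ = _ := by
        rw [lintegral_const_mul' _ _ ENNReal.ofReal_ne_top, ← mul_assoc,
          ← ENNReal.ofReal_mul (by positivity)]

/-- The map `g ↦ g / f`. -/
def toRate (hβ : 0 < β) (hγ : 0 < γ) : L2 →L[ℝ] RateL2 β γ :=
  LinearMap.mkContinuous
    { toFun := fun g => (memLp_quot hβ hγ g).toLp _
      map_add' := fun g h => by
        rw [← MemLp.toLp_add]
        refine MemLp.toLp_congr _ _ ?_
        filter_upwards [(rateMeasure_absolutelyContinuous_volume β γ).ae_eq (Lp.coeFn_add g h)] with p hp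
        simp only [quot, hp, Pi.add_apply]
        ring
      map_smul' := fun c g => by
        rw [RingHom.id_apply, ← MemLp.toLp_const_smul]
        refine MemLp.toLp_congr _ _ ?_
        filter_upwards [(rateMeasure_absolutelyContinuous_volume β γ).ae_eq (Lp.coeFn_smul c g)] with p hp
        simp only [quot, hp, Pi.smul_apply, smul_eq_mul]
        ring }
    (Real.sqrt ((1 / γ) ^ 4 * (2 * Real.pi) * (β + γ) ^ 2)) fun g => by
      have hπ := Real.pi_pos
      have h : ‖(memLp_quot hβ hγ g).toLp _‖ₑ ^ 2 ≤ _ := (le_of_eq (by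
        rw [enorm_sq_Lp]
        refine lintegral_congr_ae ?_
        filter_upwards [(memLp_quot hβ hγ g).coeFn_toLp] with p hp
        rw [hp])).trans (lintegral_enorm_quot_le hβ hγ g)
      rw [← ofReal_norm, ← ofReal_norm, ← ENNReal.ofReal_pow (norm_nonneg _),
        ← ENNReal.ofReal_pow (norm_nonneg _), ← ENNReal.ofReal_mul (by positivity),
        ENNReal.ofReal_le_ofReal_iff (by positivity)] at h
      have h2 := Real.sqrt_le_sqrt h
      rwa [Real.sqrt_sq (norm_nonneg _), Real.sqrt_mul (by positivity),
        Real.sqrt_sq (norm_nonneg _)] at h2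

theorem coeFn_toRate (hβ : 0 < β) (hγ : 0 < γ) (g : L2) :
    toRate hβ hγ g =ᵐ[rateMeasure β γ] quot β γ g :=
  (memLp_quot hβ hγ g).coeFn_toLp

theorem coeFn_toRate_volume (hβ : 0 < β) (hγ : 0 < γ) (g : L2) :
    toRate hβ hγ g =ᵐ[volume] quot β γ g :=
  (volume_absolutelyContinuous_rateMeasure hβ hγ).ae_eq (coeFn_toRate hβ hγ g)

/-- The collision difference of `g / f`. -/
def diffOp (hβ : 0 < β) (hγ : 0 < γ) : L2 →L[ℝ] CollL2 β γ :=
  (collDiff β γ).comp (toRate hβ hγ)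

/-- The negative of the linearized operator. -/
def dissip (hβ : 0 < β) (hγ : 0 < γ) : L2 →L[ℝ] L2 :=
  (1 / 4 : ℝ) • (ContinuousLinearMap.adjoint (diffOp hβ hγ)).comp (diffOp hβ hγ)

theorem inner_dissip (hβ : 0 < β) (hγ : 0 < γ) (g h : L2) :
    inner ℝ (dissip hβ hγ g) h = 1 / 4 * inner ℝ (diffOp hβ hγ g) (diffOp hβ hγ h) := by
  simp [dissip, inner_smul_left, ContinuousLinearMap.adjoint_inner_left]

theorem inner_dissip_eq (hβ : 0 < β) (hγ : 0 < γ) (g h : L2) :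
    inner ℝ (dissip hβ hγ g) h = inner ℝ (diffOp hβ hγ g) (pull₀ β γ (toRate hβ hγ h)) := by
  rw [inner_dissip, diffOp, ContinuousLinearMap.comp_apply, ContinuousLinearMap.comp_apply,
    inner_collDiff]
  ring

theorem inner_dissip_self (hβ : 0 < β) (hγ : 0 < γ) (g : L2) :
    inner ℝ (dissip hβ hγ g) g = 1 / 4 * ‖diffOp hβ hγ g‖ ^ 2 := by
  rw [inner_dissip, real_inner_self_eq_norm_sq]

theorem inner_dissip_comm (hβ : 0 < β) (hγ : 0 < γ) (g h : L2) :
    inner ℝ (dissip hβ hγ g) h = inner ℝ g (dissip hβ hγ h) := by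
  rw [inner_dissip, real_inner_comm (dissip hβ hγ h) g, inner_dissip, real_inner_comm]

theorem dissip_eq_zero_iff (hβ : 0 < β) (hγ : 0 < γ) (g : L2) :
    dissip hβ hγ g = 0 ↔ diffOp hβ hγ g = 0 := by
  constructor
  · intro h
    have := inner_dissip_self hβ hγ g
    rw [h, inner_zero_left] at this
    have h2 : ‖diffOp hβ hγ g‖ ^ 2 = 0 := by linarith
    simpa using h2
  · intro h
    simp [dissip, h]

/-- The collision difference of a function at a resonance. -/
def resDiff (φ : Torus → ℝ) (r : Torus × Torus × Torus × Torus) : ℝ :=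
  φ r.1 + φ r.2.1 - φ r.2.2.1 - φ r.2.2.2

theorem coeFn_diffOp (hβ : 0 < β) (hγ : 0 < γ) (g : L2) :
    diffOp hβ hγ g =ᵐ[collMeasure β γ] resDiff (quot β γ g) := by
  have h := coeFn_toRate hβ hγ g
  filter_upwards [coeFn_collDiff (toRate hβ hγ g),
    (measurePreserving_coord₀ β γ).quasiMeasurePreserving.ae_eq_comp h,
    (measurePreserving_coord₁ β γ).quasiMeasurePreserving.ae_eq_comp h,
    (measurePreserving_coord₂ β γ).quasiMeasurePreserving.ae_eq_comp h,
    (measurePreserving_coord₃ β γ).quasiMeasurePreserving.ae_eq_comp h] with r h0 h1 h2 h3 h4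
  simp only [Function.comp] at h1 h2 h3 h4
  rw [diffOp, ContinuousLinearMap.comp_apply, h0, h1, h2, h3, h4, resDiff]

/-- The pointwise form of `dissip`. -/
def dissipFun (β γ : ℝ) (g : Torus → ℝ) (p : Torus) : ℝ :=
  ∫ q, kern β γ p q * (resDiff (quot β γ g) (momenta (p, q)) * (1 / rayleighJeans β γ p))

theorem integrable_resDiff (hβ : 0 < β) (hγ : 0 < γ) (g : L2) :
    Integrable (fun r => resDiff (quot β γ g) r * (1 / rayleighJeans β γ r.1)) (collMeasure β γ) := by
  have h := L2.integrable_inner (𝕜 := ℝ) (diffOp hβ hγ g) (pull₀ β γ (toRate hβ hγ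
    (indicatorConstLp 2 MeasurableSet.univ (measure_ne_top volume univ) 1)))
  refine h.congr ?_
  filter_upwards [coeFn_diffOp hβ hγ g, coeFn_pull₀ (toRate hβ hγ
    (indicatorConstLp 2 MeasurableSet.univ (measure_ne_top volume univ) 1)),
    (measurePreserving_coord₀ β γ).quasiMeasurePreserving.ae_eq_comp (coeFn_toRate hβ hγ
      (indicatorConstLp 2 MeasurableSet.univ (measure_ne_top volume univ) 1)),
    (measurePreserving_coord₀ β γ).quasiMeasurePreserving.ae_eq_comp
      ((rateMeasure_absolutelyContinuous_volume β γ).ae_eq (indicatorConstLp_coeFn (p := 2)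
        (hs := MeasurableSet.univ) (hμs := measure_ne_top (volume : Measure Torus) univ)
        (c := (1 : ℝ))))] with r h1 h2 h3 h4
  simp only [Function.comp] at h3 h4
  rw [h1, h2, h3, quot, h4]
  simp [mul_comm]

/-- The operator ¼T*T is only known weakly. Testing it on indicators of sets of p₀, where its form
is ⟨Tg, pullback of the test function along p₀⟩, identifies its integral expression almost
everywhere. -/
theorem dissip_ae_eq (hβ : 0 < β) (hγ : 0 < γ) (g : L2) :
    dissip hβ hγ g =ᵐ[volume] dissipFun β γ g := by
  have hF := integrable_resDiff hβ hγ g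
  have hK := integrable_kern_mul hβ hγ hF
  refine Integrable.ae_eq_of_forall_setIntegral_eq _ _
    ((Lp.memLp (dissip hβ hγ g)).integrable (by norm_num)) hK.integral_prod_left fun s hs hμ => ?_
  rw [← L2.inner_indicatorConstLp_one (𝕜 := ℝ) hs hμ.ne, real_inner_comm, inner_dissip_eq, L2.inner_def,
    ← integral_indicator hs]
  have hm : MeasurableSet {r : Torus × Torus × Torus × Torus | r.1 ∈ s} := measurable_fst hs
  have e : ∫ r, inner ℝ (diffOp hβ hγ g r) (pull₀ β γ (toRate hβ hγ (indicatorConstLp 2 hs hμ.ne 1)) r)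
      ∂collMeasure β γ = ∫ r, {r : Torus × Torus × Torus × Torus | r.1 ∈ s}.indicator
        (fun r => resDiff (quot β γ g) r * (1 / rayleighJeans β γ r.1)) r ∂collMeasure β γ := by
    refine integral_congr_ae ?_
    filter_upwards [coeFn_diffOp hβ hγ g, coeFn_pull₀ (toRate hβ hγ (indicatorConstLp 2 hs hμ.ne 1)),
      (measurePreserving_coord₀ β γ).quasiMeasurePreserving.ae_eq_comp (coeFn_toRate hβ hγ
        (indicatorConstLp 2 hs hμ.ne 1)),
      (measurePreserving_coord₀ β γ).quasiMeasurePreserving.ae_eq_comp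
        ((rateMeasure_absolutelyContinuous_volume β γ).ae_eq (indicatorConstLp_coeFn (p := 2)
          (hs := hs) (hμs := hμ.ne) (c := (1 : ℝ))))] with r h1 h2 h3 h4
    simp only [Function.comp] at h3 h4
    rw [h1, h2, h3, quot, h4]
    by_cases hr : r.1 ∈ s
    · rw [indicator_of_mem hr, indicator_of_mem (show r ∈ {r : Torus × Torus × Torus × Torus |
        r.1 ∈ s} from hr)]
      simp [mul_comm]
    · rw [indicator_of_notMem hr, indicator_of_notMem (show r ∉ {r : Torus × Torus × Torus × Torus |
        r.1 ∈ s} from hr)]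
      simp
  rw [e, integral_collMeasure hβ hγ (hF.indicator hm)]
  refine integral_congr_ae (Filter.Eventually.of_forall fun p => ?_)
  by_cases hp : p ∈ s
  · have : ∀ q, momenta (p, q) ∈ {r : Torus × Torus × Torus × Torus | r.1 ∈ s} := fun q => hp
    simp only [indicator_of_mem (this _), indicator_of_mem hp]
    rfl
  · have : ∀ q, momenta (p, q) ∉ {r : Torus × Torus × Torus × Torus | r.1 ∈ s} := fun q => hp
    simp only [indicator_of_notMem (this _), indicator_of_notMem hp, mul_zero, integral_zero]

theorem linIntegrand_eq (g : Torus → ℝ) {x z : ℝ} (hx : x ∈ Ioc 0 (2 * Real.pi))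
    (hz : z ∈ Ioc 0 (2 * Real.pi)) : linIntegrand β γ g x z =
      -(kern β γ x z * (resDiff (quot β γ g) (momenta ((x : Torus), (z : Torus))) *
        (1 / rayleighJeans β γ (x : Torus)))) := by
  have h1 : mom1 (x : Torus) (z : Torus) = ((resonance x z : ℝ) : Torus) := by
    rw [mom1, rep_coe hx, rep_coe hz]
  have h3 : mom3 (x : Torus) (z : Torus) = ((x + resonance x z - z : ℝ) : Torus) := by
    rw [mom3, h1]; simp
  have hd : dens (x : Torus) (z : Torus) = Real.sqrt (Fplus x z) := by
    rw [dens, rep_coe hx, rep_coe hz]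
  unfold linIntegrand kern kernNum
  simp only [resDiff, momenta, h1, h3, hd, quot]
  ring

/-- The bridge to the statement: the convergence clause holds for every g in L², so L is an
everywhere defined bounded operator and the equation is an ODE in L². -/
theorem linearizedEq_iff (hβ : 0 < β) (hγ : 0 < γ) (g v : L2) :
    LinearizedEq β γ g v ↔ v = -dissip hβ hγ g := by
  have hπ := Real.two_pi_pos
  have hK := integrable_kern_mul hβ hγ (integrable_resDiff hβ hγ g)
  have hmp : MeasurePreserving (fun x : ℝ => (x : Torus))
      (volume.restrict (Ioc 0 (2 * Real.pi))) volume := by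
    have := AddCircle.measurePreserving_mk (2 * Real.pi) 0
    rwa [zero_add] at this
  have mg : Measurable (quot β γ g) := measurable_quot (Lp.stronglyMeasurable g).measurable
  have mres : Measurable fun w => resDiff (quot β γ g) (momenta w) := by
    have : Measurable (resDiff (quot β γ g)) :=
      (((mg.comp measurable_fst).add (mg.comp (by fun_prop))).sub (mg.comp (by fun_prop))).sub
        (mg.comp (by fun_prop))
    exact this.comp measurable_momenta
  have mint : Measurable fun w : Torus × Torus => kern β γ w.1 w.2 *
      (resDiff (quot β γ g) (momenta w) * (1 / rayleighJeans β γ w.1)) :=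
    (measurable_kern β γ).mul (mres.mul (measurable_const.div
      ((measurable_rayleighJeans β γ).comp measurable_fst)))
  have mS : Measurable (dissipFun β γ g) := by
    have := (mint.stronglyMeasurable (β := ℝ))
    exact (StronglyMeasurable.integral_prod_right (f := fun p q => kern β γ p q *
      (resDiff (quot β γ g) (momenta (p, q)) * (1 / rayleighJeans β γ p)))
      (ν := (volume : Measure Torus)) this).measurable
  have hint : ∀ᵐ x ∂(volume.restrict (Ioc (0 : ℝ) (2 * Real.pi))),
      IntervalIntegrable (linIntegrand β γ g x) volume 0 (2 * Real.pi) ∧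
      ∫ z in (0 : ℝ)..(2 * Real.pi), linIntegrand β γ g x z = -dissipFun β γ g (x : Torus) := by
    filter_upwards [hmp.quasiMeasurePreserving.ae hK.prod_right_ae,
      ae_restrict_mem measurableSet_Ioc] with x hx hx'
    have m1 : Measurable fun q : Torus => kern β γ x q *
      (resDiff (quot β γ g) (momenta ((x : Torus), q)) * (1 / rayleighJeans β γ (x : Torus))) :=
      mint.comp measurable_prodMk_left
    constructor
    · rw [intervalIntegrable_iff_integrableOn_Ioc_of_le hπ.le]
      have h1 := ((hmp.integrable_comp m1.aestronglyMeasurable).2 hx).neg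
      refine h1.congr ?_
      filter_upwards [ae_restrict_mem measurableSet_Ioc] with z hz
      rw [linIntegrand_eq g hx' hz]
      rfl
    · rw [intervalIntegral.integral_of_le hπ.le, setIntegral_congr_fun measurableSet_Ioc
        (fun z hz => linIntegrand_eq g hx' hz), integral_neg, dissipFun]
      have e := integral_map (μ := volume.restrict (Ioc 0 (2 * Real.pi))) hmp.measurable.aemeasurable m1.aestronglyMeasurable
      rw [hmp.map_eq] at e
      rw [e]
  have mv : Measurable v := (Lp.stronglyMeasurable v).measurable
  constructor
  · intro h
    have h1 : ∀ᵐ x : ℝ ∂(volume.restrict (Ioc (0 : ℝ) (2 * Real.pi))),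
        v (x : Torus) = -dissipFun β γ g (x : Torus) := by
      filter_upwards [h, hint] with x h1 h2
      rw [h1.2, h2.2]
    have h2 : ∀ᵐ p : Torus, v p = -dissipFun β γ g p := by
      have h3 := (ae_map_iff hmp.measurable.aemeasurable (measurableSet_eq_fun mv mS.neg)).2 h1
      rwa [hmp.map_eq] at h3
    refine Lp.ext ?_
    filter_upwards [h2, dissip_ae_eq hβ hγ g, Lp.coeFn_neg (dissip hβ hγ g)] with p h1 h2 h3
    rw [h1, h3, Pi.neg_apply, h2]
  · rintro rfl
    have h2 : ∀ᵐ p : Torus, (-dissip hβ hγ g : L2) p = -dissipFun β γ g p := by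
      filter_upwards [dissip_ae_eq hβ hγ g, Lp.coeFn_neg (dissip hβ hγ g)] with p h2 h3
      rw [h3, Pi.neg_apply, h2]
    filter_upwards [hmp.quasiMeasurePreserving.ae h2, hint] with x h1 h3
    exact ⟨h3.1, by rw [h3.2, h1]⟩

theorem mem_linearizedKer_iff (hβ : 0 < β) (hγ : 0 < γ) (g : L2) :
    g ∈ linearizedKer β γ ↔ dissip hβ hγ g = 0 := by
  have h := linearizedEq_iff hβ hγ g 0
  have e : LinearizedEq β γ g 0 ↔ LinearizedEq β γ g ((0 : L2) : Torus → ℝ) := by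
    have hmp : MeasurePreserving (fun x : ℝ => (x : Torus))
        (volume.restrict (Ioc 0 (2 * Real.pi))) volume := by
      have := AddCircle.measurePreserving_mk (2 * Real.pi) 0
      rwa [zero_add] at this
    have h0 := hmp.quasiMeasurePreserving.ae_eq_comp (Lp.coeFn_zero ℝ 2 (volume : Measure Torus))
    unfold LinearizedEq
    refine Filter.eventually_congr ?_
    filter_upwards [h0] with x hx
    simp only [Function.comp] at hx
    rw [hx]
  rw [linearizedKer, mem_ofPred_eq, e, h]
  constructor
  · intro h; simpa using h.symm
  · intro h; simp [h]

/-- The semigroup of the linearized equation. -/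
def evol (hβ : 0 < β) (hγ : 0 < γ) (t : ℝ) : L2 →L[ℝ] L2 :=
  NormedSpace.exp (t • (-dissip hβ hγ))

theorem hasDerivAt_evol (hβ : 0 < β) (hγ : 0 < γ) (g : L2) (t : ℝ) :
    HasDerivAt (fun s => evol hβ hγ s g) (-dissip hβ hγ (evol hβ hγ t g)) t := by
  have h := (hasDerivAt_exp_smul_const' (𝕂 := ℝ) (-dissip hβ hγ) t).clm_apply (hasDerivAt_const t g)
  simpa [evol] using h

theorem evol_zero (hβ : 0 < β) (hγ : 0 < γ) : evol hβ hγ 0 = 1 := by simp [evol]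

theorem isSolution_evol (hβ : 0 < β) (hγ : 0 < γ) (g : L2) :
    IsSolution β γ g fun t => evol hβ hγ t g where
  continuousOn := fun t _ => (hasDerivAt_evol hβ hγ g t).continuousAt.continuousWithinAt
  initial := by simp [evol_zero]
  equation := fun t _ => ⟨-dissip hβ hγ (evol hβ hγ t g), (linearizedEq_iff hβ hγ _ _).2 rfl,
    (hasDerivAt_evol hβ hγ g t).hasDerivWithinAt⟩

theorem IsSolution.eqOn_evol (hβ : 0 < β) (hγ : 0 < γ) {g : L2} {w : ℝ → L2}
    (hw : IsSolution β γ g w) : EqOn w (fun t => evol hβ hγ t g) (Ici 0) := by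
  have hd : ∀ t, 0 ≤ t → HasDerivWithinAt w (-dissip hβ hγ (w t)) (Ici 0) t := fun t ht => by
    obtain ⟨v, hv, hd⟩ := hw.equation t ht
    rwa [(linearizedEq_iff hβ hγ _ _).1 hv] at hd
  intro t ht
  refine ODE_solution_unique (v := fun _ g => -dissip hβ hγ g) (K := ‖-dissip hβ hγ‖₊) (a := 0) (b := t)
    (fun _ => (-dissip hβ hγ).lipschitz) (hw.continuousOn.mono Icc_subset_Ici_self)
    (fun s hs => (hd s hs.1).mono (Ici_subset_Ici.2 hs.1))
    (fun s _ => (hasDerivAt_evol hβ hγ g s).continuousAt.continuousWithinAt)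
    (fun s _ => (hasDerivAt_evol hβ hγ g s).hasDerivWithinAt) ?_ ⟨ht, le_rfl⟩
  simp [evol_zero, hw.initial]

end Operator

/-! ### Weighted norms -/

section WeightedNorm

theorem ofReal_omega_rpow_sq (s : ℝ) (q : Torus) :
    ENNReal.ofReal (omega q ^ s) ^ 2 = ENNReal.ofReal (omega q ^ (2 * s)) := by
  rw [← ENNReal.ofReal_pow (Real.rpow_nonneg (omega_nonneg q) _), ← Real.rpow_natCast,
    ← Real.rpow_mul (omega_nonneg q)]
  congr 2; push_cast; ring

theorem omega_rpow_le_one {s : ℝ} (hs : 0 ≤ s) (p : Torus) : omega p ^ s ≤ 1 :=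
  Real.rpow_le_one (omega_nonneg p) (omega_le_one p) hs

/-- The weighted square norm `∫ ω^s g²`. -/
def wsq (s : ℝ) (g : L2) : ℝ := (∫⁻ p, ENNReal.ofReal (omega p ^ s) * ‖g p‖ₑ ^ 2).toReal

theorem wsq_nonneg (s : ℝ) (g : L2) : 0 ≤ wsq s g := ENNReal.toReal_nonneg

theorem lintegral_omega_enorm_sq_le {s : ℝ} (hs : 0 ≤ s) (g : L2) :
    ∫⁻ p, ENNReal.ofReal (omega p ^ s) * ‖g p‖ₑ ^ 2 ≤ ‖g‖ₑ ^ 2 := by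
  rw [enorm_sq_Lp]
  refine lintegral_mono fun p => ?_
  refine mul_le_of_le_one_left zero_le ?_
  rw [ENNReal.ofReal_le_one]
  exact omega_rpow_le_one hs p

theorem ofReal_wsq {s : ℝ} (hs : 0 ≤ s) (g : L2) :
    ENNReal.ofReal (wsq s g) = ∫⁻ p, ENNReal.ofReal (omega p ^ s) * ‖g p‖ₑ ^ 2 :=
  ENNReal.ofReal_toReal
    ((lintegral_omega_enorm_sq_le hs g).trans_lt (by simp)).ne

/-- Pointwise, y^θ ≤ l^{θ−1}y + l^θ for y = ω^{5/3}: the first term wins for y ≥ l and the second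
for y ≤ l. Taking l = 1/⟨t⟩ later balances the O(1/t) dissipation against the bounded norm. -/
theorem wsq_interpolation {θ : ℝ} (h0 : 0 ≤ θ) (h1 : θ ≤ 1) {l : ℝ} (hl : 0 < l) (g : L2) :
    wsq (5 / 3 * θ) g ≤ l ^ (θ - 1) * wsq (5 / 3) g + l ^ θ * ‖g‖ ^ 2 := by
  have hw := wsq_nonneg (5 / 3) g
  have hm : Measurable fun p => ENNReal.ofReal (l ^ (θ - 1)) *
      (ENNReal.ofReal (omega p ^ (5 / 3 : ℝ)) * ‖g p‖ₑ ^ 2) :=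
    ((measurable_omega.pow_const _).ennreal_ofReal.mul
      ((measurable_enorm_Lp g).pow_const 2)).const_mul _
  rw [← ENNReal.ofReal_le_ofReal_iff (by positivity), ofReal_wsq (by positivity),
    ENNReal.ofReal_add (by positivity) (by positivity), ENNReal.ofReal_mul (by positivity),
    ENNReal.ofReal_mul (by positivity), ofReal_wsq (by norm_num),
    ENNReal.ofReal_pow (norm_nonneg _), ofReal_norm, enorm_sq_Lp,
    ← lintegral_const_mul' _ _ ENNReal.ofReal_ne_top,
    ← lintegral_const_mul' _ _ ENNReal.ofReal_ne_top, ← lintegral_add_left hm]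
  refine lintegral_mono fun p => ?_
  rw [← mul_assoc, ← add_mul]
  refine mul_le_mul' ?_ le_rfl
  have hp := omega_nonneg p
  rw [← ENNReal.ofReal_mul (by positivity), ← ENNReal.ofReal_add (by positivity) (by positivity)]
  apply ENNReal.ofReal_le_ofReal
  rw [Real.rpow_mul hp]
  set y := omega p ^ (5 / 3 : ℝ) with hy
  have y0 : 0 ≤ y := by positivity
  rcases le_total y l with h | h
  · have : y ^ θ ≤ l ^ θ := Real.rpow_le_rpow y0 h h0
    have h2 : 0 ≤ l ^ (θ - 1) * y := by positivity
    linarith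
  · have hy0 : 0 < y := hl.trans_le h
    have e : y ^ θ = y ^ (θ - 1) * y := by
      rw [← Real.rpow_add_one hy0.ne']; congr 1; ring
    have h2 : y ^ (θ - 1) ≤ l ^ (θ - 1) := Real.rpow_le_rpow_of_nonpos hl h (by linarith)
    have h3 : 0 ≤ l ^ θ := by positivity
    rw [e]
    nlinarith

/-- Cauchy–Schwarz with the weight ω^{2r−s}. The constant is uniform in r and s because ω^{-5/6} is
integrable and dominates all the weights allowed. -/
theorem exists_lintegral_omega_mul_le : ∃ I : ℝ, 0 < I ∧ ∀ r s : ℝ, 0 ≤ s → -(5 / 6) ≤ 2 * r - s →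
    ∀ g : L2, ∫⁻ p, ENNReal.ofReal (omega p ^ r) * ‖g p‖ₑ ≤
      ENNReal.ofReal (I * Real.sqrt (wsq s g)) := by
  have hI := lintegral_omega_rpow_lt_top (s := -(5 / 6)) (by norm_num)
  set I := (∫⁻ q, ENNReal.ofReal (omega q ^ (-(5 / 6) : ℝ))) ^ (1 / 2 : ℝ) with hIdef
  have hIt : I ≠ ⊤ := ENNReal.rpow_ne_top_of_nonneg (by norm_num) hI.ne
  have m := measurable_omega
  refine ⟨I.toReal + 1, by positivity, fun r s hs hrs g => ?_⟩
  have mg := measurable_enorm_Lp g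
  calc ∫⁻ p, ENNReal.ofReal (omega p ^ r) * ‖g p‖ₑ
      = ∫⁻ p, ENNReal.ofReal (omega p ^ (r - s / 2)) *
          (ENNReal.ofReal (omega p ^ (s / 2)) * ‖g p‖ₑ) := by
        refine lintegral_congr_ae ?_
        filter_upwards [ae_ne_zero] with p hp
        rw [← mul_assoc, ← ENNReal.ofReal_mul (Real.rpow_nonneg (omega_nonneg p) _),
          ← Real.rpow_add (omega_pos hp)]
        norm_num
    _ ≤ (∫⁻ p, ENNReal.ofReal (omega p ^ (r - s / 2)) ^ 2) ^ (1 / 2 : ℝ) *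
        (∫⁻ p, (ENNReal.ofReal (omega p ^ (s / 2)) * ‖g p‖ₑ) ^ 2) ^ (1 / 2 : ℝ) :=
        lintegral_mul_le_sqrt (m.pow_const _).ennreal_ofReal.aemeasurable
          ((m.pow_const _).ennreal_ofReal.mul mg).aemeasurable
    _ ≤ I * (ENNReal.ofReal (wsq s g)) ^ (1 / 2 : ℝ) := by
        rw [ofReal_wsq hs]
        simp only [ofReal_omega_rpow_sq, mul_pow]
        refine mul_le_mul' ?_ (le_of_eq ?_)
        · rw [hIdef]
          refine ENNReal.rpow_le_rpow (lintegral_mono_ae ?_) (by norm_num)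
          filter_upwards [ae_ne_zero] with p hp
          exact ENNReal.ofReal_le_ofReal (Real.rpow_le_rpow_of_exponent_ge (omega_pos hp)
            (omega_le_one p) (by linarith))
        · congr 2
          funext p
          congr 3
          ring
    _ = ENNReal.ofReal (I.toReal * Real.sqrt (wsq s g)) := by
        rw [ENNReal.ofReal_rpow_of_nonneg (wsq_nonneg _ _) (by norm_num), ← Real.sqrt_eq_rpow,
          ENNReal.ofReal_mul ENNReal.toReal_nonneg, ENNReal.ofReal_toReal hIt]
    _ ≤ _ := by gcongr; linarith

theorem abs_inner_le_lintegral (g h : L2) :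
    ENNReal.ofReal |inner ℝ g h| ≤ ∫⁻ p, ‖g p‖ₑ * ‖h p‖ₑ := by
  rw [L2.inner_def, ← Real.norm_eq_abs, ofReal_norm]
  refine (enorm_integral_le_lintegral_enorm _).trans (lintegral_mono fun p => ?_)
  refine le_of_eq ?_
  simp only [RCLike.inner_apply, conj_trivial, enorm_mul]
  exact mul_comm _ _

end WeightedNorm

/-! ### Decomposition along the kernel -/

section Decomposition

variable {β γ : ℝ}

/-- For a kernel element, ψ(p₀) is bounded by the values at p₁, p₂, p₃, and averaging over
resonances applies twice. On ω ≥ ρ/500 the weighted norm controls the plain one at the cost of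
ρ^{-5/6} = ω₀^{-5/18}; with ω₀^{-1/6} this gives |ψ| ≲ ω^{-4/9}. As ω^{-8/9} is integrable, ψ is in
plain L², and the second pass has no loss beyond ω^{-1/6}. -/
theorem exists_le_of_collDiff_eq_zero (hβ : 0 < β) (hγ : 0 < γ) : ∃ C : ℝ, 0 < C ∧
    ∀ ψ : RateL2 β γ, collDiff β γ ψ = 0 →
      ∀ᵐ p, ‖ψ p‖ₑ ≤ ENNReal.ofReal (C * omega p ^ (-(1 / 6) : ℝ)) * ‖ψ‖ₑ := by
  obtain ⟨C, C0, hC⟩ := exists_le_of_resonant hβ hγ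
  obtain ⟨K, K0, hK⟩ := exists_lintegral_omega_sq_le hβ hγ
  have hI := lintegral_omega_rpow_lt_top (s := -(8 / 9)) (by norm_num)
  set I := ∫⁻ q, ENNReal.ofReal (omega q ^ (-(8 / 9) : ℝ)) with hIdef
  set B : ℝ := C * (K * 500 ^ (5 / 3 : ℝ)) ^ (1 / 2 : ℝ) with hB
  have B0 : 0 < B := by positivity
  refine ⟨C * (B * (I.toReal ^ (1 / 2 : ℝ) + 1)), by positivity, fun ψ hψ => ?_⟩
  have mψ := measurable_enorm_Lp ψ
  have hres : ∀ᵐ p : Torus, ∀ᵐ q : Torus, ‖ψ p‖ₑ ≤ ‖ψ (mom1 p q)‖ₑ + ‖ψ q‖ₑ + ‖ψ (mom3 p q)‖ₑ := by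
    have h1 : ∀ᵐ r ∂collMeasure β γ, ψ r.1 + ψ r.2.1 - ψ r.2.2.1 - ψ r.2.2.2 = 0 := by
      have h2 := coeFn_collDiff ψ
      rw [hψ] at h2
      filter_upwards [h2, Lp.coeFn_zero ℝ 2 (collMeasure β γ)] with r h3 h4
      rw [← h3, h4]; rfl
    filter_upwards [ae_collMeasure_iff hβ hγ h1] with p hp
    filter_upwards [hp] with q hq
    simp only [momenta] at hq
    have e : ψ p = (-ψ (mom1 p q) + ψ q) + ψ (mom3 p q) := by linarith
    rw [e]
    refine (enorm_add_le _ _).trans (add_le_add ((enorm_add_le _ _).trans ?_) le_rfl)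
    rw [enorm_neg]
  have hfirst : ∀ᵐ p : Torus, ‖ψ p‖ₑ ≤ ENNReal.ofReal (B * omega p ^ (-(4 / 9) : ℝ)) * ‖ψ‖ₑ := by
    filter_upwards [hres, ae_ne_zero] with p hp hp0
    have hw := omega_pos hp0
    refine (hC p hp0 _ _ mψ hp).trans ?_
    set ρ := omega p ^ (1 / 3 : ℝ) with hρ
    have ρ0 : 0 < ρ := Real.rpow_pos_of_pos hw _
    have hm : MeasurableSet {q : Torus | ρ / 500 ≤ omega q} :=
      measurableSet_le measurable_const measurable_omega
    have h1 : ∫⁻ q in {q | ρ / 500 ≤ omega q}, ‖ψ q‖ₑ ^ 2 ≤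
        ENNReal.ofReal ((ρ / 500) ^ (-(5 / 3) : ℝ)) * (ENNReal.ofReal K * ‖ψ‖ₑ ^ 2) := by
      calc _ ≤ ∫⁻ q in {q | ρ / 500 ≤ omega q}, ENNReal.ofReal ((ρ / 500) ^ (-(5 / 3) : ℝ)) *
            (ENNReal.ofReal (omega q ^ (5 / 3 : ℝ)) * ‖ψ q‖ₑ ^ 2) := by
            refine setLIntegral_mono' hm fun q hq => ?_
            rw [← mul_assoc, ← ENNReal.ofReal_mul (by positivity)]
            refine le_mul_of_one_le_left zero_le ?_
            rw [ENNReal.one_le_ofReal, Real.rpow_neg (by positivity), inv_mul_eq_div,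
              one_le_div (by positivity)]
            exact Real.rpow_le_rpow (by positivity) hq (by norm_num)
        _ = ENNReal.ofReal ((ρ / 500) ^ (-(5 / 3) : ℝ)) *
            ∫⁻ q in {q | ρ / 500 ≤ omega q}, (ENNReal.ofReal (omega q ^ (5 / 3 : ℝ)) * ‖ψ q‖ₑ ^ 2) :=
            lintegral_const_mul' _ _ ENNReal.ofReal_ne_top
        _ ≤ _ := by
            gcongr
            exact (setLIntegral_le_lintegral _ _).trans (hK ψ)
    calc _ ≤ ENNReal.ofReal (C * omega p ^ (-(1 / 6) : ℝ)) *
          (ENNReal.ofReal ((ρ / 500) ^ (-(5 / 3) : ℝ)) * (ENNReal.ofReal K * ‖ψ‖ₑ ^ 2)) ^ (1 / 2 : ℝ) := by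
          gcongr
      _ = ENNReal.ofReal (C * omega p ^ (-(1 / 6) : ℝ) *
          ((ρ / 500) ^ (-(5 / 3) : ℝ) * K) ^ (1 / 2 : ℝ)) * ‖ψ‖ₑ := by
          rw [← mul_assoc, ← ENNReal.ofReal_mul (by positivity),
            ENNReal.mul_rpow_of_nonneg _ _ (by norm_num), ← ENNReal.rpow_natCast, ← ENNReal.rpow_mul,
            ENNReal.ofReal_rpow_of_nonneg (by positivity) (by norm_num), ← mul_assoc,
            ← ENNReal.ofReal_mul (by positivity)]
          norm_num
      _ = _ := by
          congr 2
          have e1 : (ρ / 500) ^ (-(5 / 3) : ℝ) * K = (K * 500 ^ (5 / 3 : ℝ)) * ρ ^ (-(5 / 3) : ℝ) := by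
            rw [Real.div_rpow ρ0.le (by norm_num), Real.rpow_neg (by norm_num : (0 : ℝ) ≤ 500),
              div_inv_eq_mul]
            ring
          rw [e1, Real.mul_rpow (by positivity) (by positivity), hρ, ← Real.rpow_mul hw.le,
            ← Real.rpow_mul hw.le, mul_mul_mul_comm, ← Real.rpow_add hw, ← hB]
          norm_num
  have hsq : ∫⁻ p, ‖ψ p‖ₑ ^ 2 ≤ (ENNReal.ofReal (B ^ 2) * I) * ‖ψ‖ₑ ^ 2 := by
    calc _ ≤ ∫⁻ p, (ENNReal.ofReal (B ^ 2) * ‖ψ‖ₑ ^ 2) * ENNReal.ofReal (omega p ^ (-(8 / 9) : ℝ)) := by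
          refine lintegral_mono_ae ?_
          filter_upwards [hfirst, ae_ne_zero] with p hp hp0
          have hw := omega_pos hp0
          calc _ ≤ (ENNReal.ofReal (B * omega p ^ (-(4 / 9) : ℝ)) * ‖ψ‖ₑ) ^ 2 := by gcongr
            _ = _ := by
                rw [ENNReal.ofReal_mul B0.le, mul_pow, mul_pow, ofReal_omega_rpow_sq,
                  ENNReal.ofReal_pow B0.le]
                norm_num
                ring
      _ = _ := by
          rw [lintegral_const_mul' _ _ (ENNReal.mul_ne_top ENNReal.ofReal_ne_top (by simp))]
          ring
  filter_upwards [hres, ae_ne_zero] with p hp hp0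
  have hw := omega_pos hp0
  calc _ ≤ _ := hC p hp0 _ _ mψ hp
    _ ≤ ENNReal.ofReal (C * omega p ^ (-(1 / 6) : ℝ)) *
        ((ENNReal.ofReal (B ^ 2) * I) * ‖ψ‖ₑ ^ 2) ^ (1 / 2 : ℝ) := by
        gcongr
        exact (setLIntegral_le_lintegral _ _).trans hsq
    _ = ENNReal.ofReal (C * omega p ^ (-(1 / 6) : ℝ) * (B * I.toReal ^ (1 / 2 : ℝ))) * ‖ψ‖ₑ := by
        rw [← ENNReal.ofReal_toReal hI.ne, ← ENNReal.ofReal_mul (by positivity),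
          ENNReal.mul_rpow_of_nonneg _ _ (by norm_num), ← ENNReal.rpow_natCast, ← ENNReal.rpow_mul,
          ENNReal.ofReal_rpow_of_nonneg (by positivity) (by norm_num), ← mul_assoc,
          ← ENNReal.ofReal_mul (by positivity), Real.mul_rpow (by positivity) (by positivity),
          ← Real.sqrt_eq_rpow (B ^ 2), Real.sqrt_sq B0.le,
          ENNReal.toReal_ofReal ENNReal.toReal_nonneg]
        norm_num
    _ ≤ _ := by
        rw [show C * (B * (I.toReal ^ (1 / 2 : ℝ) + 1)) * omega p ^ (-(1 / 6) : ℝ) =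
          C * omega p ^ (-(1 / 6) : ℝ) * (B * (I.toReal ^ (1 / 2 : ℝ) + 1)) by ring]
        gcongr
        linarith

/-- The splitting of `g` into an element of the kernel and a remainder controlled by the
dissipation. -/
theorem exists_decomposition (hβ : 0 < β) (hγ : 0 < γ) : ∃ C : ℝ, 0 < C ∧ ∀ g : L2,
    ∃ (n : L2) (q : ℝ), 0 ≤ q ∧ dissip hβ hγ n = 0 ∧ (∀ᵐ p, |n p| ≤ q * omega p ^ (-(1 / 6) : ℝ)) ∧
      wsq (5 / 3) (g - n) ≤ C * inner ℝ (dissip hβ hγ g) g ∧ ‖g - n‖ ≤ C * ‖g‖ ∧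
      ((∀ k, dissip hβ hγ k = 0 → inner ℝ k g = 0) → q ≤ C * Real.sqrt (wsq (1 / 2) (g - n))) := by
  obtain ⟨C, C0, hC⟩ := exists_le_of_collDiff_eq_zero hβ hγ
  obtain ⟨K, K0, hK⟩ := exists_lintegral_omega_sq_le hβ hγ
  obtain ⟨c, c0, hc⟩ := exists_le_norm_collDiff hβ hγ
  obtain ⟨I, I0, hI⟩ := exists_lintegral_omega_mul_le
  have hJ := lintegral_omega_rpow_lt_top (s := -(1 / 3)) (by norm_num)
  set J : ℝ := (∫⁻ q, ENNReal.ofReal (omega q ^ (-(1 / 3) : ℝ))).toReal with hJdef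
  have J0 : 0 ≤ J := ENNReal.toReal_nonneg
  set E := ‖toRate hβ hγ‖ with hE
  have E0 : 0 ≤ E := norm_nonneg _
  set C1 : ℝ := 1 / γ * C with hC1
  have C10 : 0 < C1 := by positivity
  set Q1 : ℝ := (1 / γ) ^ 2 * K * (4 / c ^ 2) with hQ1
  have Q10 : 0 < Q1 := by positivity
  set Q2 : ℝ := 1 + C1 * E * Real.sqrt J with hQ2
  have Q20 : 0 < Q2 := by positivity
  set Q3 : ℝ := C1 * E * (C1 * E * I) with hQ3
  have Q30 : 0 ≤ Q3 := by positivity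
  refine ⟨Q1 + Q2 + Q3, by positivity, fun g => ?_⟩
  set φ := toRate hβ hγ g with hφ
  set S : Submodule ℝ (RateL2 β γ) := LinearMap.ker (collDiff β γ).toLinearMap with hS
  have hSc : IsClosed (S : Set (RateL2 β γ)) := (collDiff β γ).isClosed_ker
  have : CompleteSpace S := hSc.completeSpace_coe
  -- The projection is orthogonal for the rate-weighted inner product, the one in which the spectral
  -- gap holds. It differs from the L² projection, so n need not vanish when g is orthogonal to Ker
  -- L.
  obtain ⟨ψ, hψ, z, hz, hsum⟩ := S.exists_add_mem_mem_orthogonal φ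
  have hψ0 : collDiff β γ ψ = 0 := hψ
  have hzo : ∀ χ, collDiff β γ χ = 0 → inner ℝ z χ = 0 := fun χ hχ => by
    rw [real_inner_comm]; exact hz χ hχ
  have hnorm : ‖ψ‖ ≤ ‖φ‖ := by
    have h1 : ‖φ‖ ^ 2 = ‖ψ‖ ^ 2 + ‖z‖ ^ 2 := by
      rw [hsum, norm_add_sq_real, hz ψ hψ]; ring
    nlinarith [norm_nonneg ψ, norm_nonneg φ, sq_nonneg ‖z‖]
  have hφg : ‖φ‖ ≤ E * ‖g‖ := (toRate hβ hγ).le_opNorm g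
  set q : ℝ := C1 * ‖ψ‖ with hq
  have q0 : 0 ≤ q := by positivity
  have hf := rayleighJeans_pos hβ hγ
  set nf : Torus → ℝ := fun p => ψ p * rayleighJeans β γ p with hnf
  have mnf : Measurable nf :=
    (Lp.stronglyMeasurable ψ).measurable.mul (measurable_rayleighJeans β γ)
  have hnfb : ∀ᵐ p, |nf p| ≤ q * omega p ^ (-(1 / 6) : ℝ) := by
    filter_upwards [hC ψ hψ0, ae_ne_zero] with p hp hp0
    have hw := omega_pos hp0
    rw [← ofReal_norm, ← ofReal_norm, ← ENNReal.ofReal_mul (by positivity),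
      ENNReal.ofReal_le_ofReal_iff (by positivity), Real.norm_eq_abs] at hp
    rw [hnf, abs_mul, abs_of_pos (hf p)]
    calc _ ≤ (C * omega p ^ (-(1 / 6) : ℝ) * ‖ψ‖) * (1 / γ) :=
          mul_le_mul hp (rayleighJeans_le hβ hγ p) (hf p).le (by positivity)
      _ = _ := by rw [hq, hC1]; ring
  have hnsq : ∫⁻ p, ‖nf p‖ₑ ^ 2 ≤ ENNReal.ofReal (q ^ 2 * J) := by
    calc _ ≤ ∫⁻ p, ENNReal.ofReal (q ^ 2) * ENNReal.ofReal (omega p ^ (-(1 / 3) : ℝ)) := by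
          refine lintegral_mono_ae ?_
          filter_upwards [hnfb, ae_ne_zero] with p hp hp0
          have hw := omega_pos hp0
          rw [← ofReal_norm, Real.norm_eq_abs, ← ENNReal.ofReal_mul (by positivity),
            ← ENNReal.ofReal_pow (abs_nonneg _)]
          apply ENNReal.ofReal_le_ofReal
          calc _ ≤ (q * omega p ^ (-(1 / 6) : ℝ)) ^ 2 := by gcongr
            _ = _ := by
              rw [mul_pow, ← Real.rpow_natCast (omega p ^ _), ← Real.rpow_mul hw.le]; norm_num
      _ = _ := by
          rw [lintegral_const_mul' _ _ ENNReal.ofReal_ne_top, ENNReal.ofReal_mul (by positivity),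
            hJdef, ENNReal.ofReal_toReal hJ.ne]
  -- The pointwise bound by ω^{-1/6}, whose square is integrable, brings the kernel part back to L².
  have hmem : MemLp nf 2 volume := by
    refine ⟨mnf.aestronglyMeasurable, ?_⟩
    rw [eLpNorm_lt_top_iff_lintegral_rpow_enorm_lt_top (by norm_num) (by norm_num)]
    simpa using hnsq.trans_lt ENNReal.ofReal_lt_top
  set n : L2 := hmem.toLp nf with hn
  have hncoe : n =ᵐ[volume] nf := hmem.coeFn_toLp
  have hEn : toRate hβ hγ n = ψ := by
    refine Lp.ext ?_
    filter_upwards [coeFn_toRate hβ hγ n,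
      (rateMeasure_absolutelyContinuous_volume β γ).ae_eq hncoe] with p h1 h2
    rw [h1, quot, h2, hnf, mul_div_assoc, div_self (hf p).ne', mul_one]
  have hTn : diffOp hβ hγ n = 0 := by rw [diffOp, ContinuousLinearMap.comp_apply, hEn, hψ0]
  have hAn : dissip hβ hγ n = 0 := (dissip_eq_zero_iff hβ hγ n).2 hTn
  have hnq : ∀ᵐ p, |n p| ≤ q * omega p ^ (-(1 / 6) : ℝ) := by
    filter_upwards [hncoe, hnfb] with p h1 h2
    rwa [h1]
  have hnn : ‖n‖ ≤ q * Real.sqrt J := by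
    have h1 : ‖n‖ₑ ^ 2 ≤ ENNReal.ofReal (q ^ 2 * J) := by
      rw [enorm_sq_Lp]
      refine le_trans (le_of_eq (lintegral_congr_ae ?_)) hnsq
      filter_upwards [hncoe] with p hp
      rw [hp]
    rw [← ofReal_norm, ← ENNReal.ofReal_pow (norm_nonneg _),
      ENNReal.ofReal_le_ofReal_iff (by positivity)] at h1
    have h2 := Real.sqrt_le_sqrt h1
    rwa [Real.sqrt_sq (norm_nonneg _), Real.sqrt_mul (by positivity), Real.sqrt_sq q0] at h2
  have hinner : 0 ≤ inner ℝ (dissip hβ hγ g) g := by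
    rw [inner_dissip_self]; positivity
  refine ⟨n, q, q0, hAn, hnq, ?_, ?_, fun hg => ?_⟩
  · have hz2 : ‖z‖ ^ 2 ≤ 4 / c ^ 2 * inner ℝ (dissip hβ hγ g) g := by
      have h1 := hc z hzo
      have h2 : collDiff β γ z = diffOp hβ hγ g := by
        rw [diffOp, ContinuousLinearMap.comp_apply, ← hφ, hsum, map_add, hψ0, zero_add]
      rw [h2] at h1
      have h3 : (c * ‖z‖) ^ 2 ≤ ‖diffOp hβ hγ g‖ ^ 2 := by gcongr
      rw [inner_dissip_self, div_mul_eq_mul_div, le_div_iff₀ (by positivity)]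
      nlinarith
    have hEz : toRate hβ hγ (g - n) = z := by rw [map_sub, hEn, ← hφ, hsum]; abel
    have h4 : wsq (5 / 3) (g - n) ≤ (1 / γ) ^ 2 * (K * ‖z‖ ^ 2) := by
      rw [← ENNReal.ofReal_le_ofReal_iff (by positivity), ofReal_wsq (by norm_num),
        ENNReal.ofReal_mul (by positivity), ENNReal.ofReal_mul K0.le,
        ENNReal.ofReal_pow (norm_nonneg _), ofReal_norm]
      refine le_trans ?_ (mul_le_mul' le_rfl (hK z))
      rw [← lintegral_const_mul' _ _ ENNReal.ofReal_ne_top]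
      refine lintegral_mono_ae ?_
      filter_upwards [coeFn_toRate_volume hβ hγ (g - n)] with p hp
      rw [hEz] at hp
      have e : (g - n : L2) p = rayleighJeans β γ p * z p := by
        rw [hp, quot, mul_div_cancel₀ _ (hf p).ne']
      rw [e, enorm_mul, mul_pow, mul_left_comm]
      refine mul_le_mul' ?_ le_rfl
      rw [Real.enorm_of_nonneg (hf p).le, ← ENNReal.ofReal_pow (hf p).le]
      apply ENNReal.ofReal_le_ofReal
      have := rayleighJeans_le hβ hγ p
      have := (hf p).le
      gcongr
    calc _ ≤ _ := h4
      _ ≤ (1 / γ) ^ 2 * (K * (4 / c ^ 2 * inner ℝ (dissip hβ hγ g) g)) := by gcongr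
      _ = Q1 * inner ℝ (dissip hβ hγ g) g := by rw [hQ1]; ring
      _ ≤ _ := by gcongr; linarith
  · calc ‖g - n‖ ≤ ‖g‖ + ‖n‖ := norm_sub_le _ _
      _ ≤ ‖g‖ + C1 * (E * ‖g‖) * Real.sqrt J := by
          gcongr
          refine hnn.trans ?_
          rw [hq]
          gcongr
          exact hnorm.trans hφg
      _ = Q2 * ‖g‖ := by rw [hQ2]; ring
      _ ≤ _ := by gcongr; linarith
  · have hqn : q ≤ C1 * E * ‖n‖ := by
      calc q = C1 * ‖toRate hβ hγ n‖ := by rw [hq, hEn]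
        _ ≤ C1 * (E * ‖n‖) := mul_le_mul_of_nonneg_left ((toRate hβ hγ).le_opNorm n) C10.le
        _ = _ := (mul_assoc _ _ _).symm
    set Y := Real.sqrt (wsq (1 / 2) (g - n)) with hY
    have Y0 : 0 ≤ Y := Real.sqrt_nonneg _
    -- If g is orthogonal to Ker L then ‖n‖² = −⟨n, g − n⟩. Since |n| ≤ qω^{-1/6}, this is at most
    -- q∫ω^{-1/6}|g − n|, and q ≲ ‖n‖ closes the estimate. The exponents r = −1/6, s = 1/2 are the
    -- borderline case 2r − s = −5/6.
    have h1 : ‖n‖ ^ 2 ≤ q * (I * Y) := by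
      have e : ‖n‖ ^ 2 = -inner ℝ n (g - n) := by
        rw [inner_sub_right, hg n hAn, real_inner_self_eq_norm_sq]; ring
      have h2 := abs_inner_le_lintegral n (g - n)
      have h3 : ∫⁻ p, ‖n p‖ₑ * ‖(g - n : L2) p‖ₑ ≤ ENNReal.ofReal (q * (I * Y)) := by
        calc _ ≤ ∫⁻ p, ENNReal.ofReal q * (ENNReal.ofReal (omega p ^ (-(1 / 6) : ℝ)) *
              ‖(g - n : L2) p‖ₑ) := by
              refine lintegral_mono_ae ?_
              filter_upwards [hnq] with p hp
              rw [← mul_assoc, ← ENNReal.ofReal_mul q0]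
              refine mul_le_mul' ?_ le_rfl
              rw [← ofReal_norm, Real.norm_eq_abs]
              exact ENNReal.ofReal_le_ofReal hp
          _ ≤ _ := by
              rw [lintegral_const_mul' _ _ ENNReal.ofReal_ne_top, ENNReal.ofReal_mul q0]
              gcongr
              exact hI _ _ (by norm_num) (by norm_num) _
      have h4 := (ENNReal.ofReal_le_ofReal_iff (by positivity)).1 (h2.trans h3)
      rw [e]
      exact (neg_le_abs _).trans h4
    have h2 : ‖n‖ ≤ C1 * E * (I * Y) := by
      rcases (norm_nonneg n).eq_or_lt with h | h
      · rw [← h]; positivity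
      · have h5 : ‖n‖ * ‖n‖ ≤ ‖n‖ * (C1 * E * (I * Y)) := by
          calc ‖n‖ * ‖n‖ = ‖n‖ ^ 2 := by ring
            _ ≤ q * (I * Y) := h1
            _ ≤ (C1 * E * ‖n‖) * (I * Y) := by gcongr
            _ = _ := by ring
        exact le_of_mul_le_mul_left h5 h
    calc q ≤ C1 * E * ‖n‖ := hqn
      _ ≤ C1 * E * (C1 * E * (I * Y)) := by gcongr
      _ = Q3 * Y := by rw [hQ3]; ring
      _ ≤ _ := by gcongr; linarith

end Decomposition

/-! ### Decay in `L²` -/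

section Decay

variable {β γ : ℝ}

theorem bracket_pos (t : ℝ) : 0 < bracket t := by unfold bracket; positivity

theorem one_le_bracket (t : ℝ) : 1 ≤ bracket t := by
  unfold bracket; linarith [abs_nonneg t]

theorem bracket_of_nonneg {t : ℝ} (ht : 0 ≤ t) : bracket t = 10 + t := by
  rw [bracket, abs_of_nonneg ht]

theorem evol_add (hβ : 0 < β) (hγ : 0 < γ) (s t : ℝ) :
    evol hβ hγ (s + t) = evol hβ hγ s * evol hβ hγ t := by
  have : NormedAlgebra ℚ (L2 →L[ℝ] L2) := NormedAlgebra.restrictScalars ℚ ℝ _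
  unfold evol
  rw [add_smul, NormedSpace.exp_add_of_commute]
  exact ((Commute.refl _).smul_left s).smul_right t

theorem inner_evol_comm (hβ : 0 < β) (hγ : 0 < γ) (t : ℝ) (g h : L2) :
    inner ℝ (evol hβ hγ t g) h = inner ℝ g (evol hβ hγ t h) := by
  have hA : IsSelfAdjoint (dissip hβ hγ) := by
    rw [ContinuousLinearMap.isSelfAdjoint_iff_isSymmetric]
    exact fun g h => inner_dissip_comm hβ hγ g h
  have h1 : IsSelfAdjoint (evol hβ hγ t) :=
    ((IsSelfAdjoint.all t).smul hA.neg).exp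
  exact (ContinuousLinearMap.isSelfAdjoint_iff_isSymmetric.1 h1) g h

theorem hasDerivAt_inner_evol (hβ : 0 < β) (hγ : 0 < γ) (k g : L2) (t : ℝ) :
    HasDerivAt (fun s => inner ℝ k (evol hβ hγ s g))
      (-inner ℝ (dissip hβ hγ k) (evol hβ hγ t g)) t := by
  have h := (hasDerivAt_const t k).inner ℝ (hasDerivAt_evol hβ hγ g t)
  rw [inner_dissip_comm]
  simpa using h

theorem inner_evol_eq_zero (hβ : 0 < β) (hγ : 0 < γ) {g : L2}
    (hg : ∀ k, dissip hβ hγ k = 0 → inner ℝ k g = 0) (t : ℝ) {k : L2} (hk : dissip hβ hγ k = 0) :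
    inner ℝ k (evol hβ hγ t g) = 0 := by
  have hd : ∀ s, HasDerivAt (fun s => inner ℝ k (evol hβ hγ s g)) 0 s := fun s => by
    have := hasDerivAt_inner_evol hβ hγ k g s
    rwa [hk, inner_zero_left, neg_zero] at this
  have h := is_const_of_deriv_eq_zero (fun s => (hd s).differentiableAt) (fun s => (hd s).deriv) t 0
  rw [h, evol_zero, one_apply_eq_self, hg k hk]

theorem hasDerivAt_norm_sq_evol (hβ : 0 < β) (hγ : 0 < γ) (g : L2) (t : ℝ) :
    HasDerivAt (fun s => ‖evol hβ hγ s g‖ ^ 2)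
      (-(2 * inner ℝ (dissip hβ hγ (evol hβ hγ t g)) (evol hβ hγ t g))) t := by
  have h := (hasDerivAt_evol hβ hγ g t).norm_sq
  rw [inner_neg_right, real_inner_comm] at h
  convert h using 1; ring

theorem inner_dissip_nonneg (hβ : 0 < β) (hγ : 0 < γ) (g : L2) :
    0 ≤ inner ℝ (dissip hβ hγ g) g := by
  rw [inner_dissip_self]; positivity

theorem norm_evol_le (hβ : 0 < β) (hγ : 0 < γ) (g : L2) {t : ℝ} (ht : 0 ≤ t) :
    ‖evol hβ hγ t g‖ ≤ ‖g‖ := by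
  have h := antitone_of_hasDerivAt_nonpos (hasDerivAt_norm_sq_evol hβ hγ g) (fun s => by
    have := inner_dissip_nonneg hβ hγ (evol hβ hγ s g)
    simp only [Pi.zero_apply]; linarith) ht
  simp only [evol_zero, one_apply_eq_self] at h
  exact (sq_le_sq₀ (norm_nonneg _) (norm_nonneg _)).1 h

/-- Twice the dissipation is minus the derivative of ‖u‖², so by the mean value theorem it is at
most ‖g‖²/t at some earlier time; it does not increase afterwards, since −L is symmetric. -/
theorem inner_dissip_evol_le (hβ : 0 < β) (hγ : 0 < γ) (g : L2) {t : ℝ} (ht : 0 < t) :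
    inner ℝ (dissip hβ hγ (evol hβ hγ t g)) (evol hβ hγ t g) ≤ ‖g‖ ^ 2 / (2 * t) := by
  set f : ℝ → ℝ := fun s => inner ℝ (dissip hβ hγ (evol hβ hγ s g)) (evol hβ hγ s g) with hf
  have hd : ∀ s, HasDerivAt f (-(2 * ‖dissip hβ hγ (evol hβ hγ s g)‖ ^ 2)) s := fun s => by
    have h1 := hasDerivAt_evol hβ hγ g s
    have h := (((dissip hβ hγ).hasFDerivAt.comp_hasDerivAt s h1)).inner ℝ h1
    refine h.congr_deriv ?_
    simp only [Function.comp, map_neg, inner_neg_left, inner_neg_right]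
    rw [inner_dissip_comm hβ hγ (dissip hβ hγ (evol hβ hγ s g)), real_inner_self_eq_norm_sq]
    ring
  have hanti : Antitone f := antitone_of_hasDerivAt_nonpos hd fun s => by
    simp only [Pi.zero_apply]; have := sq_nonneg ‖dissip hβ hγ (evol hβ hγ s g)‖; linarith
  obtain ⟨ξ, hξ, he⟩ := exists_hasDerivAt_eq_slope _ _ ht
    (fun s _ => (hasDerivAt_norm_sq_evol hβ hγ g s).continuousAt.continuousWithinAt)
    (fun s _ => hasDerivAt_norm_sq_evol hβ hγ g s)
  have h1 := hanti hξ.2.le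
  rw [sub_zero, eq_div_iff ht.ne'] at he
  simp only [evol_zero, one_apply_eq_self] at he
  rw [le_div_iff₀ (by positivity)]
  have h2 : f t * (2 * t) ≤ f ξ * (2 * t) := mul_le_mul_of_nonneg_right h1 (by positivity)
  have h3 := sq_nonneg ‖evol hβ hγ t g‖
  have h4 : f ξ * (2 * t) = ‖g‖ ^ 2 - ‖evol hβ hγ t g‖ ^ 2 := by
    simp only [hf]; linarith
  change f t * (2 * t) ≤ _
  linarith

theorem exists_inner_dissip_evol_le (hβ : 0 < β) (hγ : 0 < γ) : ∃ C : ℝ, 0 < C ∧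
    ∀ (g : L2) (t : ℝ), 0 ≤ t →
      inner ℝ (dissip hβ hγ (evol hβ hγ t g)) (evol hβ hγ t g) ≤ C * ‖g‖ ^ 2 / bracket t := by
  set a := ‖dissip hβ hγ‖ with ha
  have a0 : 0 ≤ a := norm_nonneg _
  refine ⟨11 * (1 + a), by positivity, fun g t ht => ?_⟩
  have hn := sq_nonneg ‖g‖
  rw [bracket_of_nonneg ht]
  rcases le_or_gt 1 t with h | h
  · refine (inner_dissip_evol_le hβ hγ g (by linarith)).trans ?_
    rw [div_le_div_iff₀ (by positivity) (by positivity)]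
    have h1 : ‖g‖ ^ 2 * (10 + t) ≤ ‖g‖ ^ 2 * (22 * t) := by gcongr; linarith
    have h2 : 0 ≤ 22 * a * ‖g‖ ^ 2 * t := by positivity
    nlinarith
  · have h1 := norm_evol_le hβ hγ g ht
    have h2 : inner ℝ (dissip hβ hγ (evol hβ hγ t g)) (evol hβ hγ t g) ≤ a * ‖g‖ ^ 2 := by
      calc _ ≤ ‖dissip hβ hγ (evol hβ hγ t g)‖ * ‖evol hβ hγ t g‖ := real_inner_le_norm _ _
        _ ≤ (a * ‖evol hβ hγ t g‖) * ‖evol hβ hγ t g‖ := by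
            gcongr; exact (dissip hβ hγ).le_opNorm _
        _ ≤ (a * ‖g‖) * ‖g‖ := by gcongr
        _ = _ := by ring
    refine h2.trans ?_
    rw [le_div_iff₀ (by positivity)]
    have h3 : a * ‖g‖ ^ 2 * (10 + t) ≤ a * ‖g‖ ^ 2 * 11 := by gcongr; linarith
    nlinarith

theorem exists_decomposition_evol (hβ : 0 < β) (hγ : 0 < γ) : ∃ C : ℝ, 0 < C ∧
    ∀ (g : L2) (t : ℝ), 0 ≤ t → ∃ (n : L2) (q : ℝ), 0 ≤ q ∧ dissip hβ hγ n = 0 ∧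
      (∀ᵐ p, |n p| ≤ q * omega p ^ (-(1 / 6) : ℝ)) ∧
      (∀ θ : ℝ, 0 ≤ θ → θ ≤ 1 →
        Real.sqrt (wsq (5 / 3 * θ) (evol hβ hγ t g - n)) ≤ C * bracket t ^ (-θ / 2) * ‖g‖) ∧
      ((∀ k, dissip hβ hγ k = 0 → inner ℝ k g = 0) → q ≤ C * bracket t ^ (-(3 / 20) : ℝ) * ‖g‖) := by
  obtain ⟨C, C0, hC⟩ := exists_decomposition hβ hγ
  obtain ⟨A, A0, hA⟩ := exists_inner_dissip_evol_le hβ hγ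
  set M : ℝ := Real.sqrt (C * A + C ^ 2) with hM
  have M0 : 0 ≤ M := Real.sqrt_nonneg _
  refine ⟨(1 + C) * (1 + M), by positivity, fun g t ht => ?_⟩
  obtain ⟨n, q, q0, hn, hnq, h1, h2, h3⟩ := hC (evol hβ hγ t g)
  have hb := bracket_pos t
  have key : ∀ θ : ℝ, 0 ≤ θ → θ ≤ 1 →
      Real.sqrt (wsq (5 / 3 * θ) (evol hβ hγ t g - n)) ≤ M * bracket t ^ (-θ / 2) * ‖g‖ := by
    intro θ t0 t1
    have h4 := wsq_interpolation t0 t1 (l := 1 / bracket t) (by positivity) (evol hβ hγ t g - n)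
    have h5 : wsq (5 / 3 * θ) (evol hβ hγ t g - n) ≤ (C * A + C ^ 2) * (bracket t ^ (-θ) * ‖g‖ ^ 2) := by
      have e1 : (1 / bracket t) ^ (θ - 1) * (C * (A * ‖g‖ ^ 2 / bracket t)) =
          C * A * (bracket t ^ (-θ) * ‖g‖ ^ 2) := by
        rw [one_div, Real.inv_rpow hb.le, ← Real.rpow_neg hb.le,
          show -(θ - 1) = -θ + 1 by ring, Real.rpow_add_one hb.ne']
        field_simp
      have e2 : (1 / bracket t) ^ θ * (C * ‖g‖) ^ 2 = C ^ 2 * (bracket t ^ (-θ) * ‖g‖ ^ 2) := by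
        rw [one_div, Real.inv_rpow hb.le, ← Real.rpow_neg hb.le]; ring
      calc _ ≤ _ := h4
        _ ≤ (1 / bracket t) ^ (θ - 1) * (C * (A * ‖g‖ ^ 2 / bracket t)) +
            (1 / bracket t) ^ θ * (C * ‖g‖) ^ 2 := by
            gcongr
            · exact h1.trans (by gcongr; exact hA g t ht)
            · exact h2.trans (by gcongr; exact norm_evol_le hβ hγ g ht)
        _ = _ := by rw [e1, e2]; ring
    refine (Real.sqrt_le_sqrt h5).trans (le_of_eq ?_)
    rw [Real.sqrt_mul (by positivity), Real.sqrt_mul (by positivity), Real.sqrt_sq (norm_nonneg _),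
      Real.sqrt_eq_rpow (bracket t ^ (-θ)), ← Real.rpow_mul hb.le, ← hM]
    rw [mul_assoc, show -θ * (1 / 2) = -θ / 2 by ring]
  refine ⟨n, q, q0, hn, hnq, fun θ t0 t1 => (key θ t0 t1).trans ?_, fun hg => ?_⟩
  · have : M ≤ (1 + C) * (1 + M) := by nlinarith
    gcongr
  · have h4 := h3 fun k hk => inner_evol_eq_zero hβ hγ hg t hk
    -- θ = 3/10 because 5/3 · 3/10 = 1/2, the weight that controls q.
    have h5 := key (3 / 10) (by norm_num) (by norm_num)
    norm_num at h5
    calc q ≤ C * Real.sqrt (wsq (1 / 2) (evol hβ hγ t g - n)) := h4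
      _ ≤ C * (M * bracket t ^ (-(3 / 20) : ℝ) * ‖g‖) := by
          gcongr
      _ = (C * M) * bracket t ^ (-(3 / 20) : ℝ) * ‖g‖ := by ring
      _ ≤ _ := by
          have : C * M ≤ (1 + C) * (1 + M) := by nlinarith
          gcongr

/-- By symmetry ‖e^{tL}g‖² = ⟨g, e^{2tL}g⟩, and the kernel part of e^{2tL}g drops out. Pairing |g| ≤
Nω^ν with the remainder, whose weighted norm decays relative to ‖e^{tL}g‖, leaves one factor
‖e^{tL}g‖ to cancel. -/
theorem exists_norm_evol_le (hβ : 0 < β) (hγ : 0 < γ) : ∃ C : ℝ, 0 < C ∧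
    ∀ ν : ℝ, 0 ≤ ν → ν ≤ 1 / 2 → ∀ (g : L2) (N : ℝ), 0 ≤ N →
      (∀ k, dissip hβ hγ k = 0 → inner ℝ k g = 0) → (∀ᵐ p, |g p| ≤ N * omega p ^ ν) →
      ∀ t : ℝ, 0 ≤ t → ‖evol hβ hγ t g‖ ≤ C * N * bracket t ^ (-(1 / 5 + 3 / 5 * ν)) := by
  obtain ⟨C, C0, hC⟩ := exists_decomposition_evol hβ hγ
  obtain ⟨I, I0, hI⟩ := exists_lintegral_omega_mul_le
  refine ⟨I * C, by positivity, fun ν n0 n1 g N N0 hg hgN t ht => ?_⟩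
  set u := evol hβ hγ t g with hu
  obtain ⟨n, q, -, hn, -, hw, -⟩ := hC u t ht
  have hb := bracket_pos t
  set r := evol hβ hγ t u - n with hr
  have e1 : ‖u‖ ^ 2 = inner ℝ g r := by
    rw [hr, inner_sub_right, real_inner_comm n g, hg n hn, sub_zero, ← inner_evol_comm, ← hu,
      real_inner_self_eq_norm_sq]
  have h1 : ENNReal.ofReal |inner ℝ g r| ≤ ENNReal.ofReal (N * (I * Real.sqrt (wsq (2 / 3 + 2 * ν) r))) := by
    refine (abs_inner_le_lintegral g r).trans ?_
    calc _ ≤ ∫⁻ p, ENNReal.ofReal N * (ENNReal.ofReal (omega p ^ ν) * ‖r p‖ₑ) := by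
          refine lintegral_mono_ae ?_
          filter_upwards [hgN] with p hp
          rw [← mul_assoc, ← ENNReal.ofReal_mul N0]
          refine mul_le_mul' ?_ le_rfl
          rw [← ofReal_norm, Real.norm_eq_abs]
          exact ENNReal.ofReal_le_ofReal hp
      _ ≤ _ := by
          rw [lintegral_const_mul' _ _ ENNReal.ofReal_ne_top, ENNReal.ofReal_mul N0]
          gcongr
          exact hI _ _ (by linarith) (by linarith) _
  have h2 := (ENNReal.ofReal_le_ofReal_iff (by positivity)).1 h1
  -- This θ corresponds to the weight s = 2/3 + 2ν, for which 2ν − s = −2/3 is integrable; θ ≤ 1 is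
  -- exactly ν ≤ 1/2.
  have h3 := hw (2 / 5 + 6 / 5 * ν) (by linarith) (by linarith)
  rw [show 5 / 3 * (2 / 5 + 6 / 5 * ν) = 2 / 3 + 2 * ν by ring,
    show -(2 / 5 + 6 / 5 * ν) / 2 = -(1 / 5 + 3 / 5 * ν) by ring] at h3
  have h4 : ‖u‖ * ‖u‖ ≤ ‖u‖ * (I * C * N * bracket t ^ (-(1 / 5 + 3 / 5 * ν))) := by
    calc ‖u‖ * ‖u‖ = ‖u‖ ^ 2 := by ring
      _ ≤ N * (I * Real.sqrt (wsq (2 / 3 + 2 * ν) r)) := by rw [e1]; exact (le_abs_self _).trans h2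
      _ ≤ N * (I * (C * bracket t ^ (-(1 / 5 + 3 / 5 * ν)) * ‖u‖)) := by gcongr
      _ = _ := by ring
  rcases (norm_nonneg u).eq_or_lt with h | h
  · rw [← h]; positivity
  · exact le_of_mul_le_mul_left h4 h

/-- The decay of the two parts of the solution. -/
theorem exists_decomposition_decay (hβ : 0 < β) (hγ : 0 < γ) : ∃ C : ℝ, 0 < C ∧
    ∀ ν : ℝ, 0 ≤ ν → ν ≤ 1 / 2 → ∀ (g : L2) (N : ℝ), 0 ≤ N →
      (∀ k, dissip hβ hγ k = 0 → inner ℝ k g = 0) → (∀ᵐ p, |g p| ≤ N * omega p ^ ν) →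
      ∀ t : ℝ, 0 ≤ t → ∃ (n : L2) (q : ℝ), 0 ≤ q ∧ dissip hβ hγ n = 0 ∧
        (∀ᵐ p, |n p| ≤ q * omega p ^ (-(1 / 6) : ℝ)) ∧
        q ≤ C * N * bracket t ^ (-(7 / 20 + 3 / 5 * ν)) ∧
        Real.sqrt (wsq (5 / 3) (evol hβ hγ t g - n)) ≤ C * N * bracket t ^ (-(7 / 10 + 3 / 5 * ν)) := by
  obtain ⟨C, C0, hC⟩ := exists_decomposition_evol hβ hγ
  obtain ⟨B, B0, hB⟩ := exists_norm_evol_le hβ hγ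
  refine ⟨2 * C * B, by positivity, fun ν n0 n1 g N N0 hg hgN t ht => ?_⟩
  have ht2 : 0 ≤ t / 2 := by linarith
  set h := evol hβ hγ (t / 2) g with hh
  -- Half of the time is spent on the decay 1/5 + 3ν/5 of the norm, the other half on the smoothing
  -- decay: 3/20 for q and 1/2 for the weight 5/3. The sums are 7/20 + 3ν/5 and 7/10 + 3ν/5.
  have e : evol hβ hγ t g = evol hβ hγ (t / 2) h := by
    rw [hh, ← mul_apply_eq_comp, ← evol_add, add_halves]
  obtain ⟨n, q, q0, hn, hnq, h1, h2⟩ := hC h (t / 2) ht2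
  have hb := bracket_pos t
  have hb2 : bracket t / 2 ≤ bracket (t / 2) := by
    rw [bracket_of_nonneg ht, bracket_of_nonneg ht2]; linarith
  have hN := hB ν n0 n1 g N N0 hg hgN (t / 2) ht2
  have hbt := bracket_pos (t / 2)
  have hrp : ∀ a : ℝ, 0 ≤ a → a ≤ 1 → bracket (t / 2) ^ (-a) ≤ 2 * bracket t ^ (-a) := by
    intro a a0 a1
    calc bracket (t / 2) ^ (-a) ≤ (bracket t / 2) ^ (-a) :=
          Real.rpow_le_rpow_of_nonpos (by positivity) hb2 (by linarith)
      _ = 2 ^ a * bracket t ^ (-a) := by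
          rw [Real.div_rpow hb.le (by norm_num), Real.rpow_neg (by norm_num : (0 : ℝ) ≤ 2),
            div_inv_eq_mul, mul_comm]
      _ ≤ 2 ^ (1 : ℝ) * bracket t ^ (-a) := by
          gcongr
          norm_num
      _ = _ := by rw [Real.rpow_one]
  rw [e]
  have comb : ∀ a : ℝ, 0 ≤ a → a + (1 / 5 + 3 / 5 * ν) ≤ 1 →
      C * bracket (t / 2) ^ (-a) * ‖h‖ ≤ 2 * C * B * N * bracket t ^ (-(a + (1 / 5 + 3 / 5 * ν))) := by
    intro a a0 a1
    calc _ ≤ C * bracket (t / 2) ^ (-a) * (B * N * bracket (t / 2) ^ (-(1 / 5 + 3 / 5 * ν))) := by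
          gcongr
      _ = C * B * N * (bracket (t / 2) ^ (-a) * bracket (t / 2) ^ (-(1 / 5 + 3 / 5 * ν))) := by ring
      _ = C * B * N * bracket (t / 2) ^ (-(a + (1 / 5 + 3 / 5 * ν))) := by
          rw [← Real.rpow_add hbt]; congr 2; ring
      _ ≤ C * B * N * (2 * bracket t ^ (-(a + (1 / 5 + 3 / 5 * ν)))) := by
          gcongr
          exact hrp _ (by linarith) a1
      _ = _ := by ring
  refine ⟨n, q, q0, hn, hnq, ?_, ?_⟩
  · refine (h2 fun k hk => inner_evol_eq_zero hβ hγ hg _ hk).trans ?_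
    refine (comb (3 / 20) (by norm_num) (by linarith)).trans (le_of_eq ?_)
    congr 2; ring
  · have h3 := h1 1 (by norm_num) le_rfl
    rw [mul_one] at h3
    refine h3.trans ?_
    rw [show (-1 : ℝ) / 2 = -(1 / 2) by norm_num]
    refine (comb (1 / 2) (by norm_num) (by linarith)).trans (le_of_eq ?_)
    congr 2; ring

end Decay

/-! ### The loss and the gain part of the operator -/

section Gain

variable {β γ : ℝ}

/-- The multiplier in the loss part of `dissip`. -/
def rateFun (β γ : ℝ) (p : Torus) : ℝ := (rateE β γ p).toReal / rayleighJeans β γ p ^ 2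

theorem measurable_rateFun (β γ : ℝ) : Measurable (rateFun β γ) :=
  (measurable_rateE β γ).ennreal_toReal.div ((measurable_rayleighJeans β γ).pow_const 2)

theorem rateFun_nonneg (β γ : ℝ) (p : Torus) : 0 ≤ rateFun β γ p :=
  div_nonneg ENNReal.toReal_nonneg (sq_nonneg _)

theorem exists_rateFun_bounds (hβ : 0 < β) (hγ : 0 < γ) : ∃ c C : ℝ, 0 < c ∧ 0 < C ∧
    ∀ p : Torus, p ≠ 0 → c * omega p ^ (5 / 3 : ℝ) ≤ rateFun β γ p ∧ rateFun β γ p ≤ C := by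
  obtain ⟨c, c0, hc⟩ := exists_rateE_ge hβ hγ
  have hπ := Real.pi_pos
  refine ⟨c * γ ^ 2, (1 / γ) ^ 4 * (2 * Real.pi) * (β + γ) ^ 2, by positivity, by positivity,
    fun p hp => ?_⟩
  have hw := omega_pos hp
  have hf := rayleighJeans_pos hβ hγ p
  have h1 := rateE_le hβ hγ hp
  have h2 : (rateE β γ p).toReal ≤ (1 / γ) ^ 4 * (2 * Real.pi) :=
    ENNReal.toReal_le_of_le_ofReal (by positivity) h1
  have h3 : c * omega p ^ (5 / 3 : ℝ) ≤ (rateE β γ p).toReal :=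
    (ENNReal.ofReal_le_iff_le_toReal (h1.trans_lt ENNReal.ofReal_lt_top).ne).1 (hc p hp)
  have h4 := inv_rayleighJeans_le hβ hγ p
  have h5 : γ ≤ 1 / rayleighJeans β γ p := by
    rw [le_div_iff₀ hf]
    have := rayleighJeans_le hβ hγ p
    rw [le_div_iff₀ hγ] at this
    linarith
  have e : rateFun β γ p = (rateE β γ p).toReal * (1 / rayleighJeans β γ p) ^ 2 := by
    rw [rateFun]; field_simp
  rw [e]
  constructor
  · calc c * γ ^ 2 * omega p ^ (5 / 3 : ℝ) = c * omega p ^ (5 / 3 : ℝ) * γ ^ 2 := by ring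
      _ ≤ _ := by gcongr
  · gcongr

/-- The p₂ and p₃ terms coincide in absolute value after the exchange and need only the weighted L²
norm w. In the p₁ term, ω^{5/2}|φ|^{5/2} = (ω^{5/3}|φ|)^{1/2}·ω^{5/3}φ², whose integral to the power
2/5 gives X^{1/5}w^{4/5}. The small power of X is what the bootstrap needs. -/
theorem exists_gain_le (hβ : 0 < β) (hγ : 0 < γ) : ∃ C : ℝ, 0 < C ∧
    ∀ (g : L2) (X : ℝ), 0 ≤ X → (∀ᵐ p, omega p ^ (5 / 3 : ℝ) * |g p| ≤ X) →
      ∀ᵐ p, |rateFun β γ p * g p - dissip hβ hγ g p| ≤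
        C * (omega p ^ (1 / 2 : ℝ) * Real.sqrt (wsq (5 / 3) g) +
          omega p ^ (7 / 10 : ℝ) * (Real.sqrt (wsq (5 / 3) g) ^ (4 / 5 : ℝ) * X ^ (1 / 5 : ℝ))) := by
  obtain ⟨C2, C20, hC2⟩ := exists_lintegral_kern_le hβ hγ
  obtain ⟨C1, C10, hC1⟩ := exists_lintegral_kern_mom1_le hβ hγ
  set B := β + γ with hB
  have B0 : 0 < B := by positivity
  refine ⟨B ^ 2 * (2 * C2 + C1), by positivity, fun g X X0 hX => ?_⟩
  set w := Real.sqrt (wsq (5 / 3) g) with hw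
  have w0 : 0 ≤ w := Real.sqrt_nonneg _
  set Φ : Torus → ENNReal := fun p => ‖quot β γ g p‖ₑ with hΦ
  have mq : Measurable (quot β γ g) := measurable_quot (Lp.stronglyMeasurable g).measurable
  have mΦ : Measurable Φ := mq.enorm
  have mo := measurable_omega
  have hΦle : ∀ p, Φ p ≤ ENNReal.ofReal B * ‖g p‖ₑ := fun p => by
    simp only [hΦ]
    rw [← ofReal_norm, ← ofReal_norm, ← ENNReal.ofReal_mul B0.le]
    exact ENNReal.ofReal_le_ofReal (norm_quot_le hβ hγ g p)
  have hsq : ∫⁻ q, ENNReal.ofReal (omega q ^ (5 / 3 : ℝ)) * Φ q ^ 2 ≤ ENNReal.ofReal ((B * w) ^ 2) := by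
    calc _ ≤ ∫⁻ q, ENNReal.ofReal (B ^ 2) * (ENNReal.ofReal (omega q ^ (5 / 3 : ℝ)) * ‖g q‖ₑ ^ 2) := by
          refine lintegral_mono fun q => ?_
          rw [mul_left_comm, ENNReal.ofReal_pow B0.le, ← mul_pow]
          gcongr
          exact hΦle q
      _ = _ := by
          rw [lintegral_const_mul' _ _ ENNReal.ofReal_ne_top, ← ofReal_wsq (by norm_num),
            ← ENNReal.ofReal_mul (by positivity), mul_pow, hw, Real.sq_sqrt (wsq_nonneg _ _)]
  have hA2 : (∫⁻ q, ENNReal.ofReal (omega q ^ (5 / 3 : ℝ)) * Φ q ^ 2) ^ (1 / 2 : ℝ) ≤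
      ENNReal.ofReal (B * w) := by
    calc _ ≤ (ENNReal.ofReal ((B * w) ^ 2)) ^ (1 / 2 : ℝ) := by gcongr
      _ = _ := by
          rw [ENNReal.ofReal_rpow_of_nonneg (by positivity) (by norm_num), ← Real.sqrt_eq_rpow,
            Real.sqrt_sq (by positivity)]
  have hA1 : (∫⁻ q, ENNReal.ofReal (omega q ^ (5 / 2 : ℝ)) * Φ q ^ (5 / 2 : ℝ)) ^ (2 / 5 : ℝ) ≤
      ENNReal.ofReal (B * (w ^ (4 / 5 : ℝ) * X ^ (1 / 5 : ℝ))) := by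
    have h1 : ∫⁻ q, ENNReal.ofReal (omega q ^ (5 / 2 : ℝ)) * Φ q ^ (5 / 2 : ℝ) ≤
        ENNReal.ofReal ((B * X) ^ (1 / 2 : ℝ)) * ENNReal.ofReal ((B * w) ^ 2) := by
      calc _ ≤ ∫⁻ q, ENNReal.ofReal ((B * X) ^ (1 / 2 : ℝ)) *
            (ENNReal.ofReal (omega q ^ (5 / 3 : ℝ)) * Φ q ^ 2) := by
            refine lintegral_mono_ae ?_
            filter_upwards [hX, ae_ne_zero] with q hq hq0
            have ho := omega_pos hq0
            have hφ := norm_quot_le hβ hγ g q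
            set z := ‖quot β γ g q‖ with hz
            have z0 : 0 ≤ z := norm_nonneg _
            have e1 : Φ q = ENNReal.ofReal z := (ofReal_norm _).symm
            rw [e1, ENNReal.ofReal_rpow_of_nonneg z0 (by norm_num), ← ENNReal.ofReal_pow z0,
              ← ENNReal.ofReal_mul (by positivity), ← ENNReal.ofReal_mul (by positivity),
              ← ENNReal.ofReal_mul (by positivity)]
            refine ENNReal.ofReal_le_ofReal ?_
            have e2 : z ^ (5 / 2 : ℝ) = z ^ (1 / 2 : ℝ) * z ^ 2 := by
              rw [← Real.rpow_natCast z 2, ← Real.rpow_add_of_nonneg z0 (by norm_num) (by norm_num)]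
              norm_num
            have e3 : omega q ^ (5 / 2 : ℝ) = (omega q ^ (5 / 3 : ℝ)) ^ (1 / 2 : ℝ) * omega q ^ (5 / 3 : ℝ) := by
              rw [← Real.rpow_mul ho.le, ← Real.rpow_add ho]
              norm_num
            have h2 : omega q ^ (5 / 3 : ℝ) * z ≤ B * X := by
              rw [Real.norm_eq_abs] at hφ
              calc _ ≤ omega q ^ (5 / 3 : ℝ) * (B * |g q|) := by gcongr
                _ = B * (omega q ^ (5 / 3 : ℝ) * |g q|) := by ring
                _ ≤ _ := by gcongr
            calc _ = (omega q ^ (5 / 3 : ℝ) * z) ^ (1 / 2 : ℝ) * (omega q ^ (5 / 3 : ℝ) * z ^ 2) := by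
                  rw [e2, e3, Real.mul_rpow (by positivity) z0]; ring
              _ ≤ _ := by gcongr
        _ = _ := lintegral_const_mul' _ _ ENNReal.ofReal_ne_top
        _ ≤ _ := by gcongr
    calc _ ≤ (ENNReal.ofReal ((B * X) ^ (1 / 2 : ℝ)) * ENNReal.ofReal ((B * w) ^ 2)) ^ (2 / 5 : ℝ) := by
          gcongr
      _ = _ := by
          rw [← ENNReal.ofReal_mul (by positivity), ENNReal.ofReal_rpow_of_nonneg (by positivity) (by norm_num),
            Real.mul_rpow (by positivity) (by positivity), ← Real.rpow_natCast (B * w) 2,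
            ← Real.rpow_mul (by positivity), ← Real.rpow_mul (by positivity),
            Real.mul_rpow B0.le X0, Real.mul_rpow B0.le w0]
          congr 1
          norm_num
          have : B ^ (1 / 5 : ℝ) * B ^ (4 / 5 : ℝ) = B := by
            rw [← Real.rpow_add B0]; norm_num
          calc _ = (B ^ (1 / 5 : ℝ) * B ^ (4 / 5 : ℝ)) * (w ^ (4 / 5 : ℝ) * X ^ (1 / 5 : ℝ)) := by ring
            _ = _ := by rw [this]
  have hK := integrable_kern_mul hβ hγ (integrable_resDiff hβ hγ g)
  filter_upwards [dissip_ae_eq hβ hγ g, hK.prod_right_ae, ae_ne_zero] with p hd hint hp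
  have ho := omega_pos hp
  have hf := rayleighJeans_pos hβ hγ p
  have hfB := inv_rayleighJeans_le hβ hγ p
  set f := rayleighJeans β γ p with hfdef
  have hfin : rateE β γ p < ⊤ := (rateE_le hβ hγ hp).trans_lt ENNReal.ofReal_lt_top
  have hkint : Integrable (kern β γ p) := by
    refine ⟨(measurable_kern_right β γ p).aestronglyMeasurable, ?_⟩
    rw [hasFiniteIntegral_iff_ofReal (Filter.Eventually.of_forall fun q => kern_nonneg hβ hγ p q)]
    exact hfin
  have hkr : ∫ q, kern β γ p q = (rateE β γ p).toReal :=
    integral_eq_lintegral_of_nonneg_ae (Filter.Eventually.of_forall fun q => kern_nonneg hβ hγ p q)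
      (measurable_kern_right β γ p).aestronglyMeasurable
  have e1 : rateFun β γ p * g p - dissip hβ hγ g p =
      ∫ q, kern β γ p q * ((quot β γ g q + quot β γ g (mom3 p q) - quot β γ g (mom1 p q)) * (1 / f)) := by
    have e2 : rateFun β γ p * g p = ∫ q, kern β γ p q * (quot β γ g p * (1 / f)) := by
      rw [integral_mul_const, hkr, rateFun, quot, ← hfdef]
      field_simp
    have hint' : Integrable fun q => kern β γ p q * (resDiff (quot β γ g) (momenta (p, q)) *
      (1 / rayleighJeans β γ p)) := hint
    rw [e2, hd, dissipFun, ← integral_sub (hkint.mul_const _) hint']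
    refine integral_congr_ae (Filter.Eventually.of_forall fun q => ?_)
    simp only [resDiff, momenta]
    ring
  have hk2 := hC2 p hp Φ mΦ
  have hk1 := hC1 p hp Φ mΦ
  have hk3 : ∫⁻ q, ENNReal.ofReal (kern β γ p q) * Φ (mom3 p q) =
      ∫⁻ q, ENNReal.ofReal (kern β γ p q) * Φ q :=
    lintegral_kern_exchange hp fun _ _ z => Φ z
  have mk : Measurable fun q => ENNReal.ofReal (kern β γ p q) := (measurable_kern_right β γ p).ennreal_ofReal
  have h2 : ENNReal.ofReal |rateFun β γ p * g p - dissip hβ hγ g p| ≤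
      ENNReal.ofReal (B * (2 * (C2 * omega p ^ (1 / 2 : ℝ) * (B * w)) +
        C1 * omega p ^ (7 / 10 : ℝ) * (B * (w ^ (4 / 5 : ℝ) * X ^ (1 / 5 : ℝ))))) := by
    rw [e1, ← Real.norm_eq_abs, ofReal_norm]
    calc _ ≤ ∫⁻ q, ENNReal.ofReal B * (ENNReal.ofReal (kern β γ p q) * Φ q +
          ENNReal.ofReal (kern β γ p q) * Φ (mom3 p q) + ENNReal.ofReal (kern β γ p q) * Φ (mom1 p q)) := by
          refine (enorm_integral_le_lintegral_enorm _).trans (lintegral_mono fun q => ?_)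
          rw [enorm_mul, enorm_mul, Real.enorm_of_nonneg (kern_nonneg hβ hγ p q),
            Real.enorm_of_nonneg (by positivity : 0 ≤ 1 / f), mul_comm _ (ENNReal.ofReal (1 / f)),
            mul_left_comm, ← mul_add, ← mul_add]
          refine mul_le_mul' (ENNReal.ofReal_le_ofReal hfB) (mul_le_mul' le_rfl ?_)
          exact (enorm_sub_le).trans (add_le_add (enorm_add_le _ _) le_rfl)
      _ = ENNReal.ofReal B * ((∫⁻ q, ENNReal.ofReal (kern β γ p q) * Φ q) +
          (∫⁻ q, ENNReal.ofReal (kern β γ p q) * Φ q) +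
          ∫⁻ q, ENNReal.ofReal (kern β γ p q) * Φ (mom1 p q)) := by
          have m1 : Measurable fun q => ENNReal.ofReal (kern β γ p q) * Φ q := mk.mul mΦ
          have m2 : Measurable fun q => ENNReal.ofReal (kern β γ p q) * Φ q +
              ENNReal.ofReal (kern β γ p q) * Φ (mom3 p q) :=
            m1.add (mk.mul (mΦ.comp (measurable_mom3_right p)))
          rw [lintegral_const_mul' _ _ ENNReal.ofReal_ne_top, lintegral_add_left m2,
            lintegral_add_left m1, hk3]
      _ ≤ ENNReal.ofReal B * (ENNReal.ofReal (C2 * omega p ^ (1 / 2 : ℝ)) * ENNReal.ofReal (B * w) +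
          ENNReal.ofReal (C2 * omega p ^ (1 / 2 : ℝ)) * ENNReal.ofReal (B * w) +
          ENNReal.ofReal (C1 * omega p ^ (7 / 10 : ℝ)) *
            ENNReal.ofReal (B * (w ^ (4 / 5 : ℝ) * X ^ (1 / 5 : ℝ)))) := by
          have k2 := hk2.trans (mul_le_mul' le_rfl hA2)
          have k1 := hk1.trans (mul_le_mul' le_rfl hA1)
          exact mul_le_mul' le_rfl (add_le_add (add_le_add k2 k2) k1)
      _ = _ := by
          rw [← ENNReal.ofReal_mul (by positivity), ← ENNReal.ofReal_mul (by positivity),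
            ← ENNReal.ofReal_add (by positivity) (by positivity),
            ← ENNReal.ofReal_add (by positivity) (by positivity), ← ENNReal.ofReal_mul B0.le]
          congr 1; ring
  refine ((ENNReal.ofReal_le_ofReal_iff (by positivity)).1 h2).trans ?_
  have p1 : 0 ≤ omega p ^ (1 / 2 : ℝ) * w := by positivity
  have p2 : 0 ≤ omega p ^ (7 / 10 : ℝ) * (w ^ (4 / 5 : ℝ) * X ^ (1 / 5 : ℝ)) := by positivity
  calc _ = B ^ 2 * (2 * C2 * (omega p ^ (1 / 2 : ℝ) * w) +
        C1 * (omega p ^ (7 / 10 : ℝ) * (w ^ (4 / 5 : ℝ) * X ^ (1 / 5 : ℝ)))) := by ring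
    _ ≤ B ^ 2 * ((2 * C2 + C1) * (omega p ^ (1 / 2 : ℝ) * w) +
        (2 * C2 + C1) * (omega p ^ (7 / 10 : ℝ) * (w ^ (4 / 5 : ℝ) * X ^ (1 / 5 : ℝ)))) := by
        gcongr <;> linarith
    _ = _ := by ring

/-! ### Decay of exponentials and convolutions -/

theorem add_le_mul_exp {a c x : ℝ} (ha : 0 ≤ a) (hc : 0 < c) (hx : 0 ≤ x) :
    a + x ≤ (a + 1 / c) * Real.exp (c * x) := by
  have h := Real.add_one_le_exp (c * x)
  have h0 : 0 ≤ c * x := by positivity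
  calc a + x = a * 1 + 1 / c * (c * x) := by field_simp
    _ ≤ a * Real.exp (c * x) + 1 / c * Real.exp (c * x) := by gcongr <;> linarith
    _ = _ := by ring

/-- With y = ω^{5/3}, the claim is that (⟨τ⟩y)^{3m/5}e^{−cτy} is bounded. As y ≤ 1, ⟨τ⟩y ≤ 10 + τy,
and 3m/5 ≤ 2 makes the bound uniform in m. -/
theorem exists_omega_rpow_mul_exp_le {c : ℝ} (hc : 0 < c) : ∃ C : ℝ, 0 < C ∧
    ∀ m : ℝ, 0 ≤ m → m ≤ 2 → ∀ τ : ℝ, 0 ≤ τ → ∀ p : Torus, p ≠ 0 →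
      omega p ^ m * Real.exp (-(τ * (c * omega p ^ (5 / 3 : ℝ)))) ≤ C * bracket τ ^ (-(3 / 5 * m)) := by
  refine ⟨(10 + 1 / (c / 2)) ^ 2, by positivity, fun m m0 m2 τ hτ p hp => ?_⟩
  have ho := omega_pos hp
  have hb := bracket_pos τ
  set y := omega p ^ (5 / 3 : ℝ) with hy
  have y0 : 0 < y := by positivity
  have y1 : y ≤ 1 := Real.rpow_le_one ho.le (omega_le_one p) (by norm_num)
  have e : omega p ^ m = y ^ (3 / 5 * m) := by
    rw [hy, ← Real.rpow_mul ho.le]; congr 1; ring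
  have h1 : bracket τ * y ≤ 10 + τ * y := by
    rw [bracket_of_nonneg hτ]; nlinarith
  have h2 : (bracket τ * y) ^ (3 / 5 * m) ≤ (10 + τ * y) ^ 2 := by
    have : 1 ≤ 10 + τ * y := by have : 0 ≤ τ * y := by positivity
                                linarith
    calc _ ≤ (10 + τ * y) ^ (3 / 5 * m) := by gcongr
      _ ≤ (10 + τ * y) ^ (2 : ℝ) := Real.rpow_le_rpow_of_exponent_le this (by linarith)
      _ = _ := by norm_num
  have h3 := add_le_mul_exp (a := 10) (c := c / 2) (x := τ * y) (by norm_num) (by positivity) (by positivity)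
  rw [e, Real.rpow_neg hb.le, ← div_eq_mul_inv, le_div_iff₀ (by positivity), Real.exp_neg]
  have hE := Real.exp_pos (τ * (c * y))
  calc _ = (bracket τ * y) ^ (3 / 5 * m) * (Real.exp (τ * (c * y)))⁻¹ := by
        rw [Real.mul_rpow hb.le y0.le]; ring
    _ ≤ ((10 + 1 / (c / 2)) * Real.exp (c / 2 * (τ * y))) ^ 2 * (Real.exp (τ * (c * y)))⁻¹ := by
        gcongr
        refine h2.trans ?_
        have : 0 ≤ τ * y := by positivity
        gcongr
    _ = _ := by
        rw [mul_pow, ← Real.exp_nat_mul, show ((2 : ℕ) : ℝ) * (c / 2 * (τ * y)) = τ * (c * y) by push_cast; ring]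
        field_simp

/-- Decay of the semigroup of the loss part. -/
theorem exists_omega_rpow_mul_exp_rateFun_le (hβ : 0 < β) (hγ : 0 < γ) : ∃ C : ℝ, 0 < C ∧
    ∀ m : ℝ, 0 ≤ m → m ≤ 2 → ∀ τ : ℝ, 0 ≤ τ → ∀ p : Torus, p ≠ 0 →
      omega p ^ m * Real.exp (-(τ * rateFun β γ p)) ≤ C * bracket τ ^ (-(3 / 5 * m)) ∧
      omega p ^ m * (rateFun β γ p * Real.exp (-(τ * rateFun β γ p))) ≤
        C * bracket τ ^ (-(1 + 3 / 5 * m)) := by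
  obtain ⟨c, R, c0, R0, hcR⟩ := exists_rateFun_bounds hβ hγ
  obtain ⟨C, C0, hC⟩ := exists_omega_rpow_mul_exp_le c0
  obtain ⟨D, D0, hD⟩ := exists_omega_rpow_mul_exp_le (c := c / 2) (by positivity)
  set K := 10 * R + 1 / (1 / 2) with hK
  have K0 : 0 < K := by positivity
  refine ⟨C + K * D, by positivity, fun m m0 m2 τ hτ p hp => ?_⟩
  have ho := omega_pos hp
  have hb := bracket_pos τ
  obtain ⟨h1, h2⟩ := hcR p hp
  set α := rateFun β γ p with hα
  have α0 : 0 ≤ α := rateFun_nonneg β γ p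
  constructor
  · calc _ ≤ omega p ^ m * Real.exp (-(τ * (c * omega p ^ (5 / 3 : ℝ)))) := by gcongr
      _ ≤ C * bracket τ ^ (-(3 / 5 * m)) := hC m m0 m2 τ hτ p hp
      _ ≤ _ := by
          gcongr
          have : 0 < K * D := by positivity
          linarith
  · have h3 : α * Real.exp (-(τ * α / 2)) ≤ K * bracket τ ^ (-1 : ℝ) := by
      have h4 := add_le_mul_exp (a := 10 * R) (c := 1 / 2) (x := τ * α) (by positivity) (by norm_num) (by positivity)
      have h5 : bracket τ * α ≤ 10 * R + τ * α := by
        rw [bracket_of_nonneg hτ]; nlinarith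
      rw [Real.rpow_neg_one, ← div_eq_mul_inv, le_div_iff₀ hb, Real.exp_neg]
      calc _ = bracket τ * α * (Real.exp (τ * α / 2))⁻¹ := by ring
        _ ≤ K * Real.exp (1 / 2 * (τ * α)) * (Real.exp (τ * α / 2))⁻¹ := by
            exact mul_le_mul_of_nonneg_right (h5.trans h4) (by positivity)
        _ = _ := by
            rw [show 1 / 2 * (τ * α) = τ * α / 2 by ring, mul_assoc, mul_inv_cancel₀ (Real.exp_pos _).ne',
              mul_one]
    have h6 : omega p ^ m * Real.exp (-(τ * α / 2)) ≤ D * bracket τ ^ (-(3 / 5 * m)) := by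
      refine le_trans ?_ (hD m m0 m2 τ hτ p hp)
      gcongr
      calc τ * (c / 2 * omega p ^ (5 / 3 : ℝ)) = τ * (c * omega p ^ (5 / 3 : ℝ)) / 2 := by ring
        _ ≤ _ := by gcongr
    calc _ = (omega p ^ m * Real.exp (-(τ * α / 2))) * (α * Real.exp (-(τ * α / 2))) := by
          rw [show Real.exp (-(τ * α)) = Real.exp (-(τ * α / 2)) * Real.exp (-(τ * α / 2)) by
            rw [← Real.exp_add]; congr 1; ring]
          ring
      _ ≤ D * bracket τ ^ (-(3 / 5 * m)) * (K * bracket τ ^ (-1 : ℝ)) := by gcongr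
      _ = K * D * bracket τ ^ (-(1 + 3 / 5 * m)) := by
          rw [show -(1 + 3 / 5 * m) = -(3 / 5 * m) + (-1) by ring, Real.rpow_add hb]; ring
      _ ≤ _ := by
          gcongr
          linarith

theorem continuous_bracket : Continuous bracket := by unfold bracket; fun_prop

theorem continuous_bracket_rpow (a : ℝ) : Continuous fun s => bracket s ^ a :=
  continuous_bracket.rpow_const fun s => Or.inl (bracket_pos s).ne'

theorem integral_bracket_rpow_le {δ a t : ℝ} (hδ : 0 < δ) (ha : a ≤ 1 - δ) (ht : 0 ≤ t) :
    ∫ s in (0 : ℝ)..t, bracket s ^ (-a) ≤ 1 / δ * bracket t ^ (1 - a) := by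
  have e : ∫ s in (0 : ℝ)..t, bracket s ^ (-a) = ∫ s in (0 : ℝ)..t, (10 + s) ^ (-a) := by
    refine intervalIntegral.integral_congr fun s hs => ?_
    rw [uIcc_of_le ht] at hs
    simp only [bracket_of_nonneg hs.1]
  rw [e, intervalIntegral.integral_comp_add_left (fun x => x ^ (-a)), integral_rpow (Or.inl (by linarith)),
    show -a + 1 = 1 - a by ring, ← bracket_of_nonneg ht]
  have h1 : 0 ≤ (10 + 0 : ℝ) ^ (1 - a) := by positivity
  have hb := bracket_pos t
  rw [div_mul_eq_mul_div, one_mul]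
  calc _ ≤ bracket t ^ (1 - a) / (1 - a) := by
        gcongr
        · linarith
        · linarith
    _ ≤ _ := by
        gcongr
        linarith

/-- One of s and t − s is at least t/2, so one factor can be frozen at time t and the other
integrated. Exponents at most 1 − δ keep the integral a power, with constant 1/δ uniform in the
exponents. -/
theorem integral_bracket_mul_bracket_le {δ a b t : ℝ} (hδ : 0 < δ) (a0 : 0 ≤ a) (b0 : 0 ≤ b)
    (ha : a ≤ 1 - δ) (hb : b ≤ 1 - δ) (ht : 0 ≤ t) :
    ∫ s in (0 : ℝ)..t, bracket (t - s) ^ (-a) * bracket s ^ (-b) ≤ 4 / δ * bracket t ^ (1 - a - b) := by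
  have hB := bracket_pos t
  have c1 : Continuous fun s => bracket (t - s) ^ (-a) :=
    (continuous_bracket_rpow (-a)).comp (by fun_prop)
  have c2 := continuous_bracket_rpow (-b)
  have half : ∀ {x r : ℝ}, t / 2 ≤ r → 0 ≤ x → x ≤ 1 - δ → bracket r ^ (-x) ≤ 2 * bracket t ^ (-x) := by
    intro x r hr x0 x1
    calc bracket r ^ (-x) ≤ (bracket t / 2) ^ (-x) := by
          refine Real.rpow_le_rpow_of_nonpos (by positivity) ?_ (by linarith)
          rw [bracket_of_nonneg ht, bracket_of_nonneg (by linarith)]; linarith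
      _ = 2 ^ x * bracket t ^ (-x) := by
          rw [Real.div_rpow hB.le (by norm_num), Real.rpow_neg (by norm_num : (0 : ℝ) ≤ 2),
            div_inv_eq_mul, mul_comm]
      _ ≤ 2 ^ (1 : ℝ) * bracket t ^ (-x) := by
          gcongr
          · norm_num
          · linarith
      _ = _ := by rw [Real.rpow_one]
  calc _ ≤ ∫ s in (0 : ℝ)..t, (2 * bracket t ^ (-a) * bracket s ^ (-b) +
        2 * bracket t ^ (-b) * bracket (t - s) ^ (-a)) := by
        refine intervalIntegral.integral_mono_on ht ((c1.mul c2).intervalIntegrable _ _)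
          (((c2.const_mul _).add (c1.const_mul _)).intervalIntegrable _ _) fun s hs => ?_
        have p1 := bracket_pos s
        have p2 := bracket_pos (t - s)
        rcases le_total (t / 2) s with h | h
        · have := half h b0 hb
          have k : 0 ≤ 2 * bracket t ^ (-a) * bracket s ^ (-b) := by positivity
          calc _ ≤ bracket (t - s) ^ (-a) * (2 * bracket t ^ (-b)) := by gcongr
            _ ≤ _ := by linarith
        · have := half (r := t - s) (by linarith) a0 ha
          have k : 0 ≤ 2 * bracket t ^ (-b) * bracket (t - s) ^ (-a) := by positivity
          calc _ ≤ 2 * bracket t ^ (-a) * bracket s ^ (-b) := by gcongr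
            _ ≤ _ := by linarith
    _ = 2 * bracket t ^ (-a) * (∫ s in (0 : ℝ)..t, bracket s ^ (-b)) +
        2 * bracket t ^ (-b) * ∫ s in (0 : ℝ)..t, bracket s ^ (-a) := by
        rw [intervalIntegral.integral_add ((c2.const_mul _).intervalIntegrable _ _)
          ((c1.const_mul _).intervalIntegrable _ _), intervalIntegral.integral_const_mul,
          intervalIntegral.integral_const_mul,
          intervalIntegral.integral_comp_sub_left (fun s => bracket s ^ (-a)), sub_self, sub_zero]
    _ ≤ 2 * bracket t ^ (-a) * (1 / δ * bracket t ^ (1 - b)) +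
        2 * bracket t ^ (-b) * (1 / δ * bracket t ^ (1 - a)) := by
        gcongr
        · exact integral_bracket_rpow_le hδ hb ht
        · exact integral_bracket_rpow_le hδ ha ht
    _ = _ := by
        have e1 : bracket t ^ (-a) * bracket t ^ (1 - b) = bracket t ^ (1 - a - b) := by
          rw [← Real.rpow_add hB]; congr 1; ring
        have e2 : bracket t ^ (-b) * bracket t ^ (1 - a) = bracket t ^ (1 - a - b) := by
          rw [← Real.rpow_add hB]; congr 1; ring
        calc _ = 2 / δ * (bracket t ^ (-a) * bracket t ^ (1 - b)) +
              2 / δ * (bracket t ^ (-b) * bracket t ^ (1 - a)) := by ring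
          _ = _ := by rw [e1, e2]; ring

end Gain

/-! ### Bounded functions as elements of `L²` -/

section Bounded

/-- The class in `L²` of a bounded measurable function. -/
def bddL2 (a : Torus → ℝ) : L2 :=
  open Classical in if h : MemLp a 2 volume then h.toLp a else 0

variable {a b : Torus → ℝ} {M R : ℝ}

theorem coeFn_bddL2 (ha : Measurable a) (h : ∀ᵐ p, |a p| ≤ M) : bddL2 a =ᵐ[volume] a := by
  have hm : MemLp a 2 volume := MemLp.of_bound ha.aestronglyMeasurable M h
  rw [bddL2, dif_pos hm]
  exact hm.coeFn_toLp

/-- The square root of the total mass of the torus. -/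
def rootMass : ℝ := (measureUnivNNReal (volume : Measure Torus) : ℝ) ^ ((2 : ENNReal).toReal)⁻¹

theorem rootMass_nonneg : 0 ≤ rootMass := by unfold rootMass; positivity

theorem norm_le_rootMass_mul {g : L2} (hM : 0 ≤ M) (h : ∀ᵐ p, |g p| ≤ M) : ‖g‖ ≤ rootMass * M :=
  Lp.norm_le_of_ae_bound hM h

theorem ae_abs_exp_le (h : ∀ᵐ p, |a p| ≤ R) (hb : ∀ᵐ p, |b p| ≤ M) (τ : ℝ) :
    ∀ᵐ p, |Real.exp (-(τ * a p)) * b p| ≤ Real.exp (|τ| * R) * M := by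
  filter_upwards [h, hb] with p h1 h2
  rw [abs_mul, Real.abs_exp]
  gcongr
  calc -(τ * a p) ≤ |τ * a p| := neg_le_abs _
    _ ≤ _ := by rw [abs_mul]; gcongr

/-- The multiplier is bounded, so the second-order Taylor remainder of the exponential is uniform in
p and the derivative exists in L² norm. -/
theorem hasDerivAt_bddL2_exp (ha : Measurable a) (h : ∀ᵐ p, |a p| ≤ R) (hR : 0 ≤ R)
    (hbm : Measurable b) (hb : ∀ᵐ p, |b p| ≤ M) (hM : 0 ≤ M) (τ : ℝ) :
    HasDerivAt (fun τ => bddL2 fun p => Real.exp (-(τ * a p)) * b p)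
      (bddL2 fun p => Real.exp (-(τ * a p)) * (-(a p * b p))) τ := by
  have mE : ∀ σ, Measurable fun p => Real.exp (-(σ * a p)) := fun σ =>
    Real.measurable_exp.comp (ha.const_mul σ).neg
  have mEb : ∀ σ, Measurable fun p => Real.exp (-(σ * a p)) * b p := fun σ => (mE σ).mul hbm
  have mEab : Measurable fun p => Real.exp (-(τ * a p)) * (-(a p * b p)) :=
    (mE τ).mul (ha.mul hbm).neg
  have hab : ∀ᵐ p, |-(a p * b p)| ≤ R * M := by
    filter_upwards [h, hb] with p h1 h2
    rw [abs_neg, abs_mul]; gcongr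
  rw [hasDerivAt_iff_isLittleO_nhds_zero]
  refine Asymptotics.IsBigO.trans_isLittleO (g := fun x : ℝ => x ^ 2) ?_
    (by simpa using Asymptotics.isLittleO_pow_id (𝕜 := ℝ) (n := 2) (by norm_num))
  refine Asymptotics.IsBigO.of_bound (rootMass * (Real.exp (|τ| * R) * R ^ 2 * M)) ?_
  have hnear : ∀ᶠ x : ℝ in nhds 0, |x| * R ≤ 1 := by
    have : ContinuousAt (fun x : ℝ => |x| * R) 0 := by fun_prop
    exact this.eventually_le_const (by simp)
  filter_upwards [hnear] with x hx
  have e : ∀ᵐ p, ((bddL2 fun p => Real.exp (-((τ + x) * a p)) * b p) -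
      (bddL2 fun p => Real.exp (-(τ * a p)) * b p) -
      x • bddL2 fun p => Real.exp (-(τ * a p)) * (-(a p * b p)) : L2) p =
      Real.exp (-(τ * a p)) * ((Real.exp (-(x * a p)) - 1 - -(x * a p)) * b p) := by
    filter_upwards [coeFn_bddL2 (mEb (τ + x)) (ae_abs_exp_le h hb (τ + x)),
      coeFn_bddL2 (mEb τ) (ae_abs_exp_le h hb τ),
      coeFn_bddL2 mEab (ae_abs_exp_le h hab τ),
      Lp.coeFn_sub ((bddL2 fun p => Real.exp (-((τ + x) * a p)) * b p) -
        (bddL2 fun p => Real.exp (-(τ * a p)) * b p))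
        (x • bddL2 fun p => Real.exp (-(τ * a p)) * (-(a p * b p))),
      Lp.coeFn_sub (bddL2 fun p => Real.exp (-((τ + x) * a p)) * b p)
        (bddL2 fun p => Real.exp (-(τ * a p)) * b p),
      Lp.coeFn_smul x (bddL2 fun p => Real.exp (-(τ * a p)) * (-(a p * b p)))] with p h1 h2 h3 h4 h5 h6
    simp only [Pi.sub_apply, Pi.smul_apply, smul_eq_mul] at h4 h5 h6
    rw [h4, h5, h6]
    rw [h1, h2, h3, show -((τ + x) * a p) = -(τ * a p) + -(x * a p) by ring, Real.exp_add]
    ring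
  calc _ ≤ rootMass * (Real.exp (|τ| * R) * ((|x| * R) ^ 2 * M)) := by
        refine norm_le_rootMass_mul (by positivity) ?_
        have hq : ∀ᵐ p, |(Real.exp (-(x * a p)) - 1 - -(x * a p)) * b p| ≤ (|x| * R) ^ 2 * M := by
          filter_upwards [h, hb] with p h1 h2
          have h3 : |-(x * a p)| ≤ |x| * R := by rw [abs_neg, abs_mul]; gcongr
          rw [abs_mul]
          refine mul_le_mul ((Real.abs_exp_sub_one_sub_id_le (h3.trans hx)).trans ?_) h2
            (abs_nonneg _) (by positivity)
          rw [← sq_abs (-(x * a p))]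
          gcongr
        filter_upwards [e, ae_abs_exp_le h hq τ] with p h1 h2
        rw [h1]; exact h2
    _ = _ := by
        rw [mul_pow, norm_pow, Real.norm_eq_abs]; ring

theorem inner_bddL2 (g : L2) (ha : Measurable a) (h : ∀ᵐ p, |a p| ≤ M) :
    Integrable (fun p => g p * a p) ∧ inner ℝ g (bddL2 a) = ∫ p, g p * a p := by
  have e : (fun p => inner ℝ (g p) (bddL2 a p)) =ᵐ[volume] fun p => g p * a p := by
    filter_upwards [coeFn_bddL2 ha h] with p hp
    rw [hp, real_inner_eq_re_inner, RCLike.inner_apply]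
    simp [mul_comm]
  exact ⟨(L2.integrable_inner (𝕜 := ℝ) g (bddL2 a)).congr e, by rw [L2.inner_def, integral_congr_ae e]⟩

/-- Pointwise bounds by duality. -/
theorem ae_abs_le_of_forall_inner {g : L2} {m : Torus → ℝ} (hm : Integrable m)
    (h : ∀ S, MeasurableSet S → |inner ℝ g (bddL2 (S.indicator 1))| ≤ ∫ p in S, m p) :
    ∀ᵐ p, |g p| ≤ m p := by
  have hg : Integrable g := (Lp.memLp g).integrable (by norm_num)
  have e : ∀ S, MeasurableSet S → inner ℝ g (bddL2 (S.indicator 1)) = ∫ p in S, g p := fun S hS => by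
    rw [(inner_bddL2 (M := 1) g (measurable_one.indicator hS)
      (Filter.Eventually.of_forall fun p => ?_)).2, ← integral_indicator hS]
    · refine integral_congr_ae (Filter.Eventually.of_forall fun p => ?_)
      by_cases hp : p ∈ S <;> simp [hp]
    · by_cases hp : p ∈ S <;> simp [hp]
  have h1 := ae_le_of_forall_setIntegral_le hg hm fun S hS _ => by
    rw [← e S hS]; exact (le_abs_self _).trans (h S hS)
  have h2 := ae_le_of_forall_setIntegral_le hg.neg hm fun S hS _ => by
    simp only [Pi.neg_apply]
    rw [integral_neg, ← e S hS]; exact (neg_le_abs _).trans (h S hS)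
  filter_upwards [h1, h2] with p p1 p2
  exact abs_le.2 ⟨by have : -(g p) ≤ m p := p2
                     linarith, p1⟩

end Bounded

/-! ### Duhamel's formula and bounded solutions -/

section Pointwise

variable {β γ : ℝ}

/-- A pointwise Duhamel estimate. -/
theorem ae_abs_evol_le (hβ : 0 < β) (hγ : 0 < γ) {W : Torus → ℝ} (hW : Integrable W)
    {g : L2} {t a₀ : ℝ} (ht : 0 ≤ t) {b : ℝ → ℝ} (hb : IntervalIntegrable b volume 0 t)
    (h0 : ∀ᵐ p, |g p| * Real.exp (-(t * rateFun β γ p)) ≤ a₀ * W p)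
    (h1 : ∀ s ∈ Ioc 0 t, ∀ᵐ p, |rateFun β γ p * evol hβ hγ s g p - dissip hβ hγ (evol hβ hγ s g) p| *
      Real.exp (-((t - s) * rateFun β γ p)) ≤ b s * W p) :
    ∀ᵐ p, |evol hβ hγ t g p| ≤ (a₀ + ∫ s in (0 : ℝ)..t, b s) * W p := by
  refine ae_abs_le_of_forall_inner (hW.const_mul _) fun S hS => ?_
  obtain ⟨c, R, c0, R0, hcR⟩ := exists_rateFun_bounds hβ hγ
  set α := rateFun β γ with hα
  have mα : Measurable α := measurable_rateFun β γ
  have hαR : ∀ᵐ p, |α p| ≤ R := by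
    filter_upwards [ae_ne_zero] with p hp
    rw [abs_of_nonneg (rateFun_nonneg β γ p)]
    exact (hcR p hp).2
  set χ : Torus → ℝ := S.indicator 1 with hχ
  have mχ : Measurable χ := measurable_one.indicator hS
  have χ1 : ∀ᵐ p, |χ p| ≤ 1 := Filter.Eventually.of_forall fun p => by
    by_cases hp : p ∈ S <;> simp [hχ, hp]
  have mαχ : Measurable fun p => -(α p * χ p) := (mα.mul mχ).neg
  have αχ1 : ∀ᵐ p, |-(α p * χ p)| ≤ R * 1 := by
    filter_upwards [hαR, χ1] with p h1 h2
    rw [abs_neg, abs_mul]; gcongr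
  have mE : ∀ σ, Measurable fun p => Real.exp (-(σ * α p)) := fun σ =>
    Real.measurable_exp.comp (mα.const_mul σ).neg
  have mEχ : ∀ σ, Measurable fun p => Real.exp (-(σ * α p)) * χ p := fun σ => (mE σ).mul mχ
  have mEαχ : ∀ σ, Measurable fun p => Real.exp (-(σ * α p)) * (-(α p * χ p)) :=
    fun σ => (mE σ).mul mαχ
  set H : ℝ → L2 := fun τ => bddL2 fun p => Real.exp (-(τ * α p)) * χ p with hH
  set H' : ℝ → L2 := fun τ => bddL2 fun p => Real.exp (-(τ * α p)) * (-(α p * χ p)) with hH'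
  have dH : ∀ τ, HasDerivAt H (H' τ) τ := fun τ =>
    hasDerivAt_bddL2_exp mα hαR R0.le mχ χ1 zero_le_one τ
  have cH : Continuous H := continuous_iff_continuousAt.2 fun τ => (dH τ).continuousAt
  have cH' : Continuous H' := continuous_iff_continuousAt.2 fun τ =>
    (hasDerivAt_bddL2_exp mα hαR R0.le mαχ αχ1 (by positivity) τ).continuousAt
  have du := hasDerivAt_evol hβ hγ g
  have cu : Continuous fun s => evol hβ hγ s g := continuous_iff_continuousAt.2 fun s => (du s).continuousAt
  -- Duhamel's formula by duality: u(s) is tested against e^{−(t−s)α}χ_S. The loss terms cancel in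
  -- F', leaving the pairing with αu + Lu. Bounds over every measurable S give a bound almost
  -- everywhere at the single time t, so no joint measurability of u in time and space is needed.
  set F : ℝ → ℝ := fun s => inner ℝ (evol hβ hγ s g) (H (t - s)) with hF
  set F' : ℝ → ℝ := fun s => inner ℝ (evol hβ hγ s g) (-H' (t - s)) +
    inner ℝ (-dissip hβ hγ (evol hβ hγ s g)) (H (t - s)) with hF'
  have dF : ∀ s, HasDerivAt F (F' s) s := fun s => by
    have h2 : HasDerivAt (fun s => H (t - s)) (-H' (t - s)) s := by
      have := (dH (t - s)).scomp s ((hasDerivAt_id s).const_sub t)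
      rw [neg_one_smul] at this
      exact this
    exact (du s).inner ℝ h2
  have cts : Continuous fun s : ℝ => t - s := by fun_prop
  have cF' : Continuous F' :=
    (cu.inner (cH'.comp cts).neg).add (((dissip hβ hγ).continuous.comp cu).neg.inner (cH.comp cts))
  have ftc := intervalIntegral.integral_eq_sub_of_hasDerivAt (a := 0) (b := t) (fun s _ => dF s)
    (cF'.intervalIntegrable _ _)
  have test : ∀ {k : L2} {f : Torus → ℝ} {τ x : ℝ}, (∀ᵐ p, k p = f p) →
      (∀ᵐ p, |f p| * Real.exp (-(τ * α p)) ≤ x * W p) → |inner ℝ k (H τ)| ≤ x * ∫ p in S, W p := by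
    intro k f τ x hk hf
    rw [(inner_bddL2 k (mEχ τ) (ae_abs_exp_le hαR χ1 τ)).2, ← integral_const_mul,
      ← integral_indicator hS, ← Real.norm_eq_abs]
    refine norm_integral_le_of_norm_le ((hW.const_mul x).indicator hS) ?_
    filter_upwards [hk, hf] with p h1 h2
    by_cases hp : p ∈ S
    · simp only [hχ, hp, indicator_of_mem, Pi.one_apply, mul_one, norm_mul, h1,
        Real.norm_eq_abs, Real.abs_exp]
      exact h2
    · simp [hχ, hp]
  have bF0 : |F 0| ≤ a₀ * ∫ p in S, W p := by
    simp only [hF, evol_zero, one_apply_eq_self, sub_zero]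
    exact test (Filter.Eventually.of_forall fun p => rfl) h0
  have bF' : ∀ s ∈ Ioc 0 t, ‖F' s‖ ≤ b s * ∫ p in S, W p := by
    intro s hs
    set u := evol hβ hγ s g with hu
    set τ := t - s with hτ
    have k1 := inner_bddL2 u (mEαχ τ) (ae_abs_exp_le hαR αχ1 τ)
    have k2 := inner_bddL2 (-dissip hβ hγ u) (mEχ τ) (ae_abs_exp_le hαR χ1 τ)
    have e1 : F' s = ∫ p, S.indicator (fun p => (α p * u p - dissip hβ hγ u p) *
        Real.exp (-(τ * α p))) p := by
      simp only [hF', ← hu, ← hτ]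
      have k3 := k1.1.neg
      simp only [Pi.neg_def] at k3
      rw [inner_neg_right, k1.2, k2.2, ← integral_neg, ← integral_add k3 k2.1]
      refine integral_congr_ae ?_
      filter_upwards [Lp.coeFn_neg (dissip hβ hγ u)] with p hp
      by_cases hpS : p ∈ S
      · simp only [hp, hχ, hpS, indicator_of_mem, Pi.neg_apply, Pi.one_apply]
        ring
      · simp [hχ, hpS]
    rw [e1, ← integral_const_mul, ← integral_indicator hS]
    refine norm_integral_le_of_norm_le ((hW.const_mul _).indicator hS) ?_
    filter_upwards [h1 s hs] with p hp
    by_cases hpS : p ∈ S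
    · simp only [hpS, indicator_of_mem, norm_mul, Real.norm_eq_abs, Real.abs_exp]
      exact hp
    · simp [hpS]
  have bI : |∫ s in (0 : ℝ)..t, F' s| ≤ (∫ s in (0 : ℝ)..t, b s) * ∫ p in S, W p := by
    rw [← intervalIntegral.integral_mul_const, ← Real.norm_eq_abs]
    exact intervalIntegral.norm_integral_le_of_norm_le ht (Filter.Eventually.of_forall bF') (hb.mul_const _)
  have eF : inner ℝ (evol hβ hγ t g) (bddL2 χ) = F t := by
    simp only [hF, hH, sub_self, zero_mul, neg_zero, Real.exp_zero, one_mul]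
  rw [integral_const_mul, eF, show F t = F 0 + ∫ s in (0 : ℝ)..t, F' s by rw [ftc]; ring, add_mul]
  exact (abs_add_le _ _).trans (add_le_add bF0 bI)

theorem exists_abs_dissip_le (hβ : 0 < β) (hγ : 0 < γ) : ∃ C : ℝ, 0 < C ∧ ∀ (g : L2) (M : ℝ), 0 ≤ M →
    (∀ᵐ p, |g p| ≤ M) → ∀ᵐ p, |dissip hβ hγ g p| ≤ C * M := by
  obtain ⟨c, R, c0, R0, hcR⟩ := exists_rateFun_bounds hβ hγ
  obtain ⟨C, C0, hC⟩ := exists_gain_le hβ hγ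
  set v := rootMass with hv
  have v0 : 0 ≤ v := rootMass_nonneg
  refine ⟨R + C * (v + v ^ (4 / 5 : ℝ)), by positivity, fun g M M0 hM => ?_⟩
  have hw : Real.sqrt (wsq (5 / 3) g) ≤ v * M := by
    refine Real.sqrt_le_iff.2 ⟨by positivity, ?_⟩
    have h1 := norm_le_rootMass_mul M0 hM
    have h2 := lintegral_omega_enorm_sq_le (s := 5 / 3) (by norm_num) g
    rw [← ofReal_wsq (by norm_num), ← ofReal_norm, ← ENNReal.ofReal_pow (norm_nonneg _),
      ENNReal.ofReal_le_ofReal_iff (by positivity)] at h2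
    exact h2.trans (by gcongr)
  have hX : ∀ᵐ p, omega p ^ (5 / 3 : ℝ) * |g p| ≤ M := by
    filter_upwards [hM] with p hp
    calc _ ≤ 1 * M := by
          gcongr
          exact omega_rpow_le_one (by norm_num) p
      _ = M := one_mul M
  filter_upwards [hC g M M0 hX, hM, ae_ne_zero] with p h1 h2 hp
  have h3 : |rateFun β γ p * g p| ≤ R * M := by
    rw [abs_mul, abs_of_nonneg (rateFun_nonneg β γ p)]
    gcongr
    exact (hcR p hp).2
  have o1 : omega p ^ (1 / 2 : ℝ) ≤ 1 := omega_rpow_le_one (by norm_num) p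
  have o2 : omega p ^ (7 / 10 : ℝ) ≤ 1 := omega_rpow_le_one (by norm_num) p
  have h4 : Real.sqrt (wsq (5 / 3) g) ^ (4 / 5 : ℝ) * M ^ (1 / 5 : ℝ) ≤ v ^ (4 / 5 : ℝ) * M := by
    calc _ ≤ (v * M) ^ (4 / 5 : ℝ) * M ^ (1 / 5 : ℝ) := by gcongr
      _ = v ^ (4 / 5 : ℝ) * (M ^ (4 / 5 : ℝ) * M ^ (1 / 5 : ℝ)) := by
          rw [Real.mul_rpow v0 M0]; ring
      _ = _ := by
          rw [← Real.rpow_add_of_nonneg M0 (by norm_num) (by norm_num)]; norm_num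
  have h5 : |rateFun β γ p * g p - dissip hβ hγ g p| ≤ C * (v + v ^ (4 / 5 : ℝ)) * M := by
    refine h1.trans ?_
    have ho := omega_nonneg p
    calc _ ≤ C * (1 * (v * M) + 1 * (v ^ (4 / 5 : ℝ) * M)) := by
          gcongr
      _ = _ := by ring
  have h6 : dissip hβ hγ g p = rateFun β γ p * g p - (rateFun β γ p * g p - dissip hβ hγ g p) := by ring
  rw [h6]
  refine (abs_sub _ _).trans ?_
  linarith

/-- L is bounded in sup norm, so the exponential series can be estimated termwise. The growth is
irrelevant: only finiteness on [0, t] is needed, to start the bootstrap. -/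
theorem exists_abs_evol_le_exp (hβ : 0 < β) (hγ : 0 < γ) : ∃ C : ℝ, 0 < C ∧ ∀ (g : L2) (M : ℝ), 0 ≤ M →
    (∀ᵐ p, |g p| ≤ M) → ∀ t : ℝ, 0 ≤ t → ∀ᵐ p, |evol hβ hγ t g p| ≤ Real.exp (C * t) * M := by
  obtain ⟨C, C0, hC⟩ := exists_abs_dissip_le hβ hγ
  refine ⟨C, C0, fun g M M0 hM t ht => ?_⟩
  set B : L2 →L[ℝ] L2 := t • (-dissip hβ hγ) with hB
  have hn : ∀ n : ℕ, ∀ᵐ p, |(B ^ n) g p| ≤ (C * t) ^ n * M := by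
    intro n
    induction n with
    | zero => simpa using hM
    | succ n ih =>
      have e : (B ^ (n + 1)) g = t • (-dissip hβ hγ ((B ^ n) g)) := by
        rw [pow_succ', mul_apply_eq_comp, hB]; rfl
      rw [e]
      filter_upwards [hC _ _ (by positivity) ih, Lp.coeFn_smul t (-dissip hβ hγ ((B ^ n) g)),
        Lp.coeFn_neg (dissip hβ hγ ((B ^ n) g))] with p h1 h2 h3
      rw [h2, Pi.smul_apply, h3, Pi.neg_apply, smul_eq_mul, abs_mul, abs_neg, abs_of_nonneg ht]
      calc _ ≤ t * (C * ((C * t) ^ n * M)) := by gcongr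
        _ = _ := by ring
  refine ae_abs_le_of_forall_inner (integrable_const _) fun S hS => ?_
  have hs := (NormedSpace.exp_series_hasSum_exp' (𝕂 := ℝ) B)
  have hs2 := (hs.mapL (ContinuousLinearMap.apply ℝ L2 g)).mapL (innerSL ℝ (bddL2 (S.indicator 1)))
  have hs3 : HasSum (fun n : ℕ => (n.factorial : ℝ)⁻¹ * (C * t) ^ n * (∫ p in S, M)) (Real.exp (C * t) * ∫ p in S, M) := by
    have := NormedSpace.exp_series_hasSum_exp' (𝕂 := ℝ) (C * t)
    rw [← Real.exp_eq_exp_ℝ] at this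
    simpa using this.mul_right (∫ p in S, M)
  have hle : ∀ n : ℕ, ‖innerSL ℝ (bddL2 (S.indicator 1)) (ContinuousLinearMap.apply ℝ L2 g
      ((n.factorial : ℝ)⁻¹ • B ^ n))‖ ≤ (n.factorial : ℝ)⁻¹ * (C * t) ^ n * ∫ p in S, M := by
    intro n
    simp only [ContinuousLinearMap.apply_apply, map_smul, innerSL_apply_apply,
      smul_eq_mul, norm_mul, norm_inv, Real.norm_natCast, mul_assoc]
    refine mul_le_mul_of_nonneg_left ?_ (by positivity)
    rw [real_inner_comm, (inner_bddL2 (M := 1) _ (measurable_one.indicator hS)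
      (Filter.Eventually.of_forall fun p => ?_)).2, ← integral_const_mul, ← integral_indicator hS]
    · refine norm_integral_le_of_norm_le ((integrable_const _).indicator hS) ?_
      filter_upwards [hn n] with p hp
      by_cases hpS : p ∈ S
      · simpa [hpS] using hp
      · simp [hpS]
    · by_cases hp : p ∈ S <;> simp [hp]
  have h1 := tsum_of_norm_bounded hs3 hle
  rw [hs2.tsum_eq] at h1
  rw [integral_const_mul, real_inner_comm]
  exact h1

end Pointwise

/-! ### Pointwise decay -/

section Bootstrap

variable {β γ : ℝ}

theorem integrable_omega_rpow {s : ℝ} (hs : -1 < s) : Integrable fun p : Torus => omega p ^ s := by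
  refine ⟨(measurable_omega.pow_const s).aestronglyMeasurable, ?_⟩
  rw [hasFiniteIntegral_iff_ofReal (Filter.Eventually.of_forall fun p => Real.rpow_nonneg (omega_nonneg p) s)]
  exact lintegral_omega_rpow_lt_top hs

theorem bracket_rpow_le_rpow (t : ℝ) {a b : ℝ} (h : a ≤ b) : bracket t ^ a ≤ bracket t ^ b :=
  Real.rpow_le_rpow_of_exponent_le (one_le_bracket t) h

set_option maxHeartbeats 1000000 in
/-- One step of the bootstrap. -/
theorem exists_pointwise_step (hβ : 0 < β) (hγ : 0 < γ) {δ : ℝ} (hδ : 0 < δ) (hδ' : δ ≤ 1 / 20) :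
    ∃ C : ℝ, 0 < C ∧ ∀ μ ∈ Ioo (1 / 6 : ℝ) (1 / 2), ∀ ν ∈ Ioo (1 / 6 : ℝ) (1 / 2),
      ∀ (g : L2) (N : ℝ), 0 ≤ N → (∀ k, dissip hβ hγ k = 0 → inner ℝ k g = 0) →
      (∀ᵐ p, |g p| ≤ N * omega p ^ ν) → ∀ T Y : ℝ, 0 ≤ Y →
      (∀ s ∈ Icc 0 T, ∀ᵐ p, |evol hβ hγ s g p| ≤
        Y * N * bracket s ^ (-(3 / 5 * (μ + ν) - δ)) * omega p ^ (-μ)) →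
      ∀ t ∈ Icc 0 T, ∀ᵐ p, |evol hβ hγ t g p| ≤
        C * (1 + (Y + C) ^ (1 / 5 : ℝ)) * N * bracket t ^ (-(3 / 5 * (μ + ν) - δ)) * omega p ^ (-μ) := by
  obtain ⟨D, D0, hD⟩ := exists_decomposition_decay hβ hγ
  obtain ⟨G, G0, hG⟩ := exists_gain_le hβ hγ
  obtain ⟨E, E0, hE⟩ := exists_omega_rpow_mul_exp_rateFun_le hβ hγ
  set k₁ := E * D with hk₁
  set k₂ := E * G * D with hk₂
  set k₃ := E * G * D ^ (4 / 5 : ℝ) with hk₃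
  refine ⟨E + 4 / δ * (k₁ + k₂ + k₃) + D, by positivity, fun μ hμ ν hν g N N0 hg hgN T Y Y0 hY t ht => ?_⟩
  set C := E + 4 / δ * (k₁ + k₂ + k₃) + D with hC
  obtain ⟨μ1, μ2⟩ := hμ
  obtain ⟨ν1, ν2⟩ := hν
  set κ := 3 / 5 * (μ + ν) - δ with hκ
  have t0 := ht.1
  have hbt := bracket_pos t
  set Z := (Y + D) ^ (1 / 5 : ℝ) with hZ
  have Z0 : 0 ≤ Z := by positivity
  -- The pairs (Aᵢ, Bᵢ) are the decay exponents in t − s and s of the three sources: the kernel part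
  -- αn, the p₂ and p₃ gain, and the p₁ gain. Each is at most 1 − δ and 1 − Aᵢ − Bᵢ ≤ −κ. A₁ is
  -- lowered by 1/4 from the available 1 + 3/5(μ − 1/6), which exceeds 1, and still A₁ + B₁ = 1 +
  -- 3/5(μ + ν). B₂ is lowered by δ because 7/10 + 3ν/5 tends to 1 as ν tends to 1/2; this is where
  -- the loss δ arises. In the third pair the deficit 1/50 is covered by 3μ/25, that is by μ > 1/6.
  set A₁ := 13 / 20 + 3 / 5 * μ with hA₁
  set B₁ := 7 / 20 + 3 / 5 * ν with hB₁
  set A₂ := 3 / 5 * (μ + 1 / 2) with hA₂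
  set B₂ := 7 / 10 + 3 / 5 * ν - δ with hB₂
  set A₃ := 3 / 5 * (μ + 7 / 10) with hA₃
  set B₃ := 4 / 5 * (7 / 10 + 3 / 5 * ν) + 1 / 5 * κ with hB₃
  set conv : ℝ → ℝ → ℝ → ℝ := fun a b s => bracket (t - s) ^ (-a) * bracket s ^ (-b) with hconv
  have cconv : ∀ a b, Continuous (conv a b) := fun a b =>
    ((continuous_bracket_rpow (-a)).comp (by fun_prop)).mul (continuous_bracket_rpow (-b))
  have iconv : ∀ a b, IntervalIntegrable (conv a b) volume 0 t := fun a b =>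
    (cconv a b).intervalIntegrable _ _
  set b : ℝ → ℝ := fun s => k₁ * N * conv A₁ B₁ s + k₂ * N * conv A₂ B₂ s + k₃ * N * Z * conv A₃ B₃ s with hb
  have ib : IntervalIntegrable b volume 0 t :=
    (((iconv _ _).const_mul _).add ((iconv _ _).const_mul _)).add ((iconv _ _).const_mul _)
  have hint : ∫ s in (0 : ℝ)..t, b s ≤ 4 / δ * (k₁ + k₂ + k₃ * Z) * N * bracket t ^ (-κ) := by
    have c1 : ∫ s in (0 : ℝ)..t, conv A₁ B₁ s ≤ 4 / δ * bracket t ^ (-κ) :=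
      (integral_bracket_mul_bracket_le hδ (by linarith) (by linarith) (by linarith) (by linarith) t0).trans
        (mul_le_mul_of_nonneg_left (bracket_rpow_le_rpow t (by linarith)) (by positivity))
    have c2 : ∫ s in (0 : ℝ)..t, conv A₂ B₂ s ≤ 4 / δ * bracket t ^ (-κ) :=
      (integral_bracket_mul_bracket_le hδ (by linarith) (by linarith) (by linarith) (by linarith) t0).trans
        (mul_le_mul_of_nonneg_left (bracket_rpow_le_rpow t (by linarith)) (by positivity))
    have c3 : ∫ s in (0 : ℝ)..t, conv A₃ B₃ s ≤ 4 / δ * bracket t ^ (-κ) :=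
      (integral_bracket_mul_bracket_le hδ (by linarith) (by linarith) (by linarith) (by linarith) t0).trans
        (mul_le_mul_of_nonneg_left (bracket_rpow_le_rpow t (by linarith)) (by positivity))
    calc _ = k₁ * N * (∫ s in (0 : ℝ)..t, conv A₁ B₁ s) + k₂ * N * (∫ s in (0 : ℝ)..t, conv A₂ B₂ s) +
          k₃ * N * Z * (∫ s in (0 : ℝ)..t, conv A₃ B₃ s) := by
          rw [hb, intervalIntegral.integral_add (((iconv _ _).const_mul _).add ((iconv _ _).const_mul _))
            ((iconv _ _).const_mul _), intervalIntegral.integral_add ((iconv _ _).const_mul _)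
            ((iconv _ _).const_mul _)]
          simp only [intervalIntegral.integral_const_mul]
      _ ≤ k₁ * N * (4 / δ * bracket t ^ (-κ)) + k₂ * N * (4 / δ * bracket t ^ (-κ)) +
          k₃ * N * Z * (4 / δ * bracket t ^ (-κ)) := by
          have : 0 ≤ k₁ * N := by positivity
          have : 0 ≤ k₂ * N := by positivity
          have : 0 ≤ k₃ * N * Z := by positivity
          gcongr
      _ = _ := by ring
  have main := ae_abs_evol_le hβ hγ (integrable_omega_rpow (s := -μ) (by linarith)) (g := g)
    (a₀ := E * N * bracket t ^ (-κ)) t0 ib ?_ ?_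
  · filter_upwards [main, ae_ne_zero] with p hp hp0
    have ho := omega_pos hp0
    refine hp.trans ?_
    have hZC : Z ≤ (Y + C) ^ (1 / 5 : ℝ) := by
      have : D ≤ C := by
        have : 0 ≤ 4 / δ * (k₁ + k₂ + k₃) := by positivity
        linarith
      rw [hZ]; gcongr
    have hfin : E + 4 / δ * (k₁ + k₂ + k₃ * Z) ≤ C * (1 + (Y + C) ^ (1 / 5 : ℝ)) := by
      have q1 : E + 4 / δ * (k₁ + k₂) ≤ C := by
        have : 0 ≤ 4 / δ * k₃ := by positivity
        rw [hC]; linarith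
      have q2 : 4 / δ * k₃ ≤ C := by
        have : 0 ≤ 4 / δ * (k₁ + k₂) := by positivity
        rw [hC]; linarith
      calc _ = (E + 4 / δ * (k₁ + k₂)) * 1 + 4 / δ * k₃ * Z := by ring
        _ ≤ C * 1 + C * (Y + C) ^ (1 / 5 : ℝ) := by
            have : 0 ≤ 4 / δ * k₃ := by positivity
            gcongr
        _ = _ := by ring
    calc _ ≤ (E * N * bracket t ^ (-κ) + 4 / δ * (k₁ + k₂ + k₃ * Z) * N * bracket t ^ (-κ)) * omega p ^ (-μ) := by
          gcongr
      _ = (E + 4 / δ * (k₁ + k₂ + k₃ * Z)) * N * bracket t ^ (-κ) * omega p ^ (-μ) := by ring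
      _ ≤ _ := by gcongr
  · filter_upwards [hgN, ae_ne_zero] with p hp hp0
    have ho := omega_pos hp0
    have h1 := (hE (μ + ν) (by linarith) (by linarith) t t0 p hp0).1
    calc _ ≤ N * omega p ^ ν * Real.exp (-(t * rateFun β γ p)) := by gcongr
      _ = N * omega p ^ (-μ) * (omega p ^ (μ + ν) * Real.exp (-(t * rateFun β γ p))) := by
          rw [show omega p ^ ν = omega p ^ (-μ) * omega p ^ (μ + ν) by
            rw [← Real.rpow_add ho]; congr 1; ring]
          ring
      _ ≤ N * omega p ^ (-μ) * (E * bracket t ^ (-(3 / 5 * (μ + ν)))) := by gcongr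
      _ ≤ N * omega p ^ (-μ) * (E * bracket t ^ (-κ)) := by
          have := bracket_rpow_le_rpow t (a := -(3 / 5 * (μ + ν))) (b := -κ) (by linarith)
          gcongr
      _ = _ := by ring
  · intro s hs
    have s0 := hs.1.le
    have hbs := bracket_pos s
    have hτ : 0 ≤ t - s := by linarith [hs.2]
    have hbτ := bracket_pos (t - s)
    obtain ⟨n, q, q0, hn, hnq, hq, hw⟩ := hD ν (by linarith) (by linarith) g N N0 hg hgN s s0
    set u := evol hβ hγ s g with hu
    set w := Real.sqrt (wsq (5 / 3) (u - n)) with hwdef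
    have w0 : 0 ≤ w := Real.sqrt_nonneg _
    set X := (Y + D) * N * bracket s ^ (-κ) with hX
    have X0 : 0 ≤ X := by positivity
    have hXr : ∀ᵐ p, omega p ^ (5 / 3 : ℝ) * |(u - n) p| ≤ X := by
      filter_upwards [hY s ⟨s0, hs.2.trans ht.2⟩, hnq, Lp.coeFn_sub u n, ae_ne_zero] with p h1 h2 h3 hp0
      have ho := omega_pos hp0
      rw [h3, Pi.sub_apply]
      have q2 : q ≤ D * N * bracket s ^ (-κ) := hq.trans
        (mul_le_mul_of_nonneg_left (bracket_rpow_le_rpow s (by linarith)) (by positivity))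
      have o1 : omega p ^ (5 / 3 : ℝ) * omega p ^ (-μ) ≤ 1 := by
        rw [← Real.rpow_add ho]; exact omega_rpow_le_one (by linarith) p
      have o2 : omega p ^ (5 / 3 : ℝ) * omega p ^ (-(1 / 6) : ℝ) ≤ 1 := by
        rw [← Real.rpow_add ho]; exact omega_rpow_le_one (by norm_num) p
      calc _ ≤ omega p ^ (5 / 3 : ℝ) * (Y * N * bracket s ^ (-κ) * omega p ^ (-μ) +
            q * omega p ^ (-(1 / 6) : ℝ)) := by
            gcongr
            exact (abs_sub _ _).trans (add_le_add h1 h2)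
        _ = Y * N * bracket s ^ (-κ) * (omega p ^ (5 / 3 : ℝ) * omega p ^ (-μ)) +
            q * (omega p ^ (5 / 3 : ℝ) * omega p ^ (-(1 / 6) : ℝ)) := by ring
        _ ≤ Y * N * bracket s ^ (-κ) * 1 + q * 1 := by gcongr
        _ ≤ Y * N * bracket s ^ (-κ) * 1 + D * N * bracket s ^ (-κ) * 1 := by gcongr
        _ = _ := by rw [hX]; ring
    -- L annihilates n, so the gain estimate is applied to u − n, whose weighted norm decays faster
    -- than that of u.
    have hdis : dissip hβ hγ (u - n) = dissip hβ hγ u := by rw [map_sub, hn, sub_zero]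
    have hwX : w ^ (4 / 5 : ℝ) * X ^ (1 / 5 : ℝ) ≤ D ^ (4 / 5 : ℝ) * N * Z * bracket s ^ (-B₃) := by
      calc _ ≤ (D * N * bracket s ^ (-(7 / 10 + 3 / 5 * ν))) ^ (4 / 5 : ℝ) * X ^ (1 / 5 : ℝ) := by gcongr
        _ = D ^ (4 / 5 : ℝ) * (N ^ (4 / 5 : ℝ) * N ^ (1 / 5 : ℝ)) * Z *
            (bracket s ^ (-(7 / 10 + 3 / 5 * ν) * (4 / 5)) * bracket s ^ (-κ * (1 / 5))) := by
            rw [hX, Real.mul_rpow (by positivity) (by positivity), Real.mul_rpow D0.le N0,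
              Real.mul_rpow (by positivity) (by positivity), Real.mul_rpow (by positivity) N0,
              Real.rpow_mul hbs.le, Real.rpow_mul hbs.le, ← hZ]
            ring
        _ = _ := by
            rw [← Real.rpow_add_of_nonneg N0 (by norm_num) (by norm_num), ← Real.rpow_add hbs]
            norm_num
            left
            congr 1
            rw [hB₃]; ring
    filter_upwards [hG (u - n) X X0 hXr, hnq, Lp.coeFn_sub u n, ae_ne_zero] with p h1 h2 h3 hp0
    have ho := omega_pos hp0
    rw [hdis, h3, Pi.sub_apply] at h1
    set α := rateFun β γ p with hα
    have α0 : 0 ≤ α := rateFun_nonneg β γ p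
    set e := Real.exp (-((t - s) * α)) with he
    have e0 : 0 ≤ e := (Real.exp_pos _).le
    have o : ∀ m : ℝ, omega p ^ m = omega p ^ (-μ) * omega p ^ (μ + m) := fun m => by
      rw [← Real.rpow_add ho]; congr 1; ring
    have T1 : α * (q * omega p ^ (-(1 / 6) : ℝ)) * e ≤ k₁ * N * conv A₁ B₁ s * omega p ^ (-μ) := by
      have h4 := (hE (μ - 1 / 6) (by linarith) (by linarith) (t - s) hτ p hp0).2
      have h5 := h4.trans (mul_le_mul_of_nonneg_left (bracket_rpow_le_rpow (t - s)
        (a := -(1 + 3 / 5 * (μ - 1 / 6))) (b := -A₁) (by linarith)) E0.le)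
      calc _ = omega p ^ (-μ) * q * (omega p ^ (μ - 1 / 6) * (α * e)) := by
            rw [o (-(1 / 6)), ← sub_eq_add_neg]; ring
        _ ≤ omega p ^ (-μ) * (D * N * bracket s ^ (-B₁)) * (E * bracket (t - s) ^ (-A₁)) := by
            gcongr
        _ = _ := by rw [hk₁, hconv]; ring
    have T2 : G * (omega p ^ (1 / 2 : ℝ) * w) * e ≤ k₂ * N * conv A₂ B₂ s * omega p ^ (-μ) := by
      have h4 := (hE (μ + 1 / 2) (by linarith) (by linarith) (t - s) hτ p hp0).1
      have h5 := bracket_rpow_le_rpow s (a := -(7 / 10 + 3 / 5 * ν)) (b := -B₂) (by linarith)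
      calc _ = omega p ^ (-μ) * (G * w) * (omega p ^ (μ + 1 / 2) * e) := by
            rw [o (1 / 2)]; ring
        _ ≤ omega p ^ (-μ) * (G * (D * N * bracket s ^ (-B₂))) * (E * bracket (t - s) ^ (-A₂)) := by
            gcongr
            exact hw.trans (by gcongr)
        _ = _ := by rw [hk₂, hconv]; ring
    have T3 : G * (omega p ^ (7 / 10 : ℝ) * (w ^ (4 / 5 : ℝ) * X ^ (1 / 5 : ℝ))) * e ≤
        k₃ * N * Z * conv A₃ B₃ s * omega p ^ (-μ) := by
      have h4 := (hE (μ + 7 / 10) (by linarith) (by linarith) (t - s) hτ p hp0).1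
      calc _ = omega p ^ (-μ) * (G * (w ^ (4 / 5 : ℝ) * X ^ (1 / 5 : ℝ))) * (omega p ^ (μ + 7 / 10) * e) := by
            rw [o (7 / 10)]; ring
        _ ≤ omega p ^ (-μ) * (G * (D ^ (4 / 5 : ℝ) * N * Z * bracket s ^ (-B₃))) *
            (E * bracket (t - s) ^ (-A₃)) := by gcongr
        _ = _ := by rw [hk₃, hconv]; ring
    -- The source is αn plus the gain of u − n. In the first part α is kept, since α e^{−(t−s)α}
    -- decays one power faster.
    have h6 : |α * u p - dissip hβ hγ u p| ≤ α * (q * omega p ^ (-(1 / 6) : ℝ)) +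
        G * (omega p ^ (1 / 2 : ℝ) * w + omega p ^ (7 / 10 : ℝ) * (w ^ (4 / 5 : ℝ) * X ^ (1 / 5 : ℝ))) := by
      calc _ = |α * n p + (α * (u p - n p) - dissip hβ hγ u p)| := by congr 1; ring
        _ ≤ _ := by
            refine (abs_add_le _ _).trans (add_le_add ?_ h1)
            rw [abs_mul, abs_of_nonneg α0]
            gcongr
    calc _ ≤ (α * (q * omega p ^ (-(1 / 6) : ℝ)) +
        G * (omega p ^ (1 / 2 : ℝ) * w + omega p ^ (7 / 10 : ℝ) * (w ^ (4 / 5 : ℝ) * X ^ (1 / 5 : ℝ)))) * e :=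
          mul_le_mul_of_nonneg_right h6 e0
      _ = α * (q * omega p ^ (-(1 / 6) : ℝ)) * e + G * (omega p ^ (1 / 2 : ℝ) * w) * e +
          G * (omega p ^ (7 / 10 : ℝ) * (w ^ (4 / 5 : ℝ) * X ^ (1 / 5 : ℝ))) * e := by ring
      _ ≤ _ := add_le_add (add_le_add T1 T2) T3
      _ = _ := by rw [hb]; ring

/-- For large Y the sublinear power 1/5 makes one bootstrap step at least halve the constant. The
exponent is relaxed to 1/2 so that only √Y has to be compared with Y. -/
theorem mul_one_add_rpow_le {C Y : ℝ} (hC : 0 < C) (hY : (8 * (1 + C)) ^ 2 ≤ Y) :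
    C * (1 + (Y + C) ^ (1 / 5 : ℝ)) ≤ Y / 2 := by
  set y := Real.sqrt Y with hy
  have hYp : 0 ≤ Y := le_trans (by positivity) hY
  have hy1 : 8 * (1 + C) ≤ y := Real.le_sqrt_of_sq_le hY
  have hyY : y ^ 2 = Y := Real.sq_sqrt hYp
  have h1 : (Y + C) ^ (1 / 5 : ℝ) ≤ 2 * y := by
    have h2 : 1 ≤ Y + C := by nlinarith
    calc (Y + C) ^ (1 / 5 : ℝ) ≤ (Y + C) ^ (1 / 2 : ℝ) := Real.rpow_le_rpow_of_exponent_le h2 (by norm_num)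
      _ = Real.sqrt (Y + C) := (Real.sqrt_eq_rpow _).symm
      _ ≤ 2 * y := Real.sqrt_le_iff.2 ⟨by positivity, by nlinarith⟩
  calc _ ≤ C * (1 + 2 * y) := by gcongr
    _ ≤ Y / 2 := by nlinarith

/-- On each interval [0, t] the crude bound gives some finite constant Y₀, depending on t. Repeated
halving brings it below the threshold C₃, which depends on neither t nor the datum. -/
theorem exists_pointwise_decay (hβ : 0 < β) (hγ : 0 < γ) {δ : ℝ} (hδ : 0 < δ) (hδ' : δ ≤ 1 / 20) :
    ∃ C : ℝ, 0 < C ∧ ∀ μ ∈ Ioo (1 / 6 : ℝ) (1 / 2), ∀ ν ∈ Ioo (1 / 6 : ℝ) (1 / 2),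
      ∀ (g : L2) (N : ℝ), 0 ≤ N → (∀ k, dissip hβ hγ k = 0 → inner ℝ k g = 0) →
      (∀ᵐ p, |g p| ≤ N * omega p ^ ν) → ∀ t : ℝ, 0 ≤ t → ∀ᵐ p, |evol hβ hγ t g p| ≤
        C * N * bracket t ^ (-(3 / 5 * (μ + ν) - δ)) * omega p ^ (-μ) := by
  obtain ⟨C, C0, hC⟩ := exists_pointwise_step hβ hγ hδ hδ'
  obtain ⟨R, R0, hR⟩ := exists_abs_evol_le_exp hβ hγ
  set C₃ := (8 * (1 + C)) ^ 2 with hC₃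
  have C₃0 : 0 < C₃ := by positivity
  refine ⟨C₃, C₃0, fun μ hμ ν hν g N N0 hg hgN t ht => ?_⟩
  set κ := 3 / 5 * (μ + ν) - δ with hκ
  have κ0 : 0 ≤ κ := by linarith [hμ.1, hν.1]
  set P : ℝ → Prop := fun Y => ∀ s ∈ Icc 0 t, ∀ᵐ p, |evol hβ hγ s g p| ≤
    Y * N * bracket s ^ (-κ) * omega p ^ (-μ) with hP
  have mono : ∀ Y Y', Y ≤ Y' → P Y → P Y' := by
    intro Y Y' h hY s hs
    have hbs := bracket_pos s
    filter_upwards [hY s hs] with p hp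
    have ho := omega_nonneg p
    exact hp.trans (by gcongr)
  have step : ∀ Y, C₃ ≤ Y → P Y → P (Y / 2) := fun Y h hY =>
    mono _ _ (mul_one_add_rpow_le C0 h) (hC μ hμ ν hν g N N0 hg hgN t Y (C₃0.le.trans h) hY)
  -- The factor ⟨t⟩^κ compensates the decaying bracket on [0, t]; the weight ω^{-μ} ≥ 1 only helps.
  set Y₀ := Real.exp (R * t) * bracket t ^ κ with hY₀
  have hbt := bracket_pos t
  have base : P Y₀ := by
    intro s hs
    have hbs := bracket_pos s
    have hgN' : ∀ᵐ p, |g p| ≤ N := by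
      filter_upwards [hgN] with p hp
      refine hp.trans ?_
      calc _ ≤ N * 1 := by
            gcongr
            exact omega_rpow_le_one (by linarith [hν.1]) p
        _ = N := mul_one N
    filter_upwards [hR g N N0 hgN' s hs.1, ae_ne_zero] with p hp hp0
    have ho := omega_pos hp0
    have h1 : 1 ≤ omega p ^ (-μ) :=
      Real.one_le_rpow_of_pos_of_le_one_of_nonpos ho (omega_le_one p) (by linarith [hμ.1])
    have h2 : 1 ≤ bracket t ^ κ * bracket s ^ (-κ) := by
      rw [Real.rpow_neg hbs.le, ← div_eq_mul_inv, le_div_iff₀ (by positivity), one_mul]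
      refine Real.rpow_le_rpow hbs.le ?_ κ0
      rw [bracket_of_nonneg hs.1, bracket_of_nonneg ht]; linarith [hs.2]
    calc _ ≤ Real.exp (R * s) * N := hp
      _ ≤ Real.exp (R * t) * N := by
          gcongr
          exact hs.2
      _ = Real.exp (R * t) * N * 1 * 1 := by ring
      _ ≤ Real.exp (R * t) * N * (bracket t ^ κ * bracket s ^ (-κ)) * omega p ^ (-μ) := by gcongr
      _ = _ := by rw [hY₀]; ring
  -- The maximum with C₃ keeps the constant in the range where a step halves it.
  have iter : ∀ n : ℕ, P (max C₃ (Y₀ / 2 ^ n)) := by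
    intro n
    induction n with
    | zero => exact mono _ _ (by simp) base
    | succ n ih =>
      refine mono _ _ ?_ (step _ (le_max_left _ _) ih)
      rw [← max_div_div_right (by norm_num)]
      refine max_le_max (by linarith) (le_of_eq ?_)
      rw [pow_succ, div_div]
  obtain ⟨n, hn⟩ := pow_unbounded_of_one_lt (Y₀ / C₃) (by norm_num : (1 : ℝ) < 2)
  have hmax : max C₃ (Y₀ / 2 ^ n) = C₃ := by
    refine max_eq_left ?_
    rw [div_lt_iff₀ C₃0] at hn
    rw [div_le_iff₀ (by positivity)]
    linarith
  have := iter n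
  rw [hmax] at this
  exact this t ⟨ht, le_rfl⟩

end Bootstrap

end FPUT

end

/-! ### The theorem -/

open FPUT in
theorem theorem5p4 (β γ : ℝ) (hβ : 0 < β) (hγ : 0 < γ) :
    -- for every initial datum in `L²` the orbit `t ↦ exp(tL) g₀` exists and is unique
    (∀ g₀ : L2, ∃ u : ℝ → L2, IsSolution β γ g₀ u ∧
      ∀ w : ℝ → L2, IsSolution β γ g₀ w → Set.EqOn w u (Set.Ici 0)) ∧
    -- pointwise decay
    ∀ δ : ℝ, 0 < δ → ∃ C : ℝ, 0 < C ∧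
      ∀ μ ∈ Set.Ioo (1 / 6 : ℝ) (1 / 2), ∀ ν ∈ Set.Ioo (1 / 6 : ℝ) (1 / 2),
      ∀ g₀ : L2, MeasureTheory.MemLp g₀ ⊤ MeasureTheory.volume →
        (∀ k ∈ linearizedKer β γ, inner ℝ k g₀ = 0) →
        ∀ u : ℝ → L2, IsSolution β γ g₀ u → ∀ t : ℝ, 0 ≤ t →
          MeasureTheory.eLpNorm (fun p => omega p ^ μ * u t p) ⊤ MeasureTheory.volume ≤
            ENNReal.ofReal (C * bracket t ^ (-(3 / 5) * (μ + ν) + δ)) *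
              MeasureTheory.eLpNorm (fun p => omega p ^ (-ν) * g₀ p) ⊤
                MeasureTheory.volume := by
  refine ⟨fun g₀ => ⟨fun t => evol hβ hγ t g₀, isSolution_evol hβ hγ g₀,
    fun w hw => hw.eqOn_evol hβ hγ⟩, fun δ hδ => ?_⟩
  -- A smaller loss is a stronger statement, so δ may be cut down to 1/20, below which the
  -- convolution exponents are admissible.
  obtain ⟨C, C0, hC⟩ := exists_pointwise_decay hβ hγ (δ := min δ (1 / 20))
    (lt_min hδ (by norm_num)) (min_le_right _ _)
  refine ⟨C, C0, fun μ hμ ν hν g₀ _ horth u hu t ht => ?_⟩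
  rw [hu.eqOn_evol hβ hγ ht]
  have hb := bracket_pos t
  have hpos : 0 < C * bracket t ^ (-(3 / 5) * (μ + ν) + δ) := by positivity
  -- If the weighted norm of the datum is infinite, so is the right-hand side, because its constant
  -- is positive. Otherwise the norm is the constant N in |g₀| ≤ Nω^ν.
  rcases eq_or_ne (MeasureTheory.eLpNorm (fun p => omega p ^ (-ν) * g₀ p) ⊤ MeasureTheory.volume) ⊤
    with h | h
  · rw [h, ENNReal.mul_top (ENNReal.ofReal_pos.2 hpos).ne']
    exact le_top
  · set N := (MeasureTheory.eLpNorm (fun p => omega p ^ (-ν) * g₀ p) ⊤ MeasureTheory.volume).toReal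
      with hN
    have N0 : 0 ≤ N := ENNReal.toReal_nonneg
    rw [← ENNReal.ofReal_toReal h, ← hN, ← ENNReal.ofReal_mul hpos.le]
    have hg : ∀ᵐ p, |g₀ p| ≤ N * omega p ^ ν := by
      filter_upwards [MeasureTheory.ae_le_eLpNormEssSup (f := fun p => omega p ^ (-ν) * g₀ p)
        (μ := MeasureTheory.volume), ae_ne_zero] with p hp hp0
      have ho := omega_pos hp0
      rw [← MeasureTheory.eLpNorm_exponent_top, ← ENNReal.ofReal_toReal h, ← hN, ← ofReal_norm,
        ENNReal.ofReal_le_ofReal_iff N0, norm_mul, Real.norm_of_nonneg (by positivity),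
        Real.norm_eq_abs, Real.rpow_neg ho.le, inv_mul_le_iff₀ (by positivity)] at hp
      linarith
    rw [MeasureTheory.eLpNorm_exponent_top]
    refine MeasureTheory.eLpNormEssSup_le_of_ae_enorm_bound ?_
    filter_upwards [hC μ hμ ν hν g₀ N N0
      (fun k hk => horth k ((mem_linearizedKer_iff hβ hγ k).2 hk)) hg t ht, ae_ne_zero] with p hp hp0
    have ho := omega_pos hp0
    rw [← ofReal_norm, norm_mul, Real.norm_of_nonneg (by positivity), Real.norm_eq_abs]
    refine ENNReal.ofReal_le_ofReal ?_
    calc omega p ^ μ * |evol hβ hγ t g₀ p|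
        ≤ omega p ^ μ * (C * N * bracket t ^ (-(3 / 5 * (μ + ν) - min δ (1 / 20))) *
          omega p ^ (-μ)) := by gcongr
      _ = C * N * bracket t ^ (-(3 / 5 * (μ + ν) - min δ (1 / 20))) := by
          rw [Real.rpow_neg ho.le]
          field_simp
      _ ≤ C * N * bracket t ^ (-(3 / 5) * (μ + ν) + δ) := by
          have := bracket_rpow_le_rpow t (a := -(3 / 5 * (μ + ν) - min δ (1 / 20)))
            (b := -(3 / 5) * (μ + ν) + δ) (by linarith [min_le_left δ (1 / 20)])
          gcongr
      _ = _ := by ring
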